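/- **Notation.** Let $c_1>1$, $\lambda=\frac{c_1-1}{c_1}\in(0,1)$, $Q(x)=\frac32\operatorname{sech}^2(x/2)$ (so $Q''-Q+Q^2=0$), $\varphi=-Q'/Q$, and $Lf=-f''+f-2Qf$. Let $\mathcal Y$ be the set of $C^\infty$ functions $f$ such that for every $j$ there are $K_j,r_j>0$ with $|f^{(j)}(x)|\le K_j(1+|x|)^{r_j}e^{-|x|}$ on $\mathbb R$. For $1<c_2<c_1$ set $$\sigma=\frac{c_2-1}{c_2\lambda},\quad \theta_\sigma=\frac{1-\lambda}{1-\lambda\sigma},\quad \mu_\sigma=\frac{1-\sigma}{1-\lambda\sigma},\quad \widetilde Q_\sigma(x)=\sigma\theta_\sigma Q(\sqrt\sigma x),\quad \tau_\sigma=\sigma^{-\frac12-\frac1{100}}.$$ Let $\Sigma_0=\{(k,l): k\ge1,\ l\ge0,\ k+l\le3\}$. Given numbers $a_{k,l}$ and functions $A_{k,l},B_{k,l}$, $(k,l)\in\Sigma_0$, put $y_\sigma=x+\mu_\sigma t$, $\beta=\sum_{\Sigma_0}a_{k,l}\sigma^l\widetilde Q_\sigma^k$, $\alpha(s)=\int_0^s\beta$,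 $y=x-\alpha(y_\sigma)$ and $$z(t,x)=Q(y)+\widetilde Q_\sigma(y_\sigma)+\sum_{(k,l)\in\Sigma_0}\sigma^l\left\{A_{k,l}(y)\widetilde Q_\sigma^k(y_\sigma)+B_{k,l}(y)(\widetilde Q_\sigma^k)'(y_\sigma)\right\},$$ $$S(z)=(1-\lambda\partial_x^2)\partial_tz+\partial_x(\partial_x^2z-z+z^2).$$ **The systems.** For $(k,l)\in\Sigma_0$ let $F_{k,l}(y)$, $G_{k,l}(y)$ be the coefficients of $\sigma^l\widetilde Q_\sigma^k(y_\sigma)$ and of $\sigma^l(\widetilde Q_\sigma^k)'(y_\sigma)$ in the expansion of $S(z)$ when only the terms with index sum $<k+l$ are kept in $\alpha$ and $z$; the expansion is made unique by $\widetilde Q_\sigma''=\sigma\widetilde Q_\sigma-\theta_\sigma^{-1}\widetilde Q_\sigma^2$, $(\widetilde Q_\sigma')^2=\sigma\widetilde Q_\sigma^2-\frac23\theta_\sigma^{-1}\widetilde Q_\sigma^3$, $\theta_\sigma^{-1}=\frac{1-\lambda\sigma}{1-\lambda}$, $\mu_\sigma=1-(1-\lambda)\sum_{j\ge0}\lambda^j\sigma^{j+1}$.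 (For instance $F_{1,0}=2Q'$, $G_{1,0}=2Q$.) They are explicit differential polynomials in $Q$ and in the $A_{k',l'},B_{k',l'}$, $k'+l'<k+l$. The system $(\Omega_{k,l})$ is $$(LA_{k,l})'=a_{k,l}\{(\lambda-3)Q''-Q^2\}'+F_{k,l},\qquad (LB_{k,l})'=(3-\lambda)A_{k,l}''+2QA_{k,l}+a_{k,l}(2\lambda-3)Q''+G_{k,l}.$$ **Admissible coefficients.** A family $(a_{k,l},b_{k,l},A_{k,l},B_{k,l})_{(k,l)\in\Sigma_0}$ is admissible if every $(\Omega_{k,l})$ holds, $A_{k,l}$ is even, $B_{k,l}$ is odd, $A_{k,l}-\gamma_{k,l}\in\mathcal Y$, $B_{k,l}-b_{k,l}\varphi\in\mathcal Y$, and $$a_{1,0}=\frac{10(1+\lambda)}{15+10\lambda-\lambda^2},\quad b_{1,0}=\frac{-30+18\lambda^2}{15+10\lambda-\lambda^2},\quad A_{1,0}=-(yQ'+2Q)-a_{1,0}\left(\tfrac{\lambda-3}2yQ'-Q\right),$$ $$B_{1,0}=\tfrac{3-\lambda}4y^2Q'+yQ-a_{1,0}\left\{\tfrac{(\lambda-3)^2}8y^2Q'+\tfrac{3-\lambda}2yQ\right\}+b_{1,0}\varphi+\kappa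 Q',\qquad \int B_{1,0}Q'=0$$ for some $\kappa\in\mathbb R$, where, with $d(\lambda)=b_{2,0}+\frac{b_{1,0}^3}{6(1-\lambda)}$, $$\gamma_{1,0}=0,\quad \gamma_{1,1}=\tfrac12b_{1,0}^2,\quad \gamma_{2,0}=-\tfrac{b_{1,0}^2}{2(1-\lambda)},\quad \gamma_{1,2}=b_{1,0}b_{1,1}-\tfrac18b_{1,0}^4,$$ $$\gamma_{3,0}=\tfrac{5b_{1,0}^4}{36(1-\lambda)^2}-\tfrac{10}{3(1-\lambda)}d(\lambda)b_{1,0},\qquad \gamma_{2,1}=-\tfrac{b_{1,0}^4}{24(1-\lambda)}+\tfrac{\lambda b_{1,0}^2}{2(1-\lambda)}-\tfrac{b_{1,0}b_{1,1}}{1-\lambda}+4d(\lambda)b_{1,0}.$$ **Lemma.** For every $c_1>1$ admissible coefficients exist. For every admissible family there are $\epsilon_0>0$ and $C>0$ (depending only on $c_1$ and on the family, not on $c_2$) such that for all $c_2$ with $1<c_2<c_1$ and $c_2-1<\epsilon_0$ the function $z$ is $C^\infty$ and $$z(t,x)=z(-t,-x)\quad\text{for all }t,x,\qquad \|S(z)(t)\|_{H^1}\le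 C\sigma^{15/4}\quad\text{for all }t\in\mathbb R,$$ $$\left\|z(\tau_\sigma)-\left\{Q(\cdot-\tfrac12\delta)+\widetilde Q_\sigma(\cdot+\mu_\sigma\tau_\sigma-\tfrac12\delta_\sigma)-d(\lambda)(\widetilde Q_\sigma^2)'(\cdot+\mu_\sigma\tau_\sigma-\tfrac12\delta_\sigma)\right\}\right\|_{H^1}\le C\sigma^{13/4},$$ $$\left\|z(-\tau_\sigma)-\left\{Q(\cdot+\tfrac12\delta)+\widetilde Q_\sigma(\cdot-\mu_\sigma\tau_\sigma+\tfrac12\delta_\sigma)+d(\lambda)(\widetilde Q_\sigma^2)'(\cdot-\mu_\sigma\tau_\sigma+\tfrac12\delta_\sigma)\right\}\right\|_{H^1}\le C\sigma^{13/4},$$ where $$\delta=\sum_{(k,l)\in\Sigma_0}a_{k,l}\,\sigma^l\int_{\mathbb R}\widetilde Q_\sigma^k,\qquad \delta_\sigma=2\left(b_{1,0}+\sigma\left(b_{1,1}-\tfrac16b_{1,0}^3\right)\right).$$ -/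

import Mathlib

open MeasureTheory
open scoped ContDiff ENNReal

noncomputable section

namespace BBM

/-- The rescaled solitary wave `Q(x) = (3/2) sech²(x/2)`, a solution of `Q'' - Q + Q² = 0`. -/
def Q (x : ℝ) : ℝ := 3 / 2 * (1 / Real.cosh (x / 2)) ^ 2

/-- `φ = -Q'/Q`. -/
def phi (x : ℝ) : ℝ := -(deriv Q x / Q x)

/-- `λ = (c₁ - 1)/c₁`. -/
def lamOf (c₁ : ℝ) : ℝ := (c₁ - 1) / c₁

/-- `σ = (c₂ - 1)/(c₂ λ)`, with `λ = (c₁ - 1)/c₁`. -/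
def sigmaOf (c₁ c₂ : ℝ) : ℝ := (c₂ - 1) / (c₂ * lamOf c₁)

/-- `θ_σ = (1 - λ)/(1 - λσ)`. -/
def theta (lam sig : ℝ) : ℝ := (1 - lam) / (1 - lam * sig)

/-- `μ_σ = (1 - σ)/(1 - λσ)`. -/
def mu (lam sig : ℝ) : ℝ := (1 - sig) / (1 - lam * sig)

/-- The small rescaled soliton `Q̃_σ(x) = σ θ_σ Q(√σ x)`. -/
def Qt (lam sig x : ℝ) : ℝ := sig * theta lam sig * Q (Real.sqrt sig * x)

/-- `τ_σ = σ^(-1/2 - 1/100)`. -/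
def tau (sig : ℝ) : ℝ := sig ^ (-(1 / 2 : ℝ) - 1 / 100)

/-- The class `𝒴`: smooth functions all of whose derivatives are bounded by
`K (1 + |x|)^r e^{-|x|}`, with `K`, `r > 0` depending on the order of the derivative. -/
def ClassY (f : ℝ → ℝ) : Prop :=
  ContDiff ℝ ∞ f ∧ ∀ j : ℕ, ∃ K r : ℝ, 0 < K ∧ 0 < r ∧
    ∀ x : ℝ, |iteratedDeriv j f x| ≤ K * (1 + |x|) ^ r * Real.exp (-|x|)

/-- `L f = -f'' + f - 2 Q f`. -/
def L (f : ℝ → ℝ) (x : ℝ) : ℝ := -iteratedDeriv 2 f x + f x - 2 * Q x * f x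

/-- `Σ₀ = {(k, l) : 1 ≤ k, 0 ≤ l, k + l ≤ 3}`. -/
def Sigma0 : Finset (ℕ × ℕ) :=
  (Finset.Icc 1 3 ×ˢ Finset.range 3).filter fun p => p.1 + p.2 ≤ 3

/-- Raw data: the numbers `a_{k,l}`, `b_{k,l}` and the functions `A_{k,l}`, `B_{k,l}`
(only the indices in `Σ₀` are ever used). -/
structure Profile where
  a : ℕ → ℕ → ℝ
  b : ℕ → ℕ → ℝ
  A : ℕ → ℕ → ℝ → ℝ
  B : ℕ → ℕ → ℝ → ℝ

/-! ### The approximate solution -/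

/-- `β(s) = ∑ a_{k,l} σ^l Q̃_σ(s)^k`. -/
def beta (lam sig : ℝ) (P : Profile) (s : ℝ) : ℝ :=
  ∑ p ∈ Sigma0, P.a p.1 p.2 * sig ^ p.2 * Qt lam sig s ^ p.1

/-- `α(s) = ∫₀ˢ β`. -/
def alpha (lam sig : ℝ) (P : Profile) (s : ℝ) : ℝ :=
  ∫ r in (0 : ℝ)..s, beta lam sig P r

/-- `y_σ = x + μ_σ t`. -/
def ySig (lam sig t x : ℝ) : ℝ := x + mu lam sig * t

/-- `y = x - α(y_σ)`. -/
def yVar (lam sig : ℝ) (P : Profile) (t x : ℝ) : ℝ :=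
  x - alpha lam sig P (ySig lam sig t x)

/-- `w = ∑ σ^l (A_{k,l}(y) Q̃_σ^k(y_σ) + B_{k,l}(y) (Q̃_σ^k)'(y_σ))`. -/
def wErr (lam sig : ℝ) (P : Profile) (t x : ℝ) : ℝ :=
  ∑ p ∈ Sigma0, sig ^ p.2 *
    (P.A p.1 p.2 (yVar lam sig P t x) * Qt lam sig (ySig lam sig t x) ^ p.1 +
      P.B p.1 p.2 (yVar lam sig P t x) *
        deriv (fun r => Qt lam sig r ^ p.1) (ySig lam sig t x))

/-- The approximate solution `z = Q(y) + Q̃_σ(y_σ) + w`. -/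
def zApp (lam sig : ℝ) (P : Profile) (t x : ℝ) : ℝ :=
  Q (yVar lam sig P t x) + Qt lam sig (ySig lam sig t x) + wErr lam sig P t x

/-- The residual `S(z) = (1 - λ ∂ₓ²) ∂ₜ z + ∂ₓ(∂ₓ² z - z + z²)`. -/
def residual (lam : ℝ) (z : ℝ → ℝ → ℝ) (t x : ℝ) : ℝ :=
  (deriv (fun s => z s x) t - lam * iteratedDeriv 2 (fun ξ => deriv (fun s => z s ξ) t) x) +
    deriv (fun ξ => iteratedDeriv 2 (z t) ξ - z t ξ + z t ξ ^ 2) x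

/-! ### The systems determining the coefficients

`sourceF lam P k l` and `sourceG lam P k l` are the functions of `y` which multiply
`σ^l Q̃_σ^k(y_σ)` and `σ^l (Q̃_σ^k)'(y_σ)` in the expansion of `S(z)` when in `z`, and in `α`,
only the terms with indices `(k', l')`, `k' + l' < k + l`, are kept. The expansion uses
`Q̃'' = σ Q̃ - Q̃²/θ`, `(Q̃')² = σ Q̃² - 2 Q̃³/(3θ)`, `1/θ = (1 - λσ)/(1 - λ)` and
`μ = 1 - (1 - λ)(σ + λσ² + λ²σ³ + ⋯)`. Below `m = 1/(1 - λ)`, and `q n`, `A₁₀ n`, … are the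
`n`-th derivatives of `Q`, `A_{1,0}`, … at `y`. -/

def sourceF (lam : ℝ) (P : Profile) (k l : ℕ) (y : ℝ) : ℝ :=
  let m := (1 - lam)⁻¹
  let q := fun n => iteratedDeriv n Q y
  let a₁₀ := P.a 1 0
  let a₁₁ := P.a 1 1
  let a₂₀ := P.a 2 0
  let A₁₀ := fun n => iteratedDeriv n (P.A 1 0) y
  let A₁₁ := fun n => iteratedDeriv n (P.A 1 1) y
  let A₂₀ := fun n => iteratedDeriv n (P.A 2 0) y
  let B₁₀ := fun n => iteratedDeriv n (P.B 1 0) y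
  let B₁₁ := fun n => iteratedDeriv n (P.B 1 1) y
  let B₂₀ := fun n => iteratedDeriv n (P.B 2 0) y
  match k, l with
  | 1, 0 =>
      2 * q 1
  | 1, 1 =>
      (3 - 2 * lam) * A₁₀ 1 + 2 * B₁₀ 0 * q 0 + (3 - lam) * B₁₀ 2
        + (-lam + lam ^ 2) * a₁₀ * q 3
  | 2, 0 =>
      2 * A₁₀ 0 * A₁₀ 1 - 2 * a₁₀ * A₁₀ 0 * q 1 - m * A₁₀ 1 - 2 * a₁₀ * A₁₀ 1 * q 0
        + (-3 + lam) * a₁₀ * A₁₀ 3 - 2 * m * B₁₀ 0 * q 0 + (-1 - 2 * m) * B₁₀ 2 - a₁₀ * q 1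
        + (3 - 2 * lam) * a₁₀ ^ 2 * q 3
  | 1, 2 =>
      (2 * lam - 2 * lam ^ 2) * A₁₀ 1 + (3 - 2 * lam) * A₁₁ 1 + (lam - lam ^ 2) * B₁₀ 2
        + 2 * B₁₁ 0 * q 0 + (3 - lam) * B₁₁ 2 + (-lam ^ 2 + lam ^ 3) * a₁₀ * q 3
        + (-lam + lam ^ 2) * a₁₁ * q 3
  | 2, 1 =>
      2 * A₁₀ 0 * A₁₁ 1 + 4 * A₁₀ 0 * B₁₀ 0 - 2 * a₁₁ * A₁₀ 0 * q 1 + (-1 + m) * A₁₀ 1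
        + 2 * A₁₀ 1 * A₁₁ 0 - 2 * a₁₁ * A₁₀ 1 * q 0 + (-6 + 6 * lam) * a₁₀ * A₁₀ 1
        + (-lam + lam ^ 2) * a₁₀ * A₁₀ 3 + (-3 + lam) * a₁₁ * A₁₀ 3 - 2 * a₁₀ * A₁₁ 0 * q 1
        - m * A₁₁ 1 - 2 * a₁₀ * A₁₁ 1 * q 0 + (-3 + lam) * a₁₀ * A₁₁ 3
        + (12 - 8 * lam) * A₂₀ 1 + 2 * B₁₀ 0 * B₁₀ 1 + (-2 + 2 * m) * B₁₀ 0 * q 0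
        + (-2 + 2 * m) * B₁₀ 2 + (-9 + 6 * lam) * a₁₀ * B₁₀ 2 - 2 * m * B₁₁ 0 * q 0
        + (-1 - 2 * m) * B₁₁ 2 + 8 * B₂₀ 0 * q 0 + (12 - 4 * lam) * B₂₀ 2 - a₁₁ * q 1
        + (-3 + 3 * lam) * a₂₀ * q 1 + (6 - 4 * lam) * a₁₀ * a₁₁ * q 3
        + (2 * lam - 2 * lam ^ 2) * a₁₀ ^ 2 * q 3 + (-lam + lam ^ 2) * a₂₀ * q 3
  | 3, 0 =>
      -2 * a₁₀ * A₁₀ 0 * A₁₀ 1 + 2 * A₁₀ 0 * A₂₀ 1 - 10 / 3 * m * A₁₀ 0 * B₁₀ 0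
        - 2 * a₂₀ * A₁₀ 0 * q 1 + 2 * A₁₀ 1 * A₂₀ 0 - 2 * a₂₀ * A₁₀ 1 * q 0
        + 4 * a₁₀ * A₁₀ 1 + (3 - 2 * lam) * a₁₀ ^ 2 * A₁₀ 3 + (-3 + lam) * a₂₀ * A₁₀ 3
        - 2 * a₁₀ * A₂₀ 0 * q 1 + (-14 / 3 - 10 / 3 * m) * A₂₀ 1 - 2 * a₁₀ * A₂₀ 1 * q 0
        + (-3 + lam) * a₁₀ * A₂₀ 3 - 4 / 3 * m * B₁₀ 0 * B₁₀ 1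
        + (16 / 3 + 8 / 3 * m) * a₁₀ * B₁₀ 2 - 20 / 3 * m * B₂₀ 0 * q 0
        + (-10 / 3 - 20 / 3 * m) * B₂₀ 2 + 4 / 3 * a₂₀ * q 1
        + (6 - 4 * lam) * a₁₀ * a₂₀ * q 3 + (-1 + lam) * a₁₀ ^ 3 * q 3
  | _, _ => 0

def sourceG (lam : ℝ) (P : Profile) (k l : ℕ) (y : ℝ) : ℝ :=
  let m := (1 - lam)⁻¹
  let q := fun n => iteratedDeriv n Q y
  let a₁₀ := P.a 1 0
  let a₁₁ := P.a 1 1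
  let a₂₀ := P.a 2 0
  let A₁₀ := fun n => iteratedDeriv n (P.A 1 0) y
  let A₁₁ := fun n => iteratedDeriv n (P.A 1 1) y
  let A₂₀ := fun n => iteratedDeriv n (P.A 2 0) y
  let B₁₀ := fun n => iteratedDeriv n (P.B 1 0) y
  let B₁₁ := fun n => iteratedDeriv n (P.B 1 1) y
  let B₂₀ := fun n => iteratedDeriv n (P.B 2 0) y
  match k, l with
  | 1, 0 =>
      2 * q 0
  | 1, 1 =>
      (lam - lam ^ 2) * A₁₀ 2 + (3 - 2 * lam) * B₁₀ 1 + (-2 * lam + 2 * lam ^ 2) * a₁₀ * q 2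
  | 2, 0 =>
      A₁₀ 0 + A₁₀ 0 * B₁₀ 1 + A₁₀ 0 ^ 2 + A₁₀ 1 * B₁₀ 0 + (-9 / 2 + 3 * lam) * a₁₀ * A₁₀ 2
        - a₁₀ * B₁₀ 0 * q 1 + (-1 - m) * B₁₀ 1 - a₁₀ * B₁₀ 1 * q 0
        + (-3 / 2 + 1 / 2 * lam) * a₁₀ * B₁₀ 3 + (3 / 2 - 3 / 2 * lam) * a₁₀ ^ 2 * q 2
  | 1, 2 =>
      (lam ^ 2 - lam ^ 3) * A₁₀ 2 + (lam - lam ^ 2) * A₁₁ 2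
        + (2 * lam - 2 * lam ^ 2) * B₁₀ 1 + (3 - 2 * lam) * B₁₁ 1
        + (-2 * lam ^ 2 + 2 * lam ^ 3) * a₁₀ * q 2 + (-2 * lam + 2 * lam ^ 2) * a₁₁ * q 2
  | 2, 1 =>
      2 * A₁₀ 0 * A₁₁ 0 + A₁₀ 0 * B₁₁ 1 + A₁₀ 1 * B₁₁ 0
        + (-3 * lam + 3 * lam ^ 2) * a₁₀ * A₁₀ 2 + (-9 / 2 + 3 * lam) * a₁₁ * A₁₀ 2 + A₁₁ 0
        + A₁₁ 0 * B₁₀ 1 + A₁₁ 1 * B₁₀ 0 + (-9 / 2 + 3 * lam) * a₁₀ * A₁₁ 2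
        + (3 - 3 * lam) * A₂₀ 0 + (lam - lam ^ 2) * A₂₀ 2 - a₁₁ * B₁₀ 0 * q 1 + B₁₀ 0 ^ 2
        + (-1 + m) * B₁₀ 1 - a₁₁ * B₁₀ 1 * q 0 + (-3 + 3 * lam) * a₁₀ * B₁₀ 1
        + (-1 / 2 * lam + 1 / 2 * lam ^ 2) * a₁₀ * B₁₀ 3
        + (-3 / 2 + 1 / 2 * lam) * a₁₁ * B₁₀ 3 - a₁₀ * B₁₁ 0 * q 1 + (-1 - m) * B₁₁ 1
        - a₁₀ * B₁₁ 1 * q 0 + (-3 / 2 + 1 / 2 * lam) * a₁₀ * B₁₁ 3 + (12 - 8 * lam) * B₂₀ 1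
        + (3 - 3 * lam) * a₁₀ * a₁₁ * q 2 + (3 / 2 * lam - 3 / 2 * lam ^ 2) * a₁₀ ^ 2 * q 2
        + (-2 * lam + 2 * lam ^ 2) * a₂₀ * q 2
  | 3, 0 =>
      2 * A₁₀ 0 * A₂₀ 0 - 2 / 3 * a₁₀ * A₁₀ 0 * B₁₀ 1 + 4 / 3 * A₁₀ 0 * B₂₀ 1
        - 2 / 3 * a₁₀ * A₁₀ 1 * B₁₀ 0 + 4 / 3 * A₁₀ 1 * B₂₀ 0
        + (2 - 2 * lam) * a₁₀ ^ 2 * A₁₀ 2 + (-4 + 8 / 3 * lam) * a₂₀ * A₁₀ 2 - 4 / 3 * A₂₀ 0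
        + 2 / 3 * A₂₀ 0 * B₁₀ 1 + 2 / 3 * A₂₀ 1 * B₁₀ 0 + (-5 + 10 / 3 * lam) * a₁₀ * A₂₀ 2
        - 2 / 3 * a₂₀ * B₁₀ 0 * q 1 - 2 / 3 * m * B₁₀ 0 ^ 2 - 2 / 3 * a₂₀ * B₁₀ 1 * q 0
        + 8 / 3 * a₁₀ * B₁₀ 1 + (1 - 2 / 3 * lam) * a₁₀ ^ 2 * B₁₀ 3
        + (-1 + 1 / 3 * lam) * a₂₀ * B₁₀ 3 - 4 / 3 * a₁₀ * B₂₀ 0 * q 1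
        + (-16 / 3 - 10 / 3 * m) * B₂₀ 1 - 4 / 3 * a₁₀ * B₂₀ 1 * q 0
        + (-2 + 2 / 3 * lam) * a₁₀ * B₂₀ 3 + (3 - 3 * lam) * a₁₀ * a₂₀ * q 2
  | _, _ => 0

/-- The system `(Ω_{k,l})`:
`(L A)' = a {(λ - 3) Q'' - Q²}' + F` and
`(L B)' = (3 - λ) A'' + 2 Q A + a (2λ - 3) Q'' + G`. -/
def Omega (lam : ℝ) (P : Profile) (k l : ℕ) : Prop :=
  (∀ y : ℝ, deriv (L (P.A k l)) y =
    P.a k l * deriv (fun x => (lam - 3) * iteratedDeriv 2 Q x - Q x ^ 2) y +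
      sourceF lam P k l y) ∧
  (∀ y : ℝ, deriv (L (P.B k l)) y =
    (3 - lam) * iteratedDeriv 2 (P.A k l) y + 2 * Q y * P.A k l y +
      P.a k l * (2 * lam - 3) * iteratedDeriv 2 Q y + sourceG lam P k l y)

/-- `a_{1,0}`. -/
def a10 (lam : ℝ) : ℝ := 10 * (1 + lam) / (15 + 10 * lam - lam ^ 2)

/-- `b_{1,0}`. -/
def b10 (lam : ℝ) : ℝ := (-30 + 18 * lam ^ 2) / (15 + 10 * lam - lam ^ 2)

/-- `A_{1,0}`. -/
def A10 (lam y : ℝ) : ℝ :=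
  -(y * deriv Q y + 2 * Q y) - a10 lam * ((lam - 3) / 2 * (y * deriv Q y) - Q y)

/-- `B_{1,0}`, with its free parameter `κ`. -/
def B10 (lam kap y : ℝ) : ℝ :=
  (3 - lam) / 4 * (y ^ 2 * deriv Q y) + y * Q y -
    a10 lam * ((lam - 3) ^ 2 / 8 * (y ^ 2 * deriv Q y) + (3 - lam) / 2 * (y * Q y)) +
    b10 lam * phi y + kap * deriv Q y

/-- `d(λ) = b_{2,0} + b_{1,0}³/(6(1 - λ))`. -/
def dCoef (lam : ℝ) (P : Profile) : ℝ :=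
  P.b 2 0 + P.b 1 0 ^ 3 / (6 * (1 - lam))

/-- The prescribed limits `γ_{k,l}` of `A_{k,l}` at `±∞`. -/
def gammaCoef (lam : ℝ) (P : Profile) (k l : ℕ) : ℝ :=
  match k, l with
  | 1, 1 => P.b 1 0 ^ 2 / 2
  | 2, 0 => -(P.b 1 0 ^ 2 / (2 * (1 - lam)))
  | 3, 0 => 5 / (36 * (1 - lam) ^ 2) * P.b 1 0 ^ 4
      - 10 / (3 * (1 - lam)) * dCoef lam P * P.b 1 0
  | 2, 1 => -(1 / (24 * (1 - lam)) * P.b 1 0 ^ 4) + lam / (2 * (1 - lam)) * P.b 1 0 ^ 2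
      - 1 / (1 - lam) * P.b 1 0 * P.b 1 1 + 4 * dCoef lam P * P.b 1 0
  | 1, 2 => -(1 / 8 * P.b 1 0 ^ 4) + P.b 1 0 * P.b 1 1
  | _, _ => 0

/-- The choice of the coefficients: `(a_{1,0}, A_{1,0}, B_{1,0})` is the explicit solution of
`(Ω_{1,0})`, normalised by `∫ B_{1,0} Q' = 0`; for every `(k, l) ∈ Σ₀` the system `(Ω_{k,l})` is
solved with `A_{k,l}` even, `A_{k,l} - γ_{k,l} ∈ 𝒴`, `B_{k,l}` odd and
`B_{k,l} - b_{k,l} φ ∈ 𝒴`. -/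
structure IsAdmissible (lam : ℝ) (P : Profile) : Prop where
  a_one_zero : P.a 1 0 = a10 lam
  b_one_zero : P.b 1 0 = b10 lam
  A_one_zero : P.A 1 0 = A10 lam
  B_one_zero : ∃ kap : ℝ, P.B 1 0 = B10 lam kap
  B_one_zero_orth : ∫ y : ℝ, P.B 1 0 y * deriv Q y = 0
  A_even : ∀ p ∈ Sigma0, Function.Even (P.A p.1 p.2)
  B_odd : ∀ p ∈ Sigma0, Function.Odd (P.B p.1 p.2)
  A_classY : ∀ p ∈ Sigma0, ClassY fun y => P.A p.1 p.2 y - gammaCoef lam P p.1 p.2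
  B_classY : ∀ p ∈ Sigma0, ClassY fun y => P.B p.1 p.2 y - P.b p.1 p.2 * phi y
  omega : ∀ p ∈ Sigma0, Omega lam P p.1 p.2

/-! ### Shifts and norms -/

/-- `δ = ∑ a_{k,l} σ^l ∫ Q̃_σ^k`. -/
def delta (lam sig : ℝ) (P : Profile) : ℝ :=
  ∑ p ∈ Sigma0, P.a p.1 p.2 * sig ^ p.2 * ∫ x : ℝ, Qt lam sig x ^ p.1

/-- `δ_σ = 2 (b_{1,0} + σ b̃_{1,1})`, `b̃_{1,1} = b_{1,1} - b_{1,0}³/6`. -/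
def deltaSig (sig : ℝ) (P : Profile) : ℝ :=
  2 * (P.b 1 0 + sig * (P.b 1 1 - P.b 1 0 ^ 3 / 6))

/-- `Q(x - δ/2) + Q̃_σ(x + μτ - δ_σ/2) - d(λ) (Q̃_σ²)'(x + μτ - δ_σ/2)`. -/
def afterCollision (lam sig : ℝ) (P : Profile) (x : ℝ) : ℝ :=
  Q (x - delta lam sig P / 2) +
    Qt lam sig (x + mu lam sig * tau sig - deltaSig sig P / 2) -
    dCoef lam P * deriv (fun r => Qt lam sig r ^ 2)
      (x + mu lam sig * tau sig - deltaSig sig P / 2)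

/-- `Q(x + δ/2) + Q̃_σ(x - μτ + δ_σ/2) + d(λ) (Q̃_σ²)'(x - μτ + δ_σ/2)`. -/
def beforeCollision (lam sig : ℝ) (P : Profile) (x : ℝ) : ℝ :=
  Q (x + delta lam sig P / 2) +
    Qt lam sig (x - mu lam sig * tau sig + deltaSig sig P / 2) +
    dCoef lam P * deriv (fun r => Qt lam sig r ^ 2)
      (x - mu lam sig * tau sig + deltaSig sig P / 2)

/-- The `H¹(ℝ)` norm `(‖f‖²_{L²} + ‖f'‖²_{L²})^{1/2}` of a smooth function, with values in
`[0, ∞]`. -/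
def h1Norm (f : ℝ → ℝ) : ℝ≥0∞ :=
  (eLpNorm f 2 volume ^ 2 + eLpNorm (deriv f) 2 volume ^ 2) ^ (1 / 2 : ℝ)

end BBM

end

/-! Write `X = Q̃_σ(y_σ)`, `Y = Q̃_σ'(y_σ)` and give σ, X, Y the weights 2, 2, 3, that is, the
powers of √σ that bound them.

Residual. The ansatz is a sum of fourteen products `f(y) g(y_σ)`. The identities for `Q̃_σ''` and
`(Q̃_σ')²` express all derivatives of the factors `g` through σ, X, Y and 1/θ_σ, so `S(z)` is
exactly a polynomial in these quantities, with coefficients built from the values at `y` of Q,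
A_{k,l}, B_{k,l} and their derivatives (`residual_zApp`). Its part of weight at most 7 involves
thirteen monomials: 1, for which the coefficient vanishes by the equation of Q, and `σ^l X^k`, `σ^l
X^{k-1} Y`, for which the coefficients vanish by the two equations of `(Ω_{k,l})`. What is left is
`O(σ⁴ e^{-√σ|y_σ|})` together with its x-derivative, and the L² norm of the exponential costs
`σ^{-1/4}`, whence the exponent 15/4.

To avoid following individual error terms, families of functions indexed by (σ, t) that are bounded
with their derivatives are made into a ring `bddRing`, in which those of a given order form an ideal
`ordIdeal`. In the quotient by the ideal of order `σ⁴ e^{-|r|}`, r = √σ y_σ, the relations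
`WeightRel` hold, and the vanishing of the residual becomes an identity valid in any commutative
ring with these relations (`residual_poly_eq_zero`); `ord_residual` draws the conclusion.

Existence. The systems are solved in order of k + l. The first equation integrates to `L A` = an
even function plus a constant; L is invertible on even functions of 𝒴, and `L 1 = 1 - 2Q` allows any
limit γ to be prescribed. The second integrates to `L B` = an odd primitive. Its nonzero limit is
carried by `b φ`, and since L annihilates Q' the rest is solvable only if the right-hand side of the
second equation is orthogonal to Q. The scalar `a` enters this condition with the coefficient `3/20
(15 + 10λ - λ²)`, which is not zero (`integral_Q_mul_Rstar`), and so is determined. Sources remain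
in 𝒴 because γ_{1,1} and γ_{2,0} make the limits cancel in G_{2,1} and G_{3,0} (`SourceData.gr_G`).

Collision. At time τ_σ the small soliton is far to the left of the large one. There A_{k,l} is close
to γ_{k,l} and B_{k,l} to -b_{k,l}, so z is close to `X + Σ σ^l (γ_{k,l} X^k - b_{k,l} (X^k)')`. The
constants γ_{k,l}, d(λ), δ_σ are exactly those for which this agrees, through weight 6, with the
Taylor expansion of the shifted profile (`matchPoly_eq_zero`); the remainder has weight 7 and H¹
norm `O(σ^{7/2 - 1/4})`. Near the large soliton α is close to δ/2. All other discrepancies carry a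
factor like `exp(-√σ μ τ_σ / 2)`, and `√σ τ_σ = σ^{-1/100}` makes this smaller than any power of σ
(`ord_collisionErr`). The time -τ_σ follows from the symmetry of z. -/

namespace BBM

/-! ### Algebra of the expansion modulo weight 8. -/

/-- The relations between `s = σ`, `X = Q̃_σ`, `Y = Q̃_σ'`, `n = 1/θ_σ`, `t = 1/3` modulo terms
of weight at least `8`, where `s`, `X`, `Y` have weights `2`, `2`, `3`. -/
structure WeightRel {R : Type*} [CommRing R] (s X Y n t : R) : Prop where
  X4 : X^4 = 0
  sX3 : s*X^3 = 0
  s2X2 : s^2*X^2 = 0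
  s3X : s^3*X = 0
  X3Y : X^3*Y = 0
  sX2Y : s*X^2*Y = 0
  s2XY : s^2*X*Y = 0
  s3Y : s^3*Y = 0
  Y2 : Y^2 = s*X^2 - 2*t*n*X^3

/-- `∂ₓ²` of `f(y) g(s)` in terms of the derivatives of `f`, `g` and of `b = β(s)`. -/
def prodDxx {R : Type*} [CommRing R] (f0 f1 f2 g0 g1 g2 b b1 : R) : R :=
  (1 - b)^2*f2*g0 - b1*f1*g0 + 2*(1 - b)*f1*g1 + f0*g2

/-- `(1 - λ∂ₓ²)∂ₜ + ∂ₓ³ - ∂ₓ` of `f(y) g(s)` in terms of the derivatives of `f`, `g` and of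
`b = β(s)`. -/
def prodLin {R : Type*} [CommRing R] (lam mu f0 f1 f2 f3 g0 g1 g2 g3 b b1 b2 : R) : R :=
  mu*(f0*g1 - b*f1*g0) - lam*mu*(prodDxx f0 f1 f2 g1 g2 g3 b b1
    + prodDxx f1 f2 f3 (-(b*g0)) (-(b1*g0 + b*g1)) (-(b2*g0 + 2*b1*g1 + b*g2)) b b1)
  + ((1 - b)^3*f3*g0 - 3*(1 - b)*b1*f2*g0 - b2*f1*g0 + 3*(1 - b)^2*f2*g1 - 3*b1*f1*g1
    + 3*(1 - b)*f1*g2 + f0*g3)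
  - ((1 - b)*f1*g0 + f0*g1)

/-- The terms are collected by the derivatives of `f`, and each product of derivatives of β and `g`
is kept as a separate variable. Such a product can then be truncated at weight 8 before it is
multiplied further, so the powers of β are never expanded in full. -/
theorem prodLin_eq {R : Type*} [CommRing R]
    {lam mu f0 f1 f2 f3 g0 g1 g2 g3 b b1 b2 bg0 bbg0 bbbg0 b1g0 bb1g0 b1g1 b2g0 bg1 bbg1 bg2 : R}
    (e1 : b*g0 = bg0) (e2 : b*bg0 = bbg0) (e3 : b*bbg0 = bbbg0) (e4 : b1*g0 = b1g0)
    (e5 : b*b1g0 = bb1g0) (e6 : b1*g1 = b1g1) (e7 : b2*g0 = b2g0) (e8 : b*g1 = bg1)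
    (e9 : b*bg1 = bbg1) (e10 : b*g2 = bg2) :
    prodLin lam mu f0 f1 f2 f3 g0 g1 g2 g3 b b1 b2 =
      f0*(mu*g1 - lam*mu*g3 + g3 - g1)
      + f1*(-mu*bg0 + lam*mu*(3*b1g1 - 2*g2 + 3*bg2 + b2g0) - b2g0 - 3*b1g1 + 3*g2 - 3*bg2
        - g0 + bg0)
      + f2*(-lam*mu*(g1 - 4*bg1 + 3*bbg1 - 2*b1g0 + 3*bb1g0) - 3*b1g0 + 3*bb1g0 + 3*g1 - 6*bg1
        + 3*bbg1)
      + f3*(lam*mu*(bg0 - 2*bbg0 + bbbg0) + g0 - 3*bg0 + 3*bbg0 - bbbg0) := by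
  subst e1 e2 e3 e4 e5 e6 e7 e8 e9 e10
  unfold prodLin prodDxx
  ring

/-- The first of thirteen normal forms, one for each type of product in the ansatz: after reduction
only monomials of weight at most 7 survive and `Y²` is eliminated. The derivatives of `f` are
independent ring elements. The remainder `rho` of μ disappears because it always comes with `s³X` or
`s³Y`. -/
theorem prodLin_Q {R : Type*} [CommRing R] {s X Y n t : R} (h : WeightRel s X Y n t)
    (lam rho a10 a11 a12 a20 a21 a30 f0 f1 f2 f3 : R) :
    prodLin lam (1 - (1 - lam)*(s + lam*s^2) + s^3*rho) f0 f1 f2 f3 (1) (0) (0) (0)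
      (X*a10 + X*a11*s + X*a12*s^2 + X^2*a20 + X^2*a21*s + X^3*a30)
      (2*X*Y*a20 + 2*X*Y*a21*s + 3*X^2*Y*a30 + Y*a10 + Y*a11*s + Y*a12*s^2)
      (6*X*Y^2*a30 + X*a10*s + X*a11*s^2 + X*a12*s^3 - X^2*a10*n - X^2*a11*n*s - X^2*a12*n*s^2
          + 2*X^2*a20*s + 2*X^2*a21*s^2 - 2*X^3*a20*n - 2*X^3*a21*n*s + 3*X^3*a30*s - 3*X^4*a30*n
          + 2*Y^2*a20 + 2*Y^2*a21*s) =
    (- f1 + f3)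
    + (- 3*a10*f3 + a10*f3*lam)*X
    + (3*a10^2*f2 - 3*a10^2*f2*lam - 6*a20*f2 + 4*a20*f2*lam)*X*Y
    + (6*a10*a11*f2 - 6*a10*a11*f2*lam + 3*a10^2*f2*lam - 3*a10^2*f2*lam^2 - 4*a20*f2*lam
        + 4*a20*f2*lam^2 - 6*a21*f2 + 4*a21*f2*lam)*X*Y*s
    + (- a10*f3*lam + a10*f3*lam^2 - 3*a11*f3 + a11*f3*lam)*X*s
    + (- a10*f3*lam^2 + a10*f3*lam^3 - a11*f3*lam + a11*f3*lam^2 - 3*a12*f3 + a12*f3*lam)*X*s^2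
    + (- a10*f1*lam*n + a10*f1*n + 3*a10^2*f3 - 2*a10^2*f3*lam - 3*a20*f3 + a20*f3*lam)*X^2
    + (9*a10*a20*f2 - 9*a10*a20*f2*lam - 9*a30*f2 + 6*a30*f2*lam)*X^2*Y
    + (6*a10*a11*f3 - 4*a10*a11*f3*lam + a10*f1*lam*n - a10*f1*lam^2*n + 2*a10^2*f3*lam
        - 2*a10^2*f3*lam^2 - a11*f1*lam*n + a11*f1*n - 3*a20*f1 + 3*a20*f1*lam - a20*f3*lam
        + a20*f3*lam^2 - 3*a21*f3 + a21*f3*lam)*X^2*s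
    + (6*a10*a20*f3 - 4*a10*a20*f3*lam - a10^3*f3 + a10^3*f3*lam - 2*a20*f1*lam*n - 4*a20*f1*lam*n*t
        + 2*a20*f1*n + 4*a20*f1*n*t - 3*a30*f3 + a30*f3*lam)*X^3
    + (- 3*a10*f2 + 2*a10*f2*lam)*Y
    + (- 2*a10*f2*lam + 2*a10*f2*lam^2 - 3*a11*f2 + 2*a11*f2*lam)*Y*s
    + (- 2*a10*f2*lam^2 + 2*a10*f2*lam^3 - 2*a11*f2*lam + 2*a11*f2*lam^2 - 3*a12*f2
        + 2*a12*f2*lam)*Y*s^2 := by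
  obtain ⟨h4, h31, h22, h13, k3, k2, k1, k0, hY⟩ := h
  -- The right-hand sides are the truncations of the products at weight 8; the multipliers of the
  -- relations record what was discarded. The same scheme is used for all the other products.
  rw [prodLin_eq
    (e1 := show _ = (X*a10 + X*a11*s + X*a12*s^2 + X^2*a20 + X^2*a21*s
        + X^3*a30 : R) by linear_combination 0)
    (e2 := show _ = (2*X^2*a10*a11*s + X^2*a10^2 + 2*X^3*a10*a20 : R) by
        linear_combination (2*a10*a12 + 2*a11*a12*s + a11^2 + a12^2*s^2)*h22 + (2*a10*a21
        + 2*a11*a20 + 2*a11*a21*s + 2*a12*a20*s + 2*a12*a21*s^2)*h31 + (2*X*a20*a30 + 2*X*a21*a30*s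
        + X^2*a30^2 + 2*a10*a30 + 2*a11*a30*s + 2*a12*a30*s^2 + 2*a20*a21*s + a20^2 + a21^2*s^2)*h4)
    (e3 := show _ = (X^3*a10^3 : R) by linear_combination (2*a10*a11*a12*s^2 + 2*a10*a11^2*s
        + 3*a10^2*a11 + a10^2*a12*s)*h31 + (2*X*a10*a11*a30*s + 2*X*a10*a20*a21*s + 2*X*a10*a20^2
        + X*a10^2*a30 + 2*X^2*a10*a20*a30 + 4*a10*a11*a20*s + 2*a10*a11*a21*s^2 + 2*a10*a12*a20*s^2
        + 3*a10^2*a20 + a10^2*a21*s)*h4)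
    (e4 := show _ = (2*X*Y*a20 + 2*X*Y*a21*s + 3*X^2*Y*a30 + Y*a10 + Y*a11*s
        + Y*a12*s^2 : R) by linear_combination 0)
    (e5 := show _ = (2*X*Y*a10*a11*s + X*Y*a10^2 + 3*X^2*Y*a10*a20 : R) by
        linear_combination (2*a10*a12 + a11^2)*k1 + (3*a10*a21 + 3*a11*a20)*k2 + (4*a10*a30
        + 2*a20^2)*k3 + (2*Y*a11*a12 + Y*a12^2*s)*h13 + (3*Y*a11*a21 + 3*Y*a12*a20
        + 3*Y*a12*a21*s)*h22 + (4*Y*a11*a30 + 4*Y*a12*a30*s + 4*Y*a20*a21 + 2*Y*a21^2*s)*h31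
        + (3*X*Y*a30^2 + 5*Y*a20*a30 + 5*Y*a21*a30*s)*h4)
    (e6 := show _ = (0 : R) by linear_combination 0)
    (e7 := show _ = (X*a10*s + X*a11*s^2 - X^2*a10*n - X^2*a11*n*s + 4*X^2*a20*s - 2*X^3*a20*n
        - 4*X^3*a20*n*t : R) by linear_combination (6*X*a30 + 2*a20 + 2*a21*s)*hY + (a12)*h13
        + (- a12*n + 4*a21)*h22 + (- 2*a21*n - 4*a21*n*t + 9*a30)*h31 + (- 3*a30*n - 12*a30*n*t)*h4)
    (e8 := show _ = (0 : R) by linear_combination 0)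
    (e9 := show _ = (0 : R) by linear_combination 0)
    (e10 := show _ = (0 : R) by linear_combination 0)]
  linear_combination (- 6*Y*a10*a11*f2*lam*rho*s + 6*Y*a10*a11*f2*lam^2 - 6*Y*a10*a11*f2*lam^3
      - 3*Y*a10^2*f2*lam*rho + 4*Y*a20*f2*lam*rho + 4*Y*a21*f2*lam*rho*s - 4*Y*a21*f2*lam^2
      + 4*Y*a21*f2*lam^3 + a10*f1*lam*rho*s - a10*f1*lam^2 + a10*f1*lam^3 - a10*f1*rho
      + a10*f3*lam*rho + a11*f1*lam*rho*s^2 - a11*f1*lam^2*s + a11*f1*lam^3*s - a11*f1*rho*s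
      + a11*f3*lam*rho*s - a11*f3*lam^2 + a11*f3*lam^3 + a12*f1 - a12*f1*lam + a12*f1*lam*s
      - a12*f1*lam^2*s - a12*f1*rho*s^2 - a12*f3*lam + a12*f3*lam*rho*s^2 + a12*f3*lam^2
      - a12*f3*lam^2*s + a12*f3*lam^3*s)*h13 + (- 9*Y*a10*a20*f2*lam*rho*s + 9*Y*a10*a20*f2*lam^2
      - 9*Y*a10*a20*f2*lam^3 + 6*Y*a30*f2*lam*rho*s - 6*Y*a30*f2*lam^2 + 6*Y*a30*f2*lam^3
      + 4*a10*a11*f3*lam - 4*a10*a11*f3*lam*rho*s^2 - 4*a10*a11*f3*lam^2 + 4*a10*a11*f3*lam^2*s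
      - 4*a10*a11*f3*lam^3*s - a10*f1*lam*n*rho*s + a10*f1*lam^2*n - a10*f1*lam^3*n
      - 2*a10^2*f3*lam*rho*s + 2*a10^2*f3*lam^2 - 2*a10^2*f3*lam^3 + a11*f1*lam*n
      - a11*f1*lam*n*rho*s^2 - a11*f1*lam^2*n + a11*f1*lam^2*n*s - a11*f1*lam^3*n*s - 3*a20*f1*lam
      + 4*a20*f1*lam*rho*s^2 + 3*a20*f1*lam^2 - 4*a20*f1*lam^2*s + 4*a20*f1*lam^3*s - a20*f1*rho*s
      + a20*f3*lam*rho*s - a20*f3*lam^2 + a20*f3*lam^3 + a21*f1 - a21*f1*lam + a21*f1*lam*s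
      - a21*f1*lam^2*s - a21*f1*rho*s^2 - a21*f3*lam + a21*f3*lam*rho*s^2 + a21*f3*lam^2
      - a21*f3*lam^2*s + a21*f3*lam^3*s)*h22 + (4*a10*a20*f3*lam - 4*a10*a20*f3*lam*rho*s^2
      - 4*a10*a20*f3*lam^2 + 4*a10*a20*f3*lam^2*s - 4*a10*a20*f3*lam^3*s - a10^3*f3*lam
      + a10^3*f3*lam*rho*s^2 + a10^3*f3*lam^2 - a10^3*f3*lam^2*s + a10^3*f3*lam^3*s + 2*a20*f1*lam*n
      - 2*a20*f1*lam*n*rho*s^2 - 4*a20*f1*lam*n*rho*s^2*t + 4*a20*f1*lam*n*t - 2*a20*f1*lam^2*n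
      + 2*a20*f1*lam^2*n*s + 4*a20*f1*lam^2*n*s*t - 4*a20*f1*lam^2*n*t - 2*a20*f1*lam^3*n*s
      - 4*a20*f1*lam^3*n*s*t + a30*f1 - a30*f1*lam + a30*f1*lam*s - a30*f1*lam^2*s - a30*f1*rho*s^2
      - a30*f3*lam + a30*f3*lam*rho*s^2 + a30*f3*lam^2 - a30*f3*lam^2*s + a30*f3*lam^3*s)*h31
      + (2*a10*f2*lam*rho + 2*a11*f2*lam*rho*s - 2*a11*f2*lam^2 + 2*a11*f2*lam^3 - 2*a12*f2*lam
      + 2*a12*f2*lam*rho*s^2 + 2*a12*f2*lam^2 - 2*a12*f2*lam^2*s + 2*a12*f2*lam^3*s)*k0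
      + (6*a10*a11*f2*lam - 6*a10*a11*f2*lam^2 + 3*a10^2*f2*lam^2 - 3*a10^2*f2*lam^3
      - 4*a20*f2*lam^2 + 4*a20*f2*lam^3 - 4*a21*f2*lam + 4*a21*f2*lam^2)*k1 + (9*a10*a20*f2*lam
      - 9*a10*a20*f2*lam^2 - 6*a30*f2*lam + 6*a30*f2*lam^2)*k2

/-- Applied with `f = A_{1,0}`, and with `f = 1` for the small soliton itself. -/
theorem prodLin_A10 {R : Type*} [CommRing R] {s X Y n t : R} (h : WeightRel s X Y n t)
    (lam rho a10 a11 a12 a20 a21 a30 f0 f1 f2 f3 : R) :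
    prodLin lam (1 - (1 - lam)*(s + lam*s^2) + s^3*rho) f0 f1 f2 f3 (X) (Y) (X*s - X^2*n) (- 2*X*Y*n
        + Y*s)
      (X*a10 + X*a11*s + X*a12*s^2 + X^2*a20 + X^2*a21*s + X^3*a30)
      (2*X*Y*a20 + 2*X*Y*a21*s + 3*X^2*Y*a30 + Y*a10 + Y*a11*s + Y*a12*s^2)
      (6*X*Y^2*a30 + X*a10*s + X*a11*s^2 + X*a12*s^3 - X^2*a10*n - X^2*a11*n*s - X^2*a12*n*s^2
          + 2*X^2*a20*s + 2*X^2*a21*s^2 - 2*X^3*a20*n - 2*X^3*a21*n*s + 3*X^3*a30*s - 3*X^4*a30*n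
          + 2*Y^2*a20 + 2*Y^2*a21*s) =
    (- f1 + f3)*X
    + (- 9*a10*f2 + 6*a10*f2*lam + 2*f0*lam*n - 2*f0*n)*X*Y
    + (- 6*a10*f2*lam + 6*a10*f2*lam^2 - 9*a11*f2 + 6*a11*f2*lam - 2*f0*lam*n + 2*f0*lam^2*n)*X*Y*s
    + (3*f1 - 2*f1*lam)*X*s
    + (2*f1*lam - 2*f1*lam^2)*X*s^2
    + (- 3*a10*f3 + a10*f3*lam + 2*f1*lam*n - 3*f1*n)*X^2
    + (6*a10^2*f2 - 6*a10^2*f2*lam - 12*a20*f2 + 8*a20*f2*lam)*X^2*Y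
    + (- 6*a10*f1 + 6*a10*f1*lam - a10*f3*lam + a10*f3*lam^2 - 3*a11*f3 + a11*f3*lam - 2*f1*lam*n
        + 2*f1*lam^2*n)*X^2*s
    + (- 4*a10*f1*lam*n - 6*a10*f1*lam*n*t + 4*a10*f1*n + 6*a10*f1*n*t + 3*a10^2*f3 - 2*a10^2*f3*lam
        - 3*a20*f3 + a20*f3*lam)*X^3
    + (3*f2 - f2*lam)*Y
    + (f2*lam - f2*lam^2)*Y*s
    + (f2*lam^2 - f2*lam^3)*Y*s^2 := by
  obtain ⟨h4, h31, h22, h13, k3, k2, k1, k0, hY⟩ := h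
  rw [prodLin_eq
    (e1 := show _ = (X^2*a10 + X^2*a11*s + X^3*a20 : R) by linear_combination (a12)*h22 + (a21)*h31
        + (a30)*h4)
    (e2 := show _ = (X^3*a10^2 : R) by linear_combination (2*a10*a11 + a10*a12*s + a11*a12*s^2
        + a11^2*s)*h31 + (X*a10*a30 + X*a11*a30*s + X*a20*a21*s + X*a20^2 + X^2*a20*a30 + 2*a10*a20
        + a10*a21*s + 2*a11*a20*s + a11*a21*s^2 + a12*a20*s^2)*h4)
    (e3 := show _ = (0 : R) by linear_combination (X*a10^2*a20 + X*a10^2*a21*s + X^2*a10^2*a30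
        + a10^2*a11*s + a10^2*a12*s^2 + a10^3)*h4)
    (e4 := show _ = (X*Y*a10 + X*Y*a11*s + 2*X^2*Y*a20 : R) by linear_combination (a12)*k1
        + (2*a21)*k2 + (3*a30)*k3)
    (e5 := show _ = (X^2*Y*a10^2 : R) by linear_combination (2*a10*a11)*k2 + (3*a10*a20)*k3
        + (Y*a10*a12 + Y*a11*a12*s + Y*a11^2)*h22 + (Y*a10*a21 + 3*Y*a11*a20 + Y*a11*a21*s
        + 2*Y*a12*a20*s)*h31 + (2*X*Y*a20*a30 + Y*a10*a30 + Y*a11*a30*s + 2*Y*a20*a21*s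
        + 2*Y*a20^2)*h4)
    (e6 := show _ = (X^2*a10*s - 2*X^3*a10*n*t : R) by linear_combination (2*X*a20 + 2*X*a21*s
        + 3*X^2*a30 + a10 + a11*s + a12*s^2)*hY + (a11 + a12*s)*h22 + (- 2*a11*n*t - 2*a12*n*s*t
        + 2*a20 + 2*a21*s)*h31 + (- 6*X*a30*n*t - 4*a20*n*t - 4*a21*n*s*t + 3*a30*s)*h4)
    (e7 := show _ = (X^2*a10*s - X^3*a10*n : R) by linear_combination (2*X*a20 + 2*X*a21*s
        + 6*X^2*a30)*hY + (a11 + a12*s)*h22 + (- a11*n - a12*n*s + 4*a20 + 4*a21*s)*h31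
        + (- 3*X*a30*n - 12*X*a30*n*t - 2*a20*n - 4*a20*n*t - 2*a21*n*s - 4*a21*n*s*t + 9*a30*s)*h4)
    (e8 := show _ = (X*Y*a10 + X*Y*a11*s + X^2*Y*a20 : R) by linear_combination (a12)*k1 + (a21)*k2
        + (a30)*k3)
    (e9 := show _ = (X^2*Y*a10^2 : R) by linear_combination (2*a10*a11)*k2 + (2*a10*a20)*k3
        + (Y*a10*a12 + Y*a11*a12*s + Y*a11^2)*h22 + (Y*a10*a21 + 2*Y*a11*a20 + Y*a11*a21*s
        + Y*a12*a20*s)*h31 + (X*Y*a20*a30 + Y*a10*a30 + Y*a11*a30*s + Y*a20*a21*s + Y*a20^2)*h4)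
    (e10 := show _ = (X^2*a10*s - X^3*a10*n : R) by linear_combination (a11 + a12*s)*h22 + (- a11*n
        - a12*n*s + a20 + a21*s)*h31 + (- X*a30*n - a20*n - a21*n*s + a30*s)*h4)]
  linear_combination (- f0*lam*rho*s + f0*lam^2 - f0*lam^3 + f0*rho - f2*lam*rho)*k0
      + (- 6*a10*f2*lam^2 + 6*a10*f2*lam^3 - 6*a11*f2*lam + 6*a11*f2*lam^2 - 2*f0*lam^2*n
      + 2*f0*lam^3*n)*k1 + (6*Y*a10*f2*lam*rho + 6*Y*a11*f2*lam*rho*s - 6*Y*a11*f2*lam^2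
      + 6*Y*a11*f2*lam^3 + 2*Y*f0*lam*n*rho - 2*f1*lam*rho*s + 2*f1*lam^2 - 2*f1*lam^3)*h13
      + (- 6*Y*a10^2*f2*lam*rho*s + 6*Y*a10^2*f2*lam^2 - 6*Y*a10^2*f2*lam^3 + 8*Y*a20*f2*lam*rho*s
      - 8*Y*a20*f2*lam^2 + 8*Y*a20*f2*lam^3 - 6*a10*f1*lam + 7*a10*f1*lam*rho*s^2 + 6*a10*f1*lam^2
      - 7*a10*f1*lam^2*s + 7*a10*f1*lam^3*s - a10*f1*rho*s + a10*f3*lam*rho*s - a10*f3*lam^2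
      + a10*f3*lam^3 + a11*f1 - a11*f1*lam + a11*f1*lam*s - a11*f1*lam^2*s - a11*f1*rho*s^2
      - a11*f3*lam + a11*f3*lam*rho*s^2 + a11*f3*lam^2 - a11*f3*lam^2*s + a11*f3*lam^3*s
      + 2*f1*lam*n*rho*s - 2*f1*lam^2*n + 2*f1*lam^3*n)*h22 + (4*a10*f1*lam*n
      - 4*a10*f1*lam*n*rho*s^2 - 6*a10*f1*lam*n*rho*s^2*t + 6*a10*f1*lam*n*t - 4*a10*f1*lam^2*n
      + 4*a10*f1*lam^2*n*s + 6*a10*f1*lam^2*n*s*t - 6*a10*f1*lam^2*n*t - 4*a10*f1*lam^3*n*s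
      - 6*a10*f1*lam^3*n*s*t + 2*a10^2*f3*lam - 2*a10^2*f3*lam*rho*s^2 - 2*a10^2*f3*lam^2
      + 2*a10^2*f3*lam^2*s - 2*a10^2*f3*lam^3*s + a20*f1 - a20*f1*lam + a20*f1*lam*s
      - a20*f1*lam^2*s - a20*f1*rho*s^2 - a20*f3*lam + a20*f3*lam*rho*s^2 + a20*f3*lam^2
      - a20*f3*lam^2*s + a20*f3*lam^3*s)*h31 + (6*a10^2*f2*lam - 6*a10^2*f2*lam^2 - 8*a20*f2*lam
      + 8*a20*f2*lam^2)*k2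

theorem prodLin_B10 {R : Type*} [CommRing R] {s X Y n t : R} (h : WeightRel s X Y n t)
    (lam rho a10 a11 a12 a20 a21 a30 f0 f1 f2 f3 : R) :
    prodLin lam (1 - (1 - lam)*(s + lam*s^2) + s^3*rho) f0 f1 f2 f3 (Y) (X*s - X^2*n) (- 2*X*Y*n
        + Y*s) (X*s^2 - 3*X^2*n*s + 2*X^3*n^2 - 2*Y^2*n)
      (X*a10 + X*a11*s + X*a12*s^2 + X^2*a20 + X^2*a21*s + X^3*a30)
      (2*X*Y*a20 + 2*X*Y*a21*s + 3*X^2*Y*a30 + Y*a10 + Y*a11*s + Y*a12*s^2)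
      (6*X*Y^2*a30 + X*a10*s + X*a11*s^2 + X*a12*s^3 - X^2*a10*n - X^2*a11*n*s - X^2*a12*n*s^2
          + 2*X^2*a20*s + 2*X^2*a21*s^2 - 2*X^3*a20*n - 2*X^3*a21*n*s + 3*X^3*a30*s - 3*X^4*a30*n
          + 2*Y^2*a20 + 2*Y^2*a21*s) =
    (- 3*a10*f3 + a10*f3*lam + 4*f1*lam*n - 6*f1*n)*X*Y
    + (- 6*a10*f1 + 6*a10*f1*lam - a10*f3*lam + a10*f3*lam^2 - 3*a11*f3 + a11*f3*lam - 4*f1*lam*n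
        + 4*f1*lam^2*n)*X*Y*s
    + (3*f2 - f2*lam)*X*s
    + (f2*lam - f2*lam^2)*X*s^2
    + (f2*lam*n - 3*f2*n)*X^2
    + (- 10*a10*f1*lam*n + 10*a10*f1*n + 3*a10^2*f3 - 2*a10^2*f3*lam - 3*a20*f3 + a20*f3*lam)*X^2*Y
    + (- 9*a10*f2 + 6*a10*f2*lam + 4*f0*lam*n - 4*f0*n - f2*lam*n + f2*lam^2*n)*X^2*s
    + (- 4*a10*f2*lam*n - 4*a10*f2*lam*n*t + 6*a10*f2*n + 6*a10*f2*n*t - 2*f0*lam*n^2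
        - 4*f0*lam*n^2*t + 2*f0*n^2 + 4*f0*n^2*t)*X^3
    + (- f1 + f3)*Y
    + (3*f1 - 2*f1*lam)*Y*s
    + (2*f1*lam - 2*f1*lam^2)*Y*s^2 := by
  obtain ⟨h4, h31, h22, h13, k3, k2, k1, k0, hY⟩ := h
  -- The third derivative of Y contains `Y²`, which has to be turned into `sX²` and `X³` before the
  -- truncation.
  have g3 : X*s^2 - 3*X^2*n*s + 2*X^3*n^2 - 2*Y^2*n = (X*s^2 - 5*X^2*n*s + 2*X^3*n^2
      + 4*X^3*n^2*t : R) := by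
    linear_combination (- 2*n)*hY
  rw [g3]
  rw [prodLin_eq
    (e1 := show _ = (X*Y*a10 + X*Y*a11*s + X^2*Y*a20 : R) by linear_combination (a12)*k1 + (a21)*k2
        + (a30)*k3)
    (e2 := show _ = (X^2*Y*a10^2 : R) by linear_combination (2*a10*a11)*k2 + (2*a10*a20)*k3
        + (Y*a10*a12 + Y*a11*a12*s + Y*a11^2)*h22 + (Y*a10*a21 + 2*Y*a11*a20 + Y*a11*a21*s
        + Y*a12*a20*s)*h31 + (X*Y*a20*a30 + Y*a10*a30 + Y*a11*a30*s + Y*a20*a21*s + Y*a20^2)*h4)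
    (e3 := show _ = (0 : R) by linear_combination (a10^3)*k3 + (Y*a10^2*a11 + Y*a10^2*a12*s)*h31
        + (X*Y*a10^2*a30 + Y*a10^2*a20 + Y*a10^2*a21*s)*h4)
    (e4 := show _ = (X^2*a10*s - 2*X^3*a10*n*t : R) by linear_combination (2*X*a20 + 2*X*a21*s
        + 3*X^2*a30 + a10 + a11*s + a12*s^2)*hY + (a11 + a12*s)*h22 + (- 2*a11*n*t - 2*a12*n*s*t
        + 2*a20 + 2*a21*s)*h31 + (- 6*X*a30*n*t - 4*a20*n*t - 4*a21*n*s*t + 3*a30*s)*h4)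
    (e5 := show _ = (0 : R) by linear_combination (a10*a11*s + a10*a12*s^2 + a10^2)*h31
        + (- 2*X*a10*a20*n*t - 2*X*a10*a21*n*s*t + X*a10*a30*s - 2*X^2*a10*a30*n*t - 2*a10*a11*n*s*t
        - 2*a10*a12*n*s^2*t + a10*a20*s + a10*a21*s^2 - 2*a10^2*n*t)*h4)
    (e6 := show _ = (X*Y*a10*s - X^2*Y*a10*n : R) by linear_combination (a11)*k1 + (- a11*n
        + 2*a20)*k2 + (Y*a12)*h13 + (- Y*a12*n + 2*Y*a21)*h22 + (- 2*a20*n)*k3 + (- 2*Y*a21*n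
        + 3*Y*a30)*h31 + (- 3*Y*a30*n)*h4)
    (e7 := show _ = (X*Y*a10*s - X^2*Y*a10*n : R) by linear_combination (6*X*Y*a30 + 2*Y*a20
        + 2*Y*a21*s)*hY + (a11)*k1 + (- a11*n + 4*a20)*k2 + (Y*a12)*h13 + (- Y*a12*n + 4*Y*a21)*h22
        + (- 2*a20*n - 4*a20*n*t)*k3 + (- 2*Y*a21*n - 4*Y*a21*n*t + 9*Y*a30)*h31 + (- 3*Y*a30*n
        - 12*Y*a30*n*t)*h4)
    (e8 := show _ = (X^2*a10*s - X^3*a10*n : R) by linear_combination (a11 + a12*s)*h22 + (- a11*n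
        - a12*n*s + a20 + a21*s)*h31 + (- X*a30*n - a20*n - a21*n*s + a30*s)*h4)
    (e9 := show _ = (0 : R) by linear_combination (a10*a11*s + a10*a12*s^2 + a10^2)*h31
        + (- X*a10*a20*n - X*a10*a21*n*s + X*a10*a30*s - X^2*a10*a30*n - a10*a11*n*s - a10*a12*n*s^2
        + a10*a20*s + a10*a21*s^2 - a10^2*n)*h4)
    (e10 := show _ = (X*Y*a10*s - 2*X^2*Y*a10*n : R) by linear_combination (a11)*k1 + (- 2*a11*n
        + a20)*k2 + (Y*a12)*h13 + (- 2*Y*a12*n + Y*a21)*h22 + (- 2*a20*n)*k3 + (- 2*Y*a21*n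
        + Y*a30)*h31 + (- 2*Y*a30*n)*h4)]
  linear_combination (- 10*Y*a10*f1*lam*n*rho*s + 10*Y*a10*f1*lam^2*n - 10*Y*a10*f1*lam^3*n
      - 2*Y*a10^2*f3*lam*rho*s + 2*Y*a10^2*f3*lam^2 - 2*Y*a10^2*f3*lam^3 + Y*a20*f1*lam
      - Y*a20*f1*lam^2 - Y*a20*f1*rho*s + Y*a20*f3*lam*rho*s - Y*a20*f3*lam^2 + Y*a20*f3*lam^3
      - 6*a10*f2*lam + 6*a10*f2*lam*rho*s^2 + 6*a10*f2*lam^2 - 6*a10*f2*lam^2*s + 6*a10*f2*lam^3*s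
      - 4*f0*lam*n + 5*f0*lam*n*rho*s^2 + 4*f0*lam^2*n - 5*f0*lam^2*n*s + 5*f0*lam^3*n*s
      - f0*n*rho*s + f2*lam*n*rho*s - f2*lam^2*n + f2*lam^3*n)*h22 + (7*Y*a10*f1*lam*rho*s
      - 7*Y*a10*f1*lam^2 + 7*Y*a10*f1*lam^3 - Y*a10*f1*rho + Y*a10*f3*lam*rho + Y*a11*f1*lam
      - Y*a11*f1*lam^2 - Y*a11*f1*rho*s + Y*a11*f3*lam*rho*s - Y*a11*f3*lam^2 + Y*a11*f3*lam^3
      + 4*Y*f1*lam*n*rho - f0*lam*rho*s^2 + f0*lam^2*s - f0*lam^3*s + f0*rho*s - f2*lam*rho*s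
      + f2*lam^2 - f2*lam^3)*h13 + (4*a10*f2*lam*n - 4*a10*f2*lam*n*rho*s^2
      - 4*a10*f2*lam*n*rho*s^2*t + 4*a10*f2*lam*n*t - 4*a10*f2*lam^2*n + 4*a10*f2*lam^2*n*s
      + 4*a10*f2*lam^2*n*s*t - 4*a10*f2*lam^2*n*t - 4*a10*f2*lam^3*n*s - 4*a10*f2*lam^3*n*s*t
      + 2*f0*lam*n^2 - 2*f0*lam*n^2*rho*s^2 - 4*f0*lam*n^2*rho*s^2*t + 4*f0*lam*n^2*t
      - 2*f0*lam^2*n^2 + 2*f0*lam^2*n^2*s + 4*f0*lam^2*n^2*s*t - 4*f0*lam^2*n^2*t - 2*f0*lam^3*n^2*s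
      - 4*f0*lam^3*n^2*s*t)*h31 + (- 6*a10*f1*lam + 6*a10*f1*lam^2 - a10*f3*lam^2 + a10*f3*lam^3
      + a11*f1 - a11*f1*lam - a11*f3*lam + a11*f3*lam^2 - 4*f1*lam^2*n + 4*f1*lam^3*n)*k1
      + (10*a10*f1*lam*n - 10*a10*f1*lam^2*n + 2*a10^2*f3*lam - 2*a10^2*f3*lam^2 + a20*f1
      - a20*f1*lam - a20*f3*lam + a20*f3*lam^2)*k2 + (- 2*f1*lam*rho*s + 2*f1*lam^2 - 2*f1*lam^3)*k0

theorem prodLin_A11 {R : Type*} [CommRing R] {s X Y n t : R} (h : WeightRel s X Y n t)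
    (lam rho a10 a11 a12 a20 a21 a30 f0 f1 f2 f3 : R) :
    prodLin lam (1 - (1 - lam)*(s + lam*s^2) + s^3*rho) f0 f1 f2 f3 (X*s) (Y*s) (X*s^2
        - X^2*n*s) (- 2*X*Y*n*s + Y*s^2)
      (X*a10 + X*a11*s + X*a12*s^2 + X^2*a20 + X^2*a21*s + X^3*a30)
      (2*X*Y*a20 + 2*X*Y*a21*s + 3*X^2*Y*a30 + Y*a10 + Y*a11*s + Y*a12*s^2)
      (6*X*Y^2*a30 + X*a10*s + X*a11*s^2 + X*a12*s^3 - X^2*a10*n - X^2*a11*n*s - X^2*a12*n*s^2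
          + 2*X^2*a20*s + 2*X^2*a21*s^2 - 2*X^3*a20*n - 2*X^3*a21*n*s + 3*X^3*a30*s - 3*X^4*a30*n
          + 2*Y^2*a20 + 2*Y^2*a21*s) =
    (- 9*a10*f2 + 6*a10*f2*lam + 2*f0*lam*n - 2*f0*n)*X*Y*s
    + (- f1 + f3)*X*s
    + (3*f1 - 2*f1*lam)*X*s^2
    + (- 3*a10*f3 + a10*f3*lam + 2*f1*lam*n - 3*f1*n)*X^2*s
    + (3*f2 - f2*lam)*Y*s
    + (f2*lam - f2*lam^2)*Y*s^2 := by
  obtain ⟨h4, h31, h22, h13, k3, k2, k1, k0, hY⟩ := h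
  rw [prodLin_eq
    (e1 := show _ = (X^2*a10*s : R) by linear_combination (a11 + a12*s)*h22 + (a20 + a21*s)*h31
        + (a30*s)*h4)
    (e2 := show _ = (0 : R) by linear_combination (a10*a11*s + a10*a12*s^2 + a10^2)*h31
        + (X*a10*a30*s + a10*a20*s + a10*a21*s^2)*h4)
    (e3 := show _ = (0 : R) by linear_combination 0)
    (e4 := show _ = (X*Y*a10*s : R) by linear_combination (a11)*k1 + (Y*a12)*h13 + (2*a20)*k2
        + (2*Y*a21)*h22 + (3*Y*a30)*h31)
    (e5 := show _ = (0 : R) by linear_combination (a10^2)*k2 + (Y*a10*a11 + Y*a10*a12*s)*h22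
        + (Y*a10*a20 + Y*a10*a21*s)*h31 + (Y*a10*a30*s)*h4)
    (e6 := show _ = (0 : R) by linear_combination (2*X*a20*s + 2*X*a21*s^2 + 3*X^2*a30*s + a10*s
        + a11*s^2 + a12*s^3)*hY + (a10 + a11*s + a12*s^2)*h22 + (- 2*a10*n*t - 2*a11*n*s*t
        - 2*a12*n*s^2*t + 2*a20*s + 2*a21*s^2)*h31 + (- 6*X*a30*n*s*t - 4*a20*n*s*t - 4*a21*n*s^2*t
        + 3*a30*s^2)*h4)
    (e7 := show _ = (0 : R) by linear_combination (2*X*a20*s + 2*X*a21*s^2 + 6*X^2*a30*s)*hY + (a10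
        + a11*s + a12*s^2)*h22 + (- a10*n - a11*n*s - a12*n*s^2 + 4*a20*s + 4*a21*s^2)*h31
        + (- 3*X*a30*n*s - 12*X*a30*n*s*t - 2*a20*n*s - 4*a20*n*s*t - 2*a21*n*s^2 - 4*a21*n*s^2*t
        + 9*a30*s^2)*h4)
    (e8 := show _ = (X*Y*a10*s : R) by linear_combination (a11)*k1 + (Y*a12)*h13 + (a20)*k2
        + (Y*a21)*h22 + (Y*a30)*h31)
    (e9 := show _ = (0 : R) by linear_combination (a10^2)*k2 + (Y*a10*a11 + Y*a10*a12*s)*h22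
        + (Y*a10*a20 + Y*a10*a21*s)*h31 + (Y*a10*a30*s)*h4)
    (e10 := show _ = (0 : R) by linear_combination (a10 + a11*s + a12*s^2)*h22 + (- a10*n - a11*n*s
        - a12*n*s^2 + a20*s + a21*s^2)*h31 + (- X*a30*n*s - a20*n*s - a21*n*s^2 + a30*s^2)*h4)]
  linear_combination (- f0*lam*rho*s^2 + f0*lam^2*s - f0*lam^3*s + f0*rho*s - f2*lam*rho*s
      + f2*lam^2 - f2*lam^3)*k0 + (- 6*a10*f2*lam + 6*a10*f2*lam^2 - 2*f0*lam*n + 2*f0*lam^2*n)*k1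
      + (6*Y*a10*f2*lam*rho*s - 6*Y*a10*f2*lam^2 + 6*Y*a10*f2*lam^3 + 2*Y*f0*lam*n*rho*s
      - 2*Y*f0*lam^2*n + 2*Y*f0*lam^3*n + 2*f1*lam - 2*f1*lam*rho*s^2 - 2*f1*lam^2 + 2*f1*lam^2*s
      - 2*f1*lam^3*s)*h13 + (a10*f1 - a10*f1*lam + a10*f1*lam*s - a10*f1*lam^2*s - a10*f1*rho*s^2
      - a10*f3*lam + a10*f3*lam*rho*s^2 + a10*f3*lam^2 - a10*f3*lam^2*s + a10*f3*lam^3*s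
      - 2*f1*lam*n + 2*f1*lam*n*rho*s^2 + 2*f1*lam^2*n - 2*f1*lam^2*n*s + 2*f1*lam^3*n*s)*h22

theorem prodLin_B11 {R : Type*} [CommRing R] {s X Y n t : R} (h : WeightRel s X Y n t)
    (lam rho a10 a11 a12 a20 a21 a30 f0 f1 f2 f3 : R) :
    prodLin lam (1 - (1 - lam)*(s + lam*s^2) + s^3*rho) f0 f1 f2 f3 (Y*s) (X*s^2
        - X^2*n*s) (- 2*X*Y*n*s + Y*s^2) (X*s^3 - 3*X^2*n*s^2 + 2*X^3*n^2*s - 2*Y^2*n*s)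
      (X*a10 + X*a11*s + X*a12*s^2 + X^2*a20 + X^2*a21*s + X^3*a30)
      (2*X*Y*a20 + 2*X*Y*a21*s + 3*X^2*Y*a30 + Y*a10 + Y*a11*s + Y*a12*s^2)
      (6*X*Y^2*a30 + X*a10*s + X*a11*s^2 + X*a12*s^3 - X^2*a10*n - X^2*a11*n*s - X^2*a12*n*s^2
          + 2*X^2*a20*s + 2*X^2*a21*s^2 - 2*X^3*a20*n - 2*X^3*a21*n*s + 3*X^3*a30*s - 3*X^4*a30*n
          + 2*Y^2*a20 + 2*Y^2*a21*s) =
    (- 3*a10*f3 + a10*f3*lam + 4*f1*lam*n - 6*f1*n)*X*Y*s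
    + (3*f2 - f2*lam)*X*s^2
    + (f2*lam*n - 3*f2*n)*X^2*s
    + (- f1 + f3)*Y*s
    + (3*f1 - 2*f1*lam)*Y*s^2 := by
  obtain ⟨h4, h31, h22, h13, k3, k2, k1, k0, hY⟩ := h
  have g3 : X*s^3 - 3*X^2*n*s^2 + 2*X^3*n^2*s - 2*Y^2*n*s = (0 : R) := by
    linear_combination (- 2*n*s)*hY + (1)*h13 + (- 5*n)*h22 + (2*n^2 + 4*n^2*t)*h31
  rw [g3]
  rw [prodLin_eq
    (e1 := show _ = (X*Y*a10*s : R) by linear_combination (a11)*k1 + (Y*a12)*h13 + (a20)*k2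
        + (Y*a21)*h22 + (Y*a30)*h31)
    (e2 := show _ = (0 : R) by linear_combination (a10^2)*k2 + (Y*a10*a11 + Y*a10*a12*s)*h22
        + (Y*a10*a20 + Y*a10*a21*s)*h31 + (Y*a10*a30*s)*h4)
    (e3 := show _ = (0 : R) by linear_combination 0)
    (e4 := show _ = (0 : R) by linear_combination (2*X*a20*s + 2*X*a21*s^2 + 3*X^2*a30*s + a10*s
        + a11*s^2 + a12*s^3)*hY + (a10 + a11*s + a12*s^2)*h22 + (- 2*a10*n*t - 2*a11*n*s*t
        - 2*a12*n*s^2*t + 2*a20*s + 2*a21*s^2)*h31 + (- 6*X*a30*n*s*t - 4*a20*n*s*t - 4*a21*n*s^2*t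
        + 3*a30*s^2)*h4)
    (e5 := show _ = (0 : R) by linear_combination 0)
    (e6 := show _ = (0 : R) by linear_combination (a10)*k1 + (- a10*n)*k2 + (Y*a11 + Y*a12*s)*h13
        + (- Y*a11*n - Y*a12*n*s + 2*Y*a20 + 2*Y*a21*s)*h22 + (- 2*Y*a20*n - 2*Y*a21*n*s
        + 3*Y*a30*s)*h31 + (- 3*Y*a30*n*s)*h4)
    (e7 := show _ = (0 : R) by linear_combination (6*X*Y*a30*s + 2*Y*a20*s + 2*Y*a21*s^2)*hY
        + (a10)*k1 + (- a10*n)*k2 + (Y*a11 + Y*a12*s)*h13 + (- Y*a11*n - Y*a12*n*s + 4*Y*a20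
        + 4*Y*a21*s)*h22 + (- 2*Y*a20*n - 4*Y*a20*n*t - 2*Y*a21*n*s - 4*Y*a21*n*s*t + 9*Y*a30*s)*h31
        + (- 3*Y*a30*n*s - 12*Y*a30*n*s*t)*h4)
    (e8 := show _ = (0 : R) by linear_combination (a10 + a11*s + a12*s^2)*h22 + (- a10*n - a11*n*s
        - a12*n*s^2 + a20*s + a21*s^2)*h31 + (- X*a30*n*s - a20*n*s - a21*n*s^2 + a30*s^2)*h4)
    (e9 := show _ = (0 : R) by linear_combination 0)
    (e10 := show _ = (0 : R) by linear_combination (a10)*k1 + (- 2*a10*n)*k2 + (Y*a11 + Y*a12*s)*h13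
        + (- 2*Y*a11*n - 2*Y*a12*n*s + Y*a20 + Y*a21*s)*h22 + (- 2*Y*a20*n - 2*Y*a21*n*s
        + Y*a30*s)*h31 + (- 2*Y*a30*n*s)*h4)]
  linear_combination (Y*a10*f1*lam - Y*a10*f1*lam^2 - Y*a10*f1*rho*s + Y*a10*f3*lam*rho*s
      - Y*a10*f3*lam^2 + Y*a10*f3*lam^3 + 4*Y*f1*lam*n*rho*s - 4*Y*f1*lam^2*n + 4*Y*f1*lam^3*n - f0
      + f0*lam - f0*lam*s + f0*lam^2*s + f0*rho*s^2 + f2*lam - f2*lam*rho*s^2 - f2*lam^2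
      + f2*lam^2*s - f2*lam^3*s)*h13 + (- f0*lam*n + f0*lam*n*s - f0*lam^2*n*s + f0*n - f0*n*rho*s^2
      - f2*lam*n + f2*lam*n*rho*s^2 + f2*lam^2*n - f2*lam^2*n*s + f2*lam^3*n*s)*h22 + (a10*f1
      - a10*f1*lam - a10*f3*lam + a10*f3*lam^2 - 4*f1*lam*n + 4*f1*lam^2*n)*k1 + (2*f1*lam
      - 2*f1*lam*rho*s^2 - 2*f1*lam^2 + 2*f1*lam^2*s - 2*f1*lam^3*s)*k0

theorem prodLin_A12 {R : Type*} [CommRing R] {s X Y n t : R} (h : WeightRel s X Y n t)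
    (lam rho a10 a11 a12 a20 a21 a30 f0 f1 f2 f3 : R) :
    prodLin lam (1 - (1 - lam)*(s + lam*s^2) + s^3*rho) f0 f1 f2 f3 (X*s^2) (Y*s^2) (X*s^3
        - X^2*n*s^2) (- 2*X*Y*n*s^2 + Y*s^3)
      (X*a10 + X*a11*s + X*a12*s^2 + X^2*a20 + X^2*a21*s + X^3*a30)
      (2*X*Y*a20 + 2*X*Y*a21*s + 3*X^2*Y*a30 + Y*a10 + Y*a11*s + Y*a12*s^2)
      (6*X*Y^2*a30 + X*a10*s + X*a11*s^2 + X*a12*s^3 - X^2*a10*n - X^2*a11*n*s - X^2*a12*n*s^2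
          + 2*X^2*a20*s + 2*X^2*a21*s^2 - 2*X^3*a20*n - 2*X^3*a21*n*s + 3*X^3*a30*s - 3*X^4*a30*n
          + 2*Y^2*a20 + 2*Y^2*a21*s) =
    (- f1 + f3)*X*s^2
    + (3*f2 - f2*lam)*Y*s^2 := by
  obtain ⟨h4, h31, h22, h13, k3, k2, k1, k0, hY⟩ := h
  have g2 : X*s^3 - X^2*n*s^2 = (0 : R) := by
    linear_combination (1)*h13 + (- n)*h22
  have g3 : - 2*X*Y*n*s^2 + Y*s^3 = (0 : R) := by
    linear_combination (1)*k0 + (- 2*n)*k1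
  rw [g2, g3]
  rw [prodLin_eq
    (e1 := show _ = (0 : R) by linear_combination (a10 + a11*s + a12*s^2)*h22 + (a20*s
        + a21*s^2)*h31 + (a30*s^2)*h4)
    (e2 := show _ = (0 : R) by linear_combination 0)
    (e3 := show _ = (0 : R) by linear_combination 0)
    (e4 := show _ = (0 : R) by linear_combination (a10)*k1 + (Y*a11 + Y*a12*s)*h13 + (2*Y*a20
        + 2*Y*a21*s)*h22 + (3*Y*a30*s)*h31)
    (e5 := show _ = (0 : R) by linear_combination 0)
    (e6 := show _ = (0 : R) by linear_combination (2*X*a20*s^2 + 2*X*a21*s^3 + 3*X^2*a30*s^2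
        + a10*s^2 + a11*s^3 + a12*s^4)*hY + (a10*s + a11*s^2 + a12*s^3)*h22 + (- 2*a10*n*s*t
        - 2*a11*n*s^2*t - 2*a12*n*s^3*t + 2*a20*s^2 + 2*a21*s^3)*h31 + (- 6*X*a30*n*s^2*t
        - 4*a20*n*s^2*t - 4*a21*n*s^3*t + 3*a30*s^3)*h4)
    (e7 := show _ = (0 : R) by linear_combination (2*X*a20*s^2 + 2*X*a21*s^3 + 6*X^2*a30*s^2)*hY
        + (a10*s + a11*s^2 + a12*s^3)*h22 + (- a10*n*s - a11*n*s^2 - a12*n*s^3 + 4*a20*s^2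
        + 4*a21*s^3)*h31 + (- 3*X*a30*n*s^2 - 12*X*a30*n*s^2*t - 2*a20*n*s^2 - 4*a20*n*s^2*t
        - 2*a21*n*s^3 - 4*a21*n*s^3*t + 9*a30*s^3)*h4)
    (e8 := show _ = (0 : R) by linear_combination (a10)*k1 + (Y*a11 + Y*a12*s)*h13 + (Y*a20
        + Y*a21*s)*h22 + (Y*a30*s)*h31)
    (e9 := show _ = (0 : R) by linear_combination 0)
    (e10 := show _ = (0 : R) by linear_combination 0)]
  linear_combination (- f0 + f0*lam - f0*lam*s + f0*lam^2*s + f0*rho*s^2 + f2*lam - f2*lam*rho*s^2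
      - f2*lam^2 + f2*lam^2*s - f2*lam^3*s)*k0

/-- `s²Y` already has weight 7, so only the contribution without β, and with no derivative on the
small soliton, is left. -/
theorem prodLin_B12 {R : Type*} [CommRing R] {s X Y n t : R} (h : WeightRel s X Y n t)
    (lam rho a10 a11 a12 a20 a21 a30 f0 f1 f2 f3 : R) :
    prodLin lam (1 - (1 - lam)*(s + lam*s^2) + s^3*rho) f0 f1 f2 f3 (Y*s^2) (X*s^3
        - X^2*n*s^2) (- 2*X*Y*n*s^2 + Y*s^3) (X*s^4 - 3*X^2*n*s^3 + 2*X^3*n^2*s^2 - 2*Y^2*n*s^2)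
      (X*a10 + X*a11*s + X*a12*s^2 + X^2*a20 + X^2*a21*s + X^3*a30)
      (2*X*Y*a20 + 2*X*Y*a21*s + 3*X^2*Y*a30 + Y*a10 + Y*a11*s + Y*a12*s^2)
      (6*X*Y^2*a30 + X*a10*s + X*a11*s^2 + X*a12*s^3 - X^2*a10*n - X^2*a11*n*s - X^2*a12*n*s^2
          + 2*X^2*a20*s + 2*X^2*a21*s^2 - 2*X^3*a20*n - 2*X^3*a21*n*s + 3*X^3*a30*s - 3*X^4*a30*n
          + 2*Y^2*a20 + 2*Y^2*a21*s) =
    (- f1 + f3)*Y*s^2 := by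
  obtain ⟨h4, h31, h22, h13, k3, k2, k1, k0, hY⟩ := h
  have g1 : X*s^3 - X^2*n*s^2 = (0 : R) := by
    linear_combination (1)*h13 + (- n)*h22
  have g2 : - 2*X*Y*n*s^2 + Y*s^3 = (0 : R) := by
    linear_combination (1)*k0 + (- 2*n)*k1
  have g3 : X*s^4 - 3*X^2*n*s^3 + 2*X^3*n^2*s^2 - 2*Y^2*n*s^2 = (0 : R) := by
    linear_combination (- 2*n*s^2)*hY + (s)*h13 + (- 5*n*s)*h22 + (2*n^2*s + 4*n^2*s*t)*h31
  rw [g1, g2, g3]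
  rw [prodLin_eq
    (e1 := show _ = (0 : R) by linear_combination (a10)*k1 + (Y*a11 + Y*a12*s)*h13 + (Y*a20
        + Y*a21*s)*h22 + (Y*a30*s)*h31)
    (e2 := show _ = (0 : R) by linear_combination 0)
    (e3 := show _ = (0 : R) by linear_combination 0)
    (e4 := show _ = (0 : R) by linear_combination (2*X*a20*s^2 + 2*X*a21*s^3 + 3*X^2*a30*s^2
        + a10*s^2 + a11*s^3 + a12*s^4)*hY + (a10*s + a11*s^2 + a12*s^3)*h22 + (- 2*a10*n*s*t
        - 2*a11*n*s^2*t - 2*a12*n*s^3*t + 2*a20*s^2 + 2*a21*s^3)*h31 + (- 6*X*a30*n*s^2*t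
        - 4*a20*n*s^2*t - 4*a21*n*s^3*t + 3*a30*s^3)*h4)
    (e5 := show _ = (0 : R) by linear_combination 0)
    (e6 := show _ = (0 : R) by linear_combination 0)
    (e7 := show _ = (0 : R) by linear_combination (6*X*Y*a30*s^2 + 2*Y*a20*s^2 + 2*Y*a21*s^3)*hY
        + (Y*a10 + Y*a11*s + Y*a12*s^2)*h13 + (- Y*a10*n - Y*a11*n*s - Y*a12*n*s^2 + 4*Y*a20*s
        + 4*Y*a21*s^2)*h22 + (- 2*Y*a20*n*s - 4*Y*a20*n*s*t - 2*Y*a21*n*s^2 - 4*Y*a21*n*s^2*t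
        + 9*Y*a30*s^2)*h31 + (- 3*Y*a30*n*s^2 - 12*Y*a30*n*s^2*t)*h4)
    (e8 := show _ = (0 : R) by linear_combination 0)
    (e9 := show _ = (0 : R) by linear_combination 0)
    (e10 := show _ = (0 : R) by linear_combination 0)]
  linear_combination 0

theorem prodLin_A20 {R : Type*} [CommRing R] {s X Y n t : R} (h : WeightRel s X Y n t)
    (lam rho a10 a11 a12 a20 a21 a30 f0 f1 f2 f3 : R) :
    prodLin lam (1 - (1 - lam)*(s + lam*s^2) + s^3*rho) f0 f1 f2 f3 (X^2) (2*X*Y) (2*X^2*s - 2*X^3*n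
        + 2*Y^2) (8*X*Y*s - 10*X^2*Y*n)
      (X*a10 + X*a11*s + X*a12*s^2 + X^2*a20 + X^2*a21*s + X^3*a30)
      (2*X*Y*a20 + 2*X*Y*a21*s + 3*X^2*Y*a30 + Y*a10 + Y*a11*s + Y*a12*s^2)
      (6*X*Y^2*a30 + X*a10*s + X*a11*s^2 + X*a12*s^3 - X^2*a10*n - X^2*a11*n*s - X^2*a12*n*s^2
          + 2*X^2*a20*s + 2*X^2*a21*s^2 - 2*X^3*a20*n - 2*X^3*a21*n*s + 3*X^3*a30*s - 3*X^4*a30*n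
          + 2*Y^2*a20 + 2*Y^2*a21*s) =
    (6*f2 - 2*f2*lam)*X*Y
    + (6*f0 - 6*f0*lam + 2*f2*lam - 2*f2*lam^2)*X*Y*s
    + (- f1 + f3)*X^2
    + (- 15*a10*f2 + 10*a10*f2*lam + 10*f0*lam*n - 10*f0*n)*X^2*Y
    + (12*f1 - 8*f1*lam)*X^2*s
    + (- 3*a10*f3 + a10*f3*lam + 4*f1*lam*n + 8*f1*lam*n*t - 6*f1*n - 12*f1*n*t)*X^3 := by
  obtain ⟨h4, h31, h22, h13, k3, k2, k1, k0, hY⟩ := h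
  have g2 : 2*X^2*s - 2*X^3*n + 2*Y^2 = (4*X^2*s - 2*X^3*n - 4*X^3*n*t : R) := by
    linear_combination (2)*hY
  rw [g2]
  rw [prodLin_eq
    (e1 := show _ = (X^3*a10 : R) by linear_combination (a11 + a12*s)*h31 + (X*a30 + a20
        + a21*s)*h4)
    (e2 := show _ = (0 : R) by linear_combination (X*a10*a20 + X*a10*a21*s + X^2*a10*a30 + a10*a11*s
        + a10*a12*s^2 + a10^2)*h4)
    (e3 := show _ = (0 : R) by linear_combination 0)
    (e4 := show _ = (X^2*Y*a10 : R) by linear_combination (a11)*k2 + (Y*a12)*h22 + (2*a20)*k3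
        + (2*Y*a21)*h31 + (3*Y*a30)*h4)
    (e5 := show _ = (0 : R) by linear_combination (a10^2)*k3 + (Y*a10*a11 + Y*a10*a12*s)*h31
        + (X*Y*a10*a30 + Y*a10*a20 + Y*a10*a21*s)*h4)
    (e6 := show _ = (0 : R) by linear_combination (2*X*a10 + 2*X*a11*s + 2*X*a12*s^2 + 4*X^2*a20
        + 4*X^2*a21*s + 6*X^3*a30)*hY + (2*a10 + 2*a11*s + 2*a12*s^2)*h31 + (- 8*X*a20*n*t
        - 8*X*a21*n*s*t + 6*X*a30*s - 12*X^2*a30*n*t - 4*a10*n*t - 4*a11*n*s*t - 4*a12*n*s^2*t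
        + 4*a20*s + 4*a21*s^2)*h4)
    (e7 := show _ = (0 : R) by linear_combination (2*X^2*a20 + 2*X^2*a21*s + 6*X^3*a30)*hY + (a10
        + a11*s + a12*s^2)*h31 + (- 2*X*a20*n - 4*X*a20*n*t - 2*X*a21*n*s - 4*X*a21*n*s*t
        + 9*X*a30*s - 3*X^2*a30*n - 12*X^2*a30*n*t - a10*n - a11*n*s - a12*n*s^2 + 4*a20*s
        + 4*a21*s^2)*h4)
    (e8 := show _ = (2*X^2*Y*a10 : R) by linear_combination (2*a11)*k2 + (2*Y*a12)*h22 + (2*a20)*k3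
        + (2*Y*a21)*h31 + (2*Y*a30)*h4)
    (e9 := show _ = (0 : R) by linear_combination (2*a10^2)*k3 + (2*Y*a10*a11 + 2*Y*a10*a12*s)*h31
        + (2*X*Y*a10*a30 + 2*Y*a10*a20 + 2*Y*a10*a21*s)*h4)
    (e10 := show _ = (0 : R) by linear_combination (4*a10 + 4*a11*s + 4*a12*s^2)*h31 + (- 2*X*a20*n
        - 4*X*a20*n*t - 2*X*a21*n*s - 4*X*a21*n*s*t + 4*X*a30*s - 2*X^2*a30*n - 4*X^2*a30*n*t
        - 2*a10*n - 4*a10*n*t - 2*a11*n*s - 4*a11*n*s*t - 2*a12*n*s^2 - 4*a12*n*s^2*t + 4*a20*s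
        + 4*a21*s^2)*h4)]
  linear_combination (6*f0*lam - 6*f0*lam^2 + 2*f2*lam^2 - 2*f2*lam^3)*k1 + (- 8*Y*f0*lam*rho*s
      + 8*Y*f0*lam^2 - 8*Y*f0*lam^3 + 2*Y*f0*rho - 2*Y*f2*lam*rho)*h13 + (- 10*a10*f2*lam
      + 10*a10*f2*lam^2 - 10*f0*lam*n + 10*f0*lam^2*n)*k2 + (10*Y*a10*f2*lam*rho*s
      - 10*Y*a10*f2*lam^2 + 10*Y*a10*f2*lam^3 + 10*Y*f0*lam*n*rho*s - 10*Y*f0*lam^2*n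
      + 10*Y*f0*lam^3*n + 8*f1*lam - 8*f1*lam*rho*s^2 - 8*f1*lam^2 + 8*f1*lam^2*s
      - 8*f1*lam^3*s)*h22 + (a10*f1 - a10*f1*lam + a10*f1*lam*s - a10*f1*lam^2*s - a10*f1*rho*s^2
      - a10*f3*lam + a10*f3*lam*rho*s^2 + a10*f3*lam^2 - a10*f3*lam^2*s + a10*f3*lam^3*s
      - 4*f1*lam*n + 4*f1*lam*n*rho*s^2 + 8*f1*lam*n*rho*s^2*t - 8*f1*lam*n*t + 4*f1*lam^2*n
      - 4*f1*lam^2*n*s - 8*f1*lam^2*n*s*t + 8*f1*lam^2*n*t + 4*f1*lam^3*n*s + 8*f1*lam^3*n*s*t)*h31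

theorem prodLin_B20 {R : Type*} [CommRing R] {s X Y n t : R} (h : WeightRel s X Y n t)
    (lam rho a10 a11 a12 a20 a21 a30 f0 f1 f2 f3 : R) :
    prodLin lam (1 - (1 - lam)*(s + lam*s^2) + s^3*rho) f0 f1 f2 f3 (2*X*Y) (2*X^2*s - 2*X^3*n
        + 2*Y^2) (8*X*Y*s - 10*X^2*Y*n) (- 20*X*Y^2*n + 8*X^2*s^2 - 18*X^3*n*s + 10*X^4*n^2
        + 8*Y^2*s)
      (X*a10 + X*a11*s + X*a12*s^2 + X^2*a20 + X^2*a21*s + X^3*a30)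
      (2*X*Y*a20 + 2*X*Y*a21*s + 3*X^2*Y*a30 + Y*a10 + Y*a11*s + Y*a12*s^2)
      (6*X*Y^2*a30 + X*a10*s + X*a11*s^2 + X*a12*s^3 - X^2*a10*n - X^2*a11*n*s - X^2*a12*n*s^2
          + 2*X^2*a20*s + 2*X^2*a21*s^2 - 2*X^3*a20*n - 2*X^3*a21*n*s + 3*X^3*a30*s - 3*X^4*a30*n
          + 2*Y^2*a20 + 2*Y^2*a21*s) =
    (- 2*f1 + 2*f3)*X*Y
    + (24*f1 - 16*f1*lam)*X*Y*s
    + (- 6*a10*f3 + 2*a10*f3*lam + 20*f1*lam*n - 30*f1*n)*X^2*Y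
    + (12*f2 - 4*f2*lam)*X^2*s
    + (2*f2*lam*n + 4*f2*lam*n*t - 6*f2*n - 12*f2*n*t)*X^3 := by
  obtain ⟨h4, h31, h22, h13, k3, k2, k1, k0, hY⟩ := h
  have g1 : 2*X^2*s - 2*X^3*n + 2*Y^2 = (4*X^2*s - 2*X^3*n - 4*X^3*n*t : R) := by
    linear_combination (2)*hY
  have g3 : - 20*X*Y^2*n + 8*X^2*s^2 - 18*X^3*n*s + 10*X^4*n^2 + 8*Y^2*s = (0 : R) := by
    linear_combination (- 20*X*n + 8*s)*hY + (16)*h22 + (- 38*n - 16*n*t)*h31 + (10*n^2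
        + 40*n^2*t)*h4
  rw [g1, g3]
  rw [prodLin_eq
    (e1 := show _ = (2*X^2*Y*a10 : R) by linear_combination (2*a11)*k2 + (2*Y*a12)*h22 + (2*a20)*k3
        + (2*Y*a21)*h31 + (2*Y*a30)*h4)
    (e2 := show _ = (0 : R) by linear_combination (2*a10^2)*k3 + (2*Y*a10*a11 + 2*Y*a10*a12*s)*h31
        + (2*X*Y*a10*a30 + 2*Y*a10*a20 + 2*Y*a10*a21*s)*h4)
    (e3 := show _ = (0 : R) by linear_combination 0)
    (e4 := show _ = (0 : R) by linear_combination (2*X*a10 + 2*X*a11*s + 2*X*a12*s^2 + 4*X^2*a20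
        + 4*X^2*a21*s + 6*X^3*a30)*hY + (2*a10 + 2*a11*s + 2*a12*s^2)*h31 + (- 8*X*a20*n*t
        - 8*X*a21*n*s*t + 6*X*a30*s - 12*X^2*a30*n*t - 4*a10*n*t - 4*a11*n*s*t - 4*a12*n*s^2*t
        + 4*a20*s + 4*a21*s^2)*h4)
    (e5 := show _ = (0 : R) by linear_combination 0)
    (e6 := show _ = (0 : R) by linear_combination (4*a10)*k2 + (- 2*a10*n - 4*a10*n*t)*k3 + (4*Y*a11
        + 4*Y*a12*s)*h22 + (- 2*Y*a11*n - 4*Y*a11*n*t - 2*Y*a12*n*s - 4*Y*a12*n*s*t + 8*Y*a20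
        + 8*Y*a21*s)*h31 + (- 6*X*Y*a30*n - 12*X*Y*a30*n*t - 4*Y*a20*n - 8*Y*a20*n*t - 4*Y*a21*n*s
        - 8*Y*a21*n*s*t + 12*Y*a30*s)*h4)
    (e7 := show _ = (0 : R) by linear_combination (4*X*Y*a20 + 4*X*Y*a21*s + 12*X^2*Y*a30)*hY
        + (2*a10)*k2 + (- 2*a10*n)*k3 + (2*Y*a11 + 2*Y*a12*s)*h22 + (- 2*Y*a11*n - 2*Y*a12*n*s
        + 8*Y*a20 + 8*Y*a21*s)*h31 + (- 6*X*Y*a30*n - 24*X*Y*a30*n*t - 4*Y*a20*n - 8*Y*a20*n*t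
        - 4*Y*a21*n*s - 8*Y*a21*n*s*t + 18*Y*a30*s)*h4)
    (e8 := show _ = (0 : R) by linear_combination (4*a10 + 4*a11*s + 4*a12*s^2)*h31 + (- 2*X*a20*n
        - 4*X*a20*n*t - 2*X*a21*n*s - 4*X*a21*n*s*t + 4*X*a30*s - 2*X^2*a30*n - 4*X^2*a30*n*t
        - 2*a10*n - 4*a10*n*t - 2*a11*n*s - 4*a11*n*s*t - 2*a12*n*s^2 - 4*a12*n*s^2*t + 4*a20*s
        + 4*a21*s^2)*h4)
    (e9 := show _ = (0 : R) by linear_combination 0)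
    (e10 := show _ = (0 : R) by linear_combination (8*a10)*k2 + (- 10*a10*n)*k3 + (8*Y*a11
        + 8*Y*a12*s)*h22 + (- 10*Y*a11*n - 10*Y*a12*n*s + 8*Y*a20 + 8*Y*a21*s)*h31 + (- 10*X*Y*a30*n
        - 10*Y*a20*n - 10*Y*a21*n*s + 8*Y*a30*s)*h4)]
  linear_combination (2*Y*a10*f1*lam - 2*Y*a10*f1*lam^2 - 2*Y*a10*f1*rho*s + 2*Y*a10*f3*lam*rho*s
      - 2*Y*a10*f3*lam^2 + 2*Y*a10*f3*lam^3 + 20*Y*f1*lam*n*rho*s - 20*Y*f1*lam^2*n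
      + 20*Y*f1*lam^3*n - 4*f0 + 4*f0*lam - 4*f0*lam*s + 4*f0*lam^2*s + 4*f0*rho*s^2 + 4*f2*lam
      - 4*f2*lam*rho*s^2 - 4*f2*lam^2 + 4*f2*lam^2*s - 4*f2*lam^3*s)*h22 + (- 2*f0*lam*n
      + 2*f0*lam*n*s + 4*f0*lam*n*s*t - 4*f0*lam*n*t - 2*f0*lam^2*n*s - 4*f0*lam^2*n*s*t + 2*f0*n
      - 2*f0*n*rho*s^2 - 4*f0*n*rho*s^2*t + 4*f0*n*t - 2*f2*lam*n + 2*f2*lam*n*rho*s^2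
      + 4*f2*lam*n*rho*s^2*t - 4*f2*lam*n*t + 2*f2*lam^2*n - 2*f2*lam^2*n*s - 4*f2*lam^2*n*s*t
      + 4*f2*lam^2*n*t + 2*f2*lam^3*n*s + 4*f2*lam^3*n*s*t)*h31 + (2*a10*f1 - 2*a10*f1*lam
      - 2*a10*f3*lam + 2*a10*f3*lam^2 - 20*f1*lam*n + 20*f1*lam^2*n)*k2 + (16*f1*lam
      - 16*f1*lam^2)*k1 + (- 16*Y*f1*lam*rho*s + 16*Y*f1*lam^2 - 16*Y*f1*lam^3)*h13

theorem prodLin_A21 {R : Type*} [CommRing R] {s X Y n t : R} (h : WeightRel s X Y n t)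
    (lam rho a10 a11 a12 a20 a21 a30 f0 f1 f2 f3 : R) :
    prodLin lam (1 - (1 - lam)*(s + lam*s^2) + s^3*rho) f0 f1 f2 f3 (X^2*s) (2*X*Y*s) (2*X^2*s^2
        - 2*X^3*n*s + 2*Y^2*s) (8*X*Y*s^2 - 10*X^2*Y*n*s)
      (X*a10 + X*a11*s + X*a12*s^2 + X^2*a20 + X^2*a21*s + X^3*a30)
      (2*X*Y*a20 + 2*X*Y*a21*s + 3*X^2*Y*a30 + Y*a10 + Y*a11*s + Y*a12*s^2)
      (6*X*Y^2*a30 + X*a10*s + X*a11*s^2 + X*a12*s^3 - X^2*a10*n - X^2*a11*n*s - X^2*a12*n*s^2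
          + 2*X^2*a20*s + 2*X^2*a21*s^2 - 2*X^3*a20*n - 2*X^3*a21*n*s + 3*X^3*a30*s - 3*X^4*a30*n
          + 2*Y^2*a20 + 2*Y^2*a21*s) =
    (6*f2 - 2*f2*lam)*X*Y*s
    + (- f1 + f3)*X^2*s := by
  obtain ⟨h4, h31, h22, h13, k3, k2, k1, k0, hY⟩ := h
  have g2 : 2*X^2*s^2 - 2*X^3*n*s + 2*Y^2*s = (0 : R) := by
    linear_combination (2*s)*hY + (4)*h22 + (- 2*n - 4*n*t)*h31
  have g3 : 8*X*Y*s^2 - 10*X^2*Y*n*s = (0 : R) := by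
    linear_combination (8)*k1 + (- 10*n)*k2
  rw [g2, g3]
  rw [prodLin_eq
    (e1 := show _ = (0 : R) by linear_combination (a10 + a11*s + a12*s^2)*h31 + (X*a30*s + a20*s
        + a21*s^2)*h4)
    (e2 := show _ = (0 : R) by linear_combination 0)
    (e3 := show _ = (0 : R) by linear_combination 0)
    (e4 := show _ = (0 : R) by linear_combination (a10)*k2 + (Y*a11 + Y*a12*s)*h22 + (2*Y*a20
        + 2*Y*a21*s)*h31 + (3*Y*a30*s)*h4)
    (e5 := show _ = (0 : R) by linear_combination 0)
    (e6 := show _ = (0 : R) by linear_combination (2*X*a10*s + 2*X*a11*s^2 + 2*X*a12*s^3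
        + 4*X^2*a20*s + 4*X^2*a21*s^2 + 6*X^3*a30*s)*hY + (2*a10*s + 2*a11*s^2 + 2*a12*s^3)*h31
        + (- 8*X*a20*n*s*t - 8*X*a21*n*s^2*t + 6*X*a30*s^2 - 12*X^2*a30*n*s*t - 4*a10*n*s*t
        - 4*a11*n*s^2*t - 4*a12*n*s^3*t + 4*a20*s^2 + 4*a21*s^3)*h4)
    (e7 := show _ = (0 : R) by linear_combination (2*X^2*a20*s + 2*X^2*a21*s^2 + 6*X^3*a30*s)*hY
        + (a10*s + a11*s^2 + a12*s^3)*h31 + (- 2*X*a20*n*s - 4*X*a20*n*s*t - 2*X*a21*n*s^2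
        - 4*X*a21*n*s^2*t + 9*X*a30*s^2 - 3*X^2*a30*n*s - 12*X^2*a30*n*s*t - a10*n*s - a11*n*s^2
        - a12*n*s^3 + 4*a20*s^2 + 4*a21*s^3)*h4)
    (e8 := show _ = (0 : R) by linear_combination (2*a10)*k2 + (2*Y*a11 + 2*Y*a12*s)*h22 + (2*Y*a20
        + 2*Y*a21*s)*h31 + (2*Y*a30*s)*h4)
    (e9 := show _ = (0 : R) by linear_combination 0)
    (e10 := show _ = (0 : R) by linear_combination 0)]
  linear_combination (- 2*f0 + 2*f0*lam + 2*f2*lam - 2*f2*lam^2)*k1 + (- 2*Y*f0*lam + 2*Y*f0*lam^2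
      + 2*Y*f0*rho*s - 2*Y*f2*lam*rho*s + 2*Y*f2*lam^2 - 2*Y*f2*lam^3)*h13

theorem prodLin_B21 {R : Type*} [CommRing R] {s X Y n t : R} (h : WeightRel s X Y n t)
    (lam rho a10 a11 a12 a20 a21 a30 f0 f1 f2 f3 : R) :
    prodLin lam (1 - (1 - lam)*(s + lam*s^2) + s^3*rho) f0 f1 f2 f3 (2*X*Y*s) (2*X^2*s^2 - 2*X^3*n*s
        + 2*Y^2*s) (8*X*Y*s^2 - 10*X^2*Y*n*s) (- 20*X*Y^2*n*s + 8*X^2*s^3 - 18*X^3*n*s^2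
        + 10*X^4*n^2*s + 8*Y^2*s^2)
      (X*a10 + X*a11*s + X*a12*s^2 + X^2*a20 + X^2*a21*s + X^3*a30)
      (2*X*Y*a20 + 2*X*Y*a21*s + 3*X^2*Y*a30 + Y*a10 + Y*a11*s + Y*a12*s^2)
      (6*X*Y^2*a30 + X*a10*s + X*a11*s^2 + X*a12*s^3 - X^2*a10*n - X^2*a11*n*s - X^2*a12*n*s^2
          + 2*X^2*a20*s + 2*X^2*a21*s^2 - 2*X^3*a20*n - 2*X^3*a21*n*s + 3*X^3*a30*s - 3*X^4*a30*n
          + 2*Y^2*a20 + 2*Y^2*a21*s) =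
    (- 2*f1 + 2*f3)*X*Y*s := by
  obtain ⟨h4, h31, h22, h13, k3, k2, k1, k0, hY⟩ := h
  have g1 : 2*X^2*s^2 - 2*X^3*n*s + 2*Y^2*s = (0 : R) := by
    linear_combination (2*s)*hY + (4)*h22 + (- 2*n - 4*n*t)*h31
  have g2 : 8*X*Y*s^2 - 10*X^2*Y*n*s = (0 : R) := by
    linear_combination (8)*k1 + (- 10*n)*k2
  have g3 : - 20*X*Y^2*n*s + 8*X^2*s^3 - 18*X^3*n*s^2 + 10*X^4*n^2*s + 8*Y^2*s^2 = (0 : R) := by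
    linear_combination (- 20*X*n*s + 8*s^2)*hY + (16*s)*h22 + (- 38*n*s - 16*n*s*t)*h31 + (10*n^2*s
        + 40*n^2*s*t)*h4
  rw [g1, g2, g3]
  rw [prodLin_eq
    (e1 := show _ = (0 : R) by linear_combination (2*a10)*k2 + (2*Y*a11 + 2*Y*a12*s)*h22 + (2*Y*a20
        + 2*Y*a21*s)*h31 + (2*Y*a30*s)*h4)
    (e2 := show _ = (0 : R) by linear_combination 0)
    (e3 := show _ = (0 : R) by linear_combination 0)
    (e4 := show _ = (0 : R) by linear_combination (2*X*a10*s + 2*X*a11*s^2 + 2*X*a12*s^3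
        + 4*X^2*a20*s + 4*X^2*a21*s^2 + 6*X^3*a30*s)*hY + (2*a10*s + 2*a11*s^2 + 2*a12*s^3)*h31
        + (- 8*X*a20*n*s*t - 8*X*a21*n*s^2*t + 6*X*a30*s^2 - 12*X^2*a30*n*s*t - 4*a10*n*s*t
        - 4*a11*n*s^2*t - 4*a12*n*s^3*t + 4*a20*s^2 + 4*a21*s^3)*h4)
    (e5 := show _ = (0 : R) by linear_combination 0)
    (e6 := show _ = (0 : R) by linear_combination 0)
    (e7 := show _ = (0 : R) by linear_combination (4*X*Y*a20*s + 4*X*Y*a21*s^2 + 12*X^2*Y*a30*s)*hY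
        + (2*Y*a10 + 2*Y*a11*s + 2*Y*a12*s^2)*h22 + (- 2*Y*a10*n - 2*Y*a11*n*s - 2*Y*a12*n*s^2
        + 8*Y*a20*s + 8*Y*a21*s^2)*h31 + (- 6*X*Y*a30*n*s - 24*X*Y*a30*n*s*t - 4*Y*a20*n*s
        - 8*Y*a20*n*s*t - 4*Y*a21*n*s^2 - 8*Y*a21*n*s^2*t + 18*Y*a30*s^2)*h4)
    (e8 := show _ = (0 : R) by linear_combination 0)
    (e9 := show _ = (0 : R) by linear_combination 0)
    (e10 := show _ = (0 : R) by linear_combination 0)]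
  linear_combination 0

theorem prodLin_A30 {R : Type*} [CommRing R] {s X Y n t : R} (h : WeightRel s X Y n t)
    (lam rho a10 a11 a12 a20 a21 a30 f0 f1 f2 f3 : R) :
    prodLin lam (1 - (1 - lam)*(s + lam*s^2) + s^3*rho) f0 f1 f2 f3 (X^3) (3*X^2*Y) (6*X*Y^2
        + 3*X^3*s - 3*X^4*n) (21*X^2*Y*s - 24*X^3*Y*n + 6*Y^3)
      (X*a10 + X*a11*s + X*a12*s^2 + X^2*a20 + X^2*a21*s + X^3*a30)
      (2*X*Y*a20 + 2*X*Y*a21*s + 3*X^2*Y*a30 + Y*a10 + Y*a11*s + Y*a12*s^2)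
      (6*X*Y^2*a30 + X*a10*s + X*a11*s^2 + X*a12*s^3 - X^2*a10*n - X^2*a11*n*s - X^2*a12*n*s^2
          + 2*X^2*a20*s + 2*X^2*a21*s^2 - 2*X^3*a20*n - 2*X^3*a21*n*s + 3*X^3*a30*s - 3*X^4*a30*n
          + 2*Y^2*a20 + 2*Y^2*a21*s) =
    (9*f2 - 3*f2*lam)*X^2*Y
    + (- f1 + f3)*X^3 := by
  obtain ⟨h4, h31, h22, h13, k3, k2, k1, k0, hY⟩ := h
  have g2 : 6*X*Y^2 + 3*X^3*s - 3*X^4*n = (0 : R) := by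
    linear_combination (6*X)*hY + (9)*h31 + (- 3*n - 12*n*t)*h4
  have g3 : 21*X^2*Y*s - 24*X^3*Y*n + 6*Y^3 = (0 : R) := by
    linear_combination (6*Y)*hY + (27)*k2 + (- 24*n - 12*n*t)*k3
  rw [g2, g3]
  rw [prodLin_eq
    (e1 := show _ = (0 : R) by linear_combination (X*a20 + X*a21*s + X^2*a30 + a10 + a11*s
        + a12*s^2)*h4)
    (e2 := show _ = (0 : R) by linear_combination 0)
    (e3 := show _ = (0 : R) by linear_combination 0)
    (e4 := show _ = (0 : R) by linear_combination (a10)*k3 + (Y*a11 + Y*a12*s)*h31 + (3*X*Y*a30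
        + 2*Y*a20 + 2*Y*a21*s)*h4)
    (e5 := show _ = (0 : R) by linear_combination 0)
    (e6 := show _ = (0 : R) by linear_combination (3*X^2*a10 + 3*X^2*a11*s + 3*X^2*a12*s^2
        + 6*X^3*a20 + 6*X^3*a21*s + 9*X^4*a30)*hY + (- 6*X*a10*n*t - 6*X*a11*n*s*t - 6*X*a12*n*s^2*t
        + 6*X*a20*s + 6*X*a21*s^2 - 12*X^2*a20*n*t - 12*X^2*a21*n*s*t + 9*X^2*a30*s - 18*X^3*a30*n*t
        + 3*a10*s + 3*a11*s^2 + 3*a12*s^3)*h4)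
    (e7 := show _ = (0 : R) by linear_combination (2*X^3*a20 + 2*X^3*a21*s + 6*X^4*a30)*hY
        + (- X*a10*n - X*a11*n*s - X*a12*n*s^2 + 4*X*a20*s + 4*X*a21*s^2 - 2*X^2*a20*n
        - 4*X^2*a20*n*t - 2*X^2*a21*n*s - 4*X^2*a21*n*s*t + 9*X^2*a30*s - 3*X^3*a30*n
        - 12*X^3*a30*n*t + a10*s + a11*s^2 + a12*s^3)*h4)
    (e8 := show _ = (0 : R) by linear_combination (3*a10)*k3 + (3*Y*a11 + 3*Y*a12*s)*h31
        + (3*X*Y*a30 + 3*Y*a20 + 3*Y*a21*s)*h4)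
    (e9 := show _ = (0 : R) by linear_combination 0)
    (e10 := show _ = (0 : R) by linear_combination 0)]
  linear_combination (- 3*f0 + 3*f0*lam + 3*f2*lam - 3*f2*lam^2)*k2 + (- 3*Y*f0*lam + 3*Y*f0*lam^2
      + 3*Y*f0*rho*s - 3*Y*f2*lam*rho*s + 3*Y*f2*lam^2 - 3*Y*f2*lam^3)*h22

theorem prodLin_B30 {R : Type*} [CommRing R] {s X Y n t : R} (h : WeightRel s X Y n t)
    (lam rho a10 a11 a12 a20 a21 a30 f0 f1 f2 f3 : R) :
    prodLin lam (1 - (1 - lam)*(s + lam*s^2) + s^3*rho) f0 f1 f2 f3 (3*X^2*Y) (6*X*Y^2 + 3*X^3*s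
        - 3*X^4*n) (21*X^2*Y*s - 24*X^3*Y*n + 6*Y^3) (60*X*Y^2*s - 90*X^2*Y^2*n + 21*X^3*s^2
        - 45*X^4*n*s + 24*X^5*n^2)
      (X*a10 + X*a11*s + X*a12*s^2 + X^2*a20 + X^2*a21*s + X^3*a30)
      (2*X*Y*a20 + 2*X*Y*a21*s + 3*X^2*Y*a30 + Y*a10 + Y*a11*s + Y*a12*s^2)
      (6*X*Y^2*a30 + X*a10*s + X*a11*s^2 + X*a12*s^3 - X^2*a10*n - X^2*a11*n*s - X^2*a12*n*s^2
          + 2*X^2*a20*s + 2*X^2*a21*s^2 - 2*X^3*a20*n - 2*X^3*a21*n*s + 3*X^3*a30*s - 3*X^4*a30*n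
          + 2*Y^2*a20 + 2*Y^2*a21*s) =
    (- 3*f1 + 3*f3)*X^2*Y := by
  obtain ⟨h4, h31, h22, h13, k3, k2, k1, k0, hY⟩ := h
  have g1 : 6*X*Y^2 + 3*X^3*s - 3*X^4*n = (0 : R) := by
    linear_combination (6*X)*hY + (9)*h31 + (- 3*n - 12*n*t)*h4
  have g2 : 21*X^2*Y*s - 24*X^3*Y*n + 6*Y^3 = (0 : R) := by
    linear_combination (6*Y)*hY + (27)*k2 + (- 24*n - 12*n*t)*k3
  have g3 : 60*X*Y^2*s - 90*X^2*Y^2*n + 21*X^3*s^2 - 45*X^4*n*s + 24*X^5*n^2 = (0 : R) := by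
    linear_combination (60*X*s - 90*X^2*n)*hY + (81*s)*h31 + (24*X*n^2 + 180*X*n^2*t - 135*n*s
        - 120*n*s*t)*h4
  rw [g1, g2, g3]
  rw [prodLin_eq
    (e1 := show _ = (0 : R) by linear_combination (3*a10)*k3 + (3*Y*a11 + 3*Y*a12*s)*h31
        + (3*X*Y*a30 + 3*Y*a20 + 3*Y*a21*s)*h4)
    (e2 := show _ = (0 : R) by linear_combination 0)
    (e3 := show _ = (0 : R) by linear_combination 0)
    (e4 := show _ = (0 : R) by linear_combination (3*X^2*a10 + 3*X^2*a11*s + 3*X^2*a12*s^2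
        + 6*X^3*a20 + 6*X^3*a21*s + 9*X^4*a30)*hY + (- 6*X*a10*n*t - 6*X*a11*n*s*t - 6*X*a12*n*s^2*t
        + 6*X*a20*s + 6*X*a21*s^2 - 12*X^2*a20*n*t - 12*X^2*a21*n*s*t + 9*X^2*a30*s - 18*X^3*a30*n*t
        + 3*a10*s + 3*a11*s^2 + 3*a12*s^3)*h4)
    (e5 := show _ = (0 : R) by linear_combination 0)
    (e6 := show _ = (0 : R) by linear_combination 0)
    (e7 := show _ = (0 : R) by linear_combination (6*X^2*Y*a20 + 6*X^2*Y*a21*s + 18*X^3*Y*a30)*hY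
        + (3*Y*a10 + 3*Y*a11*s + 3*Y*a12*s^2)*h31 + (- 6*X*Y*a20*n - 12*X*Y*a20*n*t - 6*X*Y*a21*n*s
        - 12*X*Y*a21*n*s*t + 27*X*Y*a30*s - 9*X^2*Y*a30*n - 36*X^2*Y*a30*n*t - 3*Y*a10*n
        - 3*Y*a11*n*s - 3*Y*a12*n*s^2 + 12*Y*a20*s + 12*Y*a21*s^2)*h4)
    (e8 := show _ = (0 : R) by linear_combination 0)
    (e9 := show _ = (0 : R) by linear_combination 0)
    (e10 := show _ = (0 : R) by linear_combination 0)]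
  linear_combination 0

set_option maxHeartbeats 2000000 in
/-- The residual of the approximate solution vanishes modulo terms of weight at least `8` if the
systems `(Ω_{k,l})` hold. -/
theorem residual_poly_eq_zero {R : Type*} [CommRing R] {s X Y n t m lam mu rho b b1 b2 z zx : R}
    (h : WeightRel s X Y n t) (hn : n = m - (m - 1)*s) (hm : m*lam = m - 1)
    (ht : 3*t = 1) (hmu : mu = 1 - (1 - lam)*(s + lam*s^2) + s^3*rho)
    {a10 a11 a12 a20 a21 a30 : R}
    (hb : b = X*a10 + X*a11*s + X*a12*s^2 + X^2*a20 + X^2*a21*s + X^3*a30)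
    (hb1 : b1 = 2*X*Y*a20 + 2*X*Y*a21*s + 3*X^2*Y*a30 + Y*a10 + Y*a11*s + Y*a12*s^2)
    (hb2 : b2 = 6*X*Y^2*a30 + X*a10*s + X*a11*s^2 + X*a12*s^3 - X^2*a10*n - X^2*a11*n*s
        - X^2*a12*n*s^2 + 2*X^2*a20*s + 2*X^2*a21*s^2 - 2*X^3*a20*n - 2*X^3*a21*n*s + 3*X^3*a30*s
        - 3*X^4*a30*n + 2*Y^2*a20 + 2*Y^2*a21*s)
    {q0 q1 q2 q3 A10_0 A10_1 A10_2 A10_3 B10_0 B10_1 B10_2 B10_3 A11_0 A11_1 A11_2 A11_3 B11_0 B11_1 B11_2 B11_3 A12_0 A12_1 A12_2 A12_3 B12_0 B12_1 B12_2 B12_3 A20_0 A20_1 A20_2 A20_3 B20_0 B20_1 B20_2 B20_3 A21_0 A21_1 A21_2 A21_3 B21_0 B21_1 B21_2 B21_3 A30_0 A30_1 A30_2 A30_3 B30_0 B30_1 B30_2 B30_3 : R}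
    (hz : z = A10_0*X + A11_0*X*s + A12_0*X*s^2 + A20_0*X^2 + A21_0*X^2*s + A30_0*X^3 + B10_0*Y
        + B11_0*Y*s + B12_0*Y*s^2 + 2*B20_0*X*Y + 2*B21_0*X*Y*s + 3*B30_0*X^2*Y + X + q0)
    (hzx : zx = (1 - b)*(A10_1*X + A11_1*X*s + A12_1*X*s^2 + A20_1*X^2 + A21_1*X^2*s + A30_1*X^3
        + B10_1*Y + B11_1*Y*s + B12_1*Y*s^2 + 2*B20_1*X*Y + 2*B21_1*X*Y*s + 3*B30_1*X^2*Y + q1)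
      + (A10_0*Y + A11_0*Y*s + A12_0*Y*s^2 + 2*A20_0*X*Y + 2*A21_0*X*Y*s + 3*A30_0*X^2*Y + B10_0*X*s
          - B10_0*X^2*n + B11_0*X*s^2 - B11_0*X^2*n*s + B12_0*X*s^3 - B12_0*X^2*n*s^2
          + 2*B20_0*X^2*s - 2*B20_0*X^3*n + 2*B20_0*Y^2 + 2*B21_0*X^2*s^2 - 2*B21_0*X^3*n*s
          + 2*B21_0*Y^2*s + 6*B30_0*X*Y^2 + 3*B30_0*X^3*s - 3*B30_0*X^4*n + Y))
    (Q3 : q3 - q1 + 2*q0*q1 = 0)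
    (F10 : 2*A10_0*q1 - A10_1 + 2*A10_1*q0 + A10_3 + a10*lam*q3 - 2*a10*q0*q1 - 3*a10*q3 + 2*q1 = 0)
    (G10 : 2*A10_0*q0 + 3*A10_2 - A10_2*lam + 2*B10_0*q1 - B10_1 + 2*B10_1*q0 + B10_3 + 2*a10*lam*q2
        - 3*a10*q2 + 2*q0 = 0)
    (F11 : 3*A10_1 - 2*A10_1*lam + 2*A11_0*q1 - A11_1 + 2*A11_1*q0 + A11_3 + 2*B10_0*q0 + 3*B10_2
        - B10_2*lam - a10*lam*q3 + a10*lam^2*q3 + a11*lam*q3 - 2*a11*q0*q1 - 3*a11*q3 = 0)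
    (G11 : A10_2*lam - A10_2*lam^2 + 2*A11_0*q0 + 3*A11_2 - A11_2*lam + 3*B10_1 - 2*B10_1*lam
        + 2*B11_0*q1 - B11_1 + 2*B11_1*q0 + B11_3 - 2*a10*lam*q2 + 2*a10*lam^2*q2 + 2*a11*lam*q2
        - 3*a11*q2 = 0)
    (F12 : 2*A10_1*lam - 2*A10_1*lam^2 + 3*A11_1 - 2*A11_1*lam + 2*A12_0*q1 - A12_1 + 2*A12_1*q0
        + A12_3 + B10_2*lam - B10_2*lam^2 + 2*B11_0*q0 + 3*B11_2 - B11_2*lam - a10*lam^2*q3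
        + a10*lam^3*q3 - a11*lam*q3 + a11*lam^2*q3 + a12*lam*q3 - 2*a12*q0*q1 - 3*a12*q3 = 0)
    (G12 : A10_2*lam^2 - A10_2*lam^3 + A11_2*lam - A11_2*lam^2 + 2*A12_0*q0 + 3*A12_2 - A12_2*lam
        + 2*B10_1*lam - 2*B10_1*lam^2 + 3*B11_1 - 2*B11_1*lam + 2*B12_0*q1 - B12_1 + 2*B12_1*q0
        + B12_3 - 2*a10*lam^2*q2 + 2*a10*lam^3*q2 - 2*a11*lam*q2 + 2*a11*lam^2*q2 + 2*a12*lam*q2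
        - 3*a12*q2 = 0)
    (F20 : 2*A10_0*A10_1 - 2*A10_0*a10*q1 - 2*A10_1*a10*q0 - A10_1*m - 3*A10_3*a10 + A10_3*a10*lam
        + 2*A20_0*q1 - A20_1 + 2*A20_1*q0 + A20_3 - 2*B10_0*m*q0 - B10_2 - 2*B10_2*m - a10*q1
        - 2*a10^2*lam*q3 + 3*a10^2*q3 + a20*lam*q3 - 2*a20*q0*q1 - 3*a20*q3 = 0)
    (G20 : 2*A10_0 + 2*A10_0*B10_1 + 2*A10_0^2 + 2*A10_1*B10_0 - 9*A10_2*a10 + 6*A10_2*a10*lam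
        + 4*A20_0*q0 + 6*A20_2 - 2*A20_2*lam - 2*B10_0*a10*q1 - 2*B10_1 - 2*B10_1*a10*q0 - 2*B10_1*m
        - 3*B10_3*a10 + B10_3*a10*lam + 4*B20_0*q1 - 2*B20_1 + 4*B20_1*q0 + 2*B20_3 - 3*a10^2*lam*q2
        + 3*a10^2*q2 + 4*a20*lam*q2 - 6*a20*q2 = 0)
    (F21 : 2*A10_0*A11_1 + 4*A10_0*B10_0 - 2*A10_0*a11*q1 - A10_1 + 2*A10_1*A11_0 - 6*A10_1*a10
        + 6*A10_1*a10*lam - 2*A10_1*a11*q0 + A10_1*m - A10_3*a10*lam + A10_3*a10*lam^2 - 3*A10_3*a11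
        + A10_3*a11*lam - 2*A11_0*a10*q1 - 2*A11_1*a10*q0 - A11_1*m - 3*A11_3*a10 + A11_3*a10*lam
        + 12*A20_1 - 8*A20_1*lam + 2*A21_0*q1 - A21_1 + 2*A21_1*q0 + A21_3 + 2*B10_0*B10_1
        + 2*B10_0*m*q0 - 2*B10_0*q0 - 2*B10_2 - 9*B10_2*a10 + 6*B10_2*a10*lam + 2*B10_2*m
        - 2*B11_0*m*q0 - B11_2 - 2*B11_2*m + 8*B20_0*q0 + 12*B20_2 - 4*B20_2*lam - 4*a10*a11*lam*q3
        + 6*a10*a11*q3 + 2*a10^2*lam*q3 - 2*a10^2*lam^2*q3 - a11*q1 + 3*a20*lam*q1 - a20*lam*q3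
        + a20*lam^2*q3 - 3*a20*q1 + a21*lam*q3 - 2*a21*q0*q1 - 3*a21*q3 = 0)
    (G21 : 4*A10_0*A11_0 + 2*A10_0*B11_1 + 2*A10_1*B11_0 - 6*A10_2*a10*lam + 6*A10_2*a10*lam^2
        - 9*A10_2*a11 + 6*A10_2*a11*lam + 2*A11_0 + 2*A11_0*B10_1 + 2*A11_1*B10_0 - 9*A11_2*a10
        + 6*A11_2*a10*lam + 6*A20_0 - 6*A20_0*lam + 2*A20_2*lam - 2*A20_2*lam^2 + 4*A21_0*q0
        + 6*A21_2 - 2*A21_2*lam - 2*B10_0*a11*q1 + 2*B10_0^2 - 2*B10_1 - 6*B10_1*a10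
        + 6*B10_1*a10*lam - 2*B10_1*a11*q0 + 2*B10_1*m - B10_3*a10*lam + B10_3*a10*lam^2
        - 3*B10_3*a11 + B10_3*a11*lam - 2*B11_0*a10*q1 - 2*B11_1 - 2*B11_1*a10*q0 - 2*B11_1*m
        - 3*B11_3*a10 + B11_3*a10*lam + 24*B20_1 - 16*B20_1*lam + 4*B21_0*q1 - 2*B21_1 + 4*B21_1*q0
        + 2*B21_3 - 6*a10*a11*lam*q2 + 6*a10*a11*q2 + 3*a10^2*lam*q2 - 3*a10^2*lam^2*q2
        - 4*a20*lam*q2 + 4*a20*lam^2*q2 + 4*a21*lam*q2 - 6*a21*q2 = 0)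
    (F30 : - 2*A10_0*A10_1*a10 + 2*A10_0*A20_1 - 10*A10_0*B10_0*m*t - 2*A10_0*a20*q1 + 2*A10_1*A20_0
        + 4*A10_1*a10 - 2*A10_1*a20*q0 + 3*A10_3*a10^2 - 2*A10_3*a10^2*lam - 3*A10_3*a20
        + A10_3*a20*lam - 2*A20_0*a10*q1 - 2*A20_1*a10*q0 - 10*A20_1*m*t - 14*A20_1*t - 3*A20_3*a10
        + A20_3*a10*lam + 2*A30_0*q1 - A30_1 + 2*A30_1*q0 + A30_3 - 4*B10_0*B10_1*m*t
        + 8*B10_2*a10*m*t + 16*B10_2*a10*t - 20*B20_0*m*q0*t - 20*B20_2*m*t - 10*B20_2*t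
        - 4*a10*a20*lam*q3 + 6*a10*a20*q3 + a10^3*lam*q3 - a10^3*q3 + 4*a20*q1*t + a30*lam*q3
        - 2*a30*q0*q1 - 3*a30*q3 = 0)
    (G30 : 6*A10_0*A20_0 - 2*A10_0*B10_1*a10 + 4*A10_0*B20_1 - 2*A10_1*B10_0*a10 + 4*A10_1*B20_0
        + 6*A10_2*a10^2 - 6*A10_2*a10^2*lam - 12*A10_2*a20 + 8*A10_2*a20*lam - 4*A20_0
        + 2*A20_0*B10_1 + 2*A20_1*B10_0 - 15*A20_2*a10 + 10*A20_2*a10*lam + 6*A30_0*q0 + 9*A30_2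
        - 3*A30_2*lam - 2*B10_0*a20*q1 - 2*B10_0^2*m + 8*B10_1*a10 - 2*B10_1*a20*q0 + 3*B10_3*a10^2
        - 2*B10_3*a10^2*lam - 3*B10_3*a20 + B10_3*a20*lam - 4*B20_0*a10*q1 - 16*B20_1
        - 4*B20_1*a10*q0 - 10*B20_1*m - 6*B20_3*a10 + 2*B20_3*a10*lam + 6*B30_0*q1 - 3*B30_1
        + 6*B30_1*q0 + 3*B30_3 - 9*a10*a20*lam*q2 + 9*a10*a20*q2 + 6*a30*lam*q2 - 9*a30*q2 = 0)
    : prodLin lam mu q0 q1 q2 q3 (1) (0) (0) (0) b b1 b2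
      + prodLin lam mu 1 0 0 0 (X) (Y) (X*s - X^2*n) (- 2*X*Y*n + Y*s) b b1 b2
      + prodLin lam mu A10_0 A10_1 A10_2 A10_3 (X) (Y) (X*s - X^2*n) (- 2*X*Y*n + Y*s) b b1 b2
      + prodLin lam mu B10_0 B10_1 B10_2 B10_3 (Y) (X*s - X^2*n) (- 2*X*Y*n + Y*s) (X*s^2
          - 3*X^2*n*s + 2*X^3*n^2 - 2*Y^2*n) b b1 b2
      + prodLin lam mu A11_0 A11_1 A11_2 A11_3 (X*s) (Y*s) (X*s^2 - X^2*n*s) (- 2*X*Y*n*s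
          + Y*s^2) b b1 b2
      + prodLin lam mu B11_0 B11_1 B11_2 B11_3 (Y*s) (X*s^2 - X^2*n*s) (- 2*X*Y*n*s + Y*s^2) (X*s^3
          - 3*X^2*n*s^2 + 2*X^3*n^2*s - 2*Y^2*n*s) b b1 b2
      + prodLin lam mu A12_0 A12_1 A12_2 A12_3 (X*s^2) (Y*s^2) (X*s^3 - X^2*n*s^2) (- 2*X*Y*n*s^2
          + Y*s^3) b b1 b2
      + prodLin lam mu B12_0 B12_1 B12_2 B12_3 (Y*s^2) (X*s^3 - X^2*n*s^2) (- 2*X*Y*n*s^2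
          + Y*s^3) (X*s^4 - 3*X^2*n*s^3 + 2*X^3*n^2*s^2 - 2*Y^2*n*s^2) b b1 b2
      + prodLin lam mu A20_0 A20_1 A20_2 A20_3 (X^2) (2*X*Y) (2*X^2*s - 2*X^3*n + 2*Y^2) (8*X*Y*s
          - 10*X^2*Y*n) b b1 b2
      + prodLin lam mu B20_0 B20_1 B20_2 B20_3 (2*X*Y) (2*X^2*s - 2*X^3*n + 2*Y^2) (8*X*Y*s
          - 10*X^2*Y*n) (- 20*X*Y^2*n + 8*X^2*s^2 - 18*X^3*n*s + 10*X^4*n^2 + 8*Y^2*s) b b1 b2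
      + prodLin lam mu A21_0 A21_1 A21_2 A21_3 (X^2*s) (2*X*Y*s) (2*X^2*s^2 - 2*X^3*n*s
          + 2*Y^2*s) (8*X*Y*s^2 - 10*X^2*Y*n*s) b b1 b2
      + prodLin lam mu B21_0 B21_1 B21_2 B21_3 (2*X*Y*s) (2*X^2*s^2 - 2*X^3*n*s
          + 2*Y^2*s) (8*X*Y*s^2 - 10*X^2*Y*n*s) (- 20*X*Y^2*n*s + 8*X^2*s^3 - 18*X^3*n*s^2
          + 10*X^4*n^2*s + 8*Y^2*s^2) b b1 b2
      + prodLin lam mu A30_0 A30_1 A30_2 A30_3 (X^3) (3*X^2*Y) (6*X*Y^2 + 3*X^3*s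
          - 3*X^4*n) (21*X^2*Y*s - 24*X^3*Y*n + 6*Y^3) b b1 b2
      + prodLin lam mu B30_0 B30_1 B30_2 B30_3 (3*X^2*Y) (6*X*Y^2 + 3*X^3*s - 3*X^4*n) (21*X^2*Y*s
          - 24*X^3*Y*n + 6*Y^3) (60*X*Y^2*s - 90*X^2*Y^2*n + 21*X^3*s^2 - 45*X^4*n*s
          + 24*X^5*n^2) b b1 b2
      + 2*z*zx = 0 := by
  subst hmu hb hb1 hb2
  rw [prodLin_Q h lam rho a10 a11 a12 a20 a21 a30 q0 q1 q2 q3,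
    prodLin_A10 h lam rho a10 a11 a12 a20 a21 a30 1 0 0 0,
    prodLin_A10 h lam rho a10 a11 a12 a20 a21 a30 A10_0 A10_1 A10_2 A10_3,
    prodLin_B10 h lam rho a10 a11 a12 a20 a21 a30 B10_0 B10_1 B10_2 B10_3,
    prodLin_A11 h lam rho a10 a11 a12 a20 a21 a30 A11_0 A11_1 A11_2 A11_3,
    prodLin_B11 h lam rho a10 a11 a12 a20 a21 a30 B11_0 B11_1 B11_2 B11_3,
    prodLin_A12 h lam rho a10 a11 a12 a20 a21 a30 A12_0 A12_1 A12_2 A12_3,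
    prodLin_B12 h lam rho a10 a11 a12 a20 a21 a30 B12_0 B12_1 B12_2 B12_3,
    prodLin_A20 h lam rho a10 a11 a12 a20 a21 a30 A20_0 A20_1 A20_2 A20_3,
    prodLin_B20 h lam rho a10 a11 a12 a20 a21 a30 B20_0 B20_1 B20_2 B20_3,
    prodLin_A21 h lam rho a10 a11 a12 a20 a21 a30 A21_0 A21_1 A21_2 A21_3,
    prodLin_B21 h lam rho a10 a11 a12 a20 a21 a30 B21_0 B21_1 B21_2 B21_3,
    prodLin_A30 h lam rho a10 a11 a12 a20 a21 a30 A30_0 A30_1 A30_2 A30_3,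
    prodLin_B30 h lam rho a10 a11 a12 a20 a21 a30 B30_0 B30_1 B30_2 B30_3]
  obtain ⟨h4, h31, h22, h13, k3, k2, k1, k0, hY⟩ := h
  -- The quadratic term `2 z zₓ` is reduced in stages: β times the derivative of the ansatz in `y`
  -- (`hU`), the derivative falling on the small soliton (`hW`), and finally the product with z
  -- (`hzz`).
  have hU : (X*a10 + X*a11*s + X*a12*s^2 + X^2*a20 + X^2*a21*s + X^3*a30)
      * (A10_1*X + A11_1*X*s + A12_1*X*s^2 + A20_1*X^2 + A21_1*X^2*s + A30_1*X^3 + B10_1*Y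
          + B11_1*Y*s + B12_1*Y*s^2 + 2*B20_1*X*Y + 2*B21_1*X*Y*s + 3*B30_1*X^2*Y + q1) =
      (a10*q1)*X
    + (B10_1*a10)*X*Y
    + (B10_1*a11 + B11_1*a10)*X*Y*s
    + (a11*q1)*X*s
    + (a12*q1)*X*s^2
    + (A10_1*a10 + a20*q1)*X^2
    + (B10_1*a20 + 2*B20_1*a10)*X^2*Y
    + (A10_1*a11 + A11_1*a10 + a21*q1)*X^2*s
    + (A10_1*a20 + A20_1*a10 + a30*q1)*X^3 := by
    linear_combination (A10_1*a12 + A11_1*a11 + A11_1*a12*s + A12_1*a10 + A12_1*a11*s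
        + A12_1*a12*s^2 + B11_1*Y*a21 + B12_1*Y*a20 + B12_1*Y*a21*s + 2*B20_1*Y*a12 + 2*B21_1*Y*a11
        + 2*B21_1*Y*a12*s)*h22 + (B10_1*a12 + B11_1*a11 + B12_1*a10)*k1 + (A10_1*a21 + A11_1*a20
        + A11_1*a21*s + A12_1*a20*s + A12_1*a21*s^2 + A20_1*a11 + A20_1*a12*s + A21_1*a10
        + A21_1*a11*s + A21_1*a12*s^2 + B11_1*Y*a30 + B12_1*Y*a30*s + 2*B20_1*Y*a21 + 2*B21_1*Y*a20
        + 2*B21_1*Y*a21*s + 3*B30_1*Y*a11 + 3*B30_1*Y*a12*s)*h31 + (B10_1*a21 + B11_1*a20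
        + 2*B20_1*a11 + 2*B21_1*a10)*k2 + (A10_1*a30 + A11_1*a30*s + A12_1*a30*s^2 + A20_1*X*a30
        + A20_1*a20 + A20_1*a21*s + A21_1*X*a30*s + A21_1*a20*s + A21_1*a21*s^2 + A30_1*X*a20
        + A30_1*X*a21*s + A30_1*X^2*a30 + A30_1*a10 + A30_1*a11*s + A30_1*a12*s^2 + 2*B20_1*Y*a30
        + 2*B21_1*Y*a30*s + 3*B30_1*X*Y*a30 + 3*B30_1*Y*a20 + 3*B30_1*Y*a21*s)*h4 + (B10_1*a30
        + 2*B20_1*a20 + 3*B30_1*a10)*k3 + (B11_1*Y*a12 + B12_1*Y*a11 + B12_1*Y*a12*s)*h13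
  have hW : A10_0*Y + A11_0*Y*s + A12_0*Y*s^2 + 2*A20_0*X*Y + 2*A21_0*X*Y*s + 3*A30_0*X^2*Y
      + B10_0*X*s - B10_0*X^2*n + B11_0*X*s^2 - B11_0*X^2*n*s + B12_0*X*s^3 - B12_0*X^2*n*s^2
      + 2*B20_0*X^2*s - 2*B20_0*X^3*n + 2*B20_0*Y^2 + 2*B21_0*X^2*s^2 - 2*B21_0*X^3*n*s
      + 2*B21_0*Y^2*s + 6*B30_0*X*Y^2 + 3*B30_0*X^3*s - 3*B30_0*X^4*n + Y =
      (2*A20_0)*X*Y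
    + (2*A21_0)*X*Y*s
    + (B10_0)*X*s
    + (B11_0)*X*s^2
    + (- B10_0*n)*X^2
    + (3*A30_0)*X^2*Y
    + (- B11_0*n + 4*B20_0)*X^2*s
    + (- 2*B20_0*n - 4*B20_0*n*t)*X^3
    + (1 + A10_0)*Y
    + (A11_0)*Y*s
    + (A12_0)*Y*s^2 := by
    linear_combination (2*B20_0 + 2*B21_0*s + 6*B30_0*X)*hY + (B12_0)*h13 + (- B12_0*n
        + 4*B21_0)*h22 + (- 2*B21_0*n - 4*B21_0*n*t + 9*B30_0)*h31 + (- 3*B30_0*n - 12*B30_0*n*t)*h4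
  rw [hW, sub_mul, one_mul, hU] at hzx
  have hzz : 2*z*zx =
      (2*q0*q1)
    + (2*A10_0*q1 + 2*A10_1*q0 - 2*a10*q0*q1 + 2*q1)*X
    + (2 + 4*A10_0 + 2*A10_0*B10_1 + 2*A10_0^2 + 2*A10_1*B10_0 + 4*A20_0*q0 - 2*B10_0*a10*q1
        + 2*B10_1 - 2*B10_1*a10*q0 + 4*B20_0*q1 + 4*B20_1*q0)*X*Y
    + (4*A10_0*A11_0 + 2*A10_0*B11_1 + 2*A10_1*B11_0 + 4*A11_0 + 2*A11_0*B10_1 + 2*A11_1*B10_0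
        + 4*A21_0*q0 - 2*B10_0*a11*q1 + 2*B10_0^2 - 2*B10_1*a11*q0 - 2*B11_0*a10*q1 + 2*B11_1
        - 2*B11_1*a10*q0 + 4*B21_0*q1 + 4*B21_1*q0)*X*Y*s
    + (2*A11_0*q1 + 2*A11_1*q0 + 2*B10_0*q0 - 2*a11*q0*q1)*X*s
    + (2*A12_0*q1 + 2*A12_1*q0 + 2*B11_0*q0 - 2*a12*q0*q1)*X*s^2
    + (2*A10_0*A10_1 - 2*A10_0*a10*q1 + 2*A10_1 - 2*A10_1*a10*q0 + 2*A20_0*q1 + 2*A20_1*q0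
        - 2*B10_0*n*q0 - 2*a10*q1 - 2*a20*q0*q1)*X^2
    + (6*A10_0*A20_0 - 2*A10_0*B10_1*a10 + 4*A10_0*B20_1 - 2*A10_1*B10_0*a10 + 4*A10_1*B20_0
        + 6*A20_0 + 2*A20_0*B10_1 + 2*A20_1*B10_0 + 6*A30_0*q0 - 2*B10_0*a20*q1 - 2*B10_0^2*n
        - 2*B10_1*a10 - 2*B10_1*a20*q0 - 4*B20_0*a10*q1 + 4*B20_1 - 4*B20_1*a10*q0 + 6*B30_0*q1
        + 6*B30_1*q0)*X^2*Y
    + (2*A10_0*A11_1 + 4*A10_0*B10_0 - 2*A10_0*a11*q1 + 2*A10_1*A11_0 - 2*A10_1*a11*q0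
        - 2*A11_0*a10*q1 + 2*A11_1 - 2*A11_1*a10*q0 + 2*A21_0*q1 + 2*A21_1*q0 + 4*B10_0
        + 2*B10_0*B10_1 - 2*B11_0*n*q0 + 8*B20_0*q0 - 2*a11*q1 - 2*a21*q0*q1)*X^2*s
    + (- 2*A10_0*A10_1*a10 + 2*A10_0*A20_1 - 2*A10_0*B10_0*n - 4*A10_0*B10_0*n*t - 2*A10_0*a20*q1
        + 2*A10_1*A20_0 - 2*A10_1*a10 - 2*A10_1*a20*q0 - 2*A20_0*a10*q1 + 2*A20_1 - 2*A20_1*a10*q0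
        + 2*A30_0*q1 + 2*A30_1*q0 - 4*B10_0*B10_1*n*t - 2*B10_0*n - 4*B10_0*n*t - 4*B20_0*n*q0
        - 8*B20_0*n*q0*t - 2*a20*q1 - 2*a30*q0*q1)*X^3
    + (2*A10_0*q0 + 2*B10_0*q1 + 2*B10_1*q0 + 2*q0)*Y
    + (2*A11_0*q0 + 2*B11_0*q1 + 2*B11_1*q0)*Y*s
    + (2*A12_0*q0 + 2*B12_0*q1 + 2*B12_1*q0)*Y*s^2 := by
    rw [hz, hzx]
    linear_combination (2*A10_0*B10_0 + 2*A10_0*B11_0*s + 2*A10_0*B12_0*s^2 + 4*A10_0*B20_0*X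
        + 4*A10_0*B21_0*X*s + 6*A10_0*B30_0*X^2 + 2*A11_0*B10_0*s + 2*A11_0*B11_0*s^2
        + 2*A11_0*B12_0*s^3 + 4*A11_0*B20_0*X*s + 4*A11_0*B21_0*X*s^2 + 6*A11_0*B30_0*X^2*s
        + 2*A12_0*B10_0*s^2 + 2*A12_0*B11_0*s^3 + 2*A12_0*B12_0*s^4 + 4*A12_0*B20_0*X*s^2
        + 4*A12_0*B21_0*X*s^3 + 6*A12_0*B30_0*X^2*s^2 + 4*A20_0*B10_0*X + 4*A20_0*B11_0*X*s
        + 4*A20_0*B12_0*X*s^2 + 8*A20_0*B20_0*X^2 + 8*A20_0*B21_0*X^2*s + 12*A20_0*B30_0*X^3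
        + 4*A21_0*B10_0*X*s + 4*A21_0*B11_0*X*s^2 + 4*A21_0*B12_0*X*s^3 + 8*A21_0*B20_0*X^2*s
        + 8*A21_0*B21_0*X^2*s^2 + 12*A21_0*B30_0*X^3*s + 6*A30_0*B10_0*X^2 + 6*A30_0*B11_0*X^2*s
        + 6*A30_0*B12_0*X^2*s^2 + 12*A30_0*B20_0*X^3 + 12*A30_0*B21_0*X^3*s + 18*A30_0*B30_0*X^4
        + 2*B10_0 + 2*B10_0*B10_1 - 2*B10_0*B10_1*X*a10 - 2*B10_0*B10_1*X*a11*s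
        - 2*B10_0*B10_1*X^2*a20 - 2*B10_0*B11_1*X*a10*s + 2*B10_0*B11_1*s + 2*B10_0*B12_1*s^2
        + 4*B10_0*B20_1*X - 4*B10_0*B20_1*X^2*a10 + 4*B10_0*B21_1*X*s + 6*B10_0*B30_1*X^2
        - 2*B10_1*B11_0*X*a10*s - 2*B10_1*B11_0*X*a11*s^2 - 2*B10_1*B11_0*X^2*a20*s
        + 2*B10_1*B11_0*s - 2*B10_1*B12_0*X*a10*s^2 - 2*B10_1*B12_0*X*a11*s^3
        - 2*B10_1*B12_0*X^2*a20*s^2 + 2*B10_1*B12_0*s^2 + 4*B10_1*B20_0*X - 4*B10_1*B20_0*X^2*a10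
        - 4*B10_1*B20_0*X^2*a11*s - 4*B10_1*B20_0*X^3*a20 + 4*B10_1*B21_0*X*s
        - 4*B10_1*B21_0*X^2*a10*s - 4*B10_1*B21_0*X^2*a11*s^2 - 4*B10_1*B21_0*X^3*a20*s
        + 6*B10_1*B30_0*X^2 - 6*B10_1*B30_0*X^3*a10 - 6*B10_1*B30_0*X^3*a11*s
        - 6*B10_1*B30_0*X^4*a20 - 2*B11_0*B11_1*X*a10*s^2 + 2*B11_0*B11_1*s^2 + 2*B11_0*B12_1*s^3
        + 4*B11_0*B20_1*X*s - 4*B11_0*B20_1*X^2*a10*s + 4*B11_0*B21_1*X*s^2 + 6*B11_0*B30_1*X^2*s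
        + 2*B11_0*s - 2*B11_1*B12_0*X*a10*s^3 + 2*B11_1*B12_0*s^3 + 4*B11_1*B20_0*X*s
        - 4*B11_1*B20_0*X^2*a10*s + 4*B11_1*B21_0*X*s^2 - 4*B11_1*B21_0*X^2*a10*s^2
        + 6*B11_1*B30_0*X^2*s - 6*B11_1*B30_0*X^3*a10*s + 2*B12_0*B12_1*s^4 + 4*B12_0*B20_1*X*s^2
        - 4*B12_0*B20_1*X^2*a10*s^2 + 4*B12_0*B21_1*X*s^3 + 6*B12_0*B30_1*X^2*s^2 + 2*B12_0*s^2
        + 4*B12_1*B20_0*X*s^2 + 4*B12_1*B21_0*X*s^3 + 6*B12_1*B30_0*X^2*s^2 + 8*B20_0*B20_1*X^2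
        - 8*B20_0*B20_1*X^3*a10 + 8*B20_0*B21_1*X^2*s + 12*B20_0*B30_1*X^3 + 4*B20_0*X
        + 8*B20_1*B21_0*X^2*s - 8*B20_1*B21_0*X^3*a10*s + 12*B20_1*B30_0*X^3
        - 12*B20_1*B30_0*X^4*a10 + 8*B21_0*B21_1*X^2*s^2 + 12*B21_0*B30_1*X^3*s + 4*B21_0*X*s
        + 12*B21_1*B30_0*X^3*s + 18*B30_0*B30_1*X^4 + 6*B30_0*X^2)*hY + (2*A10_0*A12_1
        + 4*A10_0*B11_0 + 2*A10_0*B12_0*s - 2*A10_0*a12*q1 + 2*A10_1*A12_0 - 2*A10_1*B11_0*Y*a11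
        - 2*A10_1*B12_0*Y*a10 - 2*A10_1*B12_0*Y*a11*s + 2*A11_0*A11_1 + 2*A11_0*A12_1*s
        + 6*A11_0*A21_0*Y + 4*A11_0*B10_0 - 2*A11_0*B10_1*Y*a11 + 4*A11_0*B11_0*s
        - 2*A11_0*B11_1*Y*a10 + 2*A11_0*B12_0*s^2 + 4*A11_0*B21_1*Y - 2*A11_0*a11*q1
        - 2*A11_0*a12*q1*s + 2*A11_1*A12_0*s - 2*A11_1*B11_0*Y*a10 - 2*A11_1*B12_0*Y*a10*s
        + 4*A11_1*B21_0*Y + 2*A12_0*A12_1*s^2 + 6*A12_0*A20_0*Y + 6*A12_0*A21_0*Y*s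
        + 4*A12_0*B10_0*s - 2*A12_0*B10_1*Y*a10 - 2*A12_0*B10_1*Y*a11*s + 4*A12_0*B11_0*s^2
        - 2*A12_0*B11_1*Y*a10*s + 2*A12_0*B12_0*s^3 + 4*A12_0*B20_1*Y + 4*A12_0*B21_1*Y*s
        - 2*A12_0*a10*q1 - 2*A12_0*a11*q1*s - 2*A12_0*a12*q1*s^2 + 2*A12_1 + 4*A12_1*B20_0*Y
        + 4*A12_1*B21_0*Y*s + 2*A20_0*B12_1*Y + 2*A20_1*B12_0*Y + 2*A21_0*B11_1*Y
        + 2*A21_0*B12_1*Y*s + 2*A21_1*B11_0*Y + 2*A21_1*B12_0*Y*s + 2*B10_0*B11_1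
        - 2*B10_0*B12_0*Y*n + 2*B10_0*B12_1*s + 4*B10_0*B21_0*Y + 2*B10_1*B11_0 + 2*B10_1*B12_0*s
        + 4*B11_0 + 2*B11_0*B11_1*s - 2*B11_0*B12_0*Y*n*s + 2*B11_0*B12_1*s^2 + 12*B11_0*B20_0*Y
        + 4*B11_0*B21_0*Y*s - 2*B11_0*Y*a21*q1 - 2*B11_0^2*Y*n + 2*B11_1*B12_0*s^2
        + 2*B12_0*B12_1*s^3 + 8*B12_0*B20_0*Y*s - 2*B12_0*Y*a20*q1 - 2*B12_0*Y*a21*q1*s + 2*B12_0*s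
        - 4*B20_0*Y*a12*q1 - 4*B21_0*Y*a11*q1 - 4*B21_0*Y*a12*q1*s - 2*a12*q1)*h22 + (4*A10_0*A12_0
        + 2*A10_0*B12_1 + 2*A10_1*B12_0 + 2*A11_0*B11_1 + 2*A11_0^2 + 2*A11_1*B11_0 + 4*A12_0
        + 2*A12_0*B10_1 + 2*A12_1*B10_0 + 4*B10_0*B11_0 - 2*B10_0*a12*q1 - 2*B11_0*a11*q1
        - 2*B12_0*a10*q1 + 2*B12_1)*k1 + (- 2*A10_0*A10_1*a11 - 2*A10_0*A11_1*a10 + 2*A10_0*A21_1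
        - 2*A10_0*B11_0*n - 4*A10_0*B11_0*n*t - 4*A10_0*B12_0*n*s*t + 12*A10_0*B20_0
        + 4*A10_0*B21_0*s - 2*A10_0*a21*q1 - 2*A10_1*A11_0*a10 - 2*A10_1*A11_0*a11*s
        - 2*A10_1*A12_0*a10*s - 2*A10_1*A12_0*a11*s^2 + 2*A10_1*A21_0 - 2*A10_1*B11_0*Y*a20
        - 2*A10_1*B12_0*Y*a20*s - 4*A10_1*B20_0*Y*a11 - 4*A10_1*B21_0*Y*a10 - 4*A10_1*B21_0*Y*a11*s
        - 2*A10_1*a11 - 2*A11_0*A11_1*a10*s + 2*A11_0*A20_1 + 2*A11_0*A21_1*s + 8*A11_0*A30_0*Y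
        - 2*A11_0*B10_0*n - 4*A11_0*B10_0*n*t - 2*A11_0*B10_1*Y*a20 - 2*A11_0*B11_0*n*s
        - 4*A11_0*B11_0*n*s*t - 4*A11_0*B12_0*n*s^2*t + 12*A11_0*B20_0*s - 4*A11_0*B20_1*Y*a10
        + 4*A11_0*B21_0*s^2 + 6*A11_0*B30_1*Y - 2*A11_0*a20*q1 - 2*A11_0*a21*q1*s
        - 2*A11_1*A12_0*a10*s^2 + 2*A11_1*A20_0 + 2*A11_1*A21_0*s - 4*A11_1*B20_0*Y*a10
        - 4*A11_1*B21_0*Y*a10*s + 6*A11_1*B30_0*Y - 2*A11_1*a10 + 2*A12_0*A20_1*s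
        + 2*A12_0*A21_1*s^2 + 8*A12_0*A30_0*Y*s - 2*A12_0*B10_0*n*s - 4*A12_0*B10_0*n*s*t
        - 2*A12_0*B10_1*Y*a20*s - 2*A12_0*B11_0*n*s^2 - 4*A12_0*B11_0*n*s^2*t
        - 4*A12_0*B12_0*n*s^3*t + 12*A12_0*B20_0*s^2 - 4*A12_0*B20_1*Y*a10*s + 4*A12_0*B21_0*s^3
        + 6*A12_0*B30_1*Y*s - 2*A12_0*a20*q1*s - 2*A12_0*a21*q1*s^2 + 2*A12_1*A20_0*s
        + 2*A12_1*A21_0*s^2 + 6*A12_1*B30_0*Y*s + 8*A20_0*A21_0*Y + 6*A20_0*B10_0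
        - 2*A20_0*B10_1*Y*a11 + 6*A20_0*B11_0*s - 2*A20_0*B11_1*Y*a10 + 4*A20_0*B12_0*s^2
        + 4*A20_0*B21_1*Y - 2*A20_0*a11*q1 - 2*A20_0*a12*q1*s - 2*A20_1*B11_0*Y*a10
        - 2*A20_1*B12_0*Y*a10*s + 4*A20_1*B21_0*Y + 6*A21_0*B10_0*s - 2*A21_0*B10_1*Y*a10
        - 2*A21_0*B10_1*Y*a11*s + 6*A21_0*B11_0*s^2 - 2*A21_0*B11_1*Y*a10*s + 4*A21_0*B12_0*s^3
        + 4*A21_0*B20_1*Y + 4*A21_0*B21_1*Y*s - 2*A21_0*a10*q1 - 2*A21_0*a11*q1*s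
        - 2*A21_0*a12*q1*s^2 + 4*A21_0^2*Y*s + 2*A21_1 + 4*A21_1*B20_0*Y + 4*A21_1*B21_0*Y*s
        + 2*A30_0*B11_1*Y + 2*A30_0*B12_1*Y*s + 2*A30_1*B11_0*Y + 2*A30_1*B12_0*Y*s
        - 2*B10_0*B10_1*a10 - 2*B10_0*B10_1*a11*s - 2*B10_0*B11_1*a10*s - 4*B10_0*B11_1*n*t
        - 4*B10_0*B12_1*n*s*t + 4*B10_0*B20_1 - 4*B10_0*B21_0*Y*n + 4*B10_0*B21_1*s
        + 6*B10_0*B30_0*Y - 2*B10_1*B11_0*a10*s - 2*B10_1*B11_0*a11*s^2 - 4*B10_1*B11_0*n*t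
        - 2*B10_1*B12_0*a10*s^2 - 2*B10_1*B12_0*a11*s^3 - 4*B10_1*B12_0*n*s*t + 4*B10_1*B20_0
        + 4*B10_1*B21_0*s - 2*B11_0*B11_1*a10*s^2 - 4*B11_0*B11_1*n*s*t - 4*B11_0*B12_1*n*s^2*t
        - 8*B11_0*B20_0*Y*n - 8*B11_0*B20_0*Y*n*t + 4*B11_0*B20_1*s - 4*B11_0*B21_0*Y*n*s
        + 4*B11_0*B21_1*s^2 + 6*B11_0*B30_0*Y*s - 2*B11_0*Y*a30*q1 - 2*B11_0*n - 4*B11_0*n*t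
        - 2*B11_1*B12_0*a10*s^3 - 4*B11_1*B12_0*n*s^2*t + 4*B11_1*B20_0*s + 4*B11_1*B21_0*s^2
        - 4*B12_0*B12_1*n*s^3*t - 4*B12_0*B20_0*Y*n*s - 8*B12_0*B20_0*Y*n*s*t + 4*B12_0*B20_1*s^2
        + 4*B12_0*B21_1*s^3 - 2*B12_0*Y*a30*q1*s - 4*B12_0*n*s*t + 4*B12_1*B20_0*s^2
        + 4*B12_1*B21_0*s^3 + 12*B20_0 + 16*B20_0*B21_0*Y*s - 4*B20_0*Y*a21*q1 + 16*B20_0^2*Y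
        - 4*B21_0*Y*a20*q1 - 4*B21_0*Y*a21*q1*s + 4*B21_0*s - 6*B30_0*Y*a11*q1 - 6*B30_0*Y*a12*q1*s
        - 2*a21*q1)*h31 + (6*A10_0*A21_0 - 2*A10_0*B10_1*a11 - 2*A10_0*B11_1*a10 + 4*A10_0*B21_1
        - 2*A10_1*B10_0*a11 - 2*A10_1*B11_0*a10 + 4*A10_1*B21_0 + 6*A11_0*A20_0 - 2*A11_0*B10_1*a10
        + 4*A11_0*B20_1 - 2*A11_1*B10_0*a10 + 4*A11_1*B20_0 + 2*A20_0*B11_1 + 2*A20_1*B11_0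
        + 6*A21_0 + 2*A21_0*B10_1 + 2*A21_1*B10_0 - 4*B10_0*B11_0*n + 12*B10_0*B20_0
        - 2*B10_0*a21*q1 - 2*B10_1*a11 - 2*B11_0*a20*q1 - 2*B11_1*a10 - 4*B20_0*a11*q1
        - 4*B21_0*a10*q1 + 4*B21_1)*k2 + (- 2*A10_0*A10_1*a20 - 2*A10_0*A20_1*a10 + 2*A10_0*A30_1
        - 4*A10_0*B20_0*n - 16*A10_0*B20_0*n*t - 8*A10_0*B21_0*n*s*t - 12*A10_0*B30_0*X*n*t
        + 6*A10_0*B30_0*s - 2*A10_0*a30*q1 - 2*A10_1*A11_0*a20*s - 2*A10_1*A12_0*a20*s^2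
        - 2*A10_1*A20_0*X*a20 - 2*A10_1*A20_0*a10 - 2*A10_1*A20_0*a11*s - 2*A10_1*A21_0*X*a20*s
        - 2*A10_1*A21_0*a10*s - 2*A10_1*A21_0*a11*s^2 + 2*A10_1*A30_0 - 2*A10_1*A30_0*X*a10
        - 2*A10_1*A30_0*X*a11*s - 2*A10_1*A30_0*X^2*a20 - 4*A10_1*B20_0*Y*a20
        - 4*A10_1*B21_0*Y*a20*s - 6*A10_1*B30_0*X*Y*a20 - 6*A10_1*B30_0*Y*a10
        - 6*A10_1*B30_0*Y*a11*s - 2*A10_1*a20 - 2*A11_0*A20_1*a10*s + 2*A11_0*A30_1*s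
        - 4*A11_0*B20_0*n*s - 16*A11_0*B20_0*n*s*t - 8*A11_0*B21_0*n*s^2*t - 12*A11_0*B30_0*X*n*s*t
        + 6*A11_0*B30_0*s^2 - 2*A11_0*a30*q1*s - 2*A11_1*A20_0*a10*s - 2*A11_1*A21_0*a10*s^2
        - 2*A11_1*A30_0*X*a10*s + 2*A11_1*A30_0*s - 6*A11_1*B30_0*Y*a10*s - 2*A12_0*A20_1*a10*s^2
        + 2*A12_0*A30_1*s^2 - 4*A12_0*B20_0*n*s^2 - 16*A12_0*B20_0*n*s^2*t - 8*A12_0*B21_0*n*s^3*t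
        - 12*A12_0*B30_0*X*n*s^2*t + 6*A12_0*B30_0*s^3 - 2*A12_0*a30*q1*s^2 + 2*A12_1*A30_0*s^2
        + 2*A20_0*A20_1 - 2*A20_0*A20_1*X*a10 + 2*A20_0*A21_1*s + 10*A20_0*A30_0*Y + 2*A20_0*A30_1*X
        - 2*A20_0*B10_0*n - 8*A20_0*B10_0*n*t - 2*A20_0*B10_1*Y*a20 - 2*A20_0*B11_0*n*s
        - 8*A20_0*B11_0*n*s*t - 8*A20_0*B12_0*n*s^2*t - 4*A20_0*B20_0*X*n - 24*A20_0*B20_0*X*n*t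
        + 16*A20_0*B20_0*s - 4*A20_0*B20_1*Y*a10 - 16*A20_0*B21_0*X*n*s*t + 8*A20_0*B21_0*s^2
        + 12*A20_0*B30_0*X*s - 24*A20_0*B30_0*X^2*n*t + 6*A20_0*B30_1*Y - 2*A20_0*X*a30*q1
        - 2*A20_0*a20*q1 - 2*A20_0*a21*q1*s - 2*A20_1*A21_0*X*a10*s + 2*A20_1*A21_0*s
        + 2*A20_1*A30_0*X - 2*A20_1*A30_0*X^2*a10 - 4*A20_1*B20_0*Y*a10 - 4*A20_1*B21_0*Y*a10*s
        - 6*A20_1*B30_0*X*Y*a10 + 6*A20_1*B30_0*Y - 2*A20_1*a10 + 2*A21_0*A21_1*s^2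
        + 10*A21_0*A30_0*Y*s + 2*A21_0*A30_1*X*s - 2*A21_0*B10_0*n*s - 8*A21_0*B10_0*n*s*t
        - 2*A21_0*B10_1*Y*a20*s - 2*A21_0*B11_0*n*s^2 - 8*A21_0*B11_0*n*s^2*t
        - 8*A21_0*B12_0*n*s^3*t - 4*A21_0*B20_0*X*n*s - 24*A21_0*B20_0*X*n*s*t + 16*A21_0*B20_0*s^2
        - 4*A21_0*B20_1*Y*a10*s - 16*A21_0*B21_0*X*n*s^2*t + 8*A21_0*B21_0*s^3
        + 12*A21_0*B30_0*X*s^2 - 24*A21_0*B30_0*X^2*n*s*t + 6*A21_0*B30_1*Y*s - 2*A21_0*X*a30*q1*s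
        - 2*A21_0*a20*q1*s - 2*A21_0*a21*q1*s^2 + 2*A21_1*A30_0*X*s + 6*A21_1*B30_0*Y*s
        + 2*A30_0*A30_1*X^2 - 2*A30_0*B10_0*X*n - 12*A30_0*B10_0*X*n*t + 8*A30_0*B10_0*s
        - 2*A30_0*B10_1*X*Y*a20 - 2*A30_0*B10_1*Y*a10 - 2*A30_0*B10_1*Y*a11*s - 2*A30_0*B11_0*X*n*s
        - 12*A30_0*B11_0*X*n*s*t + 8*A30_0*B11_0*s^2 - 2*A30_0*B11_1*Y*a10*s
        - 12*A30_0*B12_0*X*n*s^2*t + 6*A30_0*B12_0*s^3 + 20*A30_0*B20_0*X*s - 4*A30_0*B20_0*X^2*n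
        - 32*A30_0*B20_0*X^2*n*t - 4*A30_0*B20_1*X*Y*a10 + 4*A30_0*B20_1*Y + 12*A30_0*B21_0*X*s^2
        - 24*A30_0*B21_0*X^2*n*s*t + 4*A30_0*B21_1*Y*s + 18*A30_0*B30_0*X^2*s
        - 36*A30_0*B30_0*X^3*n*t + 6*A30_0*B30_1*X*Y - 2*A30_0*X*a20*q1 - 2*A30_0*X*a21*q1*s
        - 2*A30_0*X^2*a30*q1 - 2*A30_0*a10*q1 - 2*A30_0*a11*q1*s - 2*A30_0*a12*q1*s^2
        + 6*A30_0^2*X*Y + 2*A30_1 + 4*A30_1*B20_0*Y + 4*A30_1*B21_0*Y*s + 6*A30_1*B30_0*X*Y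
        + 4*B10_0*B10_1*X*a20*n*t + 4*B10_0*B10_1*a10*n*t + 4*B10_0*B10_1*a11*n*s*t
        - 2*B10_0*B10_1*a20*s + 4*B10_0*B11_1*a10*n*s*t + 8*B10_0*B20_1*X*a10*n*t
        - 4*B10_0*B20_1*a10*s - 8*B10_0*B20_1*n*t - 8*B10_0*B21_1*n*s*t - 6*B10_0*B30_0*Y*n
        - 12*B10_0*B30_1*X*n*t + 6*B10_0*B30_1*s + 4*B10_1*B11_0*X*a20*n*s*t
        + 4*B10_1*B11_0*a10*n*s*t + 4*B10_1*B11_0*a11*n*s^2*t - 2*B10_1*B11_0*a20*s^2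
        + 4*B10_1*B12_0*X*a20*n*s^2*t + 4*B10_1*B12_0*a10*n*s^2*t + 4*B10_1*B12_0*a11*n*s^3*t
        - 2*B10_1*B12_0*a20*s^3 + 8*B10_1*B20_0*X*a10*n*t + 8*B10_1*B20_0*X*a11*n*s*t
        - 4*B10_1*B20_0*X*a20*s + 8*B10_1*B20_0*X^2*a20*n*t - 4*B10_1*B20_0*a10*s
        - 4*B10_1*B20_0*a11*s^2 - 8*B10_1*B20_0*n*t + 8*B10_1*B21_0*X*a10*n*s*t
        + 8*B10_1*B21_0*X*a11*n*s^2*t - 4*B10_1*B21_0*X*a20*s^2 + 8*B10_1*B21_0*X^2*a20*n*s*t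
        - 4*B10_1*B21_0*a10*s^2 - 4*B10_1*B21_0*a11*s^3 - 8*B10_1*B21_0*n*s*t
        - 6*B10_1*B30_0*X*a10*s - 6*B10_1*B30_0*X*a11*s^2 - 12*B10_1*B30_0*X*n*t
        + 12*B10_1*B30_0*X^2*a10*n*t + 12*B10_1*B30_0*X^2*a11*n*s*t - 6*B10_1*B30_0*X^2*a20*s
        + 12*B10_1*B30_0*X^3*a20*n*t + 6*B10_1*B30_0*s + 4*B11_0*B11_1*a10*n*s^2*t
        + 8*B11_0*B20_1*X*a10*n*s*t - 4*B11_0*B20_1*a10*s^2 - 8*B11_0*B20_1*n*s*t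
        - 8*B11_0*B21_1*n*s^2*t - 6*B11_0*B30_0*Y*n*s - 12*B11_0*B30_1*X*n*s*t + 6*B11_0*B30_1*s^2
        + 4*B11_1*B12_0*a10*n*s^3*t + 8*B11_1*B20_0*X*a10*n*s*t - 4*B11_1*B20_0*a10*s^2
        - 8*B11_1*B20_0*n*s*t + 8*B11_1*B21_0*X*a10*n*s^2*t - 4*B11_1*B21_0*a10*s^3
        - 8*B11_1*B21_0*n*s^2*t - 6*B11_1*B30_0*X*a10*s^2 - 12*B11_1*B30_0*X*n*s*t
        + 12*B11_1*B30_0*X^2*a10*n*s*t + 6*B11_1*B30_0*s^2 + 8*B12_0*B20_1*X*a10*n*s^2*t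
        - 4*B12_0*B20_1*a10*s^3 - 8*B12_0*B20_1*n*s^2*t - 8*B12_0*B21_1*n*s^3*t
        - 12*B12_0*B30_1*X*n*s^2*t + 6*B12_0*B30_1*s^3 - 8*B12_1*B20_0*n*s^2*t
        - 8*B12_1*B21_0*n*s^3*t - 12*B12_1*B30_0*X*n*s^2*t + 6*B12_1*B30_0*s^3
        - 8*B20_0*B20_1*X*a10*s - 16*B20_0*B20_1*X*n*t + 16*B20_0*B20_1*X^2*a10*n*t
        + 8*B20_0*B20_1*s - 8*B20_0*B21_0*Y*n*s - 16*B20_0*B21_0*Y*n*s*t - 16*B20_0*B21_1*X*n*s*t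
        + 8*B20_0*B21_1*s^2 - 12*B20_0*B30_0*X*Y*n - 24*B20_0*B30_0*X*Y*n*t + 24*B20_0*B30_0*Y*s
        + 12*B20_0*B30_1*X*s - 24*B20_0*B30_1*X^2*n*t - 4*B20_0*Y*a30*q1 - 4*B20_0*n - 16*B20_0*n*t
        - 8*B20_0^2*Y*n - 16*B20_0^2*Y*n*t - 8*B20_1*B21_0*X*a10*s^2 - 16*B20_1*B21_0*X*n*s*t
        + 16*B20_1*B21_0*X^2*a10*n*s*t + 8*B20_1*B21_0*s^2 + 12*B20_1*B30_0*X*s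
        - 12*B20_1*B30_0*X^2*a10*s - 24*B20_1*B30_0*X^2*n*t + 24*B20_1*B30_0*X^3*a10*n*t
        - 16*B21_0*B21_1*X*n*s^2*t + 8*B21_0*B21_1*s^3 + 12*B21_0*B30_1*X*s^2
        - 24*B21_0*B30_1*X^2*n*s*t - 4*B21_0*Y*a30*q1*s - 8*B21_0*n*s*t + 12*B21_1*B30_0*X*s^2
        - 24*B21_1*B30_0*X^2*n*s*t + 18*B30_0*B30_1*X^2*s - 36*B30_0*B30_1*X^3*n*t
        - 6*B30_0*X*Y*a30*q1 - 12*B30_0*X*n*t - 6*B30_0*Y*a20*q1 - 6*B30_0*Y*a21*q1*s + 6*B30_0*s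
        - 2*a30*q1)*h4 + (8*A10_0*A30_0 - 2*A10_0*B10_1*a20 - 4*A10_0*B20_1*a10 + 6*A10_0*B30_1
        - 2*A10_1*B10_0*a20 - 4*A10_1*B20_0*a10 + 6*A10_1*B30_0 - 2*A20_0*B10_1*a10 + 4*A20_0*B20_1
        + 4*A20_0^2 - 2*A20_1*B10_0*a10 + 4*A20_1*B20_0 + 8*A30_0 + 2*A30_0*B10_1 + 2*A30_1*B10_0
        - 8*B10_0*B20_0*n - 8*B10_0*B20_0*n*t - 2*B10_0*a30*q1 - 2*B10_1*a20 - 4*B20_0*a20*q1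
        - 4*B20_1*a10 - 6*B30_0*a10*q1 + 6*B30_1)*k3 + (4*A11_0*A12_0*Y + 2*A11_0*B12_1*Y
        + 2*A11_1*B12_0*Y + 2*A12_0*B11_1*Y + 2*A12_0*B12_1*Y*s + 2*A12_0^2*Y*s + 2*A12_1*B11_0*Y
        + 2*A12_1*B12_0*Y*s + 2*B10_0*B12_0*Y + 2*B11_0*B12_0*Y*s - 2*B11_0*Y*a12*q1 + 2*B11_0^2*Y
        - 2*B12_0*Y*a11*q1 - 2*B12_0*Y*a12*q1*s)*h13
  rw [hzz, hn]
  -- The coefficient of 1 is the equation of Q', that of `s^l X^k` the first equation of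
  -- `(Ω_{k,l})`, and that of `s^l X^{k-1} Y` is k times the second one, because `(X^k)' = k X^{k-1}
  -- Y`. The other terms replace `n` by `m - (m-1)s` modulo weight 8 and use `m = 1/(1-λ)` and `t =
  -- 1/3`.
  linear_combination Q3 + X*F10 + Y*G10 + X*s*F11 + Y*s*G11 + X*s^2*F12 + Y*s^2*G12 + X^2*F20
      + X*Y*G20 + X^2*s*F21 + X*Y*s*G21 + X^3*F30 + X^2*Y*G30 + (2*A10_0*X*Y + 2*A10_0*X*Y*lam*s
      - 2*A10_0*X*Y*s + 2*A10_1*X^2 + 2*A10_1*X^2*lam*s - 2*A10_1*X^2*s - 4*A10_1*X^3*a10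
      - 6*A10_1*X^3*a10*t + 2*A11_0*X*Y*s + 2*A11_1*X^2*s + 10*A20_0*X^2*Y + 4*A20_1*X^3
      + 8*A20_1*X^3*t + 4*B10_0*X^2*s - 2*B10_0*X^3*m - 4*B10_0*X^3*m*t + 4*B10_1*X*Y
      + 4*B10_1*X*Y*lam*s - 4*B10_1*X*Y*s - 10*B10_1*X^2*Y*a10 + B10_2*X^2 + B10_2*X^2*lam*s
      - B10_2*X^2*s - 4*B10_2*X^3*a10 - 4*B10_2*X^3*a10*t + 4*B11_1*X*Y*s + B11_2*X^2*s
      + 20*B20_1*X^2*Y + 2*B20_2*X^3 + 4*B20_2*X^3*t + 2*X*Y + 2*X*Y*lam*s - 2*X*Y*s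
      - X^2*a10*lam*q1*s - X^2*a10*q1 + X^2*a10*q1*s - X^2*a11*q1*s - 2*X^3*a20*q1
      - 4*X^3*a20*q1*t)*hm + (2*A10_0*B10_0*X^3*m + 2*A10_1*X^3*a10 + 2*A20_1*X^3 + 2*A20_1*X^3*m
      - 4*B10_2*X^3*a10 - 2*B10_2*X^3*a10*m + 4*B20_0*X^3*m*q0 + 2*B20_2*X^3 + 4*B20_2*X^3*m)*ht
      + (- 2*A10_1*lam + 2*A10_1*lam*m + 2*A10_1*lam^2 - 2*A10_1*lam^2*m - 3*A11_1 + 2*A11_1*lam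
      - 2*A11_1*lam*m + 3*A11_1*m - 4*B10_0 + 4*B10_0*lam - 4*B10_0*lam*m + 4*B10_0*m - B10_2*lam
      + B10_2*lam*m + B10_2*lam^2 - B10_2*lam^2*m + 2*B11_0*m*q0 - 2*B11_0*q0 - 3*B11_2 + B11_2*lam
      - B11_2*lam*m + 3*B11_2*m - a10*lam*m*q1 + a10*lam*q1 + a10*lam^2*m*q1 - a10*lam^2*q1
      + a11*lam*m*q1 - a11*lam*q1 - a11*m*q1 + a11*q1)*h22 + (- 2*A10_0*B10_0 + 2*A10_0*B10_0*m
      + 4*A10_0*B10_0*m*t - 4*A10_0*B10_0*t + 4*A10_1*a10 - 4*A10_1*a10*lam + 4*A10_1*a10*lam*m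
      + 6*A10_1*a10*lam*m*t - 6*A10_1*a10*lam*t - 4*A10_1*a10*m - 6*A10_1*a10*m*t + 6*A10_1*a10*t
      - 6*A20_1 + 4*A20_1*lam - 4*A20_1*lam*m - 8*A20_1*lam*m*t + 8*A20_1*lam*t + 6*A20_1*m
      + 12*A20_1*m*t - 12*A20_1*t - 2*B10_0 + 4*B10_0*B10_1*m*t - 4*B10_0*B10_1*t - 4*B10_0*lam*m
      + 4*B10_0*lam*m*s + 8*B10_0*lam*m*s*t - 8*B10_0*lam*m*t + 4*B10_0*lam*m^2 - 2*B10_0*lam*m^2*s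
      - 4*B10_0*lam*m^2*s*t + 8*B10_0*lam*m^2*t - 2*B10_0*lam*s - 4*B10_0*lam*s*t + 6*B10_0*m
      - 4*B10_0*m*s - 8*B10_0*m*s*t + 12*B10_0*m*t - 4*B10_0*m^2 + 2*B10_0*m^2*s + 4*B10_0*m^2*s*t
      - 8*B10_0*m^2*t + 2*B10_0*s + 4*B10_0*s*t - 4*B10_0*t + 6*B10_2*a10 - 4*B10_2*a10*lam
      + 4*B10_2*a10*lam*m + 4*B10_2*a10*lam*m*t - 4*B10_2*a10*lam*t - 6*B10_2*a10*m
      - 6*B10_2*a10*m*t + 6*B10_2*a10*t + 4*B20_0*m*q0 + 8*B20_0*m*q0*t - 4*B20_0*q0 - 8*B20_0*q0*t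
      - 6*B20_2 + 2*B20_2*lam - 2*B20_2*lam*m - 4*B20_2*lam*m*t + 4*B20_2*lam*t + 6*B20_2*m
      + 12*B20_2*m*t - 12*B20_2*t + 2*a20*lam*m*q1 + 4*a20*lam*m*q1*t - 2*a20*lam*q1
      - 4*a20*lam*q1*t - 2*a20*m*q1 - 4*a20*m*q1*t + 2*a20*q1 + 4*a20*q1*t)*h31 + (- 2*A10_0*lam
      + 2*A10_0*lam*m + 2*A10_0*lam^2 - 2*A10_0*lam^2*m - 2*A11_0 + 2*A11_0*lam - 2*A11_0*lam*m
      + 2*A11_0*m - 4*B10_1*lam + 4*B10_1*lam*m + 4*B10_1*lam^2 - 4*B10_1*lam^2*m - 6*B11_1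
      + 4*B11_1*lam - 4*B11_1*lam*m + 6*B11_1*m - 2*lam + 2*lam*m + 2*lam^2 - 2*lam^2*m)*k1
      + (- 10*A20_0 + 10*A20_0*lam - 10*A20_0*lam*m + 10*A20_0*m - 2*B10_0^2 + 2*B10_0^2*m
      + 10*B10_1*a10 - 10*B10_1*a10*lam + 10*B10_1*a10*lam*m - 10*B10_1*a10*m - 30*B20_1
      + 20*B20_1*lam - 20*B20_1*lam*m + 30*B20_1*m)*k2


/-! ### The soliton and `φ = tanh(x/2)` -/

theorem Q_pos (x : ℝ) : 0 < Q x := by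
  unfold Q
  have := Real.cosh_pos (x / 2)
  positivity

theorem hasDerivAt_Q_tanh (x : ℝ) : HasDerivAt Q (-(Q x * Real.tanh (x / 2))) x := by
  have h1 : HasDerivAt (fun x : ℝ => x / 2) (1 / 2) x := (hasDerivAt_id x).div_const 2
  have h2 := h1.cosh
  have hc := (Real.cosh_pos (x / 2)).ne'
  have h3 := (((hasDerivAt_const x (1 : ℝ)).div h2 hc).pow 2).const_mul (3 / 2 : ℝ)
  refine HasDerivAt.congr_deriv (f := Q) h3 ?_
  rw [show Q x = 3 / 2 * (1 / Real.cosh (x / 2)) ^ 2 from rfl, Real.tanh_eq_sinh_div_cosh]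
  simp only [Pi.div_apply, Nat.cast_ofNat, Nat.add_one_sub_one, pow_one]
  field_simp
  ring

theorem phi_eq (x : ℝ) : phi x = Real.tanh (x / 2) := by
  rw [phi, (hasDerivAt_Q_tanh x).deriv]
  field_simp [(Q_pos x).ne']

theorem hasDerivAt_Q (x : ℝ) : HasDerivAt Q (-(Q x * phi x)) x := by
  rw [phi_eq]; exact hasDerivAt_Q_tanh x

theorem deriv_Q : deriv Q = fun x => -(Q x * phi x) := funext fun x => (hasDerivAt_Q x).deriv

theorem Q_eq_phi (x : ℝ) : Q x = 3 / 2 * (1 - phi x ^ 2) := by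
  rw [phi_eq, Q, Real.tanh_eq_sinh_div_cosh, div_pow, div_pow]
  have hc := (Real.cosh_pos (x / 2)).ne'
  have := Real.cosh_sq (x / 2)
  field_simp
  linarith

theorem phi_sq (x : ℝ) : phi x ^ 2 = 1 - 2 / 3 * Q x := by
  rw [Q_eq_phi]; ring

theorem hasDerivAt_phi (x : ℝ) : HasDerivAt phi (Q x / 3) x := by
  have h1 : HasDerivAt (fun x : ℝ => x / 2) (1 / 2) x := (hasDerivAt_id x).div_const 2
  have hc := (Real.cosh_pos (x / 2)).ne'
  have h3 := h1.sinh.div h1.cosh hc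
  have : phi = fun x => Real.sinh (x / 2) / Real.cosh (x / 2) := by
    funext y; rw [phi_eq, Real.tanh_eq_sinh_div_cosh]
  rw [this]
  refine h3.congr_deriv ?_
  rw [show Q x = 3 / 2 * (1 / Real.cosh (x / 2)) ^ 2 from rfl]
  have := Real.cosh_sq (x / 2)
  field_simp
  linarith

theorem contDiff_Q {n : WithTop ℕ∞} : ContDiff ℝ n Q := by
  unfold Q
  have : ContDiff ℝ n fun x : ℝ => Real.cosh (x / 2) := by fun_prop
  exact contDiff_const.mul ((contDiff_const.div this fun x => (Real.cosh_pos _).ne').pow 2)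

theorem contDiff_phi {n : WithTop ℕ∞} : ContDiff ℝ n phi := by
  have : phi = fun x => Real.sinh (x / 2) / Real.cosh (x / 2) := by
    funext y; rw [phi_eq, Real.tanh_eq_sinh_div_cosh]
  rw [this]
  have h1 : ContDiff ℝ n fun x : ℝ => Real.cosh (x / 2) := by fun_prop
  have h2 : ContDiff ℝ n fun x : ℝ => Real.sinh (x / 2) := by fun_prop
  exact h2.div h1 fun x => (Real.cosh_pos _).ne'

theorem Q_even (x : ℝ) : Q (-x) = Q x := by
  rw [Q, Q, neg_div, Real.cosh_neg]

theorem phi_odd (x : ℝ) : phi (-x) = -phi x := by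
  rw [phi_eq, phi_eq, neg_div, Real.tanh_neg]

theorem abs_phi_le (x : ℝ) : |phi x| ≤ 1 := by
  rw [phi_eq]; exact (Real.abs_tanh_lt_one _).le

theorem Q_le_exp (x : ℝ) : Q x ≤ 6 * Real.exp (-|x|) := by
  have h : Real.exp (|x| / 2) / 2 ≤ Real.cosh (x / 2) := by
    rw [← Real.cosh_abs, abs_div, abs_two, Real.cosh_eq]
    have := Real.exp_pos (-(|x| / 2))
    linarith
  have h0 := Real.exp_pos (|x| / 2)
  have h1 : (Real.exp (|x| / 2) / 2) ^ 2 ≤ Real.cosh (x / 2) ^ 2 := by gcongr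
  have h2 : Real.exp (-|x|) * (Real.exp (|x| / 2)) ^ 2 = 1 := by
    rw [← Real.exp_nat_mul, ← Real.exp_add]
    simp; ring
  have hc := Real.cosh_pos (x / 2)
  rw [Q, div_pow, one_pow, mul_one_div, div_le_iff₀ (by positivity)]
  nlinarith [Real.exp_pos (-|x|)]

theorem Q_le (x : ℝ) : Q x ≤ 3 / 2 := by
  rw [Q_eq_phi]; nlinarith [sq_nonneg (phi x)]

/-- For x ≥ 0 one has 0 ≤ φ ≤ 1, hence `1 - φ ≤ 1 - φ² = 2Q/3`. -/
theorem one_sub_phi_le (x : ℝ) (hx : 0 ≤ x) : |phi x - 1| ≤ 4 * Real.exp (-x) := by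
  have h1 := phi_sq x
  have h2 := Q_le_exp x
  rw [abs_of_nonneg hx] at h2
  have h3 := abs_le.1 (abs_phi_le x)
  have h4 : 0 ≤ phi x := by
    rw [phi_eq, Real.tanh_eq_sinh_div_cosh]
    exact div_nonneg (Real.sinh_nonneg_iff.2 (by linarith)) (Real.cosh_pos _).le
  rw [abs_sub_comm, abs_of_nonneg (by linarith)]
  nlinarith [Q_pos x]

/-! ### Functions with derivatives bounded by `poly(|x|) e^{-c|x|}` -/

/-- `f` is bounded by `K (1 + |x|)^n e^{-c|x|}`. -/
def Bnd (c : ℝ) (f : ℝ → ℝ) : Prop :=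
  ∃ (K : ℝ) (n : ℕ), 0 ≤ K ∧ ∀ x, |f x| ≤ K * (1 + |x|) ^ n * Real.exp (-(c * |x|))

/-- `f` is smooth and all its derivatives are bounded by some `K (1 + |x|)^n e^{-c|x|}`. -/
def Gr (c : ℝ) (f : ℝ → ℝ) : Prop :=
  ContDiff ℝ ∞ f ∧ ∀ j : ℕ, Bnd c (iteratedDeriv j f)

theorem Bnd.add {c : ℝ} {f g : ℝ → ℝ} (hf : Bnd c f) (hg : Bnd c g) :
    Bnd c fun x => f x + g x := by
  obtain ⟨K, n, hK, h1⟩ := hf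
  obtain ⟨M, m, hM, h2⟩ := hg
  refine ⟨K + M, n + m, by positivity, fun x => ?_⟩
  have hx : 1 ≤ 1 + |x| := by linarith [abs_nonneg x]
  have e1 : (1 + |x|) ^ n ≤ (1 + |x|) ^ (n + m) := pow_le_pow_right₀ hx (by omega)
  have e2 : (1 + |x|) ^ m ≤ (1 + |x|) ^ (n + m) := pow_le_pow_right₀ hx (by omega)
  calc |f x + g x| ≤ |f x| + |g x| := abs_add_le _ _
    _ ≤ K * (1 + |x|) ^ n * Real.exp (-(c * |x|)) + M * (1 + |x|) ^ m * Real.exp (-(c * |x|)) :=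
        add_le_add (h1 x) (h2 x)
    _ ≤ K * (1 + |x|) ^ (n + m) * Real.exp (-(c * |x|)) +
        M * (1 + |x|) ^ (n + m) * Real.exp (-(c * |x|)) := by gcongr
    _ = _ := by ring

theorem Bnd.mul {c d : ℝ} {f g : ℝ → ℝ} (hf : Bnd c f) (hg : Bnd d g) :
    Bnd (c + d) fun x => f x * g x := by
  obtain ⟨K, n, hK, h1⟩ := hf
  obtain ⟨M, m, hM, h2⟩ := hg
  refine ⟨K * M, n + m, by positivity, fun x => ?_⟩
  have hx : 1 ≤ 1 + |x| := by linarith [abs_nonneg x]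
  calc |f x * g x| = |f x| * |g x| := abs_mul _ _
    _ ≤ (K * (1 + |x|) ^ n * Real.exp (-(c * |x|))) *
        (M * (1 + |x|) ^ m * Real.exp (-(d * |x|))) := by
          gcongr
          · exact h1 x
          · exact h2 x
    _ = K * M * (1 + |x|) ^ (n + m) *
        (Real.exp (-(c * |x|)) * Real.exp (-(d * |x|))) := by rw [pow_add]; ring
    _ = _ := by rw [← Real.exp_add]; congr 2; ring

theorem Bnd.mono {c d : ℝ} {f : ℝ → ℝ} (hf : Bnd c f) (h : d ≤ c) : Bnd d f := by
  obtain ⟨K, n, hK, h1⟩ := hf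
  refine ⟨K, n, hK, fun x => (h1 x).trans ?_⟩
  gcongr

theorem Gr.mono {c d : ℝ} {f : ℝ → ℝ} (hf : Gr c f) (h : d ≤ c) : Gr d f :=
  ⟨hf.1, fun j => (hf.2 j).mono h⟩

theorem Gr.bnd {c : ℝ} {f : ℝ → ℝ} (hf : Gr c f) : Bnd c f := by
  simpa using hf.2 0

theorem contDiff_deriv {f : ℝ → ℝ} (hf : ContDiff ℝ ∞ f) : ContDiff ℝ ∞ (deriv f) :=
  (contDiff_infty_iff_deriv.1 hf).2

theorem Gr.derivative {c : ℝ} {f : ℝ → ℝ} (hf : Gr c f) : Gr c (deriv f) :=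
  ⟨contDiff_deriv hf.1, fun j => by simpa [← iteratedDeriv_succ'] using hf.2 (j + 1)⟩

theorem Gr.of_deriv {c : ℝ} {f : ℝ → ℝ} (h0 : ContDiff ℝ ∞ f) (h1 : Bnd c f)
    (h2 : Gr c (deriv f)) : Gr c f := by
  refine ⟨h0, fun j => ?_⟩
  cases j with
  | zero => simpa using h1
  | succ j => rw [iteratedDeriv_succ']; exact h2.2 j

theorem Gr.congr {c : ℝ} {f g : ℝ → ℝ} (hf : Gr c f) (h : ∀ x, f x = g x) : Gr c g :=
  (funext h : f = g) ▸ hf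

theorem Gr.add {c : ℝ} {f g : ℝ → ℝ} (hf : Gr c f) (hg : Gr c g) :
    Gr c fun x => f x + g x := by
  refine ⟨hf.1.add hg.1, fun j => ?_⟩
  have : iteratedDeriv j (fun x => f x + g x) =
      fun x => iteratedDeriv j f x + iteratedDeriv j g x := by
    funext x
    exact iteratedDeriv_fun_add (hf.1.of_le (by exact_mod_cast le_top)).contDiffAt
      (hg.1.of_le (by exact_mod_cast le_top)).contDiffAt
  rw [this]
  exact (hf.2 j).add (hg.2 j)

theorem contDiff_hasDerivAt {f : ℝ → ℝ} (hf : ContDiff ℝ ∞ f) (x : ℝ) :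
    HasDerivAt f (deriv f x) x :=
  (hf.differentiable (by simp) x).hasDerivAt

/-- Rates add by the Leibniz rule. The rate may be zero or negative: `Gr 0` consists of functions of
polynomial growth, by which one multiplies without loss, and `Gr (-1)` contains the exponentially
growing solution of `L v = 0`. -/
theorem Gr.mul {c d : ℝ} {f g : ℝ → ℝ} (hf : Gr c f) (hg : Gr d g) :
    Gr (c + d) fun x => f x * g x := by
  refine ⟨hf.1.mul hg.1, fun j => ?_⟩
  induction j generalizing f g with
  | zero => simpa using hf.bnd.mul hg.bnd
  | succ j ih =>
    have : deriv (fun x => f x * g x) =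
        fun x => deriv f x * g x + f x * deriv g x := by
      funext x
      exact ((contDiff_hasDerivAt hf.1 x).mul (contDiff_hasDerivAt hg.1 x)).deriv
    rw [iteratedDeriv_succ', this]
    have e : iteratedDeriv j (fun x => deriv f x * g x + f x * deriv g x) =
        fun x => iteratedDeriv j (fun x => deriv f x * g x) x +
          iteratedDeriv j (fun x => f x * deriv g x) x := by
      funext x
      exact iteratedDeriv_fun_add
        ((hf.derivative.1.mul hg.1).of_le (by exact_mod_cast le_top)).contDiffAt
        ((hf.1.mul hg.derivative.1).of_le (by exact_mod_cast le_top)).contDiffAt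
    rw [e]
    exact (ih hf.derivative hg).add (ih hf hg.derivative)

theorem Gr.const (a : ℝ) : Gr 0 fun _ => a := by
  refine ⟨contDiff_const, fun j => ?_⟩
  refine ⟨|a|, 0, abs_nonneg a, fun x => ?_⟩
  rw [iteratedDeriv_const]
  split_ifs <;> simp

theorem Gr.zero (c : ℝ) : Gr c fun _ => (0 : ℝ) := by
  refine ⟨contDiff_const, fun j => ⟨0, 0, le_rfl, fun x => ?_⟩⟩
  rw [iteratedDeriv_const]
  split_ifs <;> simp

theorem Gr.const_mul {c : ℝ} {f : ℝ → ℝ} (a : ℝ) (hf : Gr c f) : Gr c fun x => a * f x := by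
  simpa using (Gr.const a).mul hf

theorem Gr.neg {c : ℝ} {f : ℝ → ℝ} (hf : Gr c f) : Gr c fun x => -f x := by
  simpa using hf.const_mul (-1)

theorem Gr.sub {c : ℝ} {f g : ℝ → ℝ} (hf : Gr c f) (hg : Gr c g) :
    Gr c fun x => f x - g x := by
  simpa [sub_eq_add_neg] using hf.add hg.neg

theorem Gr.mul_zero_left {c : ℝ} {f g : ℝ → ℝ} (hf : Gr 0 f) (hg : Gr c g) :
    Gr c fun x => f x * g x := by
  simpa using hf.mul hg

theorem Gr.mul_zero_right {c : ℝ} {f g : ℝ → ℝ} (hf : Gr c f) (hg : Gr 0 g) :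
    Gr c fun x => f x * g x := by
  simpa using hf.mul hg

theorem Gr.iter {c : ℝ} {f : ℝ → ℝ} (hf : Gr c f) (n : ℕ) :
    Gr c (iteratedDeriv n f) := by
  induction n with
  | zero => simpa using hf
  | succ n ih => rw [iteratedDeriv_succ]; exact ih.derivative

theorem Gr.id : Gr 0 fun x => x := by
  refine Gr.of_deriv contDiff_id ⟨1, 1, by norm_num, fun x => ?_⟩ ?_
  · simp
  · simpa using Gr.const 1

/-- A solution of `f' = g f` with `g` of polynomial growth. -/
theorem Gr.of_deriv_eq_mul {c : ℝ} {f g : ℝ → ℝ} (hf : ContDiff ℝ ∞ f) (hb : Bnd c f)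
    (hg : Gr 0 g) (h : ∀ x, deriv f x = f x * g x) : Gr c f := by
  -- By induction every derivative of `f` has the form `f p` with `p` of polynomial growth, so a
  -- bound of `f` alone suffices.
  have key : ∀ j : ℕ, ∀ p : ℝ → ℝ, Gr 0 p → Bnd c (iteratedDeriv j fun x => f x * p x) := by
    intro j
    induction j with
    | zero => intro p hp; simpa using hb.mul hp.bnd
    | succ j ih =>
      intro p hp
      have : deriv (fun x => f x * p x) = fun x => f x * (g x * p x + deriv p x) := by
        funext x
        refine ((contDiff_hasDerivAt hf x).mul (contDiff_hasDerivAt hp.1 x)).deriv.trans ?_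
        rw [h x]
        ring
      rw [iteratedDeriv_succ', this]
      exact ih _ ((hg.mul_zero_left hp).add hp.derivative)
  refine ⟨hf, fun j => ?_⟩
  simpa using key j (fun _ => 1) (Gr.const 1)

/-- A solution of `f'' = h f + g` which is bounded together with `f'`. -/
theorem Gr.of_ode {c : ℝ} {f g h : ℝ → ℝ} (hf : ContDiff ℝ ∞ f) (hb : Bnd c f)
    (hb' : Bnd c (deriv f)) (hh : Gr 0 h) (hg : Gr c g)
    (e : ∀ x, deriv (deriv f) x = h x * f x + g x) : Gr c f := by
  -- The equation removes second derivatives: every derivative of `f` is `p f + q f'` plus a term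
  -- produced by `g`, with `p`, `q` of polynomial growth. Hence bounds of `f` and `f'` suffice.
  have key : ∀ j : ℕ, ∀ p q : ℝ → ℝ, Gr 0 p → Gr 0 q →
      Bnd c (iteratedDeriv j fun x => p x * f x + q x * deriv f x) := by
    intro j
    induction j with
    | zero =>
      intro p q hp hq
      simpa using (hp.bnd.mul hb).add (hq.bnd.mul hb')
    | succ j ih =>
      intro p q hp hq
      have hf' := contDiff_deriv hf
      have : deriv (fun x => p x * f x + q x * deriv f x) = fun x =>
          ((deriv p x + q x * h x) * f x + (p x + deriv q x) * deriv f x) +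
            q x * g x := by
        funext x
        refine (((contDiff_hasDerivAt hp.1 x).mul (contDiff_hasDerivAt hf x)).add
          ((contDiff_hasDerivAt hq.1 x).mul (contDiff_hasDerivAt hf' x))).deriv.trans ?_
        rw [e x]
        ring
      have hp1 := hp.derivative.add (hq.mul_zero_left hh)
      have hq1 := hp.add hq.derivative
      have hqg := hq.mul_zero_left hg
      rw [iteratedDeriv_succ', this]
      have e2 : iteratedDeriv j (fun x =>
          ((deriv p x + q x * h x) * f x + (p x + deriv q x) * deriv f x) +
            q x * g x) = fun x => iteratedDeriv j (fun x =>
          (deriv p x + q x * h x) * f x + (p x + deriv q x) * deriv f x) x +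
            iteratedDeriv j (fun x => q x * g x) x := by
        funext x
        exact iteratedDeriv_fun_add
          (((hp1.1.mul hf).add (hq1.1.mul hf')).of_le (by exact_mod_cast le_top)).contDiffAt
          (hqg.1.of_le (by exact_mod_cast le_top)).contDiffAt
      rw [e2]
      exact (ih _ _ hp1 hq1).add (hqg.2 j)
  refine ⟨hf, fun j => ?_⟩
  simpa using key j (fun _ => 1) (fun _ => 0) (Gr.const 1) (Gr.const 0)

/-- Since `φ' = (1 - φ²)/2`, every derivative of φ is a polynomial in φ, and φ takes values in [-1,
1]. -/
theorem gr_phi : Gr 0 phi := by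
  have key : ∀ (j : ℕ) (p : Polynomial ℝ), Bnd 0 (iteratedDeriv j fun x => p.eval (phi x)) := by
    intro j
    induction j with
    | zero =>
      intro p
      obtain ⟨K, hK⟩ := (isCompact_Icc (a := (-1 : ℝ)) (b := 1)).exists_bound_of_continuousOn
        p.continuous.continuousOn
      refine ⟨|K|, 0, abs_nonneg K, fun x => ?_⟩
      have := hK (phi x) (abs_le.1 (abs_phi_le x))
      simpa using this.trans (le_abs_self K)
    | succ j ih =>
      intro p
      have : deriv (fun x => p.eval (phi x)) = fun x =>
          (p.derivative * (Polynomial.C (1 / 2) * (1 - Polynomial.X ^ 2))).eval (phi x) := by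
        funext x
        refine ((p.hasDerivAt (phi x)).comp x (hasDerivAt_phi x)).deriv.trans ?_
        rw [Q_eq_phi]
        simp only [Polynomial.eval_mul, Polynomial.eval_C, Polynomial.eval_sub,
          Polynomial.eval_one, Polynomial.eval_pow, Polynomial.eval_X]
        ring
      rw [iteratedDeriv_succ', this]
      exact ih _
  refine ⟨contDiff_phi, fun j => ?_⟩
  simpa using key j Polynomial.X

theorem gr_Q : Gr 1 Q := by
  refine Gr.of_deriv_eq_mul contDiff_Q ⟨6, 0, by norm_num, fun x => ?_⟩ gr_phi.neg fun x => ?_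
  · rw [abs_of_pos (Q_pos x)]; simpa using Q_le_exp x
  · rw [deriv_Q]; ring

/-- A real exponent can be rounded up because `1 + |x| ≥ 1`; conversely `K + 1` and `n + 1` supply
the strict positivity required in `ClassY`. -/
theorem classY_iff {f : ℝ → ℝ} : ClassY f ↔ Gr 1 f := by
  refine and_congr_right fun _ => forall_congr' fun j => ?_
  constructor
  · rintro ⟨K, r, hK, hr, h⟩
    refine ⟨K, ⌈r⌉₊, hK.le, fun x => (h x).trans ?_⟩
    have hx : 1 ≤ 1 + |x| := by linarith [abs_nonneg x]
    rw [one_mul, ← Real.rpow_natCast]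
    gcongr
    exact Nat.le_ceil r
  · rintro ⟨K, n, hK, h⟩
    refine ⟨K + 1, n + 1, by positivity, by positivity, fun x => (h x).trans ?_⟩
    have hx : 1 ≤ 1 + |x| := by linarith [abs_nonneg x]
    rw [one_mul, ← Nat.cast_succ, Real.rpow_natCast]
    gcongr
    · linarith
    · omega


/-! ### Integrals of exponentially decaying functions -/

theorem one_add_pow_le_exp (n : ℕ) {d : ℝ} (hd : 0 < d) :
    ∃ M : ℝ, 0 < M ∧ ∀ x : ℝ, 0 ≤ x → (1 + x) ^ n ≤ M * Real.exp (d * x) := by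
  refine ⟨n.factorial * d⁻¹ ^ n * Real.exp d, by positivity, fun x hx => ?_⟩
  have h := Real.pow_div_factorial_le_exp (x := d * (1 + x)) (by positivity) n
  rw [div_le_iff₀ (by positivity), mul_pow] at h
  have e : Real.exp (d * (1 + x)) = Real.exp d * Real.exp (d * x) := by
    rw [← Real.exp_add]; ring_nf
  have : (1 + x) ^ n = d⁻¹ ^ n * (d ^ n * (1 + x) ^ n) := by
    rw [← mul_assoc, ← mul_pow, inv_mul_cancel₀ hd.ne', one_pow, one_mul]
  rw [this]
  calc d⁻¹ ^ n * (d ^ n * (1 + x) ^ n) ≤ d⁻¹ ^ n * (Real.exp (d * (1 + x)) * n.factorial) := by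
        gcongr
    _ = _ := by rw [e]; ring

theorem Bnd.le_exp {c d : ℝ} {f : ℝ → ℝ} (hf : Bnd c f) (h : d < c) :
    ∃ K : ℝ, 0 ≤ K ∧ ∀ x, |f x| ≤ K * Real.exp (-(d * |x|)) := by
  obtain ⟨K, n, hK, h1⟩ := hf
  obtain ⟨M, hM, h2⟩ := one_add_pow_le_exp n (sub_pos.2 h)
  refine ⟨K * M, by positivity, fun x => (h1 x).trans ?_⟩
  calc K * (1 + |x|) ^ n * Real.exp (-(c * |x|))
      ≤ K * (M * Real.exp ((c - d) * |x|)) * Real.exp (-(c * |x|)) := by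
        gcongr; exact h2 _ (abs_nonneg x)
    _ = K * M * (Real.exp ((c - d) * |x|) * Real.exp (-(c * |x|))) := by ring
    _ = _ := by rw [← Real.exp_add]; congr 2; ring

theorem integrable_exp_neg_abs {d : ℝ} (hd : 0 < d) :
    Integrable fun x : ℝ => Real.exp (-(d * |x|)) := by
  have h1 : IntegrableOn (fun x : ℝ => Real.exp (-(d * |x|))) (Set.Ioi 0) := by
    refine (integrableOn_exp_mul_Ioi (neg_lt_zero.2 hd) 0).congr_fun (fun x hx => ?_)
      measurableSet_Ioi
    simp only
    rw [abs_of_pos hx, neg_mul]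
  have h2 : IntegrableOn (fun x : ℝ => Real.exp (-(d * |x|))) (Set.Iic 0) := by
    refine (integrableOn_exp_mul_Iic hd 0).congr_fun (fun x hx => ?_) measurableSet_Iic
    simp only
    rw [abs_of_nonpos hx]; ring_nf
  rw [← integrableOn_univ, ← Set.Iic_union_Ioi (a := (0 : ℝ))]
  exact h2.union h1

theorem Bnd.integrable {c : ℝ} {f : ℝ → ℝ} (hf : Bnd c f) (hc : 0 < c) (h : Continuous f) :
    Integrable f := by
  obtain ⟨K, hK, h1⟩ := hf.le_exp (half_lt_self hc)
  refine ((integrable_exp_neg_abs (half_pos hc)).const_mul K).mono' h.aestronglyMeasurable ?_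
  exact Filter.Eventually.of_forall h1

theorem Bnd.tendsto {c : ℝ} {f : ℝ → ℝ} (hf : Bnd c f) (hc : 0 < c) :
    Filter.Tendsto f Filter.atTop (nhds 0) := by
  obtain ⟨K, hK, h1⟩ := hf.le_exp (half_lt_self hc)
  have h2 : Filter.Tendsto (fun x : ℝ => K * Real.exp (-(c / 2 * |x|))) Filter.atTop (nhds 0) := by
    have : Filter.Tendsto (fun x : ℝ => c / 2 * |x|) Filter.atTop Filter.atTop :=
      Filter.tendsto_abs_atTop_atTop.const_mul_atTop (half_pos hc)
    simpa using (Real.tendsto_exp_neg_atTop_nhds_zero.comp this).const_mul K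
  exact squeeze_zero_norm h1 h2

/-- For x ≥ y ≥ 0, `(1 + x)^n ≤ (1 + y)^n (1 + (x - y))^n`, and the last factor is absorbed by half
of the exponential in `x - y`. Thus the tail integral keeps the exact rate c, which a cruder
estimate would lose and with it membership in 𝒴. -/
theorem Bnd.tail {c : ℝ} {f : ℝ → ℝ} (hf : Bnd c f) (hc : 0 < c) :
    ∃ (K : ℝ) (n : ℕ), 0 ≤ K ∧ ∀ y : ℝ, 0 ≤ y →
      |∫ x in Set.Ioi y, f x| ≤ K * (1 + |y|) ^ n * Real.exp (-(c * |y|)) := by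
  obtain ⟨K, n, hK, h1⟩ := hf
  obtain ⟨M, hM, h2⟩ := one_add_pow_le_exp n (half_pos hc)
  refine ⟨K * M * (2 / c), n, by positivity, fun y hy => ?_⟩
  have hi := integrableOn_exp_mul_Ioi (a := -(c / 2)) (by linarith) y
  have h3 : ∀ x ∈ Set.Ioi y, ‖f x‖ ≤
      K * M * (1 + y) ^ n * Real.exp (-(c / 2 * y)) * Real.exp (-(c / 2) * x) := by
    intro x hx
    have hx' : y < x := hx
    have hx0 : 0 < x := by linarith
    refine (h1 x).trans ?_
    rw [abs_of_pos hx0]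
    have e1 : (1 + x) ^ n ≤ (1 + y) ^ n * (M * Real.exp (c / 2 * (x - y))) := by
      calc (1 + x) ^ n ≤ ((1 + y) * (1 + (x - y))) ^ n := by
            gcongr; nlinarith
        _ = (1 + y) ^ n * (1 + (x - y)) ^ n := mul_pow _ _ _
        _ ≤ _ := by gcongr; exact h2 _ (by linarith)
    calc K * (1 + x) ^ n * Real.exp (-(c * x))
        ≤ K * ((1 + y) ^ n * (M * Real.exp (c / 2 * (x - y)))) * Real.exp (-(c * x)) := by gcongr
      _ = K * M * (1 + y) ^ n * (Real.exp (c / 2 * (x - y)) * Real.exp (-(c * x))) := by ring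
      _ = K * M * (1 + y) ^ n * (Real.exp (-(c / 2 * y)) * Real.exp (-(c / 2) * x)) := by
          rw [← Real.exp_add, ← Real.exp_add]; ring_nf
      _ = _ := by ring
  have h4 := norm_integral_le_of_norm_le (hi.const_mul (K * M * (1 + y) ^ n *
    Real.exp (-(c / 2 * y)))) ((ae_restrict_iff' measurableSet_Ioi).2
      (Filter.Eventually.of_forall h3))
  refine h4.trans (le_of_eq ?_)
  rw [integral_const_mul, integral_exp_mul_Ioi (by linarith), abs_of_nonneg hy]
  have : Real.exp (-(c * y)) = Real.exp (-(c / 2 * y)) * Real.exp (-(c / 2) * y) := by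
    rw [← Real.exp_add]; ring_nf
  rw [this]
  field_simp

theorem bnd_of_nonneg {c : ℝ} {f : ℝ → ℝ} (h : ∀ x, |f (-x)| = |f x|)
    (h1 : ∃ (K : ℝ) (n : ℕ), 0 ≤ K ∧ ∀ x : ℝ, 0 ≤ x →
      |f x| ≤ K * (1 + |x|) ^ n * Real.exp (-(c * |x|))) : Bnd c f := by
  obtain ⟨K, n, hK, h2⟩ := h1
  refine ⟨K, n, hK, fun x => ?_⟩
  rcases le_total 0 x with hx | hx
  · exact h2 x hx
  · rw [← h x, ← abs_neg x]; exact h2 (-x) (by linarith)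

theorem hasDerivAt_primitive {f : ℝ → ℝ} (hf : Continuous f) (a x : ℝ) :
    HasDerivAt (fun y => ∫ s in a..y, f s) (f x) x :=
  (hf.integral_hasStrictDerivAt a x).hasDerivAt

theorem contDiff_primitive {f : ℝ → ℝ} (hf : ContDiff ℝ ∞ f) (a : ℝ) :
    ContDiff ℝ ∞ fun y => ∫ s in a..y, f s := by
  have h := fun x => hasDerivAt_primitive hf.continuous a x
  refine contDiff_infty_iff_deriv.2 ⟨fun x => (h x).differentiableAt, ?_⟩
  rwa [show deriv (fun y => ∫ s in a..y, f s) = f from funext fun x => (h x).deriv]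

theorem primitive_neg (f : ℝ → ℝ) (y : ℝ) :
    ∫ s in (0 : ℝ)..(-y), f s = -∫ s in (0 : ℝ)..y, f (-s) := by
  rw [intervalIntegral.integral_comp_neg, neg_zero, intervalIntegral.integral_symm]

theorem integral_Ioi_sub_primitive {c : ℝ} {f : ℝ → ℝ} (hf : Bnd c f) (hc : 0 < c)
    (h : Continuous f) (y : ℝ) :
    (∫ s in Set.Ioi (0 : ℝ), f s) - ∫ s in (0 : ℝ)..y, f s = ∫ s in Set.Ioi y, f s := by
  have hi := hf.integrable hc h
  rw [← intervalIntegral.integral_Ioi_sub_Ioi' hi.integrableOn hi.integrableOn]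
  ring

/-- The antiderivative vanishing at infinity of an odd function. -/
theorem exists_even_primitive {f : ℝ → ℝ} (hf : Gr 1 f) (ho : ∀ x, f (-x) = -f x) :
    ∃ F : ℝ → ℝ, Gr 1 F ∧ (∀ x, F (-x) = F x) ∧ ∀ x, deriv F x = f x := by
  have hd := fun x => hasDerivAt_primitive hf.1.continuous 0 x
  have he : ∀ x, ∫ s in (0 : ℝ)..(-x), f s = ∫ s in (0 : ℝ)..x, f s := by
    intro x
    rw [primitive_neg]
    simp [ho]
  have hder : ∀ x, deriv (fun y => (∫ s in (0 : ℝ)..y, f s) - ∫ s in Set.Ioi (0 : ℝ), f s) x =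
      f x := fun x => ((hd x).sub_const _).deriv
  -- The constant makes the primitive equal to `-∫_y^∞ f`, which decays at +∞; evenness gives the
  -- decay at -∞.
  refine ⟨fun y => (∫ s in (0 : ℝ)..y, f s) - ∫ s in Set.Ioi (0 : ℝ), f s, ?_, ?_, hder⟩
  · refine Gr.of_deriv ((contDiff_primitive hf.1 0).sub contDiff_const) ?_ ?_
    · refine bnd_of_nonneg (fun x => by rw [he]) ?_
      obtain ⟨K, n, hK, h⟩ := hf.bnd.tail one_pos
      refine ⟨K, n, hK, fun x hx => ?_⟩
      rw [abs_sub_comm, integral_Ioi_sub_primitive hf.bnd one_pos hf.1.continuous]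
      exact h x hx
    · rw [show deriv _ = f from funext hder]; exact hf
  · intro x; simp only [he]

/-! ### The operator `L` -/

theorem L_eq {f f' f'' : ℝ → ℝ} (h1 : ∀ x, HasDerivAt f (f' x) x)
    (h2 : ∀ x, HasDerivAt f' (f'' x) x) (x : ℝ) : L f x = -f'' x + f x - 2 * Q x * f x := by
  rw [L, iteratedDeriv_succ, iteratedDeriv_one, show deriv f = f' from funext fun x => (h1 x).deriv,
    (h2 x).deriv]

theorem iteratedDeriv_two (f : ℝ → ℝ) : iteratedDeriv 2 f = deriv (deriv f) := by
  rw [iteratedDeriv_succ, iteratedDeriv_one]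

/-- The even solution of `L v = 0` with `Q' v' - Q'' v = 1`. -/
noncomputable def kernelEven (x : ℝ) : ℝ := 5 / 3 * Q x - 5 / 6 - (Q x)⁻¹ / 2
    - 5 / 6 * (x * (phi x * Q x))

theorem hasDerivAt_Q_inv (x : ℝ) : HasDerivAt (fun x => (Q x)⁻¹) ((Q x)⁻¹ * phi x) x := by
  have h := (hasDerivAt_Q x).inv (Q_pos x).ne'
  refine h.congr_deriv ?_
  have := (Q_pos x).ne'
  field_simp

theorem hasDerivAt_phi_mul_Q (x : ℝ) :
    HasDerivAt (fun x => phi x * Q x) (Q x ^ 2 - Q x) x := by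
  refine ((hasDerivAt_phi x).mul (hasDerivAt_Q x)).congr_deriv ?_
  linear_combination (-Q x) * phi_sq x

theorem hasDerivAt_kernelEven (x : ℝ) : HasDerivAt kernelEven
    (-(5 / 2) * (phi x * Q x) - (Q x)⁻¹ * phi x / 2 - 5 / 6 * (x * (Q x ^ 2 - Q x))) x := by
  refine (((((hasDerivAt_Q x).const_mul (5 / 3 : ℝ)).sub_const (5 / 6 : ℝ)).sub
    ((hasDerivAt_Q_inv x).div_const 2)).sub
    (((hasDerivAt_id x).mul (hasDerivAt_phi_mul_Q x)).const_mul (5 / 6 : ℝ))).congr_deriv ?_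
  simp only [id]
  ring

/-- Together with the preceding derivative this is `v'' = (1 - 2Q) v`, that is `L v = 0`: with Q' it
completes a basis of solutions. -/
theorem hasDerivAt_kernelEven' (x : ℝ) : HasDerivAt (fun x =>
    -(5 / 2) * (phi x * Q x) - (Q x)⁻¹ * phi x / 2 - 5 / 6 * (x * (Q x ^ 2 - Q x)))
    ((1 - 2 * Q x) * kernelEven x) x := by
  refine ((((hasDerivAt_phi_mul_Q x).const_mul (-(5 / 2) : ℝ)).sub
    (((hasDerivAt_Q_inv x).mul (hasDerivAt_phi x)).div_const 2)).sub
    (((hasDerivAt_id x).mul (((hasDerivAt_Q x).pow 2).sub (hasDerivAt_Q x))).const_mul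
      (5 / 6 : ℝ))).congr_deriv ?_
  have hq := (Q_pos x).ne'
  simp only [id, kernelEven, Pi.pow_apply, Pi.sub_apply]
  have h := phi_sq x
  field_simp
  push_cast
  linear_combination (-18 : ℝ) * h

theorem gr_Q_inv : Gr (-1) fun x => (Q x)⁻¹ := by
  refine Gr.of_deriv_eq_mul (contDiff_Q.inv fun x => (Q_pos x).ne')
    ⟨2 / 3, 0, by norm_num, fun x => ?_⟩ gr_phi fun x => (hasDerivAt_Q_inv x).deriv
  have hc : Real.cosh (x / 2) ≤ Real.exp (|x| / 2) := by
    rw [← Real.cosh_abs, abs_div, abs_two, Real.cosh_eq]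
    have : Real.exp (-(|x| / 2)) ≤ Real.exp (|x| / 2) := by
      gcongr; linarith [abs_nonneg x]
    linarith
  have h0 := Real.cosh_pos (x / 2)
  rw [abs_of_pos (inv_pos.2 (Q_pos x)), show Q x = 3 / 2 * (1 / Real.cosh (x / 2)) ^ 2 from rfl]
  have e : Real.exp (-(-1 * |x|)) = Real.exp (|x| / 2) ^ 2 := by
    rw [← Real.exp_nat_mul]; push_cast; ring_nf
  rw [e, pow_zero, mul_one]
  have : (3 / 2 * (1 / Real.cosh (x / 2)) ^ 2)⁻¹ = 2 / 3 * Real.cosh (x / 2) ^ 2 := by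
    field_simp
  rw [this]
  gcongr

theorem gr_kernelEven : Gr (-1) kernelEven := by
  have hx : Gr (-1) fun x => x * (phi x * Q x) :=
    (Gr.id.mul_zero_left (gr_phi.mul_zero_left gr_Q)).mono (by norm_num)
  have h1 : Gr (-1) fun x => 5 / 3 * Q x := (gr_Q.const_mul _).mono (by norm_num)
  have h2 : Gr (-1) fun _ => (5 / 6 : ℝ) := (Gr.const _).mono (by norm_num)
  have h3 : Gr (-1) fun x => (Q x)⁻¹ / 2 := by
    simpa [div_eq_inv_mul] using gr_Q_inv.const_mul (2⁻¹)
  exact ((h1.sub h2).sub h3).sub (hx.const_mul _)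

theorem kernelEven_even (x : ℝ) : kernelEven (-x) = kernelEven x := by
  simp only [kernelEven, Q_even, phi_odd]; ring

theorem gr_deriv_Q : Gr 1 (deriv Q) := gr_Q.derivative

theorem deriv_Q_odd (x : ℝ) : deriv Q (-x) = -deriv Q x := by
  simp only [deriv_Q, Q_even, phi_odd]; ring

theorem hasDerivAt_deriv_Q (x : ℝ) : HasDerivAt (deriv Q) (Q x - Q x ^ 2) x := by
  rw [deriv_Q]
  have h := (hasDerivAt_phi_mul_Q x).neg
  refine (h.congr_deriv (by ring)).congr_of_eventuallyEq (Filter.Eventually.of_forall fun y => ?_)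
  simp only [Pi.neg_apply]; ring

/-- The Wronskian of two solutions of `L u = 0` is constant, and kernelEven is scaled so that
variation of constants needs no denominator. -/
theorem kernel_wronskian (x : ℝ) :
    deriv Q x * deriv kernelEven x - (Q x - Q x ^ 2) * kernelEven x = 1 := by
  rw [(hasDerivAt_kernelEven x).deriv, deriv_Q]
  have hq := (Q_pos x).ne'
  simp only [kernelEven]
  have h := phi_sq x
  field_simp
  first | linear_combination (90 * Q x ^ 2 + 18) * h | linear_combination (-30 * Q x ^ 2 - 6) * h

/-- Variation of constants for `L u = f`. -/
noncomputable def solL (f : ℝ → ℝ) (y : ℝ) : ℝ :=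
  deriv Q y * (∫ s in (0 : ℝ)..y, kernelEven s * f s) +
    kernelEven y * ((∫ s in Set.Ioi (0 : ℝ), deriv Q s * f s) - ∫ s in (0 : ℝ)..y, deriv Q s * f s)

noncomputable def solL' (f : ℝ → ℝ) (y : ℝ) : ℝ :=
  (Q y - Q y ^ 2) * (∫ s in (0 : ℝ)..y, kernelEven s * f s) +
    deriv kernelEven y *
      ((∫ s in Set.Ioi (0 : ℝ), deriv Q s * f s) - ∫ s in (0 : ℝ)..y, deriv Q s * f s)

theorem hasDerivAt_solL {f : ℝ → ℝ} (hf : Gr 1 f) (y : ℝ) :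
    HasDerivAt (solL f) (solL' f y) y := by
  have h1 := hasDerivAt_primitive (gr_kernelEven.mul hf).1.continuous 0 y
  have h2 := hasDerivAt_primitive (gr_deriv_Q.mul hf).1.continuous 0 y
  refine (((hasDerivAt_deriv_Q y).mul h1).add ((contDiff_hasDerivAt gr_kernelEven.1 y).mul
    (h2.const_sub (∫ s in Set.Ioi (0 : ℝ), deriv Q s * f s)))).congr_deriv ?_
  rw [solL']; ring

theorem hasDerivAt_solL' {f : ℝ → ℝ} (hf : Gr 1 f) (y : ℝ) :
    HasDerivAt (solL' f) ((1 - 2 * Q y) * solL f y - f y) y := by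
  have h1 := hasDerivAt_primitive (gr_kernelEven.mul hf).1.continuous 0 y
  have h2 := hasDerivAt_primitive (gr_deriv_Q.mul hf).1.continuous 0 y
  have h3 : HasDerivAt (deriv kernelEven) ((1 - 2 * Q y) * kernelEven y) y := by
    rw [show deriv kernelEven = _ from funext fun x => (hasDerivAt_kernelEven x).deriv]
    exact hasDerivAt_kernelEven' y
  refine ((((hasDerivAt_Q y).sub ((hasDerivAt_Q y).pow 2)).mul h1).add (h3.mul
    (h2.const_sub (∫ s in Set.Ioi (0 : ℝ), deriv Q s * f s)))).congr_deriv ?_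
  have hw := kernel_wronskian y
  have e : deriv Q y = -(Q y * phi y) := by rw [deriv_Q]
  simp only [solL, Pi.sub_apply, Pi.pow_apply]
  rw [e] at hw ⊢
  push_cast
  linear_combination (-f y) * hw

theorem L_solL {f : ℝ → ℝ} (hf : Gr 1 f) (y : ℝ) : L (solL f) y = f y := by
  rw [L_eq (hasDerivAt_solL hf) (hasDerivAt_solL' hf)]; ring

theorem Bnd.primitive {f : ℝ → ℝ} (hf : Bnd 0 f) : Bnd 0 fun y => ∫ s in (0 : ℝ)..y, f s := by
  obtain ⟨K, n, hK, h⟩ := hf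
  refine ⟨K, n + 1, hK, fun y => ?_⟩
  have h1 : ∀ s ∈ Set.uIoc 0 y, ‖f s‖ ≤ K * (1 + |y|) ^ n := by
    intro s hs
    have h2 : |s| ≤ |y| := by
      rcases le_total 0 y with hy | hy
      · rw [Set.uIoc_of_le hy] at hs
        rw [abs_of_pos hs.1, abs_of_nonneg hy]; exact hs.2
      · rw [Set.uIoc_of_ge hy] at hs
        rw [abs_of_nonpos hs.2, abs_of_nonpos hy]; linarith [hs.1]
    refine (h s).trans ?_
    simp only [zero_mul, neg_zero, Real.exp_zero, mul_one]
    gcongr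
  have h3 := intervalIntegral.norm_integral_le_of_norm_le_const h1
  refine h3.trans ?_
  simp only [zero_mul, neg_zero, Real.exp_zero, mul_one, sub_zero]
  rw [pow_succ, ← mul_assoc]
  gcongr
  linarith

/-- On y ≥ 0 both terms decay like `e^{-y}` up to polynomials: Q' multiplies a primitive of
polynomial growth, the rates of v and f cancelling, while v grows like `e^y` but multiplies the tail
`∫_y^∞ Q' f`, which decays like `e^{-2y}`. For y ≤ 0 the formula shows no such decay, and the
symmetry hypotheses transport the bound. Higher derivatives follow from the differential equation.
-/
theorem gr_solL {f : ℝ → ℝ} (hf : Gr 1 f) (h1 : ∀ y, |solL f (-y)| = |solL f y|)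
    (h2 : ∀ y, |solL' f (-y)| = |solL' f y|) : Gr 1 (solL f) := by
  have hI : Bnd 0 fun y => ∫ s in (0 : ℝ)..y, kernelEven s * f s := by
    have h := gr_kernelEven.mul hf
    norm_num at h
    exact h.bnd.primitive
  have hu : Bnd 2 fun y => deriv Q y * f y := by
    have h := gr_deriv_Q.mul hf
    norm_num at h
    exact h.bnd
  have huc : Continuous fun y => deriv Q y * f y := (gr_deriv_Q.mul hf).1.continuous
  have hJ := hu.tail two_pos
  have key : ∀ p q : ℝ → ℝ, Bnd 1 p → Bnd (-1) q →
      (∀ y, |(p (-y) * (∫ s in (0 : ℝ)..(-y), kernelEven s * f s) + q (-y) *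
        ((∫ s in Set.Ioi (0 : ℝ), deriv Q s * f s) - ∫ s in (0 : ℝ)..(-y), deriv Q s * f s))| =
        |(p y * (∫ s in (0 : ℝ)..y, kernelEven s * f s) + q y *
        ((∫ s in Set.Ioi (0 : ℝ), deriv Q s * f s) - ∫ s in (0 : ℝ)..y, deriv Q s * f s))|) →
      Bnd 1 fun y => p y * (∫ s in (0 : ℝ)..y, kernelEven s * f s) + q y *
        ((∫ s in Set.Ioi (0 : ℝ), deriv Q s * f s) - ∫ s in (0 : ℝ)..y, deriv Q s * f s) := by
    intro p q hp hq hsym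
    refine bnd_of_nonneg hsym ?_
    have hpI : Bnd 1 fun y => p y * (∫ s in (0 : ℝ)..y, kernelEven s * f s) := by
      simpa using hp.mul hI
    obtain ⟨K, n, hK, hJ⟩ := hJ
    have hJ' : Bnd 2 fun y => ∫ s in Set.Ioi |y|, deriv Q s * f s :=
      ⟨K, n, hK, fun y => by simpa using hJ |y| (abs_nonneg y)⟩
    have hqJ : Bnd 1 fun y => q y * ∫ s in Set.Ioi |y|, deriv Q s * f s := by
      have := hq.mul hJ'
      norm_num at this
      exact this
    obtain ⟨M, m, hM, h3⟩ := hpI.add hqJ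
    refine ⟨M, m, hM, fun y hy => ?_⟩
    have := h3 y
    simp only [abs_of_nonneg hy] at this ⊢
    rw [integral_Ioi_sub_primitive hu two_pos huc]
    exact this
  have hQQ : Bnd 1 fun y => Q y - Q y ^ 2 := by
    have : Gr 1 fun y => Q y * Q y := (gr_Q.mul gr_Q).mono (by norm_num)
    simpa [pow_two] using (gr_Q.sub this).bnd
  refine Gr.of_ode (h := fun y => 1 - 2 * Q y) (g := fun y => -f y) ?_
    (key _ _ gr_deriv_Q.bnd gr_kernelEven.bnd h1) ?_ ?_ hf.neg ?_
  · have hk := gr_kernelEven.1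
    exact (gr_deriv_Q.1.mul (contDiff_primitive (gr_kernelEven.mul hf).1 0)).add
      (hk.mul (contDiff_const.sub (contDiff_primitive (gr_deriv_Q.mul hf).1 0)))
  · rw [show deriv (solL f) = solL' f from funext fun y => (hasDerivAt_solL hf y).deriv]
    exact key _ _ hQQ gr_kernelEven.derivative.bnd h2
  · exact (Gr.const 1).sub ((gr_Q.mono zero_le_one).const_mul 2)
  · intro y
    rw [show deriv (solL f) = solL' f from funext fun y => (hasDerivAt_solL hf y).deriv,
      (hasDerivAt_solL' hf y).deriv]
    ring

theorem deriv_kernelEven_odd (x : ℝ) : deriv kernelEven (-x) = -deriv kernelEven x := by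
  rw [(hasDerivAt_kernelEven x).deriv, (hasDerivAt_kernelEven (-x)).deriv]
  simp only [Q_even, phi_odd]; ring

/-- `L` is invertible on the even functions of class `𝒴`. -/
theorem exists_L_eq_even {f : ℝ → ℝ} (hf : Gr 1 f) (he : ∀ x, f (-x) = f x) :
    ∃ B : ℝ → ℝ, Gr 1 B ∧ (∀ x, B (-x) = B x) ∧ ∀ x, L B x = f x := by
  have e1 : ∀ y, ∫ s in (0 : ℝ)..(-y), kernelEven s * f s =
      -∫ s in (0 : ℝ)..y, kernelEven s * f s := by
    intro y; rw [primitive_neg]; simp only [kernelEven_even, he]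
  have e2 : ∀ y, ∫ s in (0 : ℝ)..(-y), deriv Q s * f s = ∫ s in (0 : ℝ)..y, deriv Q s * f s := by
    intro y; rw [primitive_neg]; simp [deriv_Q_odd, he]
  -- Here `Q' f` is odd, so its integral over the line vanishes and no orthogonality condition
  -- arises.
  have h1 : ∀ y, solL f (-y) = solL f y := by
    intro y; simp only [solL, e1, e2, deriv_Q_odd, kernelEven_even]; ring
  have h2 : ∀ y, solL' f (-y) = -solL' f y := by
    intro y; simp only [solL', e1, e2, Q_even, deriv_kernelEven_odd]; ring
  exact ⟨solL f, gr_solL hf (fun y => by rw [h1]) (fun y => by rw [h2, abs_neg]), h1, L_solL hf⟩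

/-- `L u = f` is solvable for odd `f` of class `𝒴` orthogonal to `Q'`. -/
theorem exists_L_eq_odd {f : ℝ → ℝ} (hf : Gr 1 f) (ho : ∀ x, f (-x) = -f x)
    (h0 : ∫ s in Set.Ioi (0 : ℝ), deriv Q s * f s = 0) :
    ∃ B : ℝ → ℝ, Gr 1 B ∧ (∀ x, B (-x) = -B x) ∧ ∀ x, L B x = f x := by
  have e1 : ∀ y, ∫ s in (0 : ℝ)..(-y), kernelEven s * f s =
      ∫ s in (0 : ℝ)..y, kernelEven s * f s := by
    intro y; rw [primitive_neg]; simp [kernelEven_even, ho]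
  have e2 : ∀ y, ∫ s in (0 : ℝ)..(-y), deriv Q s * f s =
      -∫ s in (0 : ℝ)..y, deriv Q s * f s := by
    intro y; rw [primitive_neg]; simp [deriv_Q_odd, ho]
  -- Without `h0` the term `v ∫_0^∞ Q' f` would be even and would destroy the oddness, hence the
  -- decay at -∞.
  have h1 : ∀ y, solL f (-y) = -solL f y := by
    intro y; simp only [solL, e1, e2, deriv_Q_odd, kernelEven_even, h0]; ring
  have h2 : ∀ y, solL' f (-y) = solL' f y := by
    intro y; simp only [solL', e1, e2, Q_even, deriv_kernelEven_odd, h0]; ring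
  exact ⟨solL f, gr_solL hf (fun y => by rw [h1, abs_neg]) (fun y => by rw [h2]), h1, L_solL hf⟩


theorem contDiff_of_infty {f : ℝ → ℝ} (hf : ContDiff ℝ ∞ f) (n : ℕ) : ContDiff ℝ n f :=
  hf.of_le (by exact_mod_cast le_top)

theorem L_add {f g : ℝ → ℝ} (hf : ContDiff ℝ ∞ f) (hg : ContDiff ℝ ∞ g) (x : ℝ) :
    L (fun x => f x + g x) x = L f x + L g x := by
  have h : iteratedDeriv 2 (fun x => f x + g x) x = iteratedDeriv 2 f x + iteratedDeriv 2 g x :=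
    iteratedDeriv_fun_add (contDiff_of_infty hf 2).contDiffAt (contDiff_of_infty hg 2).contDiffAt
  simp only [L, h]; ring

theorem L_const_mul (a : ℝ) (f : ℝ → ℝ) (x : ℝ) : L (fun x => a * f x) x = a * L f x := by
  simp only [L, iteratedDeriv_const_mul_field]; ring

theorem L_const (a : ℝ) (x : ℝ) : L (fun _ => a) x = a - 2 * Q x * a := by
  rw [L, iteratedDeriv_const]; norm_num

theorem deriv_Q_apply (x : ℝ) : deriv Q x = -(Q x * phi x) := by rw [deriv_Q]

theorem iteratedDeriv_two_Q (x : ℝ) : iteratedDeriv 2 Q x = Q x - Q x ^ 2 := by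
  rw [iteratedDeriv_two, (hasDerivAt_deriv_Q x).deriv]

theorem deriv_Q_sq (x : ℝ) : deriv Q x ^ 2 = Q x ^ 2 - 2 / 3 * Q x ^ 3 := by
  rw [deriv_Q_apply]; linear_combination Q x ^ 2 * phi_sq x

theorem hasDerivAt_Q' (x : ℝ) : HasDerivAt Q (deriv Q x) x := by
  rw [deriv_Q_apply]; exact hasDerivAt_Q x

/-- Because φ tends to ±1 and the correction decays, a multiple of φ can absorb the nonzero limits
of an odd right-hand side. -/
theorem L_phi (x : ℝ) : L phi x = phi x + 5 / 3 * deriv Q x := by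
  rw [L_eq hasDerivAt_phi (fun x => (hasDerivAt_Q' x).div_const 3), deriv_Q_apply]; ring

theorem L_Q (x : ℝ) : L Q x = -Q x ^ 2 := by
  rw [L_eq hasDerivAt_Q' hasDerivAt_deriv_Q]; ring

theorem hasDerivAt_second_deriv_Q (x : ℝ) :
    HasDerivAt (fun x => Q x - Q x ^ 2) (deriv Q x * (1 - 2 * Q x)) x := by
  refine ((hasDerivAt_Q' x).sub ((hasDerivAt_Q' x).pow 2)).congr_deriv ?_
  push_cast; ring

theorem L_deriv_Q (x : ℝ) : L (deriv Q) x = 0 := by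
  rw [L_eq hasDerivAt_deriv_Q hasDerivAt_second_deriv_Q]; ring

theorem hasDerivAt_id_mul_deriv_Q (x : ℝ) :
    HasDerivAt (fun x => x * deriv Q x) (deriv Q x + x * (Q x - Q x ^ 2)) x := by
  refine ((hasDerivAt_id x).mul (hasDerivAt_deriv_Q x)).congr_deriv ?_
  simp

theorem hasDerivAt_id_mul_deriv_Q' (x : ℝ) :
    HasDerivAt (fun x => deriv Q x + x * (Q x - Q x ^ 2))
      (2 * (Q x - Q x ^ 2) + x * (deriv Q x * (1 - 2 * Q x))) x := by
  refine ((hasDerivAt_deriv_Q x).add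
    ((hasDerivAt_id x).mul (hasDerivAt_second_deriv_Q x))).congr_deriv ?_
  simp; ring

theorem L_id_mul_deriv_Q (x : ℝ) : L (fun x => x * deriv Q x) x = -2 * (Q x - Q x ^ 2) := by
  rw [L_eq hasDerivAt_id_mul_deriv_Q hasDerivAt_id_mul_deriv_Q']; ring

theorem gr_id_mul_deriv_Q : Gr 1 fun x => x * deriv Q x := Gr.id.mul_zero_left gr_deriv_Q

/-! ### Solvability of the systems (Ω). -/

/-- The even solution of `L A = (λ - 3) Q'' - Q²`. -/
noncomputable def Astar (lam x : ℝ) : ℝ := Q x + -((lam - 3) / 2) * (x * deriv Q x)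

theorem gr_Astar (lam : ℝ) : Gr 1 (Astar lam) := gr_Q.add (gr_id_mul_deriv_Q.const_mul _)

theorem Astar_even (lam x : ℝ) : Astar lam (-x) = Astar lam x := by
  simp only [Astar, Q_even, deriv_Q_odd]; ring

theorem L_Astar (lam x : ℝ) :
    L (Astar lam) x = (lam - 3) * iteratedDeriv 2 Q x - Q x ^ 2 := by
  rw [show Astar lam = fun x => Q x + -((lam - 3) / 2) * (x * deriv Q x) from rfl,
    L_add gr_Q.1 (gr_id_mul_deriv_Q.const_mul _).1, L_const_mul, L_Q, L_id_mul_deriv_Q,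
    iteratedDeriv_two_Q]
  ring

theorem iteratedDeriv_two_Astar (lam x : ℝ) : iteratedDeriv 2 (Astar lam) x =
    (Q x - Q x ^ 2) - (lam - 3) / 2 * (2 * (Q x - Q x ^ 2) + x * (deriv Q x * (1 - 2 * Q x))) := by
  have h := L_Astar lam x
  rw [L, iteratedDeriv_two_Q] at h
  simp only [Astar] at h ⊢
  linear_combination -h

/-- The right hand side of the second equation of `(Ω)` produced by `A = Astar`. -/
noncomputable def Rstar (lam x : ℝ) : ℝ :=
  (3 - lam) * iteratedDeriv 2 (Astar lam) x + 2 * Q x * Astar lam x +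
    (2 * lam - 3) * iteratedDeriv 2 Q x

theorem gr_Q_mul {f : ℝ → ℝ} (hf : Gr 1 f) : Gr 1 fun x => Q x * f x :=
  (gr_Q.mono zero_le_one).mul_zero_left hf

theorem gr_Rstar (lam : ℝ) : Gr 1 (Rstar lam) := by
  have h : Gr 1 fun x => 2 * Q x * Astar lam x := by
    simpa [mul_assoc] using (gr_Q_mul (gr_Astar lam)).const_mul 2
  exact ((((gr_Astar lam).iter 2).const_mul _).add h).add ((gr_Q.iter 2).const_mul _)

theorem tendsto_phi : Filter.Tendsto phi Filter.atTop (nhds 1) := by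
  have h : Bnd 1 fun x => phi |x| - 1 :=
    ⟨4, 0, by norm_num, fun x => by simpa using one_sub_phi_le |x| (abs_nonneg x)⟩
  have h1 := h.tendsto one_pos
  have h2 : Filter.Tendsto (fun x => phi |x|) Filter.atTop (nhds 1) := by
    simpa using h1.add_const 1
  refine h2.congr' ?_
  filter_upwards [Filter.eventually_ge_atTop 0] with x hx
  rw [abs_of_nonneg hx]

/-- This is the coefficient of `a` in the solvability condition for the second equation of (Ω). It
is positive for 0 < λ < 1, and `15 + 10λ - λ²` is the denominator of `a10` and `b10`. -/
theorem integral_Q_mul_Rstar (lam : ℝ) :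
    ∫ x in Set.Ioi (0 : ℝ), Q x * Rstar lam x = 3 / 20 * (15 + 10 * lam - lam ^ 2) := by
  set m : ℝ := (lam - 3) / 2 with hm
  let P2 : ℝ → ℝ := fun x => 9 / 2 * (phi x - phi x ^ 3 / 3)
  let P3 : ℝ → ℝ := fun x => 27 / 4 * (phi x - 2 / 3 * phi x ^ 3 + phi x ^ 5 / 5)
  -- A primitive of `Q Rstar`: `Q Q''` is integrated by parts with `Q'² = Q² - (2/3)Q³`, the terms
  -- `x Q Q'` and `x Q² Q'` by parts in x, and the primitives `P2`, `P3` of Q², Q³ are polynomials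
  -- in φ.
  let H : ℝ → ℝ := fun x => (4 * m ^ 2 + 2 * m + 3) * (Q x * deriv Q x - P2 x + 2 / 3 * P3 x)
    + 2 * P3 x + 2 * m ^ 2 * (x * Q x ^ 2 / 2 - P2 x / 2)
    - (4 * m ^ 2 + 2 * m) * (x * Q x ^ 3 / 3 - P3 x / 3)
  have dP2 : ∀ x, HasDerivAt P2 (Q x ^ 2) x := fun x => by
    refine (((hasDerivAt_phi x).sub (((hasDerivAt_phi x).pow 3).div_const 3)).const_mul
      (9 / 2 : ℝ)).congr_deriv ?_
    rw [Q_eq_phi]; push_cast; ring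
  have dP3 : ∀ x, HasDerivAt P3 (Q x ^ 3) x := fun x => by
    refine ((((hasDerivAt_phi x).sub (((hasDerivAt_phi x).pow 3).const_mul (2 / 3 : ℝ))).add
      (((hasDerivAt_phi x).pow 5).div_const 5)).const_mul (27 / 4 : ℝ)).congr_deriv ?_
    rw [Q_eq_phi]; push_cast; ring
  have dH : ∀ x, HasDerivAt H (Q x * Rstar lam x) x := fun x => by
    have hq := hasDerivAt_Q' x
    refine (((((((hq.mul (hasDerivAt_deriv_Q x)).sub (dP2 x)).add
      ((dP3 x).const_mul (2 / 3 : ℝ))).const_mul (4 * m ^ 2 + 2 * m + 3)).add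
      ((dP3 x).const_mul 2)).add
      (((((hasDerivAt_id x).mul (hq.pow 2)).div_const 2).sub ((dP2 x).div_const 2)).const_mul
        (2 * m ^ 2))).sub
      (((((hasDerivAt_id x).mul (hq.pow 3)).div_const 3).sub ((dP3 x).div_const 3)).const_mul
        (4 * m ^ 2 + 2 * m))).congr_deriv ?_
    rw [Rstar, iteratedDeriv_two_Astar, iteratedDeriv_two_Q, Astar,
      show lam = 2 * m + 3 by rw [hm]; ring]
    simp only [id, Pi.pow_apply]
    push_cast
    linear_combination (4 * m ^ 2 + 2 * m + 3) * deriv_Q_sq x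
  have hQ0 : Filter.Tendsto Q Filter.atTop (nhds 0) := gr_Q.bnd.tendsto one_pos
  have hQ' : Filter.Tendsto (deriv Q) Filter.atTop (nhds 0) := gr_deriv_Q.bnd.tendsto one_pos
  have hxQ : Filter.Tendsto (fun x => x * Q x) Filter.atTop (nhds 0) :=
    (Gr.id.mul_zero_left gr_Q).bnd.tendsto one_pos
  have tP2 : Filter.Tendsto P2 Filter.atTop (nhds (9 / 2 * (1 - 1 ^ 3 / 3))) :=
    ((tendsto_phi.sub ((tendsto_phi.pow 3).div_const 3)).const_mul _)
  have tP3 : Filter.Tendsto P3 Filter.atTop (nhds (27 / 4 * (1 - 2 / 3 * 1 ^ 3 + 1 ^ 5 / 5))) :=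
    (((tendsto_phi.sub ((tendsto_phi.pow 3).const_mul (2 / 3))).add
      ((tendsto_phi.pow 5).div_const 5)).const_mul _)
  have t2 : Filter.Tendsto (fun x => x * Q x ^ 2) Filter.atTop (nhds 0) := by
    have := hxQ.mul hQ0
    simp only [mul_zero] at this
    exact this.congr fun x => by ring
  have t3 : Filter.Tendsto (fun x => x * Q x ^ 3) Filter.atTop (nhds 0) := by
    have := t2.mul hQ0
    simp only [mul_zero] at this
    exact this.congr fun x => by ring
  have tH := ((((((hQ0.mul hQ').sub tP2).add (tP3.const_mul (2 / 3))).const_mul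
    (4 * m ^ 2 + 2 * m + 3)).add (tP3.const_mul 2)).add
    (((t2.div_const 2).sub (tP2.div_const 2)).const_mul (2 * m ^ 2))).sub
    (((t3.div_const 3).sub (tP3.div_const 3)).const_mul (4 * m ^ 2 + 2 * m))
  have hi : IntegrableOn (fun x => Q x * Rstar lam x) (Set.Ioi 0) :=
    ((gr_Q_mul (gr_Rstar lam)).bnd.integrable one_pos
      (gr_Q_mul (gr_Rstar lam)).1.continuous).integrableOn
  rw [integral_Ioi_of_hasDerivAt_of_tendsto' (fun x _ => dH x) hi tH]
  have hphi0 : phi 0 = 0 := by rw [phi_eq]; simp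
  simp only [H, P2, P3, hphi0, deriv_Q_apply]
  rw [hm]
  ring

theorem deriv_L_of_eq {A f : ℝ → ℝ} (h : ∀ x, L A x = f x) (x : ℝ) : deriv (L A) x = deriv f x := by
  rw [show L A = f from funext h]

/-- Solvability of the second equation of `(Ω)`. -/
theorem exists_odd_solution {R : ℝ → ℝ} (hR : Gr 1 R) (he : ∀ x, R (-x) = R x)
    (h0 : ∫ x in Set.Ioi (0 : ℝ), Q x * R x = 0) :
    ∃ (b : ℝ) (B : ℝ → ℝ), Gr 1 (fun x => B x - b * phi x) ∧ (∀ x, B (-x) = -B x) ∧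
      ∀ x, deriv (L B) x = R x := by
  -- Integration reduces the equation to `L B = f`. As f tends to ±b and `L φ = φ + (5/3) Q'`, the
  -- function `B - b φ` has to solve `L u = g` with g decaying.
  let f : ℝ → ℝ := fun y => ∫ s in (0 : ℝ)..y, R s
  let b : ℝ := ∫ s in Set.Ioi (0 : ℝ), R s
  let g : ℝ → ℝ := fun y => f y - b * (phi y + 5 / 3 * deriv Q y)
  have hf : ∀ y, HasDerivAt f (R y) y := hasDerivAt_primitive hR.1.continuous 0
  have hfo : ∀ y, f (-y) = -f y := fun y => by
    simp only [f]; rw [primitive_neg]; simp [he]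
  have hgo : ∀ y, g (-y) = -g y := fun y => by
    simp only [g, hfo, phi_odd, deriv_Q_odd]; ring
  have hdg : ∀ y, HasDerivAt g (R y - b * (Q y / 3 + 5 / 3 * (Q y - Q y ^ 2))) y := fun y =>
    (hf y).sub (((hasDerivAt_phi y).add ((hasDerivAt_deriv_Q y).const_mul _)).const_mul b)
  have hQQ : Gr 1 fun y => Q y - Q y ^ 2 := by
    simpa [pow_two] using gr_Q.sub (gr_Q_mul gr_Q)
  have hg : Gr 1 g := by
    refine Gr.of_deriv ?_ ?_ ?_
    · exact (contDiff_primitive hR.1 0).sub (contDiff_const.mul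
        (contDiff_phi.add (contDiff_const.mul gr_deriv_Q.1)))
    · refine bnd_of_nonneg (fun y => by rw [hgo, abs_neg]) ?_
      obtain ⟨K, n, hK, hJ⟩ := hR.bnd.tail one_pos
      have h1 : Bnd 1 fun y => ∫ s in Set.Ioi |y|, R s :=
        ⟨K, n, hK, fun y => by simpa using hJ |y| (abs_nonneg y)⟩
      have h2 : Bnd 1 fun y => phi |y| - 1 :=
        ⟨4, 0, by norm_num, fun y => by simpa using one_sub_phi_le |y| (abs_nonneg y)⟩
      have hc : ∀ c : ℝ, Bnd 0 fun _ => c := fun c => (Gr.const c).bnd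
      have h3 := (((hc (-1)).mul h1).add ((hc (-b)).mul h2)).add
        ((hc (-b * (5 / 3))).mul gr_deriv_Q.bnd)
      norm_num at h3
      obtain ⟨M, m, hM, h4⟩ := h3
      refine ⟨M, m, hM, fun y hy => ?_⟩
      have := h4 y
      simp only [abs_of_nonneg hy] at this ⊢
      rw [← integral_Ioi_sub_primitive hR.bnd one_pos hR.1.continuous] at this
      refine (le_of_eq ?_).trans this
      congr 1
      simp only [g, f, b]; ring
    · rw [show deriv g = _ from funext fun y => (hdg y).deriv]
      exact hR.sub (((((gr_Q.const_mul (1 / 3))).add (hQQ.const_mul (5 / 3))).const_mul b).congr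
        fun y => by ring)
  -- Integration by parts turns `∫ Q' g` into `-∫ Q R`. The boundary function is `f Q - b (φ Q'' -
  -- φ' Q')`; the bracket is the Wronskian of φ and Q', whose derivative is `Q' L φ` because `L Q' =
  -- 0`. It vanishes at 0 and at infinity.
  have hgQ : ∫ s in Set.Ioi (0 : ℝ), deriv Q s * g s = 0 := by
    let E : ℝ → ℝ := fun y => f y * Q y - b * (-(Q y * deriv Q y) / 3 + phi y * (Q y - Q y ^ 2))
    have hE : ∀ y, HasDerivAt E (Q y * R y + deriv Q y * g y) y := fun y => by
      refine (((hf y).mul (hasDerivAt_Q' y)).sub (((((hasDerivAt_Q' y).mul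
        (hasDerivAt_deriv_Q y)).neg.div_const 3).add ((hasDerivAt_phi y).mul
        (hasDerivAt_second_deriv_Q y))).const_mul b)).congr_deriv ?_
      simp only [g]
      have e := deriv_Q_apply y
      linear_combination (2 * b * deriv Q y) * e
    have hi1 : Gr 1 fun y => Q y * R y := gr_Q_mul hR
    have hi2 : Gr 1 fun y => deriv Q y * g y := (gr_deriv_Q.mono zero_le_one).mul_zero_left hg
    have hEB : Bnd 1 E := by
      have hfb : Bnd 0 f := hR.bnd.mono zero_le_one |>.primitive
      have a1 := hfb.mul gr_Q.bnd
      have a2 := (((gr_Q_mul gr_deriv_Q).const_mul (-1 / 3)).add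
        (gr_phi.mul_zero_left hQQ)).const_mul (-b)
      rw [zero_add] at a1
      have a3 := a1.add a2.bnd
      refine (show E = _ from ?_) ▸ a3
      funext y; simp only [E]; ring
    have h1 := integral_Ioi_of_hasDerivAt_of_tendsto' (a := 0) (fun y _ => hE y)
      ((hi1.add hi2).bnd.integrable one_pos (hi1.add hi2).1.continuous).integrableOn
      (hEB.tendsto one_pos)
    rw [integral_add (hi1.bnd.integrable one_pos hi1.1.continuous).integrableOn
      (hi2.bnd.integrable one_pos hi2.1.continuous).integrableOn, h0, zero_add] at h1
    rw [h1]
    have hphi0 : phi 0 = 0 := by rw [phi_eq]; simp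
    simp [E, f, hphi0, deriv_Q_apply]
  obtain ⟨B, hB, hBo, hBL⟩ := exists_L_eq_odd hg hgo hgQ
  refine ⟨b, fun x => B x + b * phi x, by simpa using hB, fun x => ?_, fun x => ?_⟩
  · simp only [hBo, phi_odd]; ring
  · rw [deriv_L_of_eq (f := f) _ x, (hf x).deriv]
    intro y
    rw [L_add hB.1 (gr_phi.const_mul b).1, L_const_mul, L_phi, hBL]
    simp only [g]; ring

/-- Solvability of the system `(Ω)` for sources of class `𝒴`. -/
theorem exists_omega_solution {lam : ℝ} (h0 : 0 < lam) (h1 : lam < 1) {F G : ℝ → ℝ}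
    (hF : Gr 1 F) (hFo : ∀ x, F (-x) = -F x) (hG : Gr 1 G) (hGe : ∀ x, G (-x) = G x) (gam : ℝ) :
    ∃ (a b : ℝ) (A B : ℝ → ℝ), Gr 1 (fun x => A x - gam) ∧ (∀ x, A (-x) = A x) ∧
      Gr 1 (fun x => B x - b * phi x) ∧ (∀ x, B (-x) = -B x) ∧
      (∀ y, deriv (L A) y =
        a * deriv (fun x => (lam - 3) * iteratedDeriv 2 Q x - Q x ^ 2) y + F y) ∧
      ∀ y, deriv (L B) y = (3 - lam) * iteratedDeriv 2 A y + 2 * Q y * A y +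
        a * (2 * lam - 3) * iteratedDeriv 2 Q y + G y := by
  obtain ⟨F1, hF1, hF1e, hF1d⟩ := exists_even_primitive hF hFo
  -- The constant γ contributes `γ - 2γQ` to `L A`. The term `2γQ` compensates the second part, and
  -- γ itself disappears under the derivative.
  obtain ⟨A0, hA0, hA0e, hA0L⟩ := exists_L_eq_even (hF1.add (gr_Q.const_mul (2 * gam)))
    (fun x => by simp only [hF1e, Q_even])
  let R0 : ℝ → ℝ := fun y => (3 - lam) * iteratedDeriv 2 A0 y + 2 * (Q y * A0 y) +
    2 * gam * Q y + G y
  have hR0 : Gr 1 R0 := ((((hA0.iter 2).const_mul _).add ((gr_Q_mul hA0).const_mul 2)).add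
    (gr_Q.const_mul (2 * gam))).add hG
  have hev : ∀ f : ℝ → ℝ, (∀ x, f (-x) = f x) → ∀ x, iteratedDeriv 2 f (-x) = iteratedDeriv 2 f x := by
    intro f hf x
    have := iteratedDeriv_comp_neg 2 f x
    rw [show (fun x => f (-x)) = f from funext hf] at this
    simpa using this.symm
  let c0 : ℝ := ∫ x in Set.Ioi (0 : ℝ), Q x * R0 x
  let c1 : ℝ := 3 / 20 * (15 + 10 * lam - lam ^ 2)
  have hc1 : c1 ≠ 0 := by
    have : 0 < 15 + 10 * lam - lam ^ 2 := by nlinarith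
    simp only [c1]; positivity
  -- The only free scalar of the second equation, fixed by orthogonality of its right-hand side to
  -- Q.
  let a : ℝ := -(c0 / c1)
  have hR : Gr 1 fun y => R0 y + a * Rstar lam y := hR0.add ((gr_Rstar lam).const_mul a)
  have hint : ∫ x in Set.Ioi (0 : ℝ), Q x * (R0 x + a * Rstar lam x) = 0 := by
    have e : ∀ x, Q x * (R0 x + a * Rstar lam x) = Q x * R0 x + a * (Q x * Rstar lam x) :=
      fun x => by ring
    simp only [e]
    have i1 := gr_Q_mul hR0
    have i2 := (gr_Q_mul (gr_Rstar lam)).const_mul a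
    rw [integral_add (i1.bnd.integrable one_pos i1.1.continuous).integrableOn
      (i2.bnd.integrable one_pos i2.1.continuous).integrableOn, integral_const_mul,
      integral_Q_mul_Rstar]
    simp only [a, c0]
    field_simp
    ring
  obtain ⟨b, B, hB, hBo, hBL⟩ := exists_odd_solution hR (fun x => by
    simp only [R0, Rstar, hev _ hA0e, hev _ (Astar_even lam), hev _ Q_even, Q_even, hA0e, hGe,
      Astar_even]) hint
  have hA1 := hA0.add ((gr_Astar lam).const_mul a)
  refine ⟨a, b, fun x => (A0 x + a * Astar lam x) + gam, B, by simpa using hA1, fun x => ?_, hB,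
    hBo, fun y => ?_, fun y => ?_⟩
  · simp only [hA0e, Astar_even]
  · have e : ∀ x, L (fun x => (A0 x + a * Astar lam x) + gam) x =
        a * ((lam - 3) * iteratedDeriv 2 Q x - Q x ^ 2) + (F1 x + gam) := by
      intro x
      rw [L_add hA1.1 contDiff_const, L_add hA0.1 ((gr_Astar lam).const_mul a).1, L_const_mul,
        L_const, hA0L, L_Astar]
      ring
    have d1 : Gr 1 fun x => (lam - 3) * iteratedDeriv 2 Q x - Q x ^ 2 := by
      simpa [pow_two] using ((gr_Q.iter 2).const_mul (lam - 3)).sub (gr_Q_mul gr_Q)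
    rw [deriv_L_of_eq e]
    refine ((((contDiff_hasDerivAt d1.1 y).const_mul a).add
      ((contDiff_hasDerivAt hF1.1 y).add_const gam)).deriv).trans ?_
    rw [hF1d]
  · have e : iteratedDeriv 2 (fun x => (A0 x + a * Astar lam x) + gam) y =
        iteratedDeriv 2 A0 y + a * iteratedDeriv 2 (Astar lam) y := by
      have i1 : iteratedDeriv 2 (fun x => (A0 x + a * Astar lam x) + gam) y =
          iteratedDeriv 2 (fun x => (A0 x + a * Astar lam x)) y +
            iteratedDeriv 2 (fun _ => gam) y :=
        iteratedDeriv_fun_add (contDiff_of_infty hA1.1 2).contDiffAt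
          contDiff_const.contDiffAt
      have i2 : iteratedDeriv 2 (fun x => (A0 x + a * Astar lam x)) y =
          iteratedDeriv 2 A0 y + iteratedDeriv 2 (fun x => a * Astar lam x) y :=
        iteratedDeriv_fun_add (contDiff_of_infty hA0.1 2).contDiffAt
          (contDiff_of_infty ((gr_Astar lam).const_mul a).1 2).contDiffAt
      rw [i1, i2, iteratedDeriv_const_mul_field, iteratedDeriv_const]
      simp
    rw [hBL, e]
    simp only [R0, Rstar]
    ring


/-! ### The first pair of coefficients -/

theorem gr_A10 (lam : ℝ) : Gr 1 (A10 lam) :=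
  ((gr_id_mul_deriv_Q.add (gr_Q.const_mul 2)).neg).sub
    (((gr_id_mul_deriv_Q.const_mul ((lam - 3) / 2)).sub gr_Q).const_mul (a10 lam))

/-- Splits off `Astar`; what remains solves `L u = 2Q`, since `2(Q'' + Q²) = 2Q`. -/
theorem A10_eq (lam x : ℝ) :
    A10 lam x = (-1 * (x * deriv Q x) + -2 * Q x) + a10 lam * Astar lam x := by
  rw [A10, Astar]; ring

theorem L_A10 (lam x : ℝ) : L (A10 lam) x =
    a10 lam * ((lam - 3) * iteratedDeriv 2 Q x - Q x ^ 2) + 2 * Q x := by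
  rw [show A10 lam = _ from funext (A10_eq lam),
    L_add ((gr_id_mul_deriv_Q.const_mul (-1)).add (gr_Q.const_mul (-2))).1
      ((gr_Astar lam).const_mul _).1,
    L_add (gr_id_mul_deriv_Q.const_mul (-1)).1 (gr_Q.const_mul (-2)).1, L_const_mul, L_const_mul,
    L_const_mul, L_Astar, L_Q, L_id_mul_deriv_Q]
  ring

theorem A10_even (lam x : ℝ) : A10 lam (-x) = A10 lam x := by
  simp only [A10, Q_even, deriv_Q_odd]; ring

theorem hasDerivAt_sq_mul_deriv_Q (x : ℝ) : HasDerivAt (fun x => x ^ 2 * deriv Q x)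
    (2 * x * deriv Q x + x ^ 2 * (Q x - Q x ^ 2)) x := by
  refine (((hasDerivAt_id x).pow 2).mul (hasDerivAt_deriv_Q x)).congr_deriv ?_
  simp

theorem hasDerivAt_sq_mul_deriv_Q' (x : ℝ) :
    HasDerivAt (fun x => 2 * x * deriv Q x + x ^ 2 * (Q x - Q x ^ 2))
      (2 * deriv Q x + 4 * x * (Q x - Q x ^ 2) + x ^ 2 * (deriv Q x * (1 - 2 * Q x))) x := by
  refine ((((hasDerivAt_id x).const_mul (2 : ℝ)).mul (hasDerivAt_deriv_Q x)).add
    (((hasDerivAt_id x).pow 2).mul (hasDerivAt_second_deriv_Q x))).congr_deriv ?_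
  simp; ring

theorem hasDerivAt_id_mul_Q (x : ℝ) : HasDerivAt (fun x => x * Q x) (Q x + x * deriv Q x) x := by
  refine ((hasDerivAt_id x).mul (hasDerivAt_Q' x)).congr_deriv ?_
  simp

theorem hasDerivAt_id_mul_Q' (x : ℝ) : HasDerivAt (fun x => Q x + x * deriv Q x)
    (2 * deriv Q x + x * (Q x - Q x ^ 2)) x := by
  refine ((hasDerivAt_Q' x).add (hasDerivAt_id_mul_deriv_Q x)).congr_deriv ?_
  ring

theorem gr_sq_mul_deriv_Q : Gr 1 fun x => x ^ 2 * deriv Q x := by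
  simpa [pow_two] using (Gr.id.mul_zero_left Gr.id).mul_zero_left gr_deriv_Q

theorem gr_id_mul_Q : Gr 1 fun x => x * Q x := Gr.id.mul_zero_left gr_Q

theorem gr_B10_sub (lam kap : ℝ) : Gr 1 fun x => B10 lam kap x - b10 lam * phi x :=
  (((((gr_sq_mul_deriv_Q.const_mul ((3 - lam) / 4)).add gr_id_mul_Q).sub
    (((gr_sq_mul_deriv_Q.const_mul ((lam - 3) ^ 2 / 8)).add
      (gr_id_mul_Q.const_mul ((3 - lam) / 2))).const_mul (a10 lam)))).add
      (gr_deriv_Q.const_mul kap)).congr fun x => by rw [B10]; ring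

theorem B10_odd (lam kap x : ℝ) : B10 lam kap (-x) = -B10 lam kap x := by
  simp only [B10, Q_even, deriv_Q_odd, phi_odd]; ring

theorem B10_eq (lam kap x : ℝ) : B10 lam kap x =
    ((((3 - lam) / 4 - a10 lam * ((lam - 3) ^ 2 / 8)) * (x ^ 2 * deriv Q x) +
      (1 - a10 lam * ((3 - lam) / 2)) * (x * Q x)) + b10 lam * phi x) + kap * deriv Q x := by
  rw [B10]; ring

theorem L_B10 (lam kap x : ℝ) : L (B10 lam kap) x =
    ((3 - lam) / 4 - a10 lam * ((lam - 3) ^ 2 / 8)) * (-2 * deriv Q x - 4 * (x * (Q x - Q x ^ 2))) +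
      (1 - a10 lam * ((3 - lam) / 2)) * (-2 * deriv Q x - x * Q x ^ 2) +
      b10 lam * (phi x + 5 / 3 * deriv Q x) := by
  have g1 := gr_sq_mul_deriv_Q.const_mul ((3 - lam) / 4 - a10 lam * ((lam - 3) ^ 2 / 8))
  have g2 := gr_id_mul_Q.const_mul (1 - a10 lam * ((3 - lam) / 2))
  have g3 := gr_phi.const_mul (b10 lam)
  rw [show B10 lam kap = _ from funext (B10_eq lam kap),
    L_add ((g1.1.add g2.1).add g3.1) (gr_deriv_Q.const_mul _).1, L_add (g1.1.add g2.1) g3.1,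
    L_add g1.1 g2.1, L_const_mul, L_const_mul, L_const_mul, L_const_mul, L_phi, L_deriv_Q,
    L_eq hasDerivAt_sq_mul_deriv_Q hasDerivAt_sq_mul_deriv_Q',
    L_eq hasDerivAt_id_mul_Q hasDerivAt_id_mul_Q']
  ring

theorem iteratedDeriv_two_A10 (lam x : ℝ) : iteratedDeriv 2 (A10 lam) x =
    (1 - 2 * Q x) * A10 lam x -
      (a10 lam * ((lam - 3) * iteratedDeriv 2 Q x - Q x ^ 2) + 2 * Q x) := by
  have h := L_A10 lam x
  rw [L] at h
  linear_combination -h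

/-- Both sides are combinations of Q, Q², x Q' and x Q Q', and they agree for the prescribed values
`a10`, `b10`. The parameter `kap` plays no role because `L Q' = 0`. -/
theorem deriv_L_B10 {lam : ℝ} (h0 : 0 < lam) (h1 : lam < 1) (kap y : ℝ) :
    deriv (L (B10 lam kap)) y = (3 - lam) * iteratedDeriv 2 (A10 lam) y +
      2 * Q y * A10 lam y + a10 lam * (2 * lam - 3) * iteratedDeriv 2 Q y + 2 * Q y := by
  rw [deriv_L_of_eq (L_B10 lam kap)]
  refine ((((((hasDerivAt_deriv_Q y).const_mul (-2 : ℝ)).sub (((hasDerivAt_id y).mul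
    (hasDerivAt_second_deriv_Q y)).const_mul (4 : ℝ))).const_mul _).add
    ((((hasDerivAt_deriv_Q y).const_mul (-2 : ℝ)).sub ((hasDerivAt_id y).mul
      ((hasDerivAt_Q' y).pow 2))).const_mul _)).add
    (((hasDerivAt_phi y).add ((hasDerivAt_deriv_Q y).const_mul (5 / 3 : ℝ))).const_mul
      _)).deriv.trans ?_
  rw [iteratedDeriv_two_A10, iteratedDeriv_two_Q, A10_eq, Astar, a10, b10]
  have hD : 15 + 10 * lam - lam ^ 2 ≠ 0 := by nlinarith
  simp only [id, Pi.pow_apply]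
  push_cast
  generalize hE : 15 + 10 * lam - lam ^ 2 = D at hD
  field_simp
  rw [← hE]
  ring

/-- The integral is affine in `kap` with slope `∫ Q'²`, which is positive since Q' is continuous and
not identically zero. -/
theorem exists_orthogonal_B10 (lam : ℝ) :
    ∃ kap : ℝ, ∫ y : ℝ, B10 lam kap y * deriv Q y = 0 := by
  have h1 : Gr 1 fun y => B10 lam 0 y * deriv Q y := by
    have : Gr 0 (B10 lam 0) := (((gr_B10_sub lam 0).mono zero_le_one).add
      (gr_phi.const_mul (b10 lam))).congr fun x => by ring
    exact this.mul_zero_left gr_deriv_Q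
  have h2 : Gr 1 fun y => deriv Q y * deriv Q y := (gr_deriv_Q.mono zero_le_one).mul_zero_left
    gr_deriv_Q
  have i1 := h1.bnd.integrable one_pos h1.1.continuous
  have i2 := h2.bnd.integrable one_pos h2.1.continuous
  have hne : ∫ y, deriv Q y * deriv Q y ≠ 0 := by
    intro h
    rw [integral_eq_zero_iff_of_nonneg (fun y => mul_self_nonneg _) i2] at h
    have h3 : (fun y => deriv Q y * deriv Q y) = fun _ => (0 : ℝ) :=
      (h2.1.continuous.ae_eq_iff_eq volume continuous_const).1 h
    have h4 := congrFun h3 2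
    have h5 : phi 2 ≠ 0 := by
      rw [phi_eq, Real.tanh_eq_sinh_div_cosh]
      exact (div_pos (Real.sinh_pos_iff.2 (by norm_num)) (Real.cosh_pos _)).ne'
    have h6 := (Q_pos 2).ne'
    rw [deriv_Q] at h4
    simp [h5, h6] at h4
  refine ⟨-((∫ y, B10 lam 0 y * deriv Q y) / ∫ y, deriv Q y * deriv Q y), ?_⟩
  set kap := -((∫ y, B10 lam 0 y * deriv Q y) / ∫ y, deriv Q y * deriv Q y) with hk
  have e : ∀ y, B10 lam kap y * deriv Q y =
      B10 lam 0 y * deriv Q y + kap * (deriv Q y * deriv Q y) := fun y => by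
    simp only [B10]; ring
  simp only [e]
  rw [integral_add i1 (i2.const_mul kap), integral_const_mul, hk, neg_mul, div_mul_cancel₀ _ hne, add_neg_cancel]

/-! ### Decay and parity of the sources -/

/-- `f - c` is of class `𝒴`. -/
def GrLim (c : ℝ) (f : ℝ → ℝ) : Prop := Gr 1 fun x => f x - c

theorem GrLim.add {c d : ℝ} {f g : ℝ → ℝ} (hf : GrLim c f) (hg : GrLim d g) :
    GrLim (c + d) fun x => f x + g x :=
  (Gr.add hf hg).congr fun x => by ring

theorem GrLim.sub {c d : ℝ} {f g : ℝ → ℝ} (hf : GrLim c f) (hg : GrLim d g) :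
    GrLim (c - d) fun x => f x - g x :=
  (Gr.sub hf hg).congr fun x => by ring

theorem GrLim.const_mul {c : ℝ} {f : ℝ → ℝ} (a : ℝ) (hf : GrLim c f) :
    GrLim (a * c) fun x => a * f x :=
  (Gr.const_mul a hf).congr fun x => by ring

theorem Gr.lim {f : ℝ → ℝ} (hf : Gr 1 f) : GrLim 0 f := hf.congr fun x => by ring

theorem GrLim.gr {c : ℝ} {f : ℝ → ℝ} (hf : GrLim c f) (h : c = 0) : Gr 1 f := by
  subst h; exact Gr.congr hf fun x => by ring

theorem GrLim.gr_zero {c : ℝ} {f : ℝ → ℝ} (hf : GrLim c f) : Gr 0 f :=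
  ((Gr.mono hf zero_le_one).add (Gr.const c)).congr fun x => by ring

theorem GrLim.derivative {c : ℝ} {f : ℝ → ℝ} (hf : GrLim c f) : Gr 1 (deriv f) := by
  have h := Gr.derivative hf
  exact h.congr fun x => deriv_sub_const _

theorem GrLim.iter {c : ℝ} {f : ℝ → ℝ} (hf : GrLim c f) (n : ℕ) :
    Gr 1 (iteratedDeriv (n + 1) f) := by
  rw [iteratedDeriv_succ']; exact hf.derivative.iter n

theorem gr_of_sub_phi {b : ℝ} {f : ℝ → ℝ} (hf : Gr 1 fun x => f x - b * phi x) : Gr 0 f :=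
  ((hf.mono zero_le_one).add (gr_phi.const_mul b)).congr fun x => by ring

theorem gr_deriv_of_sub_phi {b : ℝ} {f : ℝ → ℝ} (hf : Gr 1 fun x => f x - b * phi x) :
    Gr 1 (deriv f) := by
  have h0 := (gr_of_sub_phi hf).1
  refine (hf.derivative.add (gr_Q.const_mul (b / 3))).congr fun x => ?_
  have : deriv (fun x => f x - b * phi x) x = deriv f x - b * (Q x / 3) :=
    ((contDiff_hasDerivAt h0 x).sub ((hasDerivAt_phi x).const_mul b)).deriv
  rw [this]; ring

theorem gr_iter_of_sub_phi {b : ℝ} {f : ℝ → ℝ} (hf : Gr 1 fun x => f x - b * phi x) (n : ℕ) :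
    Gr 1 (iteratedDeriv (n + 1) f) := by
  rw [iteratedDeriv_succ']; exact (gr_deriv_of_sub_phi hf).iter n

/-- The limits ±b have the same square, and `φ² = 1 - (2/3)Q` shows that the difference from `b²` is
of class 𝒴. -/
theorem grLim_sq_of_sub_phi {b : ℝ} {f : ℝ → ℝ} (hf : Gr 1 fun x => f x - b * phi x) :
    GrLim (b ^ 2) fun x => f x ^ 2 := by
  have h := gr_of_sub_phi hf
  refine (((h.add (gr_phi.const_mul b)).mul_zero_left hf).sub
    (gr_Q.const_mul (b ^ 2 * (2 / 3)))).congr fun x => ?_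
  linear_combination (-b ^ 2) * phi_sq x

theorem iteratedDeriv_of_even {f : ℝ → ℝ} (hf : ∀ x, f (-x) = f x) (n : ℕ) (x : ℝ) :
    iteratedDeriv n f (-x) = (-1) ^ n * iteratedDeriv n f x := by
  have h := iteratedDeriv_comp_neg n f (-x)
  rw [show (fun x => f (-x)) = f from funext hf] at h
  simpa using h

theorem iteratedDeriv_of_odd {f : ℝ → ℝ} (hf : ∀ x, f (-x) = -f x) (n : ℕ) (x : ℝ) :
    iteratedDeriv n f (-x) = -((-1) ^ n * iteratedDeriv n f x) := by
  have h := iteratedDeriv_comp_neg n f (-x)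
  rw [show (fun x => f (-x)) = fun x => -f x from funext hf, iteratedDeriv_fun_neg] at h
  simp only [neg_neg, smul_eq_mul] at h
  rw [← h]; ring

/-- The functions `A_{1,0}`, `A_{1,1}`, `A_{2,0}`, `B_{1,0}`, `B_{1,1}`, `B_{2,0}` entering the
sources have the prescribed parity and limits. -/
structure SourceData (lam : ℝ) (P : Profile) : Prop where
  A10 : Gr 1 (P.A 1 0)
  A11 : GrLim (P.b 1 0 ^ 2 / 2) (P.A 1 1)
  A20 : GrLim (-(P.b 1 0 ^ 2 / (2 * (1 - lam)))) (P.A 2 0)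
  B10 : Gr 1 fun x => P.B 1 0 x - P.b 1 0 * phi x
  B11 : Gr 1 fun x => P.B 1 1 x - P.b 1 1 * phi x
  B20 : Gr 1 fun x => P.B 2 0 x - P.b 2 0 * phi x
  A10_even : ∀ x, P.A 1 0 (-x) = P.A 1 0 x
  A11_even : ∀ x, P.A 1 1 (-x) = P.A 1 1 x
  A20_even : ∀ x, P.A 2 0 (-x) = P.A 2 0 x
  B10_odd : ∀ x, P.B 1 0 (-x) = -P.B 1 0 x
  B11_odd : ∀ x, P.B 1 1 (-x) = -P.B 1 1 x
  B20_odd : ∀ x, P.B 2 0 (-x) = -P.B 2 0 x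

/-- Each derivative reverses parity. Counted in this way, with Q and A even and B odd, every
monomial of F is odd and every monomial of G is even. -/
theorem SourceData.parity {lam : ℝ} {P : Profile} (h : SourceData lam P) {k l : ℕ}
    (hkl : (k, l) ∈ Sigma0) (y : ℝ) :
    sourceF lam P k l (-y) = -sourceF lam P k l y ∧ sourceG lam P k l (-y) = sourceG lam P k l y := by
  have q := fun n => iteratedDeriv_of_even Q_even n y
  have a10 := fun n => iteratedDeriv_of_even h.A10_even n y
  have a11 := fun n => iteratedDeriv_of_even h.A11_even n y
  have a20 := fun n => iteratedDeriv_of_even h.A20_even n y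
  have b10 := fun n => iteratedDeriv_of_odd h.B10_odd n y
  have b11 := fun n => iteratedDeriv_of_odd h.B11_odd n y
  have b20 := fun n => iteratedDeriv_of_odd h.B20_odd n y
  have hm : (k, l) = (1, 0) ∨ (k, l) = (1, 1) ∨ (k, l) = (1, 2) ∨ (k, l) = (2, 0) ∨
      (k, l) = (2, 1) ∨ (k, l) = (3, 0) := by
    revert hkl; generalize (k, l) = p; revert p; decide
  simp only [Prod.mk.injEq] at hm
  rcases hm with ⟨rfl, rfl⟩ | ⟨rfl, rfl⟩ | ⟨rfl, rfl⟩ | ⟨rfl, rfl⟩ | ⟨rfl, rfl⟩ | ⟨rfl, rfl⟩ <;>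
  constructor <;> simp only [sourceF, sourceG, q, a10, a11, a20, b10, b11, b20] <;> ring

theorem Gr.const_mul_mul_left {f g : ℝ → ℝ} (a : ℝ) (hf : Gr 0 f) (hg : Gr 1 g) :
    Gr 1 fun x => a * f x * g x :=
  (hf.const_mul a).mul_zero_left hg

theorem Gr.const_mul_mul_right {f g : ℝ → ℝ} (a : ℝ) (hf : Gr 1 f) (hg : Gr 0 g) :
    Gr 1 fun x => a * f x * g x :=
  (hf.const_mul a).mul_zero_right hg

theorem Gr.sq {f : ℝ → ℝ} (hf : Gr 1 f) : Gr 1 fun x => f x ^ 2 :=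
  ((hf.mono zero_le_one).mul_zero_left hf).congr fun x => by ring

-- Every monomial of F has a decaying factor: a derivative of order at least one, Q, or A_{1,0}. For
-- the remaining factors polynomial growth is enough.
set_option maxHeartbeats 1000000 in
theorem SourceData.gr_F {lam : ℝ} {P : Profile} (h : SourceData lam P) {k l : ℕ}
    (hkl : (k, l) ∈ Sigma0) : Gr 1 (sourceF lam P k l) := by
  have q := fun n => gr_Q.iter n
  have q' := fun n => (gr_Q.iter n).mono zero_le_one
  have a10 := fun n => h.A10.iter n
  have a10' := fun n => (h.A10.iter n).mono zero_le_one
  have a11 := fun n => h.A11.iter n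
  have a20 := fun n => h.A20.iter n
  have b10 := fun n => gr_iter_of_sub_phi h.B10 n
  have b11 := fun n => gr_iter_of_sub_phi h.B11 n
  have b20 := fun n => gr_iter_of_sub_phi h.B20 n
  have a11' := fun n => h.A11.gr_zero.iter n
  have a20' := fun n => h.A20.gr_zero.iter n
  have b10' := fun n => (gr_of_sub_phi h.B10).iter n
  have b11' := fun n => (gr_of_sub_phi h.B11).iter n
  have b20' := fun n => (gr_of_sub_phi h.B20).iter n
  have hm : (k, l) = (1, 0) ∨ (k, l) = (1, 1) ∨ (k, l) = (1, 2) ∨ (k, l) = (2, 0) ∨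
      (k, l) = (2, 1) ∨ (k, l) = (3, 0) := by
    revert hkl; generalize (k, l) = p; revert p; decide
  simp only [Prod.mk.injEq] at hm
  show Gr 1 fun y => sourceF lam P k l y
  rcases hm with ⟨rfl, rfl⟩ | ⟨rfl, rfl⟩ | ⟨rfl, rfl⟩ | ⟨rfl, rfl⟩ | ⟨rfl, rfl⟩ | ⟨rfl, rfl⟩ <;>
  simp only [sourceF] <;>
  repeat' first
    | with_reducible refine Gr.add ?_ ?_
    | with_reducible refine Gr.sub ?_ ?_
    | with_reducible refine Gr.const_mul _ ?_
    | with_reducible (first | exact q _ | exact a10 _ | exact a11 _ | exact a20 _ | exact b10 _ | exact b11 _ | exact b20 _)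
    | with_reducible (first | exact q' _ | exact a10' _ | exact a11' _ | exact a20' _ | exact b10' _ | exact b11' _ | exact b20' _)
    | refine Gr.const_mul_mul_left _ ?_ (by with_reducible (first | exact q _ | exact a10 _ | exact a11 _ | exact a20 _ | exact b10 _ | exact b11 _ | exact b20 _))
    | refine Gr.const_mul_mul_right _ (by with_reducible (first | exact q _ | exact a10 _ | exact a11 _ | exact a20 _ | exact b10 _ | exact b11 _ | exact b20 _)) ?_

-- Monomials without a decaying factor occur only in G_{2,1} and G_{3,0}, and there the limits
-- cancel. With b = b_{1,0}, the terms `A_{1,1} + 3(1-λ) A_{2,0} + B_{1,0}²` tend to `b²/2 - 3b²/2 +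
-- b² = 0`, and `-(4/3) A_{2,0} - (2/3) B_{1,0}²/(1-λ)` tends to 0 as well. This explains the values
-- of γ_{1,1} and γ_{2,0}.
set_option maxHeartbeats 1000000 in
theorem SourceData.gr_G {lam : ℝ} {P : Profile} (h : SourceData lam P) {k l : ℕ}
    (hlam : lam < 1) (hkl : (k, l) ∈ Sigma0) : Gr 1 (sourceG lam P k l) := by
  have q := fun n => gr_Q.iter n
  have q' := fun n => (gr_Q.iter n).mono zero_le_one
  have a10 := fun n => h.A10.iter n
  have a10' := fun n => (h.A10.iter n).mono zero_le_one
  have a11 := fun n => h.A11.iter n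
  have a20 := fun n => h.A20.iter n
  have b10 := fun n => gr_iter_of_sub_phi h.B10 n
  have b11 := fun n => gr_iter_of_sub_phi h.B11 n
  have b20 := fun n => gr_iter_of_sub_phi h.B20 n
  have a11' := fun n => h.A11.gr_zero.iter n
  have a20' := fun n => h.A20.gr_zero.iter n
  have b10' := fun n => (gr_of_sub_phi h.B10).iter n
  have b11' := fun n => (gr_of_sub_phi h.B11).iter n
  have b20' := fun n => (gr_of_sub_phi h.B20).iter n
  have hm : (k, l) = (1, 0) ∨ (k, l) = (1, 1) ∨ (k, l) = (1, 2) ∨ (k, l) = (2, 0) ∨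
      (k, l) = (2, 1) ∨ (k, l) = (3, 0) := by
    revert hkl; generalize (k, l) = p; revert p; decide
  simp only [Prod.mk.injEq] at hm
  show Gr 1 fun y => sourceG lam P k l y
  have c21 : GrLim (P.b 1 0 ^ 2 / 2) (iteratedDeriv 0 (P.A 1 1)) := by simpa using h.A11
  have c20 : GrLim (-(P.b 1 0 ^ 2 / (2 * (1
      - lam)))) (iteratedDeriv 0 (P.A 2 0)) := by simpa using h.A20
  have c21' := c20.const_mul (3 - 3 * lam)
  have c21'' : GrLim (P.b 1 0 ^ 2) fun x => iteratedDeriv 0 (P.B 1 0) x ^ 2 := by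
    simpa using grLim_sq_of_sub_phi h.B10
  have c30 := c20.const_mul (4 / 3)
  have c30' := c21''.const_mul (2 / 3 * (1 - lam)⁻¹)
  have hl : 1 - lam ≠ 0 := by linarith
  rcases hm with ⟨rfl, rfl⟩ | ⟨rfl, rfl⟩ | ⟨rfl, rfl⟩ | ⟨rfl, rfl⟩ | ⟨rfl, rfl⟩ | ⟨rfl, rfl⟩ <;>
  simp only [sourceG]
  -- The cases (2,1) and (3,0), where the limits have to be tracked, come first; in the others every
  -- monomial decays.
  rotate_left 4
  · apply GrLim.gr
    repeat' first
      | with_reducible apply GrLim.add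
      | with_reducible apply GrLim.sub
      | with_reducible exact c21
      | with_reducible exact c21'
      | with_reducible exact c21''
      | with_reducible exact c30
      | with_reducible exact c30'
      | with_reducible refine Gr.lim ?_
      | with_reducible refine Gr.add ?_ ?_
      | with_reducible refine Gr.sub ?_ ?_
      | with_reducible refine Gr.const_mul _ ?_
      | with_reducible refine Gr.sq ?_
      | with_reducible (first | exact q _ | exact a10 _ | exact a11 _ | exact a20 _ | exact b10 _ | exact b11 _ | exact b20 _)
      | with_reducible (first | exact q' _ | exact a10' _ | exact a11' _ | exact a20' _ | exact b10' _ | exact b11' _ | exact b20' _)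
      | refine Gr.const_mul_mul_left _ ?_ (by with_reducible (first | exact q _ | exact a10 _ | exact a11 _ | exact a20 _ | exact b10 _ | exact b11 _ | exact b20 _))
      | refine Gr.const_mul_mul_right _ (by with_reducible (first | exact q _ | exact a10 _ | exact a11 _ | exact a20 _ | exact b10 _ | exact b11 _ | exact b20 _)) ?_
      | refine Gr.mul_zero_left ?_ (by with_reducible (first | exact q _ | exact a10 _ | exact a11 _ | exact a20 _ | exact b10 _ | exact b11 _ | exact b20 _))
      | refine Gr.mul_zero_right (by with_reducible (first | exact q _ | exact a10 _ | exact a11 _ | exact a20 _ | exact b10 _ | exact b11 _ | exact b20 _)) ?_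
    field_simp; ring
  · apply GrLim.gr
    repeat' first
      | with_reducible apply GrLim.add
      | with_reducible apply GrLim.sub
      | with_reducible exact c21
      | with_reducible exact c21'
      | with_reducible exact c21''
      | with_reducible exact c30
      | with_reducible exact c30'
      | with_reducible refine Gr.lim ?_
      | with_reducible refine Gr.add ?_ ?_
      | with_reducible refine Gr.sub ?_ ?_
      | with_reducible refine Gr.const_mul _ ?_
      | with_reducible refine Gr.sq ?_
      | with_reducible (first | exact q _ | exact a10 _ | exact a11 _ | exact a20 _ | exact b10 _ | exact b11 _ | exact b20 _)
      | with_reducible (first | exact q' _ | exact a10' _ | exact a11' _ | exact a20' _ | exact b10' _ | exact b11' _ | exact b20' _)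
      | refine Gr.const_mul_mul_left _ ?_ (by with_reducible (first | exact q _ | exact a10 _ | exact a11 _ | exact a20 _ | exact b10 _ | exact b11 _ | exact b20 _))
      | refine Gr.const_mul_mul_right _ (by with_reducible (first | exact q _ | exact a10 _ | exact a11 _ | exact a20 _ | exact b10 _ | exact b11 _ | exact b20 _)) ?_
      | refine Gr.mul_zero_left ?_ (by with_reducible (first | exact q _ | exact a10 _ | exact a11 _ | exact a20 _ | exact b10 _ | exact b11 _ | exact b20 _))
      | refine Gr.mul_zero_right (by with_reducible (first | exact q _ | exact a10 _ | exact a11 _ | exact a20 _ | exact b10 _ | exact b11 _ | exact b20 _)) ?_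
    field_simp; ring
  all_goals
    repeat' first
      | with_reducible refine Gr.add ?_ ?_
      | with_reducible refine Gr.sub ?_ ?_
      | with_reducible refine Gr.const_mul _ ?_
      | with_reducible refine Gr.sq ?_
      | with_reducible (first | exact q _ | exact a10 _ | exact a11 _ | exact a20 _ | exact b10 _ | exact b11 _ | exact b20 _)
      | with_reducible (first | exact q' _ | exact a10' _ | exact a11' _ | exact a20' _ | exact b10' _ | exact b11' _ | exact b20' _)
      | refine Gr.const_mul_mul_left _ ?_ (by with_reducible (first | exact q _ | exact a10 _ | exact a11 _ | exact a20 _ | exact b10 _ | exact b11 _ | exact b20 _))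
      | refine Gr.const_mul_mul_right _ (by with_reducible (first | exact q _ | exact a10 _ | exact a11 _ | exact a20 _ | exact b10 _ | exact b11 _ | exact b20 _)) ?_
      | refine Gr.mul_zero_left ?_ (by with_reducible (first | exact q _ | exact a10 _ | exact a11 _ | exact a20 _ | exact b10 _ | exact b11 _ | exact b20 _))
      | refine Gr.mul_zero_right (by with_reducible (first | exact q _ | exact a10 _ | exact a11 _ | exact a20 _ | exact b10 _ | exact b11 _ | exact b20 _)) ?_


/-! ### Existence of admissible coefficients -/

/-- The data `(a, b, A, B)` attached to one index. -/
abbrev Coef := ℝ × ℝ × (ℝ → ℝ) × (ℝ → ℝ)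

noncomputable def profileOf (d10 d11 d20 d12 d21 d30 : Coef) : Profile :=
  let d : ℕ → ℕ → Coef := fun k l => match k, l with
    | 1, 0 => d10
    | 1, 1 => d11
    | 2, 0 => d20
    | 1, 2 => d12
    | 2, 1 => d21
    | 3, 0 => d30
    | _, _ => d10
  ⟨fun k l => (d k l).1, fun k l => (d k l).2.1, fun k l => (d k l).2.2.1, fun k l => (d k l).2.2.2⟩

/-- The profiles `P` and `P'` agree at the indices `(1,0)`, `(1,1)`, `(2,0)`. -/
structure AgreeLow (P P' : Profile) : Prop where
  a10 : P.a 1 0 = P'.a 1 0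
  a11 : P.a 1 1 = P'.a 1 1
  a20 : P.a 2 0 = P'.a 2 0
  b10 : P.b 1 0 = P'.b 1 0
  b11 : P.b 1 1 = P'.b 1 1
  b20 : P.b 2 0 = P'.b 2 0
  A10 : P.A 1 0 = P'.A 1 0
  A11 : P.A 1 1 = P'.A 1 1
  A20 : P.A 2 0 = P'.A 2 0
  B10 : P.B 1 0 = P'.B 1 0
  B11 : P.B 1 1 = P'.B 1 1
  B20 : P.B 2 0 = P'.B 2 0

theorem AgreeLow.sourceF {P P' : Profile} (h : AgreeLow P P') (lam : ℝ) (k l : ℕ) :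
    sourceF lam P k l = sourceF lam P' k l := by
  funext y
  simp only [BBM.sourceF, h.a10, h.a11, h.a20, h.A10, h.A11, h.A20, h.B10, h.B11, h.B20]

theorem AgreeLow.sourceG {P P' : Profile} (h : AgreeLow P P') (lam : ℝ) (k l : ℕ) :
    sourceG lam P k l = sourceG lam P' k l := by
  funext y
  simp only [BBM.sourceG, h.a10, h.a11, h.a20, h.A10, h.A11, h.A20, h.B10, h.B11, h.B20]

theorem AgreeLow.gammaCoef {P P' : Profile} (h : AgreeLow P P') (lam : ℝ) (k l : ℕ) :
    gammaCoef lam P k l = gammaCoef lam P' k l := by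
  simp only [BBM.gammaCoef, dCoef, h.b10, h.b11, h.b20]

theorem agreeLow_profileOf (d10 d11 d20 d12 d21 d30 e12 e21 e30 : Coef) :
    AgreeLow (profileOf d10 d11 d20 d12 d21 d30) (profileOf d10 d11 d20 e12 e21 e30) := by
  constructor <;> rfl

theorem omega_of {lam : ℝ} {P : Profile} {k l : ℕ} {F G : ℝ → ℝ} (hF : sourceF lam P k l = F)
    (hG : sourceG lam P k l = G)
    (h1 : ∀ y, deriv (L (P.A k l)) y = P.a k l *
      deriv (fun x => (lam - 3) * iteratedDeriv 2 Q x - Q x ^ 2) y + F y)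
    (h2 : ∀ y, deriv (L (P.B k l)) y = (3 - lam) * iteratedDeriv 2 (P.A k l) y +
      2 * Q y * P.A k l y + P.a k l * (2 * lam - 3) * iteratedDeriv 2 Q y + G y) :
    Omega lam P k l := by
  subst hF hG; exact ⟨h1, h2⟩

theorem exists_coef {lam : ℝ} {P : Profile} (h0 : 0 < lam) (h1 : lam < 1) (h : SourceData lam P)
    {k l : ℕ} (hkl : (k, l) ∈ Sigma0) (gam : ℝ) : ∃ d : Coef,
      GrLim gam d.2.2.1 ∧ (∀ x, d.2.2.1 (-x) = d.2.2.1 x) ∧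
      (Gr 1 fun x => d.2.2.2 x - d.2.1 * phi x) ∧ (∀ x, d.2.2.2 (-x) = -d.2.2.2 x) ∧
      (∀ y, deriv (L d.2.2.1) y = d.1 * deriv (fun x => (lam - 3) * iteratedDeriv 2 Q x
          - Q x ^ 2) y +
        sourceF lam P k l y) ∧
      ∀ y, deriv (L d.2.2.2) y = (3 - lam) * iteratedDeriv 2 d.2.2.1 y + 2 * Q y * d.2.2.1 y +
        d.1 * (2 * lam - 3) * iteratedDeriv 2 Q y + sourceG lam P k l y := by
  obtain ⟨a, b, A, B, h⟩ := exists_omega_solution h0 h1 (h.gr_F hkl)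
    (fun y => (h.parity hkl y).1) (h.gr_G h1 hkl) (fun y => (h.parity hkl y).2) gam
  exact ⟨(a, b, A, B), h⟩

theorem mem_Sigma0_cases {p : ℕ × ℕ} (hp : p ∈ Sigma0) : p = (1, 0) ∨ p = (1, 1) ∨ p = (2, 0) ∨
    p = (1, 2) ∨ p = (2, 1) ∨ p = (3, 0) := by
  revert p; decide

theorem sourceF_one_zero (lam : ℝ) (P : Profile) (y : ℝ) :
    sourceF lam P 1 0 y = 2 * iteratedDeriv 1 Q y := by simp only [sourceF]

theorem sourceG_one_zero (lam : ℝ) (P : Profile) (y : ℝ) :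
    sourceG lam P 1 0 y = 2 * iteratedDeriv 0 Q y := by simp only [sourceG]

theorem sourceF_congr_one_one {P P' : Profile} (ha : P.a 1 0 = P'.a 1 0) (hA : P.A 1 0 = P'.A 1 0)
    (hB : P.B 1 0 = P'.B 1 0) (lam : ℝ) :
    sourceF lam P 1 1 = sourceF lam P' 1 1 ∧ sourceG lam P 1 1 = sourceG lam P' 1 1 ∧
    sourceF lam P 2 0 = sourceF lam P' 2 0 ∧ sourceG lam P 2 0 = sourceG lam P' 2 0 := by
  refine ⟨?_, ?_, ?_, ?_⟩ <;> funext y <;> simp only [sourceF, sourceG, ha, hA, hB]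

/-- The sources of index sum n involve only smaller index sums, so the construction has three
layers: the explicit (1,0), then (1,1) and (2,0), then (1,2), (2,1) and (3,0). The limits prescribed
in the last layer depend only on b_{1,0}, b_{1,1}, b_{2,0}, which are known by then. -/
theorem exists_isAdmissible {lam : ℝ} (h0 : 0 < lam) (h1 : lam < 1) :
    ∃ P : Profile, IsAdmissible lam P := by
  obtain ⟨kap, hkap⟩ := exists_orthogonal_B10 lam
  obtain ⟨d10, ha, hb, hA, hB⟩ : ∃ d : Coef, d.1 = a10 lam ∧ d.2.1 = b10 lam ∧
    d.2.2.1 = A10 lam ∧ d.2.2.2 = B10 lam kap := ⟨(_, _, _, _), rfl, rfl, rfl, rfl⟩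
  have z : Gr 1 fun _ : ℝ => (0 : ℝ) := (gr_Q.const_mul 0).congr fun x => by ring
  have gA : Gr 1 d10.2.2.1 := hA ▸ gr_A10 lam
  have eA : ∀ x, d10.2.2.1 (-x) = d10.2.2.1 x := hA ▸ A10_even lam
  have gB : Gr 1 fun x => d10.2.2.2 x - d10.2.1 * phi x := by
    rw [hB, hb]; exact gr_B10_sub lam kap
  have oB : ∀ x, d10.2.2.2 (-x) = -d10.2.2.2 x := hB ▸ B10_odd lam kap
  -- Provisional entries at (1,1) and (2,0), constants with the correct limits. They only serve to
  -- make `SourceData` hold: the sources of the second layer do not contain them.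
  obtain ⟨e11, hA11, hB11, hb11⟩ : ∃ d : Coef, d.2.2.1 = (fun _ => d10.2.1 ^ 2 / 2) ∧
    d.2.2.2 = (fun _ => 0) ∧ d.2.1 = 0 := ⟨(0, _, _, _), rfl, rfl, rfl⟩
  obtain ⟨e20, hA20, hB20, hb20⟩ : ∃ d : Coef,
    d.2.2.1 = (fun _ => -(d10.2.1 ^ 2 / (2 * (1 - lam)))) ∧
    d.2.2.2 = (fun _ => 0) ∧ d.2.1 = 0 := ⟨(0, _, _, _), rfl, rfl, rfl⟩
  have S0 : SourceData lam (profileOf d10 e11 e20 d10 d10 d10) :=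
    { A10 := gA
      A11 := z.congr fun x => by simp [profileOf, hA11]
      A20 := z.congr fun x => by simp [profileOf, hA20]
      B10 := gB
      B11 := z.congr fun x => by simp [profileOf, hB11, hb11]
      B20 := z.congr fun x => by simp [profileOf, hB20, hb20]
      A10_even := eA
      A11_even := fun x => by simp [profileOf, hA11]
      A20_even := fun x => by simp [profileOf, hA20]
      B10_odd := oB
      B11_odd := fun x => by simp [profileOf, hB11]
      B20_odd := fun x => by simp [profileOf, hB20] }
  obtain ⟨d11, A11, A11e, B11, B11o, F11, G11⟩ := exists_coef h0 h1 S0 (k := 1) (l := 1) (by decide)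
    (d10.2.1 ^ 2 / 2)
  obtain ⟨d20, A20, A20e, B20, B20o, F20, G20⟩ := exists_coef h0 h1 S0 (k := 2) (l := 0) (by decide)
    (-(d10.2.1 ^ 2 / (2 * (1 - lam))))
  have S1 : SourceData lam (profileOf d10 d11 d20 d10 d10 d10) :=
    ⟨gA, A11, A20, gB, B11, B20, eA, A11e, A20e, oB, B11o, B20o⟩
  obtain ⟨d12, A12, A12e, B12, B12o, F12, G12⟩ := exists_coef h0 h1 S1 (k := 1) (l := 2) (by decide)
    (gammaCoef lam (profileOf d10 d11 d20 d10 d10 d10) 1 2)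
  obtain ⟨d21, A21, A21e, B21, B21o, F21, G21⟩ := exists_coef h0 h1 S1 (k := 2) (l := 1) (by decide)
    (gammaCoef lam (profileOf d10 d11 d20 d10 d10 d10) 2 1)
  obtain ⟨d30, A30, A30e, B30, B30o, F30, G30⟩ := exists_coef h0 h1 S1 (k := 3) (l := 0) (by decide)
    (gammaCoef lam (profileOf d10 d11 d20 d10 d10 d10) 3 0)
  have ag := agreeLow_profileOf d10 d11 d20 d12 d21 d30 d10 d10 d10
  rw [← ag.gammaCoef] at A12 A21 A30
  have c := sourceF_congr_one_one (P := profileOf d10 d11 d20 d12 d21 d30)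
    (P' := profileOf d10 e11 e20 d10 d10 d10) rfl rfl rfl lam
  refine ⟨profileOf d10 d11 d20 d12 d21 d30, ha, hb, hA, ⟨kap, hB⟩, ?_, ?_, ?_, ?_, ?_, ?_⟩
  · rw [show (profileOf d10 d11 d20 d12 d21 d30).B 1 0 = B10 lam kap from hB]; exact hkap
  · intro p hp
    rcases mem_Sigma0_cases hp with rfl | rfl | rfl | rfl | rfl | rfl
    exacts [eA, A11e, A20e, A12e, A21e, A30e]
  · intro p hp
    rcases mem_Sigma0_cases hp with rfl | rfl | rfl | rfl | rfl | rfl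
    exacts [oB, B11o, B20o, B12o, B21o, B30o]
  · intro p hp
    rw [classY_iff]
    rcases mem_Sigma0_cases hp with rfl | rfl | rfl | rfl | rfl | rfl
    exacts [gA.lim, A11, A20, A12, A21, A30]
  · intro p hp
    rw [classY_iff]
    rcases mem_Sigma0_cases hp with rfl | rfl | rfl | rfl | rfl | rfl
    exacts [gB, B11, B20, B12, B21, B30]
  · intro p hp
    rcases mem_Sigma0_cases hp with rfl | rfl | rfl | rfl | rfl | rfl
    · refine omega_of (funext (sourceF_one_zero _ _)) (funext (sourceG_one_zero _ _)) ?_ ?_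
      · intro y
        have hc : ContDiff ℝ ∞ fun x => (lam - 3) * iteratedDeriv 2 Q x - Q x ^ 2 :=
          (((gr_Q.iter 2).const_mul (lam - 3)).sub gr_Q.sq).1
        have := (((contDiff_hasDerivAt hc y).const_mul (a10 lam)).add
          ((hasDerivAt_Q' y).const_mul 2))
        show deriv (L d10.2.2.1) y = d10.1 * _ + _
        rw [hA, ha, deriv_L_of_eq (L_A10 lam), iteratedDeriv_one]
        exact this.deriv
      · show ∀ y, deriv (L d10.2.2.2) y = (3 - lam) * iteratedDeriv 2 d10.2.2.1 y +
          2 * Q y * d10.2.2.1 y + d10.1 * (2 * lam - 3) * iteratedDeriv 2 Q y + _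
        rw [hA, hB, ha]
        simpa using deriv_L_B10 h0 h1 kap
    · exact omega_of c.1 c.2.1 F11 G11
    · exact omega_of c.2.2.1 c.2.2.2 F20 G20
    · exact omega_of (ag.sourceF lam 1 2) (ag.sourceG lam 1 2) F12 G12
    · exact omega_of (ag.sourceF lam 2 1) (ag.sourceG lam 2 1) F21 G21
    · exact omega_of (ag.sourceF lam 3 0) (ag.sourceG lam 3 0) F30 G30


/-! ### Families of functions of prescribed order -/

/-- The functions `f i` and their derivatives are bounded by a multiple of `w i`, uniformly in
`i`. -/
def Ord {ι : Type*} (w f : ι → ℝ → ℝ) : Prop :=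
  ∃ C : ℝ, 0 ≤ C ∧ ∀ i x, DifferentiableAt ℝ (f i) x ∧ |f i x| ≤ C * w i x ∧
    |deriv (f i) x| ≤ C * w i x

section Ord
variable {ι : Type*} {v w f g : ι → ℝ → ℝ}

theorem Ord.add (hf : Ord w f) (hg : Ord w g) : Ord w (f + g) := by
  obtain ⟨C, hC, hf⟩ := hf
  obtain ⟨D, hD, hg⟩ := hg
  refine ⟨C + D, add_nonneg hC hD, fun i x => ?_⟩
  obtain ⟨f1, f2, f3⟩ := hf i x
  obtain ⟨g1, g2, g3⟩ := hg i x
  refine ⟨f1.add g1, ?_, ?_⟩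
  · rw [add_mul]; exact (abs_add_le _ _).trans (add_le_add f2 g2)
  · rw [show (f + g) i = f i + g i from rfl, deriv_add f1 g1, add_mul]
    exact (abs_add_le _ _).trans (add_le_add f3 g3)

theorem Ord.mul (hf : Ord v f) (hg : Ord w g) : Ord (v * w) (f * g) := by
  obtain ⟨C, hC, hf⟩ := hf
  obtain ⟨D, hD, hg⟩ := hg
  refine ⟨2 * (C * D), by positivity, fun i x => ?_⟩
  obtain ⟨f1, f2, f3⟩ := hf i x
  obtain ⟨g1, g2, g3⟩ := hg i x
  have h0 : 0 ≤ C * v i x := (abs_nonneg _).trans f2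
  have h0' : 0 ≤ D * w i x := (abs_nonneg _).trans g2
  have e : 2 * (C * D) * (v * w) i x = C * v i x * (D * w i x) + C * v i x * (D * w i x) := by
    show 2 * (C * D) * (v i x * w i x) = _
    ring
  refine ⟨f1.mul g1, ?_, ?_⟩
  · rw [e]
    show |f i x * g i x| ≤ _
    rw [abs_mul]
    have := mul_le_mul f2 g2 (abs_nonneg _) h0
    nlinarith [mul_nonneg h0 h0']
  · rw [e, show (f * g) i = f i * g i from rfl, deriv_mul f1 g1]
    refine (abs_add_le _ _).trans (add_le_add ?_ ?_)
    · rw [abs_mul]; exact mul_le_mul f3 g2 (abs_nonneg _) h0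
    · rw [abs_mul]; exact mul_le_mul f2 g3 (abs_nonneg _) h0

theorem Ord.mono (hf : Ord v f) (K : ℝ) (hK : 0 ≤ K) (h : ∀ i x, v i x ≤ K * w i x) : Ord w f := by
  obtain ⟨C, hC, hf⟩ := hf
  refine ⟨C * K, mul_nonneg hC hK, fun i x => ⟨(hf i x).1, ?_, ?_⟩⟩
  · rw [mul_assoc]; exact (hf i x).2.1.trans (mul_le_mul_of_nonneg_left (h i x) hC)
  · rw [mul_assoc]; exact (hf i x).2.2.trans (mul_le_mul_of_nonneg_left (h i x) hC)

theorem ord_const {c : ι → ℝ} {w : ι → ℝ} (C : ℝ) (hC : 0 ≤ C) (h : ∀ i, |c i| ≤ C * w i) :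
    Ord (fun i _ => w i) (fun i _ => c i) :=
  ⟨C, hC, fun i x => ⟨differentiableAt_const _, h i, by
    simpa using (abs_nonneg _).trans (h i)⟩⟩

end Ord

/-- The ring of the families which are bounded together with their derivatives. -/
def bddRing (ι : Type*) : Subring (ι → ℝ → ℝ) where
  carrier := {f | Ord (fun _ _ => 1) f}
  mul_mem' hf hg := (Ord.mul hf hg).mono 1 zero_le_one fun i x => by simp
  one_mem' := ⟨1, zero_le_one, fun i x => ⟨differentiableAt_const _, by simp, by
    rw [show (1 : ι → ℝ → ℝ) i = fun _ => 1 from rfl]; simp⟩⟩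
  add_mem' hf hg := Ord.add hf hg
  zero_mem' := ⟨0, le_rfl, fun i x => ⟨differentiableAt_const _, by simp, by
    rw [show (0 : ι → ℝ → ℝ) i = fun _ => 0 from rfl]; simp⟩⟩
  neg_mem' := by
    rintro f ⟨C, hC, hf⟩
    refine ⟨C, hC, fun i x => ⟨(hf i x).1.neg, ?_, ?_⟩⟩
    · simpa using (hf i x).2.1
    · rw [show (-f) i = -f i from rfl, deriv.neg]; simpa using (hf i x).2.2

/-- The ideal of the bounded families of order `w`. -/
def ordIdeal {ι : Type*} (w : ι → ℝ → ℝ) : Ideal (bddRing ι) where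
  carrier := {f | Ord w f.1}
  add_mem' hf hg := Ord.add hf hg
  zero_mem' := ⟨0, le_rfl, fun i x => ⟨differentiableAt_const _, by simp, by
    rw [show (((0 : bddRing ι) : ι → ℝ → ℝ)) i = fun _ => 0 from rfl]; simp⟩⟩
  smul_mem' c f hf := (Ord.mul c.2 hf).mono 1 zero_le_one fun i x => by simp

/-- Evaluation of a bounded family at a point. -/
def evalHom {ι : Type*} (i : ι) (x : ℝ) : bddRing ι →+* ℝ :=
  (Pi.evalRingHom (fun _ : ℝ => ℝ) x).comp
    ((Pi.evalRingHom (fun _ : ι => ℝ → ℝ) i).comp (bddRing ι).subtype)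

theorem evalHom_apply {ι : Type*} (i : ι) (x : ℝ) (f : bddRing ι) : evalHom i x f = f.1 i x := rfl

theorem map_prodDxx {R S : Type*} [CommRing R] [CommRing S] (φ : R →+* S)
    (f0 f1 f2 g0 g1 g2 b b1 : R) : φ (prodDxx f0 f1 f2 g0 g1 g2 b b1) =
      prodDxx (φ f0) (φ f1) (φ f2) (φ g0) (φ g1) (φ g2) (φ b) (φ b1) := by
  simp only [prodDxx, map_add, map_sub, map_mul, map_pow, map_one, map_ofNat]

theorem map_prodLin {R S : Type*} [CommRing R] [CommRing S] (φ : R →+* S)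
    (lam mu f0 f1 f2 f3 g0 g1 g2 g3 b b1 b2 : R) :
    φ (prodLin lam mu f0 f1 f2 f3 g0 g1 g2 g3 b b1 b2) =
      prodLin (φ lam) (φ mu) (φ f0) (φ f1) (φ f2) (φ f3) (φ g0) (φ g1) (φ g2) (φ g3)
        (φ b) (φ b1) (φ b2) := by
  simp only [prodLin, map_prodDxx, map_add, map_sub, map_mul, map_pow, map_one, map_ofNat, map_neg]

/-! ### The small soliton -/

/-- The admissible parameters `(σ, t)`. -/
abbrev Par := {p : ℝ × ℝ // 0 < p.1 ∧ p.1 < 1}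

theorem theta_pos {lam sig : ℝ} (h0 : 0 < lam) (h1 : lam < 1) (hs : sig < 1) :
    0 < theta lam sig :=
  div_pos (by linarith) (by nlinarith)

theorem theta_le_one {lam sig : ℝ} (h0 : 0 < lam) (h1 : lam < 1) (hs : sig < 1) :
    theta lam sig ≤ 1 := by
  rw [theta, div_le_one (by nlinarith)]; nlinarith

theorem abs_mu_le {lam sig : ℝ} (h0 : 0 < lam) (h1 : lam < 1) (hp : 0 < sig) (hs : sig < 1) :
    |mu lam sig| ≤ 1 := by
  have : 0 < 1 - lam * sig := by nlinarith
  rw [mu, abs_of_nonneg (div_nonneg (by linarith) this.le), div_le_one this]; nlinarith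

/-- The derivative of `Q̃_σ`. -/
noncomputable def Qt' (lam sig x : ℝ) : ℝ :=
  sig * theta lam sig * (Real.sqrt sig * deriv Q (Real.sqrt sig * x))

theorem hasDerivAt_Qt (lam sig x : ℝ) : HasDerivAt (Qt lam sig) (Qt' lam sig x) x := by
  have h := ((hasDerivAt_Q' (Real.sqrt sig * x)).comp x
    ((hasDerivAt_id x).const_mul (Real.sqrt sig))).const_mul (sig * theta lam sig)
  refine h.congr_deriv ?_
  rw [Qt']; ring

theorem hasDerivAt_Qt' {lam sig : ℝ} (h0 : 0 < lam) (h1 : lam < 1) (hp : 0 < sig) (hs : sig < 1)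
    (x : ℝ) : HasDerivAt (Qt' lam sig)
      (Qt lam sig x * sig - Qt lam sig x ^ 2 * (theta lam sig)⁻¹) x := by
  have h := (((hasDerivAt_deriv_Q (Real.sqrt sig * x)).comp x
    ((hasDerivAt_id x).const_mul (Real.sqrt sig))).const_mul (Real.sqrt sig)).const_mul
      (sig * theta lam sig)
  refine h.congr_deriv ?_
  have e := Real.mul_self_sqrt hp.le
  have ht := (theta_pos h0 h1 hs).ne'
  simp only [Qt]
  field_simp
  rw [Real.sq_sqrt hp.le]

theorem Qt'_sq {lam sig : ℝ} (h0 : 0 < lam) (h1 : lam < 1) (hp : 0 < sig) (hs : sig < 1) (x : ℝ) :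
    Qt' lam sig x ^ 2 = sig * Qt lam sig x ^ 2 -
      2 * (1 / 3) * (theta lam sig)⁻¹ * Qt lam sig x ^ 3 := by
  have ht := (theta_pos h0 h1 hs).ne'
  simp only [Qt, Qt', mul_pow, deriv_Q_sq, Real.sq_sqrt hp.le]
  field_simp

theorem abs_Qt_le {lam sig : ℝ} (h0 : 0 < lam) (h1 : lam < 1) (hp : 0 < sig) (hs : sig < 1)
    (x : ℝ) : |Qt lam sig x| ≤ 6 * (sig * Real.exp (-|Real.sqrt sig * x|)) := by
  have a := theta_pos h0 h1 hs
  have b := theta_le_one h0 h1 hs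
  have c := Q_le_exp (Real.sqrt sig * x)
  have d := Q_pos (Real.sqrt sig * x)
  rw [Qt, abs_of_pos (by positivity)]
  calc _ ≤ sig * 1 * (6 * Real.exp (-|Real.sqrt sig * x|)) := by gcongr
    _ = _ := by ring

theorem abs_deriv_Q_le (x : ℝ) : |deriv Q x| ≤ 6 * Real.exp (-|x|) := by
  rw [deriv_Q, abs_neg, abs_mul, abs_of_pos (Q_pos x)]
  calc _ ≤ Q x * 1 := by gcongr; exacts [(Q_pos x).le, abs_phi_le x]
    _ ≤ _ := by rw [mul_one]; exact Q_le_exp x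

theorem abs_Qt'_le {lam sig : ℝ} (h0 : 0 < lam) (h1 : lam < 1) (hp : 0 < sig) (hs : sig < 1)
    (x : ℝ) : |Qt' lam sig x| ≤
      6 * (sig * Real.sqrt sig * Real.exp (-|Real.sqrt sig * x|)) := by
  have a := theta_pos h0 h1 hs
  have b := theta_le_one h0 h1 hs
  have c := abs_deriv_Q_le (Real.sqrt sig * x)
  rw [Qt', abs_mul, abs_mul, abs_mul, abs_of_pos hp, abs_of_pos a,
    abs_of_nonneg (Real.sqrt_nonneg _)]
  calc _ ≤ sig * 1 * (Real.sqrt sig * (6 * Real.exp (-|Real.sqrt sig * x|))) := by gcongr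
    _ = _ := by ring

/-- `r = √σ (x + μ t)`. -/
noncomputable def rVar (lam : ℝ) (i : Par) (x : ℝ) : ℝ := Real.sqrt i.1.1 * ySig lam i.1.1 i.1.2 x

/-- `σ^{k/2} e^{-|r|}`. -/
noncomputable def wExp (lam : ℝ) (k : ℕ) (i : Par) (x : ℝ) : ℝ :=
  Real.sqrt i.1.1 ^ k * Real.exp (-|rVar lam i x|)

/-- Powers of σ add, whereas `e^{-2|r|} ≤ e^{-|r|}`: one exponential is kept, however many factors
there are. -/
theorem ord_wExp_mul {lam : ℝ} {k l : ℕ} {f g : Par → ℝ → ℝ} (hf : Ord (wExp lam k) f)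
    (hg : Ord (wExp lam l) g) : Ord (wExp lam (k + l)) (f * g) := by
  refine (hf.mul hg).mono 1 zero_le_one fun i x => ?_
  show wExp lam k i x * wExp lam l i x ≤ _
  simp only [wExp, pow_add, one_mul]
  have h1 : Real.exp (-|rVar lam i x|) ≤ 1 := Real.exp_le_one_iff.2 (by simp)
  have h2 := Real.exp_pos (-|rVar lam i x|)
  have h3 : 0 ≤ Real.sqrt i.1.1 ^ k * Real.sqrt i.1.1 ^ l := by positivity
  calc _ = Real.sqrt i.1.1 ^ k * Real.sqrt i.1.1 ^ l *
        (Real.exp (-|rVar lam i x|) * Real.exp (-|rVar lam i x|)) := by ring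
    _ ≤ Real.sqrt i.1.1 ^ k * Real.sqrt i.1.1 ^ l * (1 * Real.exp (-|rVar lam i x|)) := by gcongr
    _ = _ := by ring

theorem Ord.wExp_mono {lam : ℝ} {k l : ℕ} {f : Par → ℝ → ℝ} (hf : Ord (wExp lam l) f)
    (h : k ≤ l) : Ord (wExp lam k) f := by
  refine hf.mono 1 zero_le_one fun i x => ?_
  rw [one_mul, wExp, wExp]
  have : Real.sqrt i.1.1 ≤ 1 := Real.sqrt_le_one.2 i.2.2.le
  exact mul_le_mul_of_nonneg_right (pow_le_pow_of_le_one (Real.sqrt_nonneg _) this h)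
    (Real.exp_pos _).le

/-- A power of σ has weight but no decay in x. For this reason each vanishing monomial of
`WeightRel` contains X or Y, and no pure power of `s` is set to zero. -/
theorem ord_pow_mul {lam : ℝ} {k l : ℕ} {f g : Par → ℝ → ℝ}
    (hf : Ord (fun i _ => Real.sqrt i.1.1 ^ k) f)
    (hg : Ord (wExp lam l) g) : Ord (wExp lam (k + l)) (f * g) := by
  refine (hf.mul hg).mono 1 zero_le_one fun i x => ?_
  show Real.sqrt i.1.1 ^ k * wExp lam l i x ≤ _
  simp only [wExp, pow_add]
  exact le_of_eq (by ring)

theorem hasDerivAt_ySig (lam sig t x : ℝ) : HasDerivAt (ySig lam sig t) 1 x :=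
  (hasDerivAt_id x).add_const _

theorem ord_X {lam : ℝ} (h0 : 0 < lam) (h1 : lam < 1) :
    Ord (wExp lam 2) fun i x => Qt lam i.1.1 (ySig lam i.1.1 i.1.2 x) := by
  refine ⟨6, by norm_num, fun i x => ?_⟩
  have hd := (hasDerivAt_Qt lam i.1.1 (ySig lam i.1.1 i.1.2 x)).comp x (hasDerivAt_ySig _ _ _ x)
  have e : Real.sqrt i.1.1 ^ 2 = i.1.1 := Real.sq_sqrt i.2.1.le
  have hs : Real.sqrt i.1.1 ≤ 1 := Real.sqrt_le_one.2 i.2.2.le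
  refine ⟨hd.differentiableAt, ?_, ?_⟩
  · rw [wExp, rVar, e]; exact abs_Qt_le h0 h1 i.2.1 i.2.2 _
  · have hd' : deriv (fun x => Qt lam i.1.1 (ySig lam i.1.1 i.1.2 x)) x = _ := hd.deriv
    rw [hd', mul_one, wExp, rVar, e]
    refine (abs_Qt'_le h0 h1 i.2.1 i.2.2 _).trans ?_
    have := i.2.1
    gcongr
    nlinarith

theorem ord_Y {lam : ℝ} (h0 : 0 < lam) (h1 : lam < 1) :
    Ord (wExp lam 3) fun i x => Qt' lam i.1.1 (ySig lam i.1.1 i.1.2 x) := by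
  refine ⟨6, by norm_num, fun i x => ?_⟩
  have hd := (hasDerivAt_Qt' h0 h1 i.2.1 i.2.2 (ySig lam i.1.1 i.1.2 x)).comp x
    (hasDerivAt_ySig _ _ _ x)
  have e : Real.sqrt i.1.1 ^ 3 = i.1.1 * Real.sqrt i.1.1 := by
    rw [pow_succ, Real.sq_sqrt i.2.1.le]
  have hp := i.2.1
  have hs : Real.sqrt i.1.1 ≤ 1 := Real.sqrt_le_one.2 i.2.2.le
  have hs0 := Real.sqrt_nonneg i.1.1
  refine ⟨hd.differentiableAt, ?_, ?_⟩
  · rw [wExp, rVar, e]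
    exact abs_Qt'_le h0 h1 i.2.1 i.2.2 _
  · have hd' : deriv (fun x => Qt' lam i.1.1 (ySig lam i.1.1 i.1.2 x)) x = _ := hd.deriv
    rw [hd', mul_one, wExp, rVar, e]
    generalize ySig lam i.1.1 i.1.2 x = s
    have a := theta_pos h0 h1 i.2.2
    have b := theta_le_one h0 h1 i.2.2
    have c := Q_le_exp (Real.sqrt i.1.1 * s)
    have d := Q_pos (Real.sqrt i.1.1 * s)
    have f := Q_le (Real.sqrt i.1.1 * s)
    -- This is `Q̃_σ'' = σ²θ (Q - Q²)(√σ s)`, and `|1 - Q| ≤ 1` because 0 < Q ≤ 3/2. One factor √σ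
    -- is given away, so the derivative is bounded by the same weight 3 as Y.
    have e' : Qt lam i.1.1 s * i.1.1 - Qt lam i.1.1 s ^ 2 * (theta lam i.1.1)⁻¹ =
        i.1.1 * Real.sqrt i.1.1 * (Real.sqrt i.1.1 * theta lam i.1.1) * (Q (Real.sqrt i.1.1 * s) *
          (1 - Q (Real.sqrt i.1.1 * s))) := by
      rw [Qt]
      field_simp
      rw [Real.sq_sqrt i.2.1.le]
    have g : |1 - Q (Real.sqrt i.1.1 * s)| ≤ 1 := abs_le.2 ⟨by linarith, by linarith⟩
    rw [e', abs_mul, abs_mul _ (1 - _), abs_of_pos d,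
      abs_of_nonneg (by positivity : 0 ≤ i.1.1 * Real.sqrt i.1.1 * (Real.sqrt i.1.1 * theta lam i.1.1))]
    calc _ ≤ i.1.1 * Real.sqrt i.1.1 * (1 * 1) * (6 * Real.exp (-|Real.sqrt i.1.1 * s|) * 1) := by
          gcongr
      _ = _ := by ring


/-! ### The residual of a sum of products -/

/-- `f1`, `f2`, `f3` are the first three derivatives of `f0`. -/
structure Chain (f0 f1 f2 f3 : ℝ → ℝ) : Prop where
  d0 : ∀ x, HasDerivAt f0 (f1 x) x
  d1 : ∀ x, HasDerivAt f1 (f2 x) x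
  d2 : ∀ x, HasDerivAt f2 (f3 x) x

theorem Chain.of_contDiff {f : ℝ → ℝ} (hf : ContDiff ℝ ∞ f) :
    Chain (iteratedDeriv 0 f) (iteratedDeriv 1 f) (iteratedDeriv 2 f) (iteratedDeriv 3 f) := by
  have h : ∀ n x, HasDerivAt (iteratedDeriv n f) (iteratedDeriv (n + 1) f x) x := fun n x => by
    rw [iteratedDeriv_succ]
    exact ((hf.differentiable_iteratedDeriv n (by exact_mod_cast WithTop.coe_lt_top _)) x).hasDerivAt
  exact ⟨h 0, h 1, h 2⟩

theorem Chain.const (c : ℝ) : Chain (fun _ => c) (fun _ => 0) (fun _ => 0) fun _ => 0 :=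
  ⟨fun x => hasDerivAt_const x c, fun x => hasDerivAt_const x 0, fun x => hasDerivAt_const x 0⟩

theorem Chain.mul_const {f0 f1 f2 f3 : ℝ → ℝ} (h : Chain f0 f1 f2 f3) (c : ℝ) :
    Chain (fun x => f0 x * c) (fun x => f1 x * c) (fun x => f2 x * c) fun x => f3 x * c :=
  ⟨fun x => (h.d0 x).mul_const c, fun x => (h.d1 x).mul_const c, fun x => (h.d2 x).mul_const c⟩

theorem Chain.congr {f0 f1 f2 f3 g0 g1 g2 g3 : ℝ → ℝ} (h : Chain f0 f1 f2 f3)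
    (h0 : ∀ x, f0 x = g0 x) (h1 : ∀ x, f1 x = g1 x) (h2 : ∀ x, f2 x = g2 x)
    (h3 : ∀ x, f3 x = g3 x) : Chain g0 g1 g2 g3 := by
  rw [← funext h0, ← funext h1, ← funext h2, ← funext h3]; exact h

/-- `u` has the derivatives occurring in the residual at time `t`; `ux` is `∂ₓu` and `lin` is
`(1 - λ∂ₓ²)∂ₜu + ∂ₓ³u - ∂ₓu`. -/
def Jet (lam : ℝ) (u : ℝ → ℝ → ℝ) (t : ℝ) (ux lin : ℝ → ℝ) : Prop :=
  ∃ ut utx utxx uxx uxxx : ℝ → ℝ,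
    (∀ x, HasDerivAt (fun s => u s x) (ut x) t) ∧ (∀ x, HasDerivAt ut (utx x) x) ∧
    (∀ x, HasDerivAt utx (utxx x) x) ∧ (∀ x, HasDerivAt (u t) (ux x) x) ∧
    (∀ x, HasDerivAt ux (uxx x) x) ∧ (∀ x, HasDerivAt uxx (uxxx x) x) ∧
    ∀ x, lin x = ut x - lam * utxx x + uxxx x - ux x

theorem Jet.add {lam t : ℝ} {u v : ℝ → ℝ → ℝ} {ux vx ul vl : ℝ → ℝ} (hu : Jet lam u t ux ul)
    (hv : Jet lam v t vx vl) : Jet lam (fun s x => u s x + v s x) t (fun x => ux x + vx x)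
      fun x => ul x + vl x := by
  obtain ⟨a, b, c, d, e, h1, h2, h3, h4, h5, h6, h7⟩ := hu
  obtain ⟨a', b', c', d', e', h1', h2', h3', h4', h5', h6', h7'⟩ := hv
  exact ⟨_, _, _, _, _, fun x => (h1 x).add (h1' x), fun x => (h2 x).add (h2' x),
    fun x => (h3 x).add (h3' x), fun x => (h4 x).add (h4' x), fun x => (h5 x).add (h5' x),
    fun x => (h6 x).add (h6' x), fun x => by simp only [h7, h7']; ring⟩

theorem Jet.residual_eq {lam t : ℝ} {u : ℝ → ℝ → ℝ} {ux lin : ℝ → ℝ} (h : Jet lam u t ux lin)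
    (x : ℝ) : residual lam u t x = lin x + 2 * u t x * ux x := by
  obtain ⟨a, b, c, d, e, h1, h2, h3, h4, h5, h6, h7⟩ := h
  have e1 : (fun ξ => deriv (fun s => u s ξ) t) = a := funext fun x => (h1 x).deriv
  have e2 : iteratedDeriv 2 a = c := by
    rw [iteratedDeriv_two, show deriv a = b from funext fun x => (h2 x).deriv]
    exact funext fun x => (h3 x).deriv
  have e3 : iteratedDeriv 2 (u t) = d := by
    rw [iteratedDeriv_two, show deriv (u t) = ux from funext fun x => (h4 x).deriv]
    exact funext fun x => (h5 x).deriv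
  have e4 : deriv (fun ξ => d ξ - u t ξ + u t ξ ^ 2) x = _ :=
    (((h6 x).sub (h4 x)).add ((h4 x).pow 2)).deriv
  rw [residual, e1, e2, e3, (h1 x).deriv, e4, h7]
  norm_num
  ring

/-- The jet of `f(x - α(x + μt)) g(x + μt)`. -/
theorem jet_prod {lam m t : ℝ} {al b b1 b2 f0 f1 f2 f3 g0 g1 g2 g3 : ℝ → ℝ}
    (hf : Chain f0 f1 f2 f3) (hg : Chain g0 g1 g2 g3) (hal : Chain al b b1 b2) :
    Jet lam (fun t x => f0 (x - al (x + m * t)) * g0 (x + m * t)) t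
      (fun x => (1 - b (x + m * t)) * f1 (x - al (x + m * t)) * g0 (x + m * t) +
        f0 (x - al (x + m * t)) * g1 (x + m * t))
      fun x => prodLin lam m (f0 (x - al (x + m * t))) (f1 (x - al (x + m * t)))
        (f2 (x - al (x + m * t))) (f3 (x - al (x + m * t))) (g0 (x + m * t)) (g1 (x + m * t))
        (g2 (x + m * t)) (g3 (x + m * t)) (b (x + m * t)) (b1 (x + m * t)) (b2 (x + m * t)) := by
  have hs : ∀ x, HasDerivAt (fun x => x + m * t) 1 x := fun x => (hasDerivAt_id x).add_const _
  have hst : ∀ x, HasDerivAt (fun t => x + m * t) m t := fun x => by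
    simpa using ((hasDerivAt_id t).const_mul m).const_add x
  have cs : ∀ {g g' : ℝ → ℝ}, (∀ x, HasDerivAt g (g' x) x) →
      ∀ x, HasDerivAt (fun x => g (x + m * t)) (g' (x + m * t)) x := fun h x => by
    exact ((h (x + m * t)).comp x (hs x)).congr_deriv (mul_one _)
  have cy : ∀ {g g' : ℝ → ℝ}, (∀ x, HasDerivAt g (g' x) x) →
      ∀ x, HasDerivAt (fun x => g (x - al (x + m * t)))
        ((1 - b (x + m * t)) * g' (x - al (x + m * t))) x := fun h x => by
    have := (h (x - al (x + m * t))).comp x ((hasDerivAt_id x).sub (cs hal.d0 x))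
    exact this.congr_deriv (mul_comm _ _)
  have first : ∀ {f f' g g' : ℝ → ℝ}, (∀ x, HasDerivAt f (f' x) x) →
      (∀ x, HasDerivAt g (g' x) x) → ∀ x,
      HasDerivAt (fun x => f (x - al (x + m * t)) * g (x + m * t))
        ((1 - b (x + m * t)) * f' (x - al (x + m * t)) * g (x + m * t) +
          f (x - al (x + m * t)) * g' (x + m * t)) x := fun hf hg x => (cy hf x).mul (cs hg x)
  have second : ∀ {f f' f'' g g' g'' : ℝ → ℝ}, (∀ x, HasDerivAt f (f' x) x) →
      (∀ x, HasDerivAt f' (f'' x) x) → (∀ x, HasDerivAt g (g' x) x) →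
      (∀ x, HasDerivAt g' (g'' x) x) → ∀ x,
      HasDerivAt (fun x => (1 - b (x + m * t)) * f' (x - al (x + m * t)) * g (x + m * t) +
          f (x - al (x + m * t)) * g' (x + m * t))
        (prodDxx (f (x - al (x + m * t))) (f' (x - al (x + m * t))) (f'' (x - al (x + m * t)))
          (g (x + m * t)) (g' (x + m * t)) (g'' (x + m * t)) (b (x + m * t)) (b1 (x + m * t))) x :=
    fun hf hf' hg hg' x => (((((cs hal.d1 x).const_sub 1).mul (cy hf' x)).mul (cs hg x)).add
      ((cy hf x).mul (cs hg' x))).congr_deriv (by simp only [prodDxx, Pi.mul_apply]; ring)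
  have dbg : ∀ x, HasDerivAt (fun x => -(b x * g0 x)) (-(b1 x * g0 x + b x * g1 x)) x :=
    fun x => ((hal.d1 x).mul (hg.d0 x)).neg
  have dbg' : ∀ x, HasDerivAt (fun x => -(b1 x * g0 x + b x * g1 x))
      (-(b2 x * g0 x + 2 * b1 x * g1 x + b x * g2 x)) x := fun x =>
    (((hal.d2 x).mul (hg.d0 x)).add ((hal.d1 x).mul (hg.d1 x))).neg.congr_deriv (by ring)
  have third : ∀ x, HasDerivAt (fun x => prodDxx (f0 (x - al (x + m * t))) (f1 (x - al (x
      + m * t))) (f2 (x - al (x + m * t)))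
      (g0 (x + m * t)) (g1 (x + m * t)) (g2 (x + m * t)) (b (x + m * t)) (b1 (x + m * t)))
      ((1 - b (x + m * t)) ^ 3 * f3 (x - al (x + m * t)) * g0 (x + m * t) - 3 * (1 - b (x
          + m * t)) * b1 (x + m * t) * f2 (x - al (x + m * t)) * g0 (x + m * t) - b2 (x
          + m * t) * f1 (x - al (x + m * t)) * g0 (x + m * t) + 3 * (1 - b (x + m * t)) ^ 2 * f2 (x
          - al (x + m * t)) * g1 (x + m * t) - 3 * b1 (x + m * t) * f1 (x - al (x + m * t)) * g1 (x
          + m * t) + 3 * (1 - b (x + m * t)) * f1 (x - al (x + m * t)) * g2 (x + m * t) + f0 (x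
          - al (x + m * t)) * g3 (x + m * t)) x := fun x =>
    ((((((((cs hal.d1 x).const_sub 1).pow 2).mul (cy hf.d2 x)).mul (cs hg.d0 x)).sub
      (((cs hal.d2 x).mul (cy hf.d1 x)).mul (cs hg.d0 x))).add
      (((((cs hal.d1 x).const_sub 1).const_mul 2).mul (cy hf.d1 x)).mul (cs hg.d1 x))).add
      ((cy hf.d0 x).mul (cs hg.d2 x))).congr_deriv (by
        simp only [Pi.mul_apply, Pi.pow_apply]
        push_cast
        ring)
  -- The time derivative is itself a sum of two products, `f0 · g1` and `f1 · (-b g0)`, so the rule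
  -- for the second x-derivative applies to it again.
  refine ⟨fun x => m * (f0 (x - al (x + m * t)) * g1 (x + m * t) +
      f1 (x - al (x + m * t)) * -(b (x + m * t) * g0 (x + m * t))), _, _, _, _, fun x => ?_,
    fun x => ((first hf.d0 hg.d1 x).add (first hf.d1 dbg x)).const_mul m,
    fun x => ((second hf.d0 hf.d1 hg.d1 hg.d2 x).add
      (second hf.d1 hf.d2 dbg dbg' x)).const_mul m,
    first hf.d0 hg.d0, second hf.d0 hf.d1 hg.d0 hg.d1, third, fun x => ?_⟩
  · have hy : HasDerivAt (fun t => x - al (x + m * t)) (-(b (x + m * t) * m)) t :=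
      ((hal.d0 (x + m * t)).comp t (hst x)).const_sub x
    exact (((hf.d0 _).comp t hy).mul ((hg.d0 _).comp t (hst x))).congr_deriv (by
      simp only [Function.comp_apply]; ring)
  · simp only [prodLin]
    ring

/-! ### The powers of the small soliton -/

theorem hasDerivAt_congr {f g : ℝ → ℝ} {f' g' x : ℝ} (h : HasDerivAt f f' x)
    (hf : ∀ x, f x = g x) (h' : f' = g') : HasDerivAt g g' x := by
  rw [← h', ← funext hf]; exact h

section Powers
variable {X Y : ℝ → ℝ} {s n : ℝ}

/-- The equations `X' = Y`, `Y' = sX - nX²` keep the polynomials in X, Y stable under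
differentiation. The truncated exponents `i - 1`, `j - 1` do no harm at 0, being multiplied by `i`,
`j`. -/
theorem hasDerivAt_monomial (hX : ∀ x, HasDerivAt X (Y x) x)
    (hY : ∀ x, HasDerivAt Y (X x * s - X x ^ 2 * n) x) (c : ℝ) (i j : ℕ) (x : ℝ) :
    HasDerivAt (fun x => c * (X x ^ i * Y x ^ j))
      (c * (i * X x ^ (i - 1) * Y x * Y x ^ j +
        X x ^ i * (j * Y x ^ (j - 1) * (X x * s - X x ^ 2 * n)))) x :=
  (((hX x).pow i).mul ((hY x).pow j)).const_mul c

theorem chain_pow_one (hX : ∀ x, HasDerivAt X (Y x) x)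
    (hY : ∀ x, HasDerivAt Y (X x * s - X x ^ 2 * n) x) :
    Chain (fun x => X x) (fun x => Y x) (fun x => X x * s
        - X x ^ 2 * n) (fun x => -2 * X x * Y x * n + Y x * s) ∧
    Chain (fun x => Y x) (fun x => X x * s - X x ^ 2 * n) (fun x => -2 * X x * Y x * n + Y x * s)
      fun x => X x * s ^ 2 - 3 * X x ^ 2 * n * s + 2 * X x ^ 3 * n ^ 2 - 2 * Y x ^ 2 * n := by
  have M := hasDerivAt_monomial hX hY
  have h0 : ∀ x, HasDerivAt (fun x => X x) (Y x) x := fun x =>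
    hasDerivAt_congr (M 1 1 0 x)
      (fun x => by ring) (by norm_num <;> ring)
  have h1 : ∀ x, HasDerivAt (fun x => Y x) (X x * s - X x ^ 2 * n) x := fun x =>
    hasDerivAt_congr (M 1 0 1 x)
      (fun x => by ring) (by norm_num <;> ring)
  have h2 : ∀ x, HasDerivAt (fun x => X x * s - X x ^ 2 * n) (-2 * X x * Y x * n
      + Y x * s) x := fun x =>
    hasDerivAt_congr ((M (1 * s) 1 0 x).add (M (-1 * n) 2 0 x))
      (fun x => by simp only [Pi.add_apply]; ring) (by norm_num <;> ring)
  have h3 : ∀ x, HasDerivAt (fun x => -2 * X x * Y x * n + Y x * s) (X x * s ^ 2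
      - 3 * X x ^ 2 * n * s + 2 * X x ^ 3 * n ^ 2 - 2 * Y x ^ 2 * n) x := fun x =>
    hasDerivAt_congr ((M (1 * s) 0 1 x).add (M (-2 * n) 1 1 x))
      (fun x => by simp only [Pi.add_apply]; ring) (by norm_num <;> ring)
  exact ⟨⟨h0, h1, h2⟩, ⟨h1, h2, h3⟩⟩

theorem chain_pow_two (hX : ∀ x, HasDerivAt X (Y x) x)
    (hY : ∀ x, HasDerivAt Y (X x * s - X x ^ 2 * n) x) :
    Chain (fun x => X x ^ 2) (fun x => 2 * X x * Y x) (fun x => 2 * X x ^ 2 * s - 2 * X x ^ 3 * n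
        + 2 * Y x ^ 2) (fun x => 8 * X x * Y x * s - 10 * X x ^ 2 * Y x * n) ∧
    Chain (fun x => 2 * X x * Y x) (fun x => 2 * X x ^ 2 * s - 2 * X x ^ 3 * n
        + 2 * Y x ^ 2) (fun x => 8 * X x * Y x * s - 10 * X x ^ 2 * Y x * n)
      fun x => -20 * X x * Y x ^ 2 * n + 8 * X x ^ 2 * s ^ 2 - 18 * X x ^ 3 * n * s
          + 10 * X x ^ 4 * n ^ 2 + 8 * Y x ^ 2 * s := by
  have M := hasDerivAt_monomial hX hY
  have h0 : ∀ x, HasDerivAt (fun x => X x ^ 2) (2 * X x * Y x) x := fun x =>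
    hasDerivAt_congr (M 1 2 0 x)
      (fun x => by ring) (by norm_num <;> ring)
  have h1 : ∀ x, HasDerivAt (fun x => 2 * X x * Y x) (2 * X x ^ 2 * s - 2 * X x ^ 3 * n
      + 2 * Y x ^ 2) x := fun x =>
    hasDerivAt_congr (M 2 1 1 x)
      (fun x => by ring) (by norm_num <;> ring)
  have h2 : ∀ x, HasDerivAt (fun x => 2 * X x ^ 2 * s - 2 * X x ^ 3 * n
      + 2 * Y x ^ 2) (8 * X x * Y x * s - 10 * X x ^ 2 * Y x * n) x := fun x =>
    hasDerivAt_congr (((M 2 0 2 x).add (M (2 * s) 2 0 x)).add (M (-2 * n) 3 0 x))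
      (fun x => by simp only [Pi.add_apply]; ring) (by norm_num <;> ring)
  have h3 : ∀ x, HasDerivAt (fun x => 8 * X x * Y x * s
      - 10 * X x ^ 2 * Y x * n) (-20 * X x * Y x ^ 2 * n + 8 * X x ^ 2 * s ^ 2
      - 18 * X x ^ 3 * n * s + 10 * X x ^ 4 * n ^ 2 + 8 * Y x ^ 2 * s) x := fun x =>
    hasDerivAt_congr ((M (8 * s) 1 1 x).add (M (-10 * n) 2 1 x))
      (fun x => by simp only [Pi.add_apply]; ring) (by norm_num <;> ring)
  exact ⟨⟨h0, h1, h2⟩, ⟨h1, h2, h3⟩⟩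

theorem chain_pow_three (hX : ∀ x, HasDerivAt X (Y x) x)
    (hY : ∀ x, HasDerivAt Y (X x * s - X x ^ 2 * n) x) :
    Chain (fun x => X x ^ 3) (fun x => 3 * X x ^ 2 * Y x) (fun x => 6 * X x * Y x ^ 2
        + 3 * X x ^ 3 * s - 3 * X x ^ 4 * n) (fun x => 21 * X x ^ 2 * Y x * s
        - 24 * X x ^ 3 * Y x * n + 6 * Y x ^ 3) ∧
    Chain (fun x => 3 * X x ^ 2 * Y x) (fun x => 6 * X x * Y x ^ 2 + 3 * X x ^ 3 * s
        - 3 * X x ^ 4 * n) (fun x => 21 * X x ^ 2 * Y x * s - 24 * X x ^ 3 * Y x * n + 6 * Y x ^ 3)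
      fun x => 60 * X x * Y x ^ 2 * s - 90 * X x ^ 2 * Y x ^ 2 * n + 21 * X x ^ 3 * s ^ 2
          - 45 * X x ^ 4 * n * s + 24 * X x ^ 5 * n ^ 2 := by
  have M := hasDerivAt_monomial hX hY
  have h0 : ∀ x, HasDerivAt (fun x => X x ^ 3) (3 * X x ^ 2 * Y x) x := fun x =>
    hasDerivAt_congr (M 1 3 0 x)
      (fun x => by ring) (by norm_num <;> ring)
  have h1 : ∀ x, HasDerivAt (fun x => 3 * X x ^ 2 * Y x) (6 * X x * Y x ^ 2 + 3 * X x ^ 3 * s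
      - 3 * X x ^ 4 * n) x := fun x =>
    hasDerivAt_congr (M 3 2 1 x)
      (fun x => by ring) (by norm_num <;> ring)
  have h2 : ∀ x, HasDerivAt (fun x => 6 * X x * Y x ^ 2 + 3 * X x ^ 3 * s
      - 3 * X x ^ 4 * n) (21 * X x ^ 2 * Y x * s - 24 * X x ^ 3 * Y x * n
      + 6 * Y x ^ 3) x := fun x =>
    hasDerivAt_congr (((M 6 1 2 x).add (M (3 * s) 3 0 x)).add (M (-3 * n) 4 0 x))
      (fun x => by simp only [Pi.add_apply]; ring) (by norm_num <;> ring)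
  have h3 : ∀ x, HasDerivAt (fun x => 21 * X x ^ 2 * Y x * s - 24 * X x ^ 3 * Y x * n
      + 6 * Y x ^ 3) (60 * X x * Y x ^ 2 * s - 90 * X x ^ 2 * Y x ^ 2 * n + 21 * X x ^ 3 * s ^ 2
      - 45 * X x ^ 4 * n * s + 24 * X x ^ 5 * n ^ 2) x := fun x =>
    hasDerivAt_congr (((M 6 0 3 x).add (M (21 * s) 2 1 x)).add (M (-24 * n) 3 1 x))
      (fun x => by simp only [Pi.add_apply]; ring) (by norm_num <;> ring)
  exact ⟨⟨h0, h1, h2⟩, ⟨h1, h2, h3⟩⟩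

end Powers


/-! ### The residual of the approximate solution as a polynomial -/

/-- Values, in a ring, of the quantities entering the residual: `X = Q̃_σ`, `Y = Q̃_σ'`,
`n = 1/θ_σ`, and the derivatives of `Q`, `A_{k,l}`, `B_{k,l}`. -/
structure Symbols (R : Type*) where
  lam : R
  mu : R
  s : R
  X : R
  Y : R
  n : R
  a : ℕ → ℕ → R
  q : ℕ → R
  A : ℕ → ℕ → ℕ → R
  B : ℕ → ℕ → ℕ → R

namespace Symbols

/-- The image under a ring homomorphism. -/
def map {R S : Type*} [CommRing R] [CommRing S] (D : Symbols R) (φ : R →+* S) : Symbols S where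
  lam := φ D.lam
  mu := φ D.mu
  s := φ D.s
  X := φ D.X
  Y := φ D.Y
  n := φ D.n
  a k l := φ (D.a k l)
  q j := φ (D.q j)
  A k l j := φ (D.A k l j)
  B k l j := φ (D.B k l j)

variable {R S : Type*} [CommRing R] [CommRing S] (D : Symbols R)

/-- `β`. -/
def b : R :=
  D.X * D.a 1 0 + D.X * D.a 1 1 * D.s + D.X * D.a 1 2 * D.s ^ 2 + D.X ^ 2 * D.a 2 0 + D.X ^ 2 *
  D.a 2 1 * D.s + D.X ^ 3 * D.a 3 0

/-- `β'`. -/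
def b1 : R :=
  2 * D.X * D.Y * D.a 2 0 + 2 * D.X * D.Y * D.a 2 1 * D.s + 3 * D.X ^ 2 * D.Y * D.a 3 0 + D.Y *
  D.a 1 0 + D.Y * D.a 1 1 * D.s + D.Y * D.a 1 2 * D.s ^ 2

/-- `β''`. -/
def b2 : R :=
  6 * D.X * D.Y ^ 2 * D.a 3 0 + D.X * D.a 1 0 * D.s + D.X * D.a 1 1 * D.s ^ 2 + D.X * D.a 1 2 *
  D.s ^ 3 - D.X ^ 2 * D.a 1 0 * D.n - D.X ^ 2 * D.a 1 1 * D.n * D.s - D.X ^ 2 * D.a 1 2 * D.n *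
  D.s ^ 2 + 2 * D.X ^ 2 * D.a 2 0 * D.s + 2 * D.X ^ 2 * D.a 2 1 * D.s ^ 2 - 2 * D.X ^ 3 * D.a 2 0
  * D.n - 2 * D.X ^ 3 * D.a 2 1 * D.n * D.s + 3 * D.X ^ 3 * D.a 3 0 * D.s - 3 * D.X ^ 4 * D.a 3 0
  * D.n + 2 * D.Y ^ 2 * D.a 2 0 + 2 * D.Y ^ 2 * D.a 2 1 * D.s

/-- The approximate solution. -/
def z : R :=
  D.A 1 0 0 * D.X + D.A 1 1 0 * D.X * D.s + D.A 1 2 0 * D.X * D.s ^ 2 + D.A 2 0 0 * D.X ^ 2 + D.A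
  2 1 0 * D.X ^ 2 * D.s + D.A 3 0 0 * D.X ^ 3 + D.B 1 0 0 * D.Y + D.B 1 1 0 * D.Y * D.s + D.B 1 2
  0 * D.Y * D.s ^ 2 + 2 * D.B 2 0 0 * D.X * D.Y + 2 * D.B 2 1 0 * D.X * D.Y * D.s + 3 * D.B 3 0 0
  * D.X ^ 2 * D.Y + D.X + D.q 0

/-- Its derivative in `x`. -/
def zx : R :=
  (1 - D.b) * (D.A 1 0 1 * D.X + D.A 1 1 1 * D.X * D.s + D.A 1 2 1 * D.X * D.s ^ 2 + D.A 2 0 1 *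
  D.X ^ 2 + D.A 2 1 1 * D.X ^ 2 * D.s + D.A 3 0 1 * D.X ^ 3 + D.B 1 0 1 * D.Y + D.B 1 1 1 * D.Y *
  D.s + D.B 1 2 1 * D.Y * D.s ^ 2 + 2 * D.B 2 0 1 * D.X * D.Y + 2 * D.B 2 1 1 * D.X * D.Y * D.s +
  3 * D.B 3 0 1 * D.X ^ 2 * D.Y + D.q 1) + (D.A 1 0 0 * D.Y + D.A 1 1 0 * D.Y * D.s + D.A 1 2 0 *
  D.Y * D.s ^ 2 + 2 * D.A 2 0 0 * D.X * D.Y + 2 * D.A 2 1 0 * D.X * D.Y * D.s + 3 * D.A 3 0 0 *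
  D.X ^ 2 * D.Y + D.B 1 0 0 * D.X * D.s - D.B 1 0 0 * D.X ^ 2 * D.n + D.B 1 1 0 * D.X * D.s ^ 2 -
  D.B 1 1 0 * D.X ^ 2 * D.n * D.s + D.B 1 2 0 * D.X * D.s ^ 3 - D.B 1 2 0 * D.X ^ 2 * D.n * D.s ^
  2 + 2 * D.B 2 0 0 * D.X ^ 2 * D.s - 2 * D.B 2 0 0 * D.X ^ 3 * D.n + 2 * D.B 2 0 0 * D.Y ^ 2 + 2
  * D.B 2 1 0 * D.X ^ 2 * D.s ^ 2 - 2 * D.B 2 1 0 * D.X ^ 3 * D.n * D.s + 2 * D.B 2 1 0 * D.Y ^ 2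
  * D.s + 6 * D.B 3 0 0 * D.X * D.Y ^ 2 + 3 * D.B 3 0 0 * D.X ^ 3 * D.s - 3 * D.B 3 0 0 * D.X ^ 4
  * D.n + D.Y)

/-- Its residual. -/
def res : R :=
    prodLin D.lam D.mu (D.q 0) (D.q 1) (D.q 2) (D.q 3) (1) (0) (0) (0) D.b D.b1 D.b2
    + prodLin D.lam D.mu 1 0 0 0 (D.X) (D.Y) (D.X * D.s - D.X ^ 2 * D.n) (- 2 * D.X * D.Y * D.n +
    D.Y * D.s) D.b D.b1 D.b2
    + prodLin D.lam D.mu (D.A 1 0 0) (D.A 1 0 1) (D.A 1 0 2) (D.A 1 0 3) (D.X) (D.Y) (D.X * D.s -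
    D.X ^ 2 * D.n) (- 2 * D.X * D.Y * D.n + D.Y * D.s) D.b D.b1 D.b2
    + prodLin D.lam D.mu (D.B 1 0 0) (D.B 1 0 1) (D.B 1 0 2) (D.B 1 0 3) (D.Y) (D.X * D.s - D.X ^
    2 * D.n) (- 2 * D.X * D.Y * D.n + D.Y * D.s) (D.X * D.s ^ 2 - 3 * D.X ^ 2 * D.n * D.s + 2 *
    D.X ^ 3 * D.n ^ 2 - 2 * D.Y ^ 2 * D.n) D.b D.b1 D.b2
    + prodLin D.lam D.mu (D.A 1 1 0) (D.A 1 1 1) (D.A 1 1 2) (D.A 1 1 3) (D.X * D.s) (D.Y * D.s)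
    (D.X * D.s ^ 2 - D.X ^ 2 * D.n * D.s) (- 2 * D.X * D.Y * D.n * D.s + D.Y * D.s ^ 2) D.b D.b1
    D.b2
    + prodLin D.lam D.mu (D.B 1 1 0) (D.B 1 1 1) (D.B 1 1 2) (D.B 1 1 3) (D.Y * D.s) (D.X * D.s ^
    2 - D.X ^ 2 * D.n * D.s) (- 2 * D.X * D.Y * D.n * D.s + D.Y * D.s ^ 2) (D.X * D.s ^ 3 - 3 *
    D.X ^ 2 * D.n * D.s ^ 2 + 2 * D.X ^ 3 * D.n ^ 2 * D.s - 2 * D.Y ^ 2 * D.n * D.s) D.b D.b1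
    D.b2
    + prodLin D.lam D.mu (D.A 1 2 0) (D.A 1 2 1) (D.A 1 2 2) (D.A 1 2 3) (D.X * D.s ^ 2) (D.Y *
    D.s ^ 2) (D.X * D.s ^ 3 - D.X ^ 2 * D.n * D.s ^ 2) (- 2 * D.X * D.Y * D.n * D.s ^ 2 + D.Y *
    D.s ^ 3) D.b D.b1 D.b2
    + prodLin D.lam D.mu (D.B 1 2 0) (D.B 1 2 1) (D.B 1 2 2) (D.B 1 2 3) (D.Y * D.s ^ 2) (D.X *
    D.s ^ 3 - D.X ^ 2 * D.n * D.s ^ 2) (- 2 * D.X * D.Y * D.n * D.s ^ 2 + D.Y * D.s ^ 3) (D.X *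
    D.s ^ 4 - 3 * D.X ^ 2 * D.n * D.s ^ 3 + 2 * D.X ^ 3 * D.n ^ 2 * D.s ^ 2 - 2 * D.Y ^ 2 * D.n *
    D.s ^ 2) D.b D.b1 D.b2
    + prodLin D.lam D.mu (D.A 2 0 0) (D.A 2 0 1) (D.A 2 0 2) (D.A 2 0 3) (D.X ^ 2) (2 * D.X *
    D.Y) (2 * D.X ^ 2 * D.s - 2 * D.X ^ 3 * D.n + 2 * D.Y ^ 2) (8 * D.X * D.Y * D.s - 10 * D.X ^
    2 * D.Y * D.n) D.b D.b1 D.b2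
    + prodLin D.lam D.mu (D.B 2 0 0) (D.B 2 0 1) (D.B 2 0 2) (D.B 2 0 3) (2 * D.X * D.Y) (2 * D.X
    ^ 2 * D.s - 2 * D.X ^ 3 * D.n + 2 * D.Y ^ 2) (8 * D.X * D.Y * D.s - 10 * D.X ^ 2 * D.Y * D.n)
    (- 20 * D.X * D.Y ^ 2 * D.n + 8 * D.X ^ 2 * D.s ^ 2 - 18 * D.X ^ 3 * D.n * D.s + 10 * D.X ^ 4
    * D.n ^ 2 + 8 * D.Y ^ 2 * D.s) D.b D.b1 D.b2
    + prodLin D.lam D.mu (D.A 2 1 0) (D.A 2 1 1) (D.A 2 1 2) (D.A 2 1 3) (D.X ^ 2 * D.s) (2 * D.X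
    * D.Y * D.s) (2 * D.X ^ 2 * D.s ^ 2 - 2 * D.X ^ 3 * D.n * D.s + 2 * D.Y ^ 2 * D.s) (8 * D.X *
    D.Y * D.s ^ 2 - 10 * D.X ^ 2 * D.Y * D.n * D.s) D.b D.b1 D.b2
    + prodLin D.lam D.mu (D.B 2 1 0) (D.B 2 1 1) (D.B 2 1 2) (D.B 2 1 3) (2 * D.X * D.Y * D.s) (2
    * D.X ^ 2 * D.s ^ 2 - 2 * D.X ^ 3 * D.n * D.s + 2 * D.Y ^ 2 * D.s) (8 * D.X * D.Y * D.s ^ 2 -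
    10 * D.X ^ 2 * D.Y * D.n * D.s) (- 20 * D.X * D.Y ^ 2 * D.n * D.s + 8 * D.X ^ 2 * D.s ^ 3 -
    18 * D.X ^ 3 * D.n * D.s ^ 2 + 10 * D.X ^ 4 * D.n ^ 2 * D.s + 8 * D.Y ^ 2 * D.s ^ 2) D.b D.b1
    D.b2
    + prodLin D.lam D.mu (D.A 3 0 0) (D.A 3 0 1) (D.A 3 0 2) (D.A 3 0 3) (D.X ^ 3) (3 * D.X ^ 2 *
    D.Y) (6 * D.X * D.Y ^ 2 + 3 * D.X ^ 3 * D.s - 3 * D.X ^ 4 * D.n) (21 * D.X ^ 2 * D.Y * D.s -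
    24 * D.X ^ 3 * D.Y * D.n + 6 * D.Y ^ 3) D.b D.b1 D.b2
    + prodLin D.lam D.mu (D.B 3 0 0) (D.B 3 0 1) (D.B 3 0 2) (D.B 3 0 3) (3 * D.X ^ 2 * D.Y) (6 *
    D.X * D.Y ^ 2 + 3 * D.X ^ 3 * D.s - 3 * D.X ^ 4 * D.n) (21 * D.X ^ 2 * D.Y * D.s - 24 * D.X ^
    3 * D.Y * D.n + 6 * D.Y ^ 3) (60 * D.X * D.Y ^ 2 * D.s - 90 * D.X ^ 2 * D.Y ^ 2 * D.n + 21 *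
    D.X ^ 3 * D.s ^ 2 - 45 * D.X ^ 4 * D.n * D.s + 24 * D.X ^ 5 * D.n ^ 2) D.b D.b1 D.b2
    + 2 * D.z * D.zx

theorem map_b (φ : R →+* S) : φ D.b = (D.map φ).b := by
  simp only [b, Symbols.map, map_add, map_sub, map_mul, map_pow, map_neg, map_ofNat]

theorem map_b1 (φ : R →+* S) : φ D.b1 = (D.map φ).b1 := by
  simp only [b1, Symbols.map, map_add, map_sub, map_mul, map_pow, map_neg, map_ofNat]

theorem map_b2 (φ : R →+* S) : φ D.b2 = (D.map φ).b2 := by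
  simp only [b2, Symbols.map, map_add, map_sub, map_mul, map_pow, map_neg, map_ofNat]

theorem map_z (φ : R →+* S) : φ D.z = (D.map φ).z := by
  simp only [z, Symbols.map, map_add, map_sub, map_mul, map_pow, map_neg, map_ofNat]

theorem map_zx (φ : R →+* S) : φ D.zx = (D.map φ).zx := by
  simp only [zx, map_add, map_sub, map_mul, map_pow, map_neg, map_ofNat, map_one, map_b]
  rfl

theorem map_res (φ : R →+* S) : φ D.res = (D.map φ).res := by
  simp only [res, map_add, map_sub, map_mul, map_pow, map_neg, map_ofNat, map_one, map_zero,
    map_b, map_b1, map_b2, map_z, map_zx, map_prodLin]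
  rfl

end Symbols


theorem sum_Sigma0 (F : ℕ × ℕ → ℝ) : ∑ p ∈ Sigma0, F p =
    F (1, 0) + F (1, 1) + F (1, 2) + F (2, 0) + F (2, 1) + F (3, 0) := by
  rw [show Sigma0 = {(1, 0), (1, 1), (1, 2), (2, 0), (2, 1), (3, 0)} by decide]
  rw [Finset.sum_insert (by decide), Finset.sum_insert (by decide), Finset.sum_insert (by decide),
    Finset.sum_insert (by decide), Finset.sum_insert (by decide), Finset.sum_singleton]
  ring

theorem Chain.add {f0 f1 f2 f3 g0 g1 g2 g3 : ℝ → ℝ} (h : Chain f0 f1 f2 f3)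
    (h' : Chain g0 g1 g2 g3) : Chain (fun x => f0 x + g0 x) (fun x => f1 x + g1 x)
      (fun x => f2 x + g2 x) fun x => f3 x + g3 x :=
  ⟨fun x => (h.d0 x).add (h'.d0 x), fun x => (h.d1 x).add (h'.d1 x),
    fun x => (h.d2 x).add (h'.d2 x)⟩

/-- The values of the symbols for the approximate solution. -/
noncomputable def realSymb (lam sig : ℝ) (P : Profile) (y s : ℝ) : Symbols ℝ where
  lam := lam
  mu := mu lam sig
  s := sig
  X := Qt lam sig s
  Y := Qt' lam sig s
  n := (theta lam sig)⁻¹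
  a := P.a
  q j := iteratedDeriv j Q y
  A k l j := iteratedDeriv j (P.A k l) y
  B k l j := iteratedDeriv j (P.B k l) y

theorem beta_eq (lam sig : ℝ) (P : Profile) (s : ℝ) :
    beta lam sig P s = (realSymb lam sig P 0 s).b := by
  rw [beta, sum_Sigma0]
  simp only [Symbols.b, realSymb]
  ring

theorem contDiff_Qt (lam sig : ℝ) {n : WithTop ℕ∞} : ContDiff ℝ n (Qt lam sig) :=
  contDiff_const.mul (contDiff_Q.comp (contDiff_const.mul contDiff_id))

theorem contDiff_beta (lam sig : ℝ) (P : Profile) {n : WithTop ℕ∞} :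
    ContDiff ℝ n (beta lam sig P) :=
  ContDiff.sum fun _ _ => contDiff_const.mul ((contDiff_Qt lam sig).pow _)

theorem hasDerivAt_alpha (lam sig : ℝ) (P : Profile) (s : ℝ) :
    HasDerivAt (alpha lam sig P) (beta lam sig P s) s :=
  hasDerivAt_primitive (contDiff_beta lam sig P (n := 0)).continuous 0 s

theorem chain_alpha {lam sig : ℝ} (h0 : 0 < lam) (h1 : lam < 1) (hp : 0 < sig) (hs : sig < 1)
    (P : Profile) : Chain (alpha lam sig P)
    (fun s => (realSymb lam sig P 0 s).b) (fun s => (realSymb lam sig P 0 s).b1)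
    fun s => (realSymb lam sig P 0 s).b2 := by
  have hX := hasDerivAt_Qt lam sig
  have hY := hasDerivAt_Qt' h0 h1 hp hs
  have c1 := (chain_pow_one hX hY).1
  have c2 := (chain_pow_two hX hY).1
  have c3 := (chain_pow_three hX hY).1
  have c := ((((((c1.mul_const (P.a 1 0)).add (c1.mul_const (P.a 1 1 * sig))).add
    (c1.mul_const (P.a 1 2 * sig ^ 2))).add (c2.mul_const (P.a 2 0))).add
    (c2.mul_const (P.a 2 1 * sig))).add (c3.mul_const (P.a 3 0))).congr
    (g0 := fun s => (realSymb lam sig P 0 s).b) (g1 := fun s => (realSymb lam sig P 0 s).b1)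
    (g2 := fun s => (realSymb lam sig P 0 s).b2)
    (fun s => by simp only [Symbols.b, realSymb]; ring)
    (fun s => by simp only [Symbols.b1, realSymb]; ring)
    (fun s => by simp only [Symbols.b2, realSymb]; ring) (fun s => rfl)
  exact ⟨fun s => by rw [← beta_eq]; exact hasDerivAt_alpha lam sig P s, c.d0, c.d1⟩

/-- The linear part of the residual is additive over the fourteen products of the ansatz, and each
is given by `jet_prod`; the quadratic part is `2 z zₓ`. This is an exact identity, nothing being
discarded yet. -/
theorem residual_zApp {lam sig : ℝ} (h0 : 0 < lam) (h1 : lam < 1) (hp : 0 < sig) (hs : sig < 1)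
    {P : Profile} (hA : ∀ p ∈ Sigma0, ContDiff ℝ ∞ (P.A p.1 p.2))
    (hB : ∀ p ∈ Sigma0, ContDiff ℝ ∞ (P.B p.1 p.2)) (t x : ℝ) :
    residual lam (zApp lam sig P) t x =
      (realSymb lam sig P (yVar lam sig P t x) (ySig lam sig t x)).res := by
  have hX := hasDerivAt_Qt lam sig
  have hY := hasDerivAt_Qt' h0 h1 hp hs
  obtain ⟨c1, d1⟩ := chain_pow_one hX hY
  obtain ⟨c2, d2⟩ := chain_pow_two hX hY
  obtain ⟨c3, d3⟩ := chain_pow_three hX hY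
  have al := chain_alpha h0 h1 hp hs P
  have A : ∀ k l, (k, l) ∈ Sigma0 → Chain _ _ _ _ := fun k l h => Chain.of_contDiff (hA (k, l) h)
  have B : ∀ k l, (k, l) ∈ Sigma0 → Chain _ _ _ _ := fun k l h => Chain.of_contDiff (hB (k, l) h)
  let E : ℝ → Symbols ℝ := fun r => realSymb lam sig P 0 r
  have jQ := jet_prod (lam := lam) (m := mu lam sig) (t := t) (Chain.of_contDiff contDiff_Q) (Chain.const 1) al
  have j1 := jet_prod (lam := lam) (m := mu lam sig) (t := t) (Chain.const 1) c1 al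
  have jA10 := jet_prod (lam := lam) (m := mu lam sig) (t := t) (A 1 0 (by decide)) c1 al
  have jB10 := jet_prod (lam := lam) (m := mu lam sig) (t := t) (B 1 0 (by decide)) d1 al
  have jA11 := jet_prod (lam := lam) (m := mu lam sig) (t := t) (A 1 1 (by decide)) ((c1.mul_const (sig ^ 1)).congr
    (g0 := (fun r => (E r).X * (E r).s))
    (g1 := (fun r => (E r).Y * (E r).s))
    (g2 := (fun r => (E r).X * (E r).s ^ 2 - (E r).X ^ 2 * (E r).n * (E r).s))
    (g3 := (fun r => -2 * (E r).X * (E r).Y * (E r).n * (E r).s + (E r).Y * (E r).s ^ 2))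
    (fun r => by simp only [E, realSymb] <;> ring)
        (fun r => by simp only [E, realSymb] <;> ring)
        (fun r => by simp only [E, realSymb] <;> ring)
        (fun r => by simp only [E, realSymb] <;> ring)) al
  have jB11 := jet_prod (lam := lam) (m := mu lam sig) (t := t) (B 1 1 (by decide)) ((d1.mul_const (sig ^ 1)).congr
    (g0 := (fun r => (E r).Y * (E r).s))
    (g1 := (fun r => (E r).X * (E r).s ^ 2 - (E r).X ^ 2 * (E r).n * (E r).s))
    (g2 := (fun r => -2 * (E r).X * (E r).Y * (E r).n * (E r).s + (E r).Y * (E r).s ^ 2))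
    (g3 := (fun r => (E r).X * (E r).s ^ 3 - 3 * (E r).X ^ 2 * (E r).n * (E r).s ^ 2
        + 2 * (E r).X ^ 3 * (E r).n ^ 2 * (E r).s - 2 * (E r).Y ^ 2 * (E r).n * (E r).s))
    (fun r => by simp only [E, realSymb] <;> ring)
        (fun r => by simp only [E, realSymb] <;> ring)
        (fun r => by simp only [E, realSymb] <;> ring)
        (fun r => by simp only [E, realSymb] <;> ring)) al
  have jA12 := jet_prod (lam := lam) (m := mu lam sig) (t := t) (A 1 2 (by decide)) ((c1.mul_const (sig ^ 2)).congr
    (g0 := (fun r => (E r).X * (E r).s ^ 2))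
    (g1 := (fun r => (E r).Y * (E r).s ^ 2))
    (g2 := (fun r => (E r).X * (E r).s ^ 3 - (E r).X ^ 2 * (E r).n * (E r).s ^ 2))
    (g3 := (fun r => -2 * (E r).X * (E r).Y * (E r).n * (E r).s ^ 2 + (E r).Y * (E r).s ^ 3))
    (fun r => by simp only [E, realSymb] <;> ring)
        (fun r => by simp only [E, realSymb] <;> ring)
        (fun r => by simp only [E, realSymb] <;> ring)
        (fun r => by simp only [E, realSymb] <;> ring)) al
  have jB12 := jet_prod (lam := lam) (m := mu lam sig) (t := t) (B 1 2 (by decide)) ((d1.mul_const (sig ^ 2)).congr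
    (g0 := (fun r => (E r).Y * (E r).s ^ 2))
    (g1 := (fun r => (E r).X * (E r).s ^ 3 - (E r).X ^ 2 * (E r).n * (E r).s ^ 2))
    (g2 := (fun r => -2 * (E r).X * (E r).Y * (E r).n * (E r).s ^ 2 + (E r).Y * (E r).s ^ 3))
    (g3 := (fun r => (E r).X * (E r).s ^ 4 - 3 * (E r).X ^ 2 * (E r).n * (E r).s ^ 3
        + 2 * (E r).X ^ 3 * (E r).n ^ 2 * (E r).s ^ 2 - 2 * (E r).Y ^ 2 * (E r).n * (E r).s ^ 2))
    (fun r => by simp only [E, realSymb] <;> ring)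
        (fun r => by simp only [E, realSymb] <;> ring)
        (fun r => by simp only [E, realSymb] <;> ring)
        (fun r => by simp only [E, realSymb] <;> ring)) al
  have jA20 := jet_prod (lam := lam) (m := mu lam sig) (t := t) (A 2 0 (by decide)) c2 al
  have jB20 := jet_prod (lam := lam) (m := mu lam sig) (t := t) (B 2 0 (by decide)) d2 al
  have jA21 := jet_prod (lam := lam) (m := mu lam sig) (t := t) (A 2 1 (by decide)) ((c2.mul_const (sig ^ 1)).congr
    (g0 := (fun r => (E r).X ^ 2 * (E r).s))
    (g1 := (fun r => 2 * (E r).X * (E r).Y * (E r).s))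
    (g2 := (fun r => 2 * (E r).X ^ 2 * (E r).s ^ 2 - 2 * (E r).X ^ 3 * (E r).n * (E r).s
        + 2 * (E r).Y ^ 2 * (E r).s))
    (g3 := (fun r => 8 * (E r).X * (E r).Y * (E r).s ^ 2
        - 10 * (E r).X ^ 2 * (E r).Y * (E r).n * (E r).s))
    (fun r => by simp only [E, realSymb] <;> ring)
        (fun r => by simp only [E, realSymb] <;> ring)
        (fun r => by simp only [E, realSymb] <;> ring)
        (fun r => by simp only [E, realSymb] <;> ring)) al
  have jB21 := jet_prod (lam := lam) (m := mu lam sig) (t := t) (B 2 1 (by decide)) ((d2.mul_const (sig ^ 1)).congr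
    (g0 := (fun r => 2 * (E r).X * (E r).Y * (E r).s))
    (g1 := (fun r => 2 * (E r).X ^ 2 * (E r).s ^ 2 - 2 * (E r).X ^ 3 * (E r).n * (E r).s
        + 2 * (E r).Y ^ 2 * (E r).s))
    (g2 := (fun r => 8 * (E r).X * (E r).Y * (E r).s ^ 2
        - 10 * (E r).X ^ 2 * (E r).Y * (E r).n * (E r).s))
    (g3 := (fun r => -20 * (E r).X * (E r).Y ^ 2 * (E r).n * (E r).s + 8 * (E r).X ^ 2 * (E r).s ^ 3
        - 18 * (E r).X ^ 3 * (E r).n * (E r).s ^ 2 + 10 * (E r).X ^ 4 * (E r).n ^ 2 * (E r).s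
        + 8 * (E r).Y ^ 2 * (E r).s ^ 2))
    (fun r => by simp only [E, realSymb] <;> ring)
        (fun r => by simp only [E, realSymb] <;> ring)
        (fun r => by simp only [E, realSymb] <;> ring)
        (fun r => by simp only [E, realSymb] <;> ring)) al
  have jA30 := jet_prod (lam := lam) (m := mu lam sig) (t := t) (A 3 0 (by decide)) c3 al
  have jB30 := jet_prod (lam := lam) (m := mu lam sig) (t := t) (B 3 0 (by decide)) d3 al
  have J := (((((((((((((jQ.add j1).add jA10).add jB10).add jA11).add jB11).add jA12).add jB12).add jA20).add jB20).add jA21).add jB21).add jA30).add jB30)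
  have e2 : deriv (fun r => Qt lam sig r ^ 2) = fun r => 2 * Qt lam sig r * Qt' lam sig r :=
    funext fun r => (c2.d0 r).deriv
  have e3 : deriv (fun r => Qt lam sig r ^ 3) = fun r => 3 * Qt lam sig r ^ 2 * Qt' lam sig r :=
    funext fun r => (c3.d0 r).deriv
  have e1 : deriv (fun r => Qt lam sig r) = Qt' lam sig := funext fun r => (c1.d0 r).deriv
  have hz : ∀ t x, zApp lam sig P t x =
      (realSymb lam sig P (yVar lam sig P t x) (ySig lam sig t x)).z := fun t x => by
    simp only [zApp, wErr, sum_Sigma0, Symbols.z, realSymb, pow_one, e1, e2, e3, iteratedDeriv_zero]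
    ring
  refine (congrArg (fun u => residual lam u t x) (?_ : zApp lam sig P = _)).trans
    ((J.residual_eq x).trans ?_)
  · funext t x
    rw [hz]
    simp only [Symbols.z, realSymb, E, iteratedDeriv_zero, yVar, ySig]
    ring
  · rw [Symbols.res]
    refine congrArg₂ (· + ·) rfl ?_
    simp only [Symbols.z, Symbols.zx, realSymb, E, iteratedDeriv_zero, yVar, ySig, Symbols.b]
    ring


/-! ### The size of the residual -/

/-- `f` is smooth and bounded together with all its derivatives. -/
def BddDer (f : ℝ → ℝ) : Prop := ContDiff ℝ ∞ f ∧ ∀ n, ∃ C, ∀ x, |iteratedDeriv n f x| ≤ C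

theorem Gr.bounded {f : ℝ → ℝ} (hf : Gr 1 f) : ∃ C, ∀ x, |f x| ≤ C := by
  obtain ⟨K, -, hK⟩ := hf.bnd.le_exp one_pos
  exact ⟨K, fun x => by simpa using hK x⟩

theorem Gr.bddDer {f : ℝ → ℝ} (hf : Gr 1 f) : BddDer f := ⟨hf.1, fun n => (hf.iter n).bounded⟩

theorem GrLim.bddDer {c : ℝ} {f : ℝ → ℝ} (hf : GrLim c f) : BddDer f := by
  refine ⟨hf.gr_zero.1, fun n => ?_⟩
  cases n with
  | zero =>
    obtain ⟨K, hK⟩ := Gr.bounded hf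
    refine ⟨K + |c|, fun x => ?_⟩
    have := abs_add_le (f x - c) c
    rw [iteratedDeriv_zero]
    rw [sub_add_cancel] at this
    linarith [hK x]
  | succ n => exact (hf.iter n).bounded

theorem bddDer_of_sub_phi {b : ℝ} {f : ℝ → ℝ} (hf : Gr 1 fun x => f x - b * phi x) : BddDer f := by
  refine ⟨(gr_of_sub_phi hf).1, fun n => ?_⟩
  cases n with
  | zero =>
    obtain ⟨K, hK⟩ := hf.bounded
    refine ⟨K + |b|, fun x => ?_⟩
    have := abs_add_le (f x - b * phi x) (b * phi x)
    rw [iteratedDeriv_zero]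
    rw [sub_add_cancel, abs_mul] at this
    nlinarith [hK x, abs_phi_le x, abs_nonneg b]
  | succ n => exact (gr_iter_of_sub_phi hf n).bounded

theorem abs_beta_le {lam : ℝ} (h0 : 0 < lam) (h1 : lam < 1) (P : Profile) :
    ∃ K, 0 ≤ K ∧ ∀ sig, 0 < sig → sig < 1 → ∀ s,
      |beta lam sig P s| ≤ K * (sig * Real.exp (-|Real.sqrt sig * s|)) := by
  refine ⟨∑ p ∈ Sigma0, |P.a p.1 p.2| * 6 ^ p.1, Finset.sum_nonneg fun _ _ => by positivity,
    fun sig hp hs s => ?_⟩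
  rw [beta, Finset.sum_mul]
  refine (Finset.abs_sum_le_sum_abs _ _).trans (Finset.sum_le_sum fun p hpm => ?_)
  have hk : p.1 ≠ 0 := by
    rcases mem_Sigma0_cases hpm with rfl | rfl | rfl | rfl | rfl | rfl <;> simp
  have h := abs_Qt_le h0 h1 hp hs s
  set e := sig * Real.exp (-|Real.sqrt sig * s|) with he
  have he0 : 0 ≤ e := by positivity
  have he1 : e ≤ 1 := mul_le_one₀ hs.le (Real.exp_pos _).le (Real.exp_le_one_iff.2 (neg_nonpos.2 (abs_nonneg _)))
  rw [abs_mul, abs_mul, abs_pow, abs_pow, abs_of_pos hp]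
  calc _ ≤ |P.a p.1 p.2| * 1 * (6 * e) ^ p.1 := by
        gcongr; exact pow_le_one₀ hp.le hs.le
    _ = |P.a p.1 p.2| * 6 ^ p.1 * e ^ p.1 := by rw [mul_pow]; ring
    _ ≤ _ := by gcongr; exact pow_le_of_le_one he0 he1 hk

theorem hasDerivAt_yVar (lam sig : ℝ) (P : Profile) (t x : ℝ) :
    HasDerivAt (yVar lam sig P t) (1 - beta lam sig P (ySig lam sig t x)) x := by
  have h := (hasDerivAt_id x).sub ((hasDerivAt_alpha lam sig P (ySig lam sig t x)).comp x
    (hasDerivAt_ySig lam sig t x))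
  exact h.congr_deriv (by ring)

/-- Uniformity in (σ, t) holds because `∂ₓ y = 1 - β` and β is bounded independently of σ. -/
theorem ord_comp_yVar {lam : ℝ} (h0 : 0 < lam) (h1 : lam < 1) (P : Profile) {f : ℝ → ℝ}
    (hf : BddDer f) (n : ℕ) : Ord (fun _ _ => (1 : ℝ)) fun (i : Par) x =>
      iteratedDeriv n f (yVar lam i.1.1 P i.1.2 x) := by
  obtain ⟨C, hC⟩ := hf.2 n
  obtain ⟨C', hC'⟩ := hf.2 (n + 1)
  obtain ⟨K, hK, hb⟩ := abs_beta_le h0 h1 P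
  have hC0 : 0 ≤ C := (abs_nonneg _).trans (hC 0)
  have hC0' : 0 ≤ C' := (abs_nonneg _).trans (hC' 0)
  refine ⟨C + C' * (1 + K), by positivity, fun i x => ?_⟩
  have hd := (((hf.1.differentiable_iteratedDeriv n
    (by exact_mod_cast WithTop.coe_lt_top _)) _).hasDerivAt).comp x
    (hasDerivAt_yVar lam i.1.1 P i.1.2 x)
  refine ⟨hd.differentiableAt, ?_, ?_⟩
  · have := hC (yVar lam i.1.1 P i.1.2 x)
    nlinarith [mul_nonneg hC0' (by positivity : 0 ≤ 1 + K)]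
  · have e : deriv (fun x => iteratedDeriv n f (yVar lam i.1.1 P i.1.2 x)) x = _ := hd.deriv
    rw [e, ← iteratedDeriv_succ, abs_mul]
    have hb' : |beta lam i.1.1 P (ySig lam i.1.1 i.1.2 x)| ≤ K := by
      refine (hb _ i.2.1 i.2.2 _).trans (mul_le_of_le_one_right hK ?_)
      exact mul_le_one₀ i.2.2.le (Real.exp_pos _).le (Real.exp_le_one_iff.2 (neg_nonpos.2 (abs_nonneg _)))
    have := abs_sub (1 : ℝ) (beta lam i.1.1 P (ySig lam i.1.1 i.1.2 x))
    rw [abs_one] at this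
    calc _ ≤ C' * (1 + K) := mul_le_mul (hC' _) (by linarith) (abs_nonneg _) hC0'
      _ ≤ _ := by linarith

theorem deriv_L {f : ℝ → ℝ} (hf : ContDiff ℝ ∞ f) (y : ℝ) : deriv (L f) y =
    -iteratedDeriv 3 f y + iteratedDeriv 1 f y -
      2 * (iteratedDeriv 1 Q y * iteratedDeriv 0 f y
          + iteratedDeriv 0 Q y * iteratedDeriv 1 f y) := by
  have c := Chain.of_contDiff hf
  have q := Chain.of_contDiff contDiff_Q
  have := (((c.d2 y).neg.add (c.d0 y)).sub (((q.d0 y).const_mul 2).mul (c.d0 y))).deriv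
  refine Eq.trans ?_ (this.trans ?_)
  · simp only [iteratedDeriv_zero]; rfl
  · ring

theorem deriv_omega_rhs (lam y : ℝ) : deriv (fun x => (lam - 3) * iteratedDeriv 2 Q x - Q x ^ 2) y =
    (lam - 3) * iteratedDeriv 3 Q y - 2 * iteratedDeriv 0 Q y * iteratedDeriv 1 Q y := by
  have q := Chain.of_contDiff contDiff_Q
  have := (((q.d2 y).const_mul (lam - 3)).sub ((q.d0 y).pow 2)).deriv
  refine Eq.trans ?_ (this.trans ?_)
  · simp only [iteratedDeriv_zero]; rfl
  · norm_num

theorem Omega.eqs {lam : ℝ} {P : Profile} {k l : ℕ} (h : Omega lam P k l)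
    (hA : ContDiff ℝ ∞ (P.A k l)) (hB : ContDiff ℝ ∞ (P.B k l)) (y : ℝ) :
    (-iteratedDeriv 3 (P.A k l) y + iteratedDeriv 1 (P.A k l) y -
      2 * (iteratedDeriv 1 Q y * iteratedDeriv 0 (P.A k l) y +
        iteratedDeriv 0 Q y * iteratedDeriv 1 (P.A k l) y) =
      P.a k l * ((lam - 3) * iteratedDeriv 3 Q y - 2 * iteratedDeriv 0 Q y * iteratedDeriv 1 Q y) +
        sourceF lam P k l y) ∧
    (-iteratedDeriv 3 (P.B k l) y + iteratedDeriv 1 (P.B k l) y -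
      2 * (iteratedDeriv 1 Q y * iteratedDeriv 0 (P.B k l) y +
        iteratedDeriv 0 Q y * iteratedDeriv 1 (P.B k l) y) =
      (3 - lam) * iteratedDeriv 2 (P.A k l) y +
        2 * iteratedDeriv 0 Q y * iteratedDeriv 0 (P.A k l) y +
        P.a k l * (2 * lam - 3) * iteratedDeriv 2 Q y + sourceG lam P k l y) := by
  rw [← deriv_L hA, ← deriv_L hB, ← deriv_omega_rhs]
  exact ⟨h.1 y, by simpa only [iteratedDeriv_zero] using h.2 y⟩

theorem iteratedDeriv_three_Q (y : ℝ) : iteratedDeriv 3 Q y - iteratedDeriv 1 Q y +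
    2 * iteratedDeriv 0 Q y * iteratedDeriv 1 Q y = 0 := by
  have h := ((Chain.of_contDiff contDiff_Q).d2 y).unique
    ((hasDerivAt_second_deriv_Q y).congr_of_eventuallyEq
      (Filter.Eventually.of_forall fun x => iteratedDeriv_two_Q x))
  rw [h, iteratedDeriv_one, iteratedDeriv_zero]
  ring


theorem mk_eq_zero_of_eval {w : Par → ℝ → ℝ} {E : bddRing Par}
    (h : ∀ i x, evalHom i x E = 0) : Ideal.Quotient.mk (ordIdeal w) E = 0 := by
  rw [show E = 0 from Subtype.ext (funext fun i => funext fun x => h i x), map_zero]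

theorem mk_eq_zero_of_ord {w : Par → ℝ → ℝ} {E : bddRing Par} (h : Ord w E.1) :
    Ideal.Quotient.mk (ordIdeal w) E = 0 :=
  Ideal.Quotient.eq_zero_iff_mem.2 h

theorem mk_eq_of_eval {w : Par → ℝ → ℝ} {E F : bddRing Par}
    (h : ∀ i x, evalHom i x E = evalHom i x F) :
    Ideal.Quotient.mk (ordIdeal w) E = Ideal.Quotient.mk (ordIdeal w) F := by
  rw [show E = F from Subtype.ext (funext fun i => funext fun x => h i x)]

theorem Ord.to_one {w f : Par → ℝ → ℝ} (h : Ord w f) (hw : ∀ i x, w i x ≤ 1) :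
    Ord (fun _ _ => (1 : ℝ)) f := h.mono 1 zero_le_one fun i x => by simpa using hw i x

theorem wExp_le_one (lam : ℝ) (k : ℕ) (i : Par) (x : ℝ) : wExp lam k i x ≤ 1 :=
  mul_le_one₀ (pow_le_one₀ (Real.sqrt_nonneg _) (Real.sqrt_le_one.2 i.2.2.le))
    (Real.exp_pos _).le (Real.exp_le_one_iff.2 (neg_nonpos.2 (abs_nonneg _)))

theorem ord_sig : Ord (fun (i : Par) _ => Real.sqrt i.1.1 ^ 2) fun i _ => i.1.1 :=
  ord_const (c := fun i : Par => i.1.1) 1 zero_le_one fun i => by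
    rw [Real.sq_sqrt i.2.1.le, abs_of_pos i.2.1, one_mul]

theorem ord_one_of_le {c : Par → ℝ} (C : ℝ) (h : ∀ i, |c i| ≤ C) :
    Ord (fun _ _ => (1 : ℝ)) fun i _ => c i :=
  ord_const (w := fun _ => (1 : ℝ)) (max C 0) (le_max_right _ _) fun i => by
    rw [mul_one]; exact (h i).trans (le_max_left _ _)

/-- A constant, as a bounded family. -/
def constFam (c : ℝ) : bddRing Par := ⟨fun _ _ => c, ord_one_of_le (c := fun _ => c) |c| fun _ => le_rfl⟩

theorem theta_inv {lam sig : ℝ} (h1 : lam < 1) : (theta lam sig)⁻¹ =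
    (1 - lam)⁻¹ - ((1 - lam)⁻¹ - 1) * sig := by
  have : 1 - lam ≠ 0 := by linarith
  rw [theta, inv_div]
  field_simp
  ring

/-- The tail of the geometric series for μ is summed exactly, so that the remainder is `σ³` times a
bounded function of σ. -/
theorem mu_eq {lam sig : ℝ} (h0 : 0 < lam) (h1 : lam < 1) (hs : sig < 1) : mu lam sig =
    1 - (1 - lam) * (sig + lam * sig ^ 2) + sig ^ 3 * (-(1 - lam) * lam ^ 2 / (1 - lam * sig)) := by
  have : 1 - lam * sig ≠ 0 := by nlinarith
  rw [mu, ← sub_eq_zero]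
  have e : (1 - sig) / (1 - lam * sig) - (1 - (1 - lam) * (sig + lam * sig ^ 2) +
      sig ^ 3 * (-(1 - lam) * lam ^ 2 / (1 - lam * sig))) =
      ((1 - sig) - (1 - (1 - lam) * (sig + lam * sig ^ 2)) * (1 - lam * sig) +
        sig ^ 3 * (1 - lam) * lam ^ 2) / (1 - lam * sig) := by
    rw [eq_div_iff this, sub_mul, add_mul, div_mul_cancel₀ _ this, mul_assoc (sig ^ 3),
      div_mul_cancel₀ _ this]
    ring
  rw [e, div_eq_zero_iff]
  left
  ring

theorem ord_rho {lam : ℝ} (h0 : 0 < lam) (h1 : lam < 1) : Ord (fun _ _ => (1 : ℝ))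
    fun (i : Par) _ => -(1 - lam) * lam ^ 2 / (1 - lam * i.1.1) :=
  ord_one_of_le (c := fun i : Par => -(1 - lam) * lam ^ 2 / (1 - lam * i.1.1)) 1 fun i => by
    have h := i.2.2
    have : 0 < 1 - lam * i.1.1 := by nlinarith
    rw [abs_div, abs_of_pos this, div_le_one this, abs_mul, abs_neg,
      abs_of_pos (by linarith : 0 < 1 - lam), abs_of_pos (by positivity)]
    nlinarith [pow_le_one₀ h0.le h1.le (n := 2)]

-- The residual is the value of one polynomial expression `D.res` over `bddRing`. Being of order
-- `wExp lam 8` means vanishing in the quotient by the corresponding ideal, and there the hypotheses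
-- of `residual_poly_eq_zero` hold: relations between functions are checked pointwise through
-- `evalHom`, vanishing monomials by their weight.
set_option maxHeartbeats 2000000 in
theorem ord_residual {lam : ℝ} (h0 : 0 < lam) (h1 : lam < 1) {P : Profile}
    (hA : ∀ k l, BddDer (P.A k l)) (hB : ∀ k l, BddDer (P.B k l))
    (hΩ : ∀ p ∈ Sigma0, Omega lam P p.1 p.2) :
    Ord (wExp lam 8) fun i x => residual lam (zApp lam i.1.1 P) i.1.2 x := by
  let D : Symbols (bddRing Par) :=
    { lam := constFam lam
      mu := ⟨fun i _ => mu lam i.1.1, ord_one_of_le (c := fun i : Par => mu lam i.1.1) 1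
        fun i => abs_mu_le h0 h1 i.2.1 i.2.2⟩
      s := ⟨fun i _ => i.1.1, ord_one_of_le (c := fun i : Par => i.1.1) 1 fun i => by
        rw [abs_of_pos i.2.1]; exact i.2.2.le⟩
      X := ⟨_, (ord_X h0 h1).to_one (wExp_le_one lam 2)⟩
      Y := ⟨_, (ord_Y h0 h1).to_one (wExp_le_one lam 3)⟩
      n := ⟨fun i _ => (theta lam i.1.1)⁻¹, ord_one_of_le (c := fun i : Par => (theta lam i.1.1)⁻¹)
        (1 - lam)⁻¹ fun i => by
          have h := theta_pos h0 h1 i.2.2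
          have h2 := i.2.1
          rw [abs_of_pos (inv_pos.2 h), theta_inv h1]
          have : 1 ≤ (1 - lam)⁻¹ := (one_le_inv₀ (by linarith)).2 (by linarith)
          nlinarith⟩
      a := fun k l => constFam (P.a k l)
      q := fun j => ⟨_, ord_comp_yVar h0 h1 P gr_Q.bddDer j⟩
      A := fun k l j => ⟨_, ord_comp_yVar h0 h1 P (hA k l) j⟩
      B := fun k l j => ⟨_, ord_comp_yVar h0 h1 P (hB k l) j⟩ }
  have hD : ∀ i x, D.map (evalHom i x) = realSymb lam i.1.1 P (yVar lam i.1.1 P i.1.2 x)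
    (ySig lam i.1.1 i.1.2 x) := fun i x => rfl
  have hres : D.res.1 = fun i x => residual lam (zApp lam i.1.1 P) i.1.2 x := by
    funext i x
    rw [residual_zApp h0 h1 i.2.1 i.2.2 (fun p _ => (hA _ _).1) (fun p _ => (hB _ _).1), ← hD,
      ← Symbols.map_res]
    rfl
  rw [← hres]
  suffices h : Ideal.Quotient.mk (ordIdeal (wExp lam 8)) D.res = 0 from
    Ideal.Quotient.eq_zero_iff_mem.1 h
  have oX : Ord (wExp lam 2) D.X.1 := ord_X h0 h1
  have oY : Ord (wExp lam 3) D.Y.1 := ord_Y h0 h1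
  have os : Ord (fun (i : Par) _ => Real.sqrt i.1.1 ^ 2) D.s.1 := ord_sig
  have eX : ∀ i x, evalHom i x D.X = Qt lam i.1.1 (ySig lam i.1.1 i.1.2 x) := fun i x => rfl
  have eY : ∀ i x, evalHom i x D.Y = Qt' lam i.1.1 (ySig lam i.1.1 i.1.2 x) := fun i x => rfl
  have es : ∀ i x, evalHom i x D.s = i.1.1 := fun i x => rfl
  have en : ∀ i x, evalHom i x D.n = (theta lam i.1.1)⁻¹ := fun i x => rfl
  have el : ∀ i x, evalHom i x D.lam = lam := fun i x => rfl
  have em : ∀ i x, evalHom i x D.mu = mu lam i.1.1 := fun i x => rfl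
  have ec : ∀ i x c, evalHom i x (constFam c) = c := fun i x c => rfl
  have ea : ∀ i x k l, evalHom i x (D.a k l) = P.a k l := fun i x k l => rfl
  have eq : ∀ i x j, evalHom i x (D.q j) = iteratedDeriv j Q (yVar lam i.1.1 P i.1.2 x) :=
    fun i x j => rfl
  have eA : ∀ i x k l j, evalHom i x (D.A k l j) =
    iteratedDeriv j (P.A k l) (yVar lam i.1.1 P i.1.2 x) := fun i x k l j => rfl
  have eB : ∀ i x k l j, evalHom i x (D.B k l j) =
    iteratedDeriv j (P.B k l) (yVar lam i.1.1 P i.1.2 x) := fun i x k l j => rfl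
  clear_value D
  rw [Symbols.map_res]
  set π := Ideal.Quotient.mk (ordIdeal (wExp lam 8)) with hπ
  -- The eight monomials have weight 8 or 9 and therefore lie in the ideal; the relation for `Y²` is
  -- an exact identity between functions.
  have W : WeightRel (π D.s) (π D.X) (π D.Y) (π D.n) (π (constFam (1 / 3))) := by
    have X2 := ord_wExp_mul oX oX
    have X3 := ord_wExp_mul X2 oX
    have z : ∀ {E F : bddRing Par} {k : ℕ}, Ord (wExp lam k) F.1 → 8 ≤ k → E = F → π E = 0 :=
      fun h hk e => e ▸ mk_eq_zero_of_ord (h.wExp_mono hk)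
    constructor
    · rw [← map_pow]; exact z (F := D.X * D.X * D.X * D.X) (ord_wExp_mul X3 oX) (by norm_num)
        (by simp only [pow_succ, pow_zero, one_mul, mul_assoc])
    · rw [← map_pow, ← map_mul]
      exact z (F := D.s * (D.X * D.X * D.X)) (ord_pow_mul os X3) (by norm_num)
        (by simp only [pow_succ, pow_zero, one_mul, mul_assoc])
    · rw [← map_pow, ← map_pow, ← map_mul]
      exact z (F := D.s * (D.s * (D.X * D.X))) (ord_pow_mul os (ord_pow_mul os X2)) (by norm_num)
        (by simp only [pow_succ, pow_zero, one_mul, mul_assoc])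
    · rw [← map_pow, ← map_mul]
      exact z (F := D.s * (D.s * (D.s * D.X))) (ord_pow_mul os (ord_pow_mul os (ord_pow_mul os oX)))
        (by norm_num) (by simp only [pow_succ, pow_zero, one_mul, mul_assoc])
    · rw [← map_pow, ← map_mul]
      exact z (F := D.X * D.X * D.X * D.Y) (ord_wExp_mul X3 oY) (by norm_num)
        (by simp only [pow_succ, pow_zero, one_mul, mul_assoc])
    · rw [← map_pow, ← map_mul, ← map_mul]
      exact z (F := D.s * (D.X * D.X * D.Y)) (ord_pow_mul os (ord_wExp_mul X2 oY)) (by norm_num)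
        (by simp only [pow_succ, pow_zero, one_mul, mul_assoc])
    · rw [← map_pow, ← map_mul, ← map_mul]
      exact z (F := D.s * (D.s * (D.X * D.Y))) (ord_pow_mul os (ord_pow_mul os (ord_wExp_mul oX oY)))
        (by norm_num) (by simp only [pow_succ, pow_zero, one_mul, mul_assoc])
    · rw [← map_pow, ← map_mul]
      exact z (F := D.s * (D.s * (D.s * D.Y))) (ord_pow_mul os (ord_pow_mul os (ord_pow_mul os oY)))
        (by norm_num) (by simp only [pow_succ, pow_zero, one_mul, mul_assoc])
    · have h2 : (2 : bddRing Par ⧸ ordIdeal (wExp lam 8)) = π 2 := (map_ofNat π 2).symm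
      rw [h2]
      simp only [← map_pow, ← map_mul, ← map_sub]
      refine mk_eq_of_eval fun i x => ?_
      simp only [map_sub, map_mul, map_pow, map_ofNat, eX, eY, es, en, ec]
      rw [Qt'_sq h0 h1 i.2.1 i.2.2]
  have hm : (1 - lam)⁻¹ * lam = (1 - lam)⁻¹ - 1 := by
    have : 1 - lam ≠ 0 := by linarith
    field_simp; ring
  have Ω := fun k l (h : (k, l) ∈ Sigma0) => (hΩ (k, l) h).eqs (hA k l).1 (hB k l).1
  have p1 : (1 : bddRing Par ⧸ ordIdeal (wExp lam 8)) = π 1 := (map_one π).symm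
  have pn : ∀ (k : ℕ) [k.AtLeastTwo], (OfNat.ofNat k : bddRing Par ⧸ ordIdeal (wExp lam 8)) =
    π (OfNat.ofNat k) := fun k _ => (map_ofNat π k).symm
  rw [Symbols.res]
  refine residual_poly_eq_zero (m := π (constFam (1 - lam)⁻¹))
    (rho := π ⟨_, ord_rho h0 h1⟩) W ?_ ?_ ?_ ?_ rfl rfl rfl rfl rfl ?_ ?_ ?_ ?_ ?_ ?_ ?_ ?_ ?_ ?_ ?_ ?_ ?_
  · simp only [Symbols.map, p1, ← map_mul, ← map_sub]
    refine mk_eq_of_eval fun i x => ?_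
    simp only [map_sub, map_mul, map_one, en, ec, es]
    exact theta_inv h1
  · simp only [Symbols.map, p1, ← map_mul, ← map_sub]
    refine mk_eq_of_eval fun i x => ?_
    simp only [map_sub, map_mul, map_one, el, ec]
    exact hm
  · simp only [p1, pn, ← map_mul]
    refine mk_eq_of_eval fun i x => ?_
    simp only [map_mul, map_one, map_ofNat, ec]
    norm_num
  · simp only [Symbols.map, p1, ← map_mul, ← map_sub, ← map_add, ← map_pow]
    refine mk_eq_of_eval fun i x => ?_
    simp only [map_sub, map_mul, map_one, map_add, map_pow, el, em, es]
    exact mu_eq h0 h1 i.2.2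
  · simp only [Symbols.map, pn, ← map_mul, ← map_sub, ← map_add, ← map_pow]
    refine mk_eq_zero_of_eval fun i x => ?_
    simp only [map_sub, map_mul, map_add, map_ofNat, eq]
    exact iteratedDeriv_three_Q _
  · simp only [Symbols.map, pn, ← map_mul, ← map_sub, ← map_add, ← map_pow, ← map_neg]
    refine mk_eq_zero_of_eval fun i x => ?_
    simp only [map_sub, map_mul, map_add, map_neg, map_pow, map_ofNat, el, ec, ea, eq, eA, eB]
    have h := (Ω 1 0 (by decide) (yVar lam i.1.1 P i.1.2 x)).1
    simp only [sourceF] at h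
    linear_combination (-1) * h
  · simp only [Symbols.map, pn, ← map_mul, ← map_sub, ← map_add, ← map_pow, ← map_neg]
    refine mk_eq_zero_of_eval fun i x => ?_
    simp only [map_sub, map_mul, map_add, map_neg, map_pow, map_ofNat, el, ec, ea, eq, eA, eB]
    have h := (Ω 1 0 (by decide) (yVar lam i.1.1 P i.1.2 x)).2
    simp only [sourceG] at h
    linear_combination (-1) * h
  · simp only [Symbols.map, pn, ← map_mul, ← map_sub, ← map_add, ← map_pow, ← map_neg]
    refine mk_eq_zero_of_eval fun i x => ?_
    simp only [map_sub, map_mul, map_add, map_neg, map_pow, map_ofNat, el, ec, ea, eq, eA, eB]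
    have h := (Ω 1 1 (by decide) (yVar lam i.1.1 P i.1.2 x)).1
    simp only [sourceF] at h
    linear_combination (-1) * h
  · simp only [Symbols.map, pn, ← map_mul, ← map_sub, ← map_add, ← map_pow, ← map_neg]
    refine mk_eq_zero_of_eval fun i x => ?_
    simp only [map_sub, map_mul, map_add, map_neg, map_pow, map_ofNat, el, ec, ea, eq, eA, eB]
    have h := (Ω 1 1 (by decide) (yVar lam i.1.1 P i.1.2 x)).2
    simp only [sourceG] at h
    linear_combination (-1) * h
  · simp only [Symbols.map, pn, ← map_mul, ← map_sub, ← map_add, ← map_pow, ← map_neg]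
    refine mk_eq_zero_of_eval fun i x => ?_
    simp only [map_sub, map_mul, map_add, map_neg, map_pow, map_ofNat, el, ec, ea, eq, eA, eB]
    have h := (Ω 1 2 (by decide) (yVar lam i.1.1 P i.1.2 x)).1
    simp only [sourceF] at h
    linear_combination (-1) * h
  · simp only [Symbols.map, pn, ← map_mul, ← map_sub, ← map_add, ← map_pow, ← map_neg]
    refine mk_eq_zero_of_eval fun i x => ?_
    simp only [map_sub, map_mul, map_add, map_neg, map_pow, map_ofNat, el, ec, ea, eq, eA, eB]
    have h := (Ω 1 2 (by decide) (yVar lam i.1.1 P i.1.2 x)).2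
    simp only [sourceG] at h
    linear_combination (-1) * h
  · simp only [Symbols.map, pn, ← map_mul, ← map_sub, ← map_add, ← map_pow, ← map_neg]
    refine mk_eq_zero_of_eval fun i x => ?_
    simp only [map_sub, map_mul, map_add, map_neg, map_pow, map_ofNat, el, ec, ea, eq, eA, eB]
    have h := (Ω 2 0 (by decide) (yVar lam i.1.1 P i.1.2 x)).1
    simp only [sourceF] at h
    linear_combination (-1) * h
  · simp only [Symbols.map, pn, ← map_mul, ← map_sub, ← map_add, ← map_pow, ← map_neg]
    refine mk_eq_zero_of_eval fun i x => ?_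
    simp only [map_sub, map_mul, map_add, map_neg, map_pow, map_ofNat, el, ec, ea, eq, eA, eB]
    have h := (Ω 2 0 (by decide) (yVar lam i.1.1 P i.1.2 x)).2
    simp only [sourceG] at h
    -- The factor 2 comes from `(X²)' = 2XY`: the coefficient of XY is twice the second equation of
    -- `(Ω_{2,0})`. It recurs for (2,1), and becomes 3 for (3,0).
    linear_combination (-2) * h
  · simp only [Symbols.map, pn, ← map_mul, ← map_sub, ← map_add, ← map_pow, ← map_neg]
    refine mk_eq_zero_of_eval fun i x => ?_
    simp only [map_sub, map_mul, map_add, map_neg, map_pow, map_ofNat, el, ec, ea, eq, eA, eB]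
    have h := (Ω 2 1 (by decide) (yVar lam i.1.1 P i.1.2 x)).1
    simp only [sourceF] at h
    linear_combination (-1) * h
  · simp only [Symbols.map, pn, ← map_mul, ← map_sub, ← map_add, ← map_pow, ← map_neg]
    refine mk_eq_zero_of_eval fun i x => ?_
    simp only [map_sub, map_mul, map_add, map_neg, map_pow, map_ofNat, el, ec, ea, eq, eA, eB]
    have h := (Ω 2 1 (by decide) (yVar lam i.1.1 P i.1.2 x)).2
    simp only [sourceG] at h
    linear_combination (-2) * h
  · simp only [Symbols.map, pn, ← map_mul, ← map_sub, ← map_add, ← map_pow, ← map_neg]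
    refine mk_eq_zero_of_eval fun i x => ?_
    simp only [map_sub, map_mul, map_add, map_neg, map_pow, map_ofNat, el, ec, ea, eq, eA, eB]
    have h := (Ω 3 0 (by decide) (yVar lam i.1.1 P i.1.2 x)).1
    simp only [sourceF] at h
    linear_combination (-1) * h
  · simp only [Symbols.map, pn, ← map_mul, ← map_sub, ← map_add, ← map_pow, ← map_neg]
    refine mk_eq_zero_of_eval fun i x => ?_
    simp only [map_sub, map_mul, map_add, map_neg, map_pow, map_ofNat, el, ec, ea, eq, eA, eB]
    have h := (Ω 3 0 (by decide) (yVar lam i.1.1 P i.1.2 x)).2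
    simp only [sourceG] at h
    linear_combination (-3) * h


/-! ### Norms of exponentially decaying functions -/

/-- The constant `(∫ e^{-2|x|})^{1/2}`. -/
noncomputable def expNorm : ℝ := Real.sqrt (∫ x : ℝ, Real.exp (-(2 * |x|)))

theorem integrable_exp_comp {c : ℝ} (hc : 0 < c) (a : ℝ) :
    Integrable fun x : ℝ => Real.exp (-|c * (x + a)|) ^ 2 := by
  have h := ((integrable_exp_neg_abs (d := 2) two_pos).comp_mul_left' hc.ne').comp_add_right a
  refine h.congr (Filter.Eventually.of_forall fun x => ?_)
  simp only []
  rw [← Real.exp_nat_mul]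
  congr 1
  push_cast
  ring

/-- Scaling: a profile of width 1/c has L² norm proportional to `c^{-1/2}`, whatever its centre. -/
theorem eLpNorm_exp {c : ℝ} (hc : 0 < c) (a : ℝ) :
    eLpNorm (fun x : ℝ => Real.exp (-|c * (x + a)|)) 2 volume =
      ENNReal.ofReal (expNorm / Real.sqrt c) := by
  have hm : MemLp (fun x : ℝ => Real.exp (-|c * (x + a)|)) 2 volume :=
    (memLp_two_iff_integrable_sq (by fun_prop)).2 (integrable_exp_comp hc a)
  rw [hm.eLpNorm_eq_integral_rpow_norm (by simp) (by simp)]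
  congr 1
  have e : ∀ x : ℝ, ‖Real.exp (-|c * (x + a)|)‖ ^ (2 : ℝ≥0∞).toReal =
      (fun u => (fun v => Real.exp (-(2 * |v|))) (c * u)) (x + a) := fun x => by
    simp only [ENNReal.toReal_ofNat, Real.rpow_two, Real.norm_eq_abs, sq_abs]
    rw [← Real.exp_nat_mul]
    congr 1
    push_cast
    ring
  simp only [e]
  rw [integral_add_right_eq_self (fun u => (fun v => Real.exp (-(2 * |v|))) (c * u)) a,
    Measure.integral_comp_mul_left (fun v => Real.exp (-(2 * |v|))) c, abs_of_pos (inv_pos.2 hc),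
    expNorm, ← Real.sqrt_div' _ hc.le, Real.sqrt_eq_rpow]
  simp [div_eq_inv_mul]

theorem eLpNorm_le_of_exp {f : ℝ → ℝ} {M N c d a b : ℝ} (hM : 0 ≤ M) (hN : 0 ≤ N) (hc : 0 < c)
    (hd : 0 < d)
    (h : ∀ x, |f x| ≤ M * Real.exp (-|c * (x + a)|) + N * Real.exp (-|d * (x + b)|)) :
    eLpNorm f 2 volume ≤
      ENNReal.ofReal (expNorm * (M / Real.sqrt c + N / Real.sqrt d)) := by
  have h1 : eLpNorm f 2 volume ≤ eLpNorm ((fun x : ℝ => M * Real.exp (-|c * (x + a)|)) +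
      fun x => N * Real.exp (-|d * (x + b)|)) 2 volume :=
    eLpNorm_mono_real fun x => h x
  refine h1.trans ((eLpNorm_add_le (by fun_prop) (by fun_prop) (by norm_num)).trans ?_)
  have e : ∀ {M c a : ℝ}, 0 ≤ M → 0 < c →
      eLpNorm (fun x : ℝ => M * Real.exp (-|c * (x + a)|)) 2 volume =
        ENNReal.ofReal (expNorm * (M / Real.sqrt c)) := fun {M c a} hM hc => by
    have := eLpNorm_const_smul M (fun x : ℝ => Real.exp (-|c * (x + a)|)) 2 volume
    rw [eLpNorm_exp hc, Real.enorm_eq_ofReal hM, ← ENNReal.ofReal_mul hM] at this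
    refine Eq.trans ?_ (this.trans ?_)
    · rfl
    · congr 1; ring
  rw [e hM hc, e hN hd, ← ENNReal.ofReal_add, mul_add]
  · exact mul_nonneg (Real.sqrt_nonneg _) (by positivity)
  · exact mul_nonneg (Real.sqrt_nonneg _) (by positivity)

/-- Two exponentials are allowed because the error at ±τ_σ has two scales: a fixed width near the
large soliton and width `σ^{-1/2}` near the small one. -/
theorem h1Norm_le_of_exp {f : ℝ → ℝ} {M N c d a b : ℝ} (hM : 0 ≤ M) (hN : 0 ≤ N) (hc : 0 < c)
    (hd : 0 < d)
    (h : ∀ x, |f x| ≤ M * Real.exp (-|c * (x + a)|) + N * Real.exp (-|d * (x + b)|))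
    (h' : ∀ x, |deriv f x| ≤ M * Real.exp (-|c * (x + a)|) + N * Real.exp (-|d * (x + b)|)) :
    h1Norm f ≤ ENNReal.ofReal (2 * expNorm * (M / Real.sqrt c + N / Real.sqrt d)) := by
  set R := expNorm * (M / Real.sqrt c + N / Real.sqrt d) with hR
  have hR0 : 0 ≤ R := mul_nonneg (Real.sqrt_nonneg _) (by positivity)
  have h1 := eLpNorm_le_of_exp hM hN hc hd h
  have h2 := eLpNorm_le_of_exp hM hN hc hd h'
  rw [h1Norm]
  calc _ ≤ (ENNReal.ofReal R ^ 2 + ENNReal.ofReal R ^ 2) ^ (1 / 2 : ℝ) := by gcongr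
    _ ≤ (ENNReal.ofReal ((2 * R) ^ 2)) ^ (1 / 2 : ℝ) := by
        rw [← ENNReal.ofReal_pow hR0, ← ENNReal.ofReal_add (by positivity) (by positivity)]
        gcongr
        nlinarith
    _ = _ := by
        rw [ENNReal.ofReal_rpow_of_nonneg (by positivity) (by norm_num), ← Real.sqrt_eq_rpow,
          Real.sqrt_sq (by positivity), hR, mul_assoc]

/-- The factor `σ^{1/4}` in the denominator is the price of the L² norm of `e^{-√σ|x|}`. The case k
= 7 gives the exponent 15/4, the case k = 6 gives 13/4. -/
theorem rpow_quarter {sig : ℝ} (hp : 0 < sig) (k : ℕ) :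
    Real.sqrt sig ^ (k + 1) / Real.sqrt (Real.sqrt sig) = sig ^ ((2 * k + 1 : ℝ) / 4) := by
  rw [Real.sqrt_eq_rpow, Real.sqrt_eq_rpow, ← Real.rpow_natCast, ← Real.rpow_mul hp.le,
    ← Real.rpow_mul hp.le, ← Real.rpow_sub hp]
  congr 1
  push_cast
  ring

theorem h1Norm_residual_le {lam : ℝ} (h0 : 0 < lam) (h1 : lam < 1) {P : Profile}
    (hA : ∀ k l, BddDer (P.A k l)) (hB : ∀ k l, BddDer (P.B k l))
    (hΩ : ∀ p ∈ Sigma0, Omega lam P p.1 p.2) :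
    ∃ C, 0 < C ∧ ∀ sig, 0 < sig → sig < 1 → ∀ t, h1Norm (residual lam (zApp lam sig P) t) ≤
      ENNReal.ofReal (C * sig ^ (15 / 4 : ℝ)) := by
  obtain ⟨C, hC, h⟩ := ord_residual h0 h1 hA hB hΩ
  refine ⟨2 * expNorm * C + 1, ?_, fun sig hp hs t => ?_⟩
  · have : 0 ≤ expNorm := Real.sqrt_nonneg _
    positivity
  have hr := Real.sqrt_pos.2 hp
  have key := h1Norm_le_of_exp (f := residual lam (zApp lam sig P) t) (M := C * Real.sqrt sig ^ 8)
    (N := 0) (c := Real.sqrt sig) (d := 1) (a := mu lam sig * t) (b := 0) (by positivity) le_rfl hr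
    one_pos (fun x => by
      have := (h ⟨(sig, t), hp, hs⟩ x).2.1
      rw [zero_mul, add_zero, mul_assoc]; exact this) (fun x => by
      have := (h ⟨(sig, t), hp, hs⟩ x).2.2
      rw [zero_mul, add_zero, mul_assoc]; exact this)
  refine key.trans (ENNReal.ofReal_le_ofReal ?_)
  rw [zero_div, add_zero, mul_div_assoc, rpow_quarter hp 7, show ((2 * (7 : ℕ)
      + 1 : ℝ) / 4) = 15 / 4 by norm_num]
  have := Real.rpow_nonneg hp.le (15 / 4 : ℝ)
  linarith


/-! ### Smoothness and symmetry -/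

theorem contDiff_alpha (lam sig : ℝ) (P : Profile) : ContDiff ℝ ∞ (alpha lam sig P) :=
  contDiff_primitive (contDiff_beta lam sig P) 0

theorem contDiff_ySig (lam sig : ℝ) :
    ContDiff ℝ ∞ fun p : ℝ × ℝ => ySig lam sig p.1 p.2 :=
  contDiff_snd.add (contDiff_const.mul contDiff_fst)

theorem contDiff_yVar (lam sig : ℝ) (P : Profile) :
    ContDiff ℝ ∞ fun p : ℝ × ℝ => yVar lam sig P p.1 p.2 :=
  contDiff_snd.sub ((contDiff_alpha lam sig P).comp (contDiff_ySig lam sig))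

theorem contDiff_zApp (lam sig : ℝ) {P : Profile} (hA : ∀ p ∈ Sigma0, ContDiff ℝ ∞ (P.A p.1 p.2))
    (hB : ∀ p ∈ Sigma0, ContDiff ℝ ∞ (P.B p.1 p.2)) :
    ContDiff ℝ ∞ fun p : ℝ × ℝ => zApp lam sig P p.1 p.2 := by
  have hs := contDiff_ySig lam sig
  have hy := contDiff_yVar lam sig P
  refine ((contDiff_Q.comp hy).add ((contDiff_Qt lam sig).comp hs)).add
    (ContDiff.sum fun p hp => contDiff_const.mul ((((hA p hp).comp hy).mul
      (((contDiff_Qt lam sig).comp hs).pow p.1)).add (((hB p hp).comp hy).mul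
        ((contDiff_deriv ((contDiff_Qt lam sig).pow p.1)).comp hs))))

theorem Qt_even (lam sig x : ℝ) : Qt lam sig (-x) = Qt lam sig x := by
  rw [Qt, Qt, mul_neg, Q_even]

theorem beta_even (lam sig : ℝ) (P : Profile) (s : ℝ) :
    beta lam sig P (-s) = beta lam sig P s := by
  simp only [beta, Qt_even]

theorem alpha_odd (lam sig : ℝ) (P : Profile) (s : ℝ) :
    alpha lam sig P (-s) = -alpha lam sig P s := by
  rw [alpha, primitive_neg]
  simp only [beta_even]
  rfl

theorem deriv_odd_of_even {f : ℝ → ℝ} (hf : ∀ x, f (-x) = f x) (x : ℝ) :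
    deriv f (-x) = -deriv f x := by
  have := iteratedDeriv_of_even hf 1 x
  simpa [iteratedDeriv_one] using this

/-- As Q̃_σ is even, α is odd, so both `y` and `y_σ` change sign. The terms with A are products of
even functions, those with B products of two odd ones. -/
theorem zApp_symm (lam sig : ℝ) {P : Profile} (hA : ∀ p ∈ Sigma0, Function.Even (P.A p.1 p.2))
    (hB : ∀ p ∈ Sigma0, Function.Odd (P.B p.1 p.2)) (t x : ℝ) :
    zApp lam sig P t x = zApp lam sig P (-t) (-x) := by
  have hs : ySig lam sig (-t) (-x) = -ySig lam sig t x := by rw [ySig, ySig]; ring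
  have hy : yVar lam sig P (-t) (-x) = -yVar lam sig P t x := by
    rw [yVar, yVar, hs, alpha_odd]; ring
  rw [zApp, zApp, wErr, wErr, hs, hy, Q_even, Qt_even]
  congr 1
  refine Finset.sum_congr rfl fun p hp => ?_
  rw [hA p hp, hB p hp, deriv_odd_of_even (fun r => by rw [Qt_even])]
  ring

/-! ### Admissible families -/

theorem IsAdmissible.grLim_A {lam : ℝ} {P : Profile} (h : IsAdmissible lam P) {p : ℕ × ℕ}
    (hp : p ∈ Sigma0) : GrLim (gammaCoef lam P p.1 p.2) (P.A p.1 p.2) :=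
  classY_iff.1 (h.A_classY p hp)

theorem IsAdmissible.gr_B {lam : ℝ} {P : Profile} (h : IsAdmissible lam P) {p : ℕ × ℕ}
    (hp : p ∈ Sigma0) : Gr 1 fun y => P.B p.1 p.2 y - P.b p.1 p.2 * phi y :=
  classY_iff.1 (h.B_classY p hp)

/-- The profile which vanishes at the indices outside `Σ₀`. -/
noncomputable def Profile.trunc (P : Profile) : Profile where
  a := P.a
  b := P.b
  A k l := if (k, l) ∈ Sigma0 then P.A k l else 0
  B k l := if (k, l) ∈ Sigma0 then P.B k l else 0

theorem Profile.trunc_A (P : Profile) {p : ℕ × ℕ} (hp : p ∈ Sigma0) :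
    P.trunc.A p.1 p.2 = P.A p.1 p.2 := if_pos hp

theorem Profile.trunc_B (P : Profile) {p : ℕ × ℕ} (hp : p ∈ Sigma0) :
    P.trunc.B p.1 p.2 = P.B p.1 p.2 := if_pos hp

theorem zApp_trunc (lam sig : ℝ) (P : Profile) : zApp lam sig P.trunc = zApp lam sig P := by
  funext t x
  refine congrArg₂ (· + ·) rfl (Finset.sum_congr rfl fun p hp => ?_)
  rw [P.trunc_A hp, P.trunc_B hp]
  rfl

theorem agreeLow_trunc (P : Profile) : AgreeLow P.trunc P :=
  ⟨rfl, rfl, rfl, rfl, rfl, rfl, P.trunc_A (p := (1, 0)) (by decide),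
    P.trunc_A (p := (1, 1)) (by decide), P.trunc_A (p := (2, 0)) (by decide),
    P.trunc_B (p := (1, 0)) (by decide), P.trunc_B (p := (1, 1)) (by decide),
    P.trunc_B (p := (2, 0)) (by decide)⟩

/-- Admissibility says nothing outside Σ₀, whereas the general estimate asks for boundedness at all
indices; the truncated profile has it and defines the same z. -/
theorem IsAdmissible.h1Norm_residual_le {lam : ℝ} (h0 : 0 < lam) (h1 : lam < 1) {P : Profile}
    (h : IsAdmissible lam P) :
    ∃ C, 0 < C ∧ ∀ sig, 0 < sig → sig < 1 → ∀ t, h1Norm (residual lam (zApp lam sig P) t) ≤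
      ENNReal.ofReal (C * sig ^ (15 / 4 : ℝ)) := by
  have hz : BddDer 0 := ((Gr.zero 1).bddDer : BddDer fun _ => (0 : ℝ))
  have hA : ∀ k l, BddDer (P.trunc.A k l) := fun k l => by
    by_cases hp : (k, l) ∈ Sigma0
    · rw [P.trunc_A (p := (k, l)) hp]; exact (h.grLim_A hp).bddDer
    · rw [show P.trunc.A k l = 0 from if_neg hp]; exact hz
  have hB : ∀ k l, BddDer (P.trunc.B k l) := fun k l => by
    by_cases hp : (k, l) ∈ Sigma0
    · rw [P.trunc_B (p := (k, l)) hp]; exact bddDer_of_sub_phi (h.gr_B hp)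
    · rw [show P.trunc.B k l = 0 from if_neg hp]; exact hz
  obtain ⟨C, hC, key⟩ := BBM.h1Norm_residual_le h0 h1 hA hB fun p hp => by
    refine omega_of ((agreeLow_trunc P).sourceF lam p.1 p.2)
      ((agreeLow_trunc P).sourceG lam p.1 p.2) ?_ ?_
    · rw [P.trunc_A hp]; exact (h.omega p hp).1
    · rw [P.trunc_A hp, P.trunc_B hp]; exact (h.omega p hp).2
  refine ⟨C, hC, fun sig hp hs t => ?_⟩
  have := key sig hp hs t
  rwa [zApp_trunc] at this


/-! ### Matching of the expansions at infinity -/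

/-- `72` times the difference between the limit of the approximate solution on the left of the
large soliton and the Taylor polynomial of the shifted small soliton. -/
def matchPoly {R : Type*} [CommRing R]
    (s X Y n h d b10 b11 b12 b20 b21 b30 g11 g20 g12 g21 g30 : R) : R :=
  72 * (g11 * s * X + g20 * X ^ 2 + g12 * s ^ 2 * X + g21 * s * X ^ 2 + g30 * X ^ 3)
    - 72 * (b10 * Y + b11 * s * Y + b12 * s ^ 2 * Y + 2 * b20 * X * Y + 2 * b21 * s * X * Y +
      3 * b30 * X ^ 2 * Y)
    - (-72 * h * Y + 36 * h ^ 2 * (X * s - X ^ 2 * n) - 12 * h ^ 3 * (-2 * X * Y * n + Y * s) +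
      3 * h ^ 4 * (X * s ^ 2 - 3 * X ^ 2 * n * s + 2 * X ^ 3 * n ^ 2 - 2 * Y ^ 2 * n))
    + 72 * d * (2 * X * Y - 2 * h * (X * (X * s - X ^ 2 * n) + Y ^ 2))

theorem map_matchPoly {R S : Type*} [CommRing R] [CommRing S] (φ : R →+* S)
    (s X Y n h d b10 b11 b12 b20 b21 b30 g11 g20 g12 g21 g30 : R) :
    φ (matchPoly s X Y n h d b10 b11 b12 b20 b21 b30 g11 g20 g12 g21 g30) =
      matchPoly (φ s) (φ X) (φ Y) (φ n) (φ h) (φ d) (φ b10) (φ b11) (φ b12) (φ b20) (φ b21) (φ b30)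
        (φ g11) (φ g20) (φ g12) (φ g21) (φ g30) := by
  simp only [matchPoly, map_add, map_sub, map_mul, map_pow, map_neg, map_ofNat]

/-- Comparison weight by weight with `h = δ_σ/2` and `Q̃_σ(s - h) - d (Q̃_σ²)'(s - h)`. In weight 3,
`h` must begin with b_{1,0}. Weight 4 compares `γ_{1,1} sX + γ_{2,0} X²` with `h² Q̃_σ''/2`. Weight
5 fixes the correction of δ_σ and d(λ), and weight 6 fixes γ_{1,2}, γ_{2,1}, γ_{3,0}. The numbers
b_{1,2}, b_{2,1}, b_{3,0} multiply terms of weight 7 and remain free. The overall factor 72 clears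
the denominators. -/
theorem matchPoly_eq_zero {R : Type*} [CommRing R]
    {s X Y n h d b10 b11 b12 b20 b21 b30 g11 g20 g12 g21 g30 m lam e : R}
    (s2Y : s ^ 2 * Y = 0) (sXY : s * X * Y = 0) (X2Y : X ^ 2 * Y = 0) (s3X : s ^ 3 * X = 0)
    (s2X2 : s ^ 2 * X ^ 2 = 0) (sX3 : s * X ^ 3 = 0)
    (Y2 : 3 * Y ^ 2 = 3 * s * X ^ 2 - 2 * n * X ^ 3) (hn : n = m - (m - 1) * s)
    (hm : m * lam = m - 1) (hh : h = b10 + s * e) (he : 6 * e = 6 * b11 - b10 ^ 3)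
    (hd : 6 * d = 6 * b20 + b10 ^ 3 * m) (hg11 : 2 * g11 = b10 ^ 2)
    (hg20 : 2 * g20 = -(b10 ^ 2 * m)) (hg12 : 8 * g12 = -b10 ^ 4 + 8 * b10 * b11)
    (hg30 : 36 * g30 = 5 * m ^ 2 * b10 ^ 4 - 120 * m * d * b10)
    (hg21 : 24 * g21 = -(m * b10 ^ 4) + 12 * lam * m * b10 ^ 2 - 24 * m * b10 * b11 +
      96 * d * b10) :
    matchPoly s X Y n h d b10 b11 b12 b20 b21 b30 g11 g20 g12 g21 g30 = 0 := by
  subst hh hn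
  rw [matchPoly]
  linear_combination
    (2 * (b10 + s * e) ^ 4 * (m - (m - 1) * s) - 48 * d * (b10 + s * e)) * Y2 + (36 * s * X) *
    hg11 + (36 * X ^ 2) * hg20 + (9 * s ^ 2 * X) * hg12 + (2 * X ^ 3) * hg30 + (3 * s * X ^ 2) *
    hg21 + (12 * s * Y-12 * b10 * s ^ 2 * X+12 * b10 * m * s * X ^ 2) * he + (24 * X * Y) * hd +
    (36 * b10 ^ 2 * s * X ^ 2) * hm + ((-72 * X * b10 * e ^ 2 * m) + 72 * X * b10 * e ^ 2 * m * s
    + (-72 * X * b10 * e ^ 2 * s) + (-72 * X * b10 ^ 2 * e) + 72 * X * b10 ^ 2 * e * m + (-24 * X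
    * e ^ 3 * m * s) + 24 * X * e ^ 3 * m * s ^ 2 + (-24 * X * e ^ 3 * s ^ 2) + 36 * b10 * e ^ 2
    * s + 36 * b10 ^ 2 * e + (-72 * b12) + 12 * e ^ 3 * s ^ 2) * s2Y + ((-72 * b10 ^ 2 * e * m) +
    (-24 * b10 ^ 3) + 24 * b10 ^ 3 * m + (-144 * b21)) * sXY + ((-216 * b30)) * X2Y + (60 * X *
    b10 * e ^ 3 * m * s + (-60 * X * b10 * e ^ 3 * m * s ^ 2) + 60 * X * b10 * e ^ 3 * s ^ 2 + 90
    * X * b10 ^ 2 * e ^ 2 * m + (-90 * X * b10 ^ 2 * e ^ 2 * m * s) + 90 * X * b10 ^ 2 * e ^ 2 *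
    s + 60 * X * b10 ^ 3 * e + (-60 * X * b10 ^ 3 * e * m) + 36 * X * e ^ 2 + (-36 * X * e ^ 2 *
    m) + 15 * X * e ^ 4 * m * s ^ 2 + (-15 * X * e ^ 4 * m * s ^ 3) + 15 * X * e ^ 4 * s ^ 3 +
    (-80 * X ^ 2 * b10 * e ^ 3 * m * s) + 80 * X ^ 2 * b10 * e ^ 3 * m * s ^ 2 + (-40 * X ^ 2 *
    b10 * e ^ 3 * m ^ 2) + 80 * X ^ 2 * b10 * e ^ 3 * m ^ 2 * s + (-40 * X ^ 2 * b10 * e ^ 3 * m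
    ^ 2 * s ^ 2) + (-40 * X ^ 2 * b10 * e ^ 3 * s ^ 2) + (-120 * X ^ 2 * b10 ^ 2 * e ^ 2 * m) +
    120 * X ^ 2 * b10 ^ 2 * e ^ 2 * m * s + 120 * X ^ 2 * b10 ^ 2 * e ^ 2 * m ^ 2 + (-60 * X ^ 2
    * b10 ^ 2 * e ^ 2 * m ^ 2 * s) + (-60 * X ^ 2 * b10 ^ 2 * e ^ 2 * s) + (-40 * X ^ 2 * b10 ^ 3
    * e) + 80 * X ^ 2 * b10 ^ 3 * e * m + (-40 * X ^ 2 * b10 ^ 3 * e * m ^ 2) + (-20 * X ^ 2 * e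
    ^ 4 * m * s ^ 2) + 20 * X ^ 2 * e ^ 4 * m * s ^ 3 + (-10 * X ^ 2 * e ^ 4 * m ^ 2 * s) + 20 *
    X ^ 2 * e ^ 4 * m ^ 2 * s ^ 2 + (-10 * X ^ 2 * e ^ 4 * m ^ 2 * s ^ 3) + (-10 * X ^ 2 * e ^ 4
    * s ^ 3) + (-12 * b10 * e ^ 3 * s ^ 2) + (-18 * b10 ^ 2 * e ^ 2 * s) + (-12 * b10 ^ 3 * e) +
    (-36 * e ^ 2) + (-3 * e ^ 4 * s ^ 3)) * s3X + ((-60 * X * b10 ^ 2 * e ^ 2 * m ^ 2) + (-80 * X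
    * b10 ^ 3 * e * m) + 80 * X * b10 ^ 3 * e * m ^ 2 + (-10 * X * b10 ^ 4) + 20 * X * b10 ^ 4 *
    m + (-10 * X * b10 ^ 4 * m ^ 2) + 240 * X * d * e + (-240 * X * d * e * m) + 72 * b10 * e +
    (-72 * b10 * e * m) + 60 * b10 ^ 3 * e * m + 15 * b10 ^ 4 + (-15 * b10 ^ 4 * m) + (-288 * d *
    e) + 36 * e ^ 2 * m) * s2X2 + (240 * b10 * d + (-240 * b10 * d * m) + (-40 * b10 ^ 3 * e * m
    ^ 2) + (-20 * b10 ^ 4 * m) + 20 * b10 ^ 4 * m ^ 2 + 240 * d * e * m) * sX3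

/-! ### Taylor expansion -/

/-- The derivative of the Taylor remainder of `G 0` is the remainder, one order lower, of `G 1`;
induction and the mean value inequality on [0, 1] give the bound. The factor `1/n!` is not needed.
-/
theorem taylor_bound {M : ℝ} (n : ℕ) : ∀ G : ℕ → ℝ → ℝ,
    (∀ j θ, HasDerivAt (G j) (G (j + 1) θ) θ) → (∀ θ ∈ Set.Icc (0 : ℝ) 1, |G n θ| ≤ M) →
    ∀ θ ∈ Set.Icc (0 : ℝ) 1,
      |G 0 θ - ∑ j ∈ Finset.range n, θ ^ j / (j.factorial : ℝ) * G j 0| ≤ M := by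
  induction n with
  | zero => intro G _ h θ hθ; simpa using h θ hθ
  | succ n ih =>
    intro G hG h θ hθ
    have ih' := ih (fun j => G (j + 1)) (fun j => hG (j + 1)) h
    have hd : ∀ θ, HasDerivAt (fun θ => G 0 θ - ∑ j ∈ Finset.range (n + 1),
        θ ^ j / (j.factorial : ℝ) * G j 0)
        (G 1 θ - ∑ j ∈ Finset.range n, θ ^ j / (j.factorial : ℝ) * G (j + 1) 0) θ := fun θ => by
      refine (hG 0 θ).sub ?_
      simp only [Finset.sum_range_succ' _ n, pow_zero]
      apply HasDerivAt.add_const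
      apply HasDerivAt.fun_sum
      intro j _
      refine (((hasDerivAt_pow (j + 1) θ).div_const _).mul_const _).congr_deriv ?_
      rw [Nat.factorial_succ]
      push_cast
      have : (j.factorial : ℝ) ≠ 0 := by positivity
      field_simp
    have hM : 0 ≤ M := (abs_nonneg _).trans (h θ hθ)
    have key := norm_image_sub_le_of_norm_deriv_le_segment' (E := ℝ)
      (f := fun θ => G 0 θ - ∑ j ∈ Finset.range (n + 1), θ ^ j / (j.factorial : ℝ) * G j 0)
      (a := 0) (b := 1) (fun x _ => (hd x).hasDerivWithinAt) (C := M) (fun x hx => ih' x ⟨hx.1, hx.2.le⟩) θ hθ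
    have e0 : G 0 0 - ∑ j ∈ Finset.range (n + 1), (0 : ℝ) ^ j / (j.factorial : ℝ) * G j 0 = 0 := by
      rw [Finset.sum_range_succ']
      simp
    rw [e0, sub_zero, Real.norm_eq_abs, sub_zero] at key
    exact key.trans (mul_le_of_le_one_right hM hθ.2)

theorem iteratedDeriv_hasDerivAt {f : ℝ → ℝ} (hf : ContDiff ℝ ∞ f) (n : ℕ) (x : ℝ) :
    HasDerivAt (iteratedDeriv n f) (iteratedDeriv (n + 1) f x) x := by
  rw [iteratedDeriv_succ]
  exact ((hf.differentiable_iteratedDeriv n (by exact_mod_cast WithTop.coe_lt_top _)) x).hasDerivAt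

/-- Taylor expansion along the segment from `r` to `r - k`. Half of the exponential rate is given
up: this absorbs the polynomial factors in 𝒴 and bounds the effect of the shift by `e^{|k|/2}`. -/
theorem taylor_exp {g : ℝ → ℝ} (hg : Gr 1 g) (n : ℕ) : ∃ K, 0 ≤ K ∧ ∀ r k : ℝ,
    |g (r - k) - ∑ j ∈ Finset.range n, (-k) ^ j / (j.factorial : ℝ) * iteratedDeriv j g r| ≤
      K * |k| ^ n * Real.exp (|k| / 2) * Real.exp (-(|r| / 2)) := by
  obtain ⟨K, hK, hb⟩ := (hg.iter n).bnd.le_exp (show (1 / 2 : ℝ) < 1 by norm_num)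
  refine ⟨K, hK, fun r k => ?_⟩
  have key := taylor_bound n (fun j θ => (-k) ^ j * iteratedDeriv j g (r - θ * k)) (fun j θ => ?_)
    (M := K * |k| ^ n * Real.exp (|k| / 2) * Real.exp (-(|r| / 2))) (fun θ hθ => ?_) 1
    ⟨zero_le_one, le_rfl⟩
  · simp only [pow_zero, one_mul, iteratedDeriv_zero, one_pow, zero_mul, sub_zero] at key
    refine (le_of_eq ?_).trans key
    congr 2
    exact Finset.sum_congr rfl fun j _ => by ring
  · have h1 : HasDerivAt (fun θ : ℝ => r - θ * k) (-k) θ := by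
      simpa using ((hasDerivAt_id θ).mul_const k).const_sub r
    refine (((iteratedDeriv_hasDerivAt hg.1 j _).comp θ h1).const_mul ((-k) ^ j)).congr_deriv ?_
    ring
  · rw [abs_mul, abs_pow, abs_neg]
    have h2 : |r| - |k| ≤ |r - θ * k| := by
      have h3 := abs_sub_abs_le_abs_sub r (θ * k)
      rw [abs_mul, abs_of_nonneg hθ.1] at h3
      nlinarith [hθ.2, abs_nonneg k]
    calc |k| ^ n * |iteratedDeriv n g (r - θ * k)|
        ≤ |k| ^ n * (K * Real.exp (-(1 / 2 * |r - θ * k|))) := by gcongr; exact hb _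
      _ ≤ |k| ^ n * (K * Real.exp (|k| / 2 + -(|r| / 2))) := by gcongr; linarith
      _ = _ := by rw [Real.exp_add]; ring

/-- `σ^{k/2} e^{-|r|/2}`. -/
noncomputable def wHalf (lam : ℝ) (k : ℕ) (i : Par) (x : ℝ) : ℝ :=
  Real.sqrt i.1.1 ^ k * Real.exp (-(|rVar lam i x| / 2))

theorem Ord.to_wHalf {lam : ℝ} {k : ℕ} {f : Par → ℝ → ℝ} (hf : Ord (wExp lam k) f) :
    Ord (wHalf lam k) f := by
  refine hf.mono 1 zero_le_one fun i x => ?_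
  rw [one_mul, wExp, wHalf]
  have := abs_nonneg (rVar lam i x)
  gcongr
  linarith

/-- In the variable r the shift is `√σ h`, so n terms of the expansion gain `σ^{n/2}`; with the
weight of the prefactor κ this has to add up to 7. The derivative of the remainder is √σ times the
remainder of `g'`. -/
theorem ord_taylor {g : ℝ → ℝ} (hg : Gr 1 g) (lam : ℝ) (n : ℕ) {κ h : Par → ℝ} {K₀ H : ℝ}
    (hκ : ∀ i, |κ i| * Real.sqrt i.1.1 ^ n ≤ K₀ * Real.sqrt i.1.1 ^ 7) (hH : ∀ i, |h i| ≤ H) :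
    Ord (wHalf lam 7) fun i x => κ i * (g (rVar lam i x - Real.sqrt i.1.1 * h i) -
      ∑ j ∈ Finset.range n, (-(Real.sqrt i.1.1 * h i)) ^ j / (j.factorial : ℝ) *
        iteratedDeriv j g (rVar lam i x)) := by
  obtain ⟨K, hK, hb⟩ := taylor_exp hg n
  obtain ⟨K', hK', hb'⟩ := taylor_exp hg.derivative n
  refine ⟨(K + K') * (|K₀| * H ^ n * Real.exp (H / 2)), ?_, fun i x => ?_⟩
  · have : 0 ≤ H := (abs_nonneg _).trans (hH ⟨(1 / 2, 0), by norm_num, by norm_num⟩)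
    positivity
  set ε := Real.sqrt i.1.1 with hε
  have hε0 : 0 ≤ ε := Real.sqrt_nonneg _
  have hε1 : ε ≤ 1 := Real.sqrt_le_one.2 i.2.2.le
  have hH0 : 0 ≤ H := (abs_nonneg _).trans (hH i)
  have hk : |ε * h i| ≤ ε * H := by
    rw [abs_mul, abs_of_nonneg hε0]; exact mul_le_mul_of_nonneg_left (hH i) hε0
  have bound : ∀ {L : ℝ}, 0 ≤ L → |κ i| * (L * |ε * h i| ^ n * Real.exp (|ε * h i| / 2) *
      Real.exp (-(|rVar lam i x| / 2))) ≤
      L * (|K₀| * H ^ n * Real.exp (H / 2)) * wHalf lam 7 i x := fun {L} hL => by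
    have e1 : |ε * h i| ^ n ≤ ε ^ n * H ^ n := by rw [← mul_pow]; gcongr
    have e2 : Real.exp (|ε * h i| / 2) ≤ Real.exp (H / 2) := by
      gcongr; exact hk.trans (mul_le_of_le_one_left hH0 hε1)
    have e3 : |κ i| * ε ^ n ≤ |K₀| * ε ^ 7 :=
      (hκ i).trans (mul_le_mul_of_nonneg_right (le_abs_self _) (by positivity))
    calc _ ≤ |κ i| * (L * (ε ^ n * H ^ n) * Real.exp (H / 2) *
          Real.exp (-(|rVar lam i x| / 2))) := by gcongr
      _ = L * ((|κ i| * ε ^ n) * H ^ n * Real.exp (H / 2)) *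
          Real.exp (-(|rVar lam i x| / 2)) := by ring
      _ ≤ L * ((|K₀| * ε ^ 7) * H ^ n * Real.exp (H / 2)) *
          Real.exp (-(|rVar lam i x| / 2)) := by gcongr
      _ = _ := by rw [wHalf]; ring
  have hw : 0 ≤ (|K₀| * H ^ n * Real.exp (H / 2)) * wHalf lam 7 i x := by
    rw [wHalf]; positivity
  have hr : HasDerivAt (rVar lam i) ε x :=
    ((hasDerivAt_ySig lam i.1.1 i.1.2 x).const_mul (Real.sqrt i.1.1)).congr_deriv (mul_one _)
  have hd : HasDerivAt (fun x => κ i * (g (rVar lam i x - ε * h i) -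
      ∑ j ∈ Finset.range n, (-(ε * h i)) ^ j / (j.factorial : ℝ) *
        iteratedDeriv j g (rVar lam i x)))
      (ε * (κ i * (deriv g (rVar lam i x - ε * h i) -
      ∑ j ∈ Finset.range n, (-(ε * h i)) ^ j / (j.factorial : ℝ) *
        iteratedDeriv j (deriv g) (rVar lam i x)))) x := by
    have h1 := (contDiff_hasDerivAt hg.1 (rVar lam i x - ε * h i)).comp x (hr.sub_const (ε * h i))
    have h2 := fun j => (((iteratedDeriv_hasDerivAt hg.1 j (rVar lam i x)).comp x hr).const_mul
      ((-(ε * h i)) ^ j / (j.factorial : ℝ)))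
    refine ((h1.sub (HasDerivAt.fun_sum fun j (_ : j ∈ Finset.range n) => h2 j)).const_mul
      (κ i)).congr_deriv ?_
    simp only [iteratedDeriv_succ', ← mul_assoc, ← Finset.sum_mul]
    ring
  refine ⟨hd.differentiableAt, ?_, ?_⟩
  · rw [abs_mul]
    refine (mul_le_mul_of_nonneg_left (hb _ _) (abs_nonneg _)).trans ((bound hK).trans ?_)
    nlinarith [mul_nonneg hK' hw]
  · rw [hd.deriv, abs_mul, abs_mul, abs_of_nonneg hε0]
    refine (mul_le_of_le_one_left (by positivity) hε1).trans ?_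
    refine (mul_le_mul_of_nonneg_left (hb' _ _) (abs_nonneg _)).trans ((bound hK').trans ?_)
    nlinarith [mul_nonneg hK hw]


/-! ### Expansion of the approximate solution to the left of the large soliton. -/

theorem deriv_Qt_pow (lam sig s : ℝ) (k : ℕ) : deriv (fun r => Qt lam sig r ^ k) s =
    k * Qt lam sig s ^ (k - 1) * Qt' lam sig s :=
  ((hasDerivAt_Qt lam sig s).pow k).deriv

theorem iteratedDeriv_four_Q (y : ℝ) : iteratedDeriv 4 Q y =
    (Q y - Q y ^ 2) * (1 - 2 * Q y) - 2 * deriv Q y ^ 2 := by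
  have e : iteratedDeriv 3 Q = fun y => deriv Q y - 2 * Q y * deriv Q y := by
    funext y
    have := iteratedDeriv_three_Q y
    rw [iteratedDeriv_one, iteratedDeriv_zero] at this
    linarith
  rw [show 4 = 3 + 1 from rfl, iteratedDeriv_succ, e]
  have h := hasDerivAt_deriv_Q y
  have h0 := hasDerivAt_Q' y
  refine (h.sub ((h0.const_mul 2).mul h)).deriv.trans ?_
  ring

theorem gr_Q_mul_deriv : Gr 1 fun x => Q x * deriv Q x := by
  refine (Gr.mul gr_Q gr_Q.derivative).mono ?_
  norm_num

/-- The expansion of the approximate solution on the left of the large soliton, minus the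
prediction for the small soliton. -/
noncomputable def matchErr (lam : ℝ) (P : Profile) (i : Par) (x : ℝ) : ℝ :=
  Qt lam i.1.1 (ySig lam i.1.1 i.1.2 x) +
    ∑ p ∈ Sigma0, i.1.1 ^ p.2 *
      (gammaCoef lam P p.1 p.2 * Qt lam i.1.1 (ySig lam i.1.1 i.1.2 x) ^ p.1 -
        P.b p.1 p.2 * deriv (fun r => Qt lam i.1.1 r ^ p.1) (ySig lam i.1.1 i.1.2 x)) -
    (Qt lam i.1.1 (ySig lam i.1.1 i.1.2 x - deltaSig i.1.1 P / 2) -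
      dCoef lam P * deriv (fun r => Qt lam i.1.1 r ^ 2)
        (ySig lam i.1.1 i.1.2 x - deltaSig i.1.1 P / 2))

theorem ord_matchErr {lam : ℝ} (h0 : 0 < lam) (h1 : lam < 1) (P : Profile) :
    Ord (wHalf lam 7) (matchErr lam P) := by
  set H := |P.b 1 0| + |P.b 1 1 - P.b 1 0 ^ 3 / 6| with hH
  have hh : ∀ i : Par, |deltaSig i.1.1 P / 2| ≤ H := fun i => by
    rw [deltaSig, mul_div_cancel_left₀ _ two_ne_zero]
    refine (abs_add_le _ _).trans ?_
    rw [abs_mul, abs_of_pos i.2.1]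
    nlinarith [i.2.2, abs_nonneg (P.b 1 1 - P.b 1 0 ^ 3 / 6)]
  -- Q̃_σ has weight 2, so five Taylor terms leave a remainder of weight 7.
  have t1 := ord_taylor gr_Q lam 5 (κ := fun i => i.1.1 * theta lam i.1.1)
    (h := fun i => deltaSig i.1.1 P / 2) (K₀ := 1) (H := H) (fun i => by
      have a := theta_pos h0 h1 i.2.2
      have b := theta_le_one h0 h1 i.2.2
      have c := i.2.1
      have e : Real.sqrt i.1.1 ^ 7 = i.1.1 * Real.sqrt i.1.1 ^ 5 := by
        rw [show 7 = 2 + 5 from rfl, pow_add, Real.sq_sqrt c.le]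
      rw [abs_of_pos (by positivity), e, one_mul]
      have : 0 ≤ Real.sqrt i.1.1 ^ 5 := by positivity
      gcongr
      nlinarith) hh
  -- `(Q̃_σ²)' = 2(σθ)² √σ (Q Q')(√σ s)` has weight 5, so two Taylor terms suffice.
  have t2 := ord_taylor gr_Q_mul_deriv lam 2
    (κ := fun i => 2 * (i.1.1 * theta lam i.1.1) ^ 2 * Real.sqrt i.1.1)
    (h := fun i => deltaSig i.1.1 P / 2) (K₀ := 2) (H := H) (fun i => by
      have a := theta_pos h0 h1 i.2.2
      have b := theta_le_one h0 h1 i.2.2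
      have c := i.2.1
      have e : Real.sqrt i.1.1 ^ 7 = i.1.1 ^ 2 * Real.sqrt i.1.1 * Real.sqrt i.1.1 ^ 2 := by
        have := Real.sq_sqrt c.le
        rw [show Real.sqrt i.1.1 ^ 7 = (Real.sqrt i.1.1 ^ 2) ^ 2 * Real.sqrt i.1.1 *
          Real.sqrt i.1.1 ^ 2 by ring, this]
      rw [abs_of_nonneg (by positivity), e, mul_pow]
      have h3 : theta lam i.1.1 ^ 2 ≤ 1 := pow_le_one₀ a.le b
      have h4 : 0 ≤ Real.sqrt i.1.1 * Real.sqrt i.1.1 ^ 2 := by positivity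
      calc _ = 2 * (i.1.1 ^ 2 * theta lam i.1.1 ^ 2 * (Real.sqrt i.1.1 * Real.sqrt i.1.1 ^ 2)) := by
            ring
        _ ≤ 2 * (i.1.1 ^ 2 * 1 * (Real.sqrt i.1.1 * Real.sqrt i.1.1 ^ 2)) := by gcongr
        _ = _ := by ring) hh
  let s : bddRing Par := ⟨fun i _ => i.1.1, ord_one_of_le (c := fun i : Par => i.1.1) 1 fun i => by
        rw [abs_of_pos i.2.1]; exact i.2.2.le⟩
  let X : bddRing Par := ⟨_, (ord_X h0 h1).to_one (wExp_le_one lam 2)⟩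
  let Y : bddRing Par := ⟨_, (ord_Y h0 h1).to_one (wExp_le_one lam 3)⟩
  let n : bddRing Par := constFam (1 - lam)⁻¹ - (constFam (1 - lam)⁻¹ - 1) * s
  let c : ℝ → bddRing Par := constFam
  let h : bddRing Par := c (P.b 1 0) + s * c (P.b 1 1 - P.b 1 0 ^ 3 / 6)
  let E : bddRing Par := matchPoly s X Y n h (c (dCoef lam P)) (c (P.b 1 0)) (c (P.b 1 1))
    (c (P.b 1 2)) (c (P.b 2 0)) (c (P.b 2 1)) (c (P.b 3 0)) (c (gammaCoef lam P 1 1))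
    (c (gammaCoef lam P 2 0)) (c (gammaCoef lam P 1 2)) (c (gammaCoef lam P 2 1))
    (c (gammaCoef lam P 3 0))
  have oE : Ord (wHalf lam 7) E.1 := by
    refine Ord.to_wHalf ?_
    suffices h : Ideal.Quotient.mk (ordIdeal (wExp lam 7)) E = 0 from
      Ideal.Quotient.eq_zero_iff_mem.1 h
    have oX : Ord (wExp lam 2) X.1 := ord_X h0 h1
    have oY : Ord (wExp lam 3) Y.1 := ord_Y h0 h1
    have os : Ord (fun (i : Par) _ => Real.sqrt i.1.1 ^ 2) s.1 := ord_sig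
    have eX : ∀ i x, evalHom i x X = Qt lam i.1.1 (ySig lam i.1.1 i.1.2 x) := fun i x => rfl
    have eY : ∀ i x, evalHom i x Y = Qt' lam i.1.1 (ySig lam i.1.1 i.1.2 x) := fun i x => rfl
    have es : ∀ i x, evalHom i x s = i.1.1 := fun i x => rfl
    have ec : ∀ i x a, evalHom i x (c a) = a := fun i x a => rfl
    have en : n = c (1 - lam)⁻¹ - (c (1 - lam)⁻¹ - 1) * s := rfl
    have eh : h = c (P.b 1 0) + s * c (P.b 1 1 - P.b 1 0 ^ 3 / 6) := rfl
    have en' : ∀ i x, evalHom i x n = (theta lam i.1.1)⁻¹ := fun i x => by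
      rw [en, map_sub, map_mul, map_sub, map_one, ec, es, theta_inv h1]
    show Ideal.Quotient.mk _ (matchPoly s X Y n h _ _ _ _ _ _ _ _ _ _ _ _) = 0
    clear_value s X Y n h c
    rw [map_matchPoly]
    set π := Ideal.Quotient.mk (ordIdeal (wExp lam 7)) with hπ
    have X2 := ord_wExp_mul oX oX
    have X3 := ord_wExp_mul X2 oX
    have z : ∀ {E F : bddRing Par} {k : ℕ}, Ord (wExp lam k) F.1 → 7 ≤ k → E = F → π E = 0 :=
      fun h hk e => e ▸ mk_eq_zero_of_ord (h.wExp_mono hk)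
    have p1 : (1 : bddRing Par ⧸ ordIdeal (wExp lam 7)) = π 1 := (map_one π).symm
    have pn : ∀ (k : ℕ) [k.AtLeastTwo],
      (OfNat.ofNat k : bddRing Par ⧸ ordIdeal (wExp lam 7)) = π (OfNat.ofNat k) :=
      fun k _ => (map_ofNat π k).symm
    have hm : (1 - lam) ≠ 0 := by linarith
    refine matchPoly_eq_zero (m := π (c (1 - lam)⁻¹)) (lam := π (c lam))
      (e := π (c (P.b 1 1 - P.b 1 0 ^ 3 / 6))) ?_ ?_ ?_ ?_ ?_ ?_ ?_ ?_ ?_ ?_ ?_ ?_ ?_ ?_ ?_ ?_ ?_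
    · rw [← map_pow, ← map_mul]
      exact z (F := s * (s * Y)) (ord_pow_mul os (ord_pow_mul os oY)) (by norm_num)
        (by simp only [pow_succ, pow_zero, one_mul, mul_assoc])
    · rw [← map_mul, ← map_mul]
      exact z (F := s * (X * Y)) (ord_pow_mul os (ord_wExp_mul oX oY)) (by norm_num)
        (by simp only [mul_assoc])
    · rw [← map_pow, ← map_mul]
      exact z (F := X * X * Y) (ord_wExp_mul X2 oY) (by norm_num)
        (by simp only [pow_succ, pow_zero, one_mul])
    · rw [← map_pow, ← map_mul]
      exact z (F := s * (s * (s * X))) (ord_pow_mul os (ord_pow_mul os (ord_pow_mul os oX)))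
        (by norm_num) (by simp only [pow_succ, pow_zero, one_mul, mul_assoc])
    · rw [← map_pow, ← map_pow, ← map_mul]
      exact z (F := s * (s * (X * X))) (ord_pow_mul os (ord_pow_mul os X2)) (by norm_num)
        (by simp only [pow_succ, pow_zero, one_mul, mul_assoc])
    · rw [← map_pow, ← map_mul]
      exact z (F := s * (X * X * X)) (ord_pow_mul os X3) (by norm_num)
        (by simp only [pow_succ, pow_zero, one_mul, mul_assoc])
    all_goals simp only [p1, pn, ← map_mul, ← map_sub, ← map_add, ← map_pow, ← map_neg]
    · refine mk_eq_of_eval fun i x => ?_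
      simp only [map_mul, map_sub, map_pow, map_ofNat, eX, eY, es, en',
        Qt'_sq h0 h1 i.2.1 i.2.2]
      ring
    · rw [en]
    · refine mk_eq_of_eval fun i x => ?_
      simp only [map_mul, map_sub, map_one, ec]
      field_simp
      ring
    · rw [eh]
    · refine mk_eq_of_eval fun i x => ?_
      simp only [map_mul, map_sub, map_pow, map_ofNat, ec]
      ring
    all_goals
      refine mk_eq_of_eval fun i x => ?_
      simp only [map_mul, map_sub, map_add, map_neg, map_pow, map_ofNat, ec, gammaCoef, dCoef]
      field_simp
      try ring
  -- The matching error is `1/72` of the matching polynomial, plus d(λ) times the second Taylor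
  -- remainder, minus the first one.
  have key := (oE.add ((t2.mul (ord_const (ι := Par) (c := fun _ => 72 * dCoef lam P)
      (w := fun _ => 1) |72 * dCoef lam P| (abs_nonneg _) fun _ => by simp)).add
      (t1.mul (ord_const (ι := Par) (c := fun _ => -72) (w := fun _ => 1) 72
        (by norm_num) fun _ => by simp)) |>.mono 1 zero_le_one (w := wHalf lam 7)
          fun i x => by simp)).mul
    (ord_const (ι := Par) (c := fun _ => 1 / 72) (w := fun _ => 1) 1 zero_le_one
      fun _ => by norm_num)
  refine (congrArg (Ord (wHalf lam 7)) ?_).mpr (key.mono 1 zero_le_one fun i x => by simp)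
  funext i x
  have hc := i.2.1
  have ht := (theta_pos h0 h1 i.2.2).ne'
  have hε := Real.sq_sqrt hc.le
  have eE : E.1 i x = matchPoly i.1.1 (Qt lam i.1.1 (ySig lam i.1.1 i.1.2 x))
      (Qt' lam i.1.1 (ySig lam i.1.1 i.1.2 x)) ((theta lam i.1.1)⁻¹) (deltaSig i.1.1 P / 2)
      (dCoef lam P) (P.b 1 0) (P.b 1 1) (P.b 1 2) (P.b 2 0) (P.b 2 1) (P.b 3 0)
      (gammaCoef lam P 1 1) (gammaCoef lam P 2 0) (gammaCoef lam P 1 2) (gammaCoef lam P 2 1)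
      (gammaCoef lam P 3 0) := by
    rw [← evalHom_apply, theta_inv h1, deltaSig, mul_div_cancel_left₀ _ two_ne_zero]
    exact map_matchPoly (evalHom i x) _ _ _ _ _ _ _ _ _ _ _ _ _ _ _ _ _
  have d2 : iteratedDeriv 1 (fun x => Q x * deriv Q x) (rVar lam i x) =
      deriv Q (rVar lam i x) ^ 2 + Q (rVar lam i x) * (Q (rVar lam i x)
          - Q (rVar lam i x) ^ 2) := by
    rw [iteratedDeriv_one]
    refine ((hasDerivAt_Q' _).mul (hasDerivAt_deriv_Q _)).deriv.trans ?_
    ring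
  have d3 := iteratedDeriv_three_Q (rVar lam i x)
  rw [iteratedDeriv_one, iteratedDeriv_zero] at d3
  have er : ∀ u, Real.sqrt i.1.1 * (ySig lam i.1.1 i.1.2 x - u) =
    rVar lam i x - Real.sqrt i.1.1 * u := fun u => mul_sub _ _ _
  show _ = (E.1 i x + (_ * (72 * dCoef lam P) + _ * (-72))) * (1 / 72)
  rw [eE, matchErr]
  have g10 : gammaCoef lam P 1 0 = 0 := rfl
  have g3 : iteratedDeriv 3 Q (rVar lam i x) = deriv Q (rVar lam i x) -
    2 * Q (rVar lam i x) * deriv Q (rVar lam i x) := by linarith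
  simp only [sum_Sigma0, Finset.sum_range_succ, Finset.sum_range_zero, d2, iteratedDeriv_four_Q,
    g3, g10, iteratedDeriv_two_Q, iteratedDeriv_one, iteratedDeriv_zero, deriv_Qt_pow]
  simp only [Qt, Qt', er, matchPoly, Nat.factorial]
  rw [show Real.sqrt i.1.1 * ySig lam i.1.1 i.1.2 x = rVar lam i x from rfl]
  generalize theta lam i.1.1 = θ at *
  generalize deltaSig i.1.1 P / 2 = η at *
  generalize Real.sqrt i.1.1 = ε at *
  rw [← hε]
  generalize Q (rVar lam i x - ε * η) = u
  generalize deriv Q (rVar lam i x - ε * η) = u'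
  generalize Q (rVar lam i x) = v
  generalize deriv Q (rVar lam i x) = v'
  field_simp
  push_cast
  ring


/-! ### The exponentially small terms -/

theorem integrable_Qt_pow (lam : ℝ) {sig : ℝ} (hp : 0 < sig) {k : ℕ} (hk : k ≠ 0) :
    Integrable fun s => Qt lam sig s ^ k := by
  obtain ⟨j, rfl⟩ := Nat.exists_eq_succ_of_ne_zero hk
  have hc : Continuous Q := (contDiff_Q (n := 0)).continuous
  have hQ : Integrable fun x => Q x ^ (j + 1) := by
    refine ((gr_Q.bnd.integrable one_pos hc).const_mul ((3 / 2) ^ j)).mono'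
      (hc.pow (j + 1)).aestronglyMeasurable (Filter.Eventually.of_forall fun x => ?_)
    have h := (Q_pos x).le
    rw [Real.norm_eq_abs, abs_of_nonneg (pow_nonneg h _), pow_succ]
    gcongr
    exact Q_le x
  have h := (hQ.comp_mul_left' (Real.sqrt_pos.2 hp).ne').const_mul ((sig * theta lam sig) ^ (j + 1))
  simpa only [Qt, mul_pow] using h

theorem integral_beta {lam sig : ℝ} (P : Profile) (hp : 0 < sig) :
    Integrable (beta lam sig P) ∧ ∫ s in Set.Ioi 0, beta lam sig P s = delta lam sig P / 2 := by
  have hi : ∀ p ∈ Sigma0, Integrable fun s => P.a p.1 p.2 * sig ^ p.2 * Qt lam sig s ^ p.1 :=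
    fun p hpm => (integrable_Qt_pow lam hp (by
      rcases mem_Sigma0_cases hpm with rfl | rfl | rfl | rfl | rfl | rfl <;> simp)).const_mul _
  refine ⟨integrable_finset_sum _ hi, ?_⟩
  have h1 : ∫ s, beta lam sig P s = delta lam sig P := by
    simp only [beta]
    rw [integral_finset_sum _ hi]
    exact Finset.sum_congr rfl fun p _ => integral_const_mul _ _
  have h2 : ∫ s, beta lam sig P |s| = ∫ s, beta lam sig P s := by
    refine integral_congr_ae (Filter.Eventually.of_forall fun s => ?_)
    rcases abs_choice s with h | h
    · simp only [h]
    · simp only [h, beta_even]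
  rw [integral_comp_abs, h1] at h2
  linarith

/-- `∫_0^∞ β = δ/2` because β is even, and `β = O(σ e^{-√σ s})` integrates to a tail `O(√σ e^{-√σ
s})`. The second bound is used for all real s; for negative s it is weak but true. -/
theorem exists_alpha_bound {lam : ℝ} (h0 : 0 < lam) (h1 : lam < 1) (P : Profile) :
    ∃ K, 0 ≤ K ∧ ∀ sig, 0 < sig → sig < 1 → |delta lam sig P / 2| ≤ K ∧ ∀ s,
      |alpha lam sig P s| ≤ K ∧
        |alpha lam sig P s - delta lam sig P / 2| ≤ K * Real.exp (-(Real.sqrt sig * s)) := by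
  obtain ⟨K, hK, hb⟩ := abs_beta_le h0 h1 P
  refine ⟨2 * K, by positivity, fun sig hp hs => ?_⟩
  obtain ⟨hi, hd⟩ := integral_beta (lam := lam) P hp
  set ε := Real.sqrt sig with hε
  have hε0 : 0 < ε := Real.sqrt_pos.2 hp
  have hε1 : ε ≤ 1 := Real.sqrt_le_one.2 hs.le
  have hε2 : ε * ε = sig := Real.mul_self_sqrt hp.le
  have t : ∀ s, |alpha lam sig P s - delta lam sig P / 2| ≤ K * Real.exp (-(ε * s)) := fun s => by
    have e := intervalIntegral.integral_interval_add_Ioi (a := 0) (b := s) hi.integrableOn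
      hi.integrableOn
    rw [hd] at e
    have e' : alpha lam sig P s - delta lam sig P / 2 = -∫ u in Set.Ioi s, beta lam sig P u := by
      rw [alpha]; linarith
    rw [e', abs_neg]
    have hexp := integrableOn_exp_mul_Ioi (neg_lt_zero.2 hε0) s
    refine (norm_integral_le_of_norm_le (G := ℝ) (f := beta lam sig P)
      (hexp.const_mul (K * sig)) (Filter.Eventually.of_forall
      fun u => ?_)).trans ?_
    · refine (hb sig hp hs u).trans (le_of_le_of_eq (b := K * (sig * Real.exp (-ε * u))) ?_ (by ring))
      gcongr
      linarith [le_abs_self (ε * u)]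
    · rw [integral_const_mul, integral_exp_mul_Ioi (neg_lt_zero.2 hε0), neg_div_neg_eq, neg_mul,
        ← hε2]
      calc _ = ε * (K * Real.exp (-(ε * s))) := by field_simp
        _ ≤ _ := mul_le_of_le_one_left (by positivity) hε1
  have hδ : |delta lam sig P / 2| ≤ K := by
    have := t 0
    simpa [alpha] using this
  have hα : ∀ s, 0 ≤ s → |alpha lam sig P s| ≤ 2 * K := fun s hs => by
    have h2 := abs_add_le (alpha lam sig P s - delta lam sig P / 2) (delta lam sig P / 2)
    rw [sub_add_cancel] at h2
    have h3 : K * Real.exp (-(ε * s)) ≤ K :=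
      mul_le_of_le_one_right hK (Real.exp_le_one_iff.2 (by nlinarith [mul_nonneg hε0.le hs]))
    linarith [t s]
  refine ⟨by linarith, fun s => ⟨?_, (t s).trans ?_⟩⟩
  · rcases le_total 0 s with h | h
    · exact hα s h
    · rw [← neg_neg s, alpha_odd, abs_neg]; exact hα _ (by linarith)
  · have := Real.exp_pos (-(ε * s))
    nlinarith

/-- Mean value inequality on a ball around x. The rate 3/4 is below 1, to absorb polynomial factors,
and exceeds the value 1/2 that bounds √σ in the final estimate. -/
theorem Gr.shift_sub {g : ℝ → ℝ} (hg : Gr 1 g) (M : ℝ) : ∃ K, 0 ≤ K ∧ ∀ x a b, |a| ≤ M → |b| ≤ M →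
    |g (x - a) - g (x - b)| ≤ K * |a - b| * Real.exp (-(3 / 4 * |x|)) := by
  obtain ⟨K, hK, hb⟩ := hg.derivative.bnd.le_exp (show (3 / 4 : ℝ) < 1 by norm_num)
  refine ⟨K * Real.exp (3 / 4 * M), by positivity, fun x a b ha hb' => ?_⟩
  have key := (convex_closedBall x M).norm_image_sub_le_of_norm_deriv_le (𝕜 := ℝ) (f := g)
    (C := K * Real.exp (3 / 4 * M) * Real.exp (-(3 / 4 * |x|))) (x := x - b) (y := x - a)
    (fun u _ => (contDiff_hasDerivAt hg.1 u).differentiableAt) (fun u hu => ?_) ?_ ?_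
  · rw [Real.norm_eq_abs, Real.norm_eq_abs] at key
    refine key.trans (le_of_eq ?_)
    rw [show x - a - (x - b) = -(a - b) by ring, abs_neg]
    ring
  · refine (hb u).trans ?_
    rw [mul_assoc, ← Real.exp_add]
    gcongr
    rw [Metric.mem_closedBall, Real.dist_eq] at hu
    have := abs_sub_abs_le_abs_sub x u
    rw [abs_sub_comm] at this
    linarith
  · rw [Metric.mem_closedBall, Real.dist_eq]; simpa using hb'
  · rw [Metric.mem_closedBall, Real.dist_eq]; simpa using ha


theorem Ord.sum {ι κ : Type*} {w : ι → ℝ → ℝ} {s : Finset κ} {f : κ → ι → ℝ → ℝ}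
    (h : ∀ k ∈ s, Ord w (f k)) : Ord w (∑ k ∈ s, f k) :=
  Finset.sum_induction f (Ord w) (fun _ _ => Ord.add)
    ⟨0, le_rfl, fun i x => ⟨differentiableAt_const _, by simp, by
      rw [show (0 : ι → ℝ → ℝ) i = fun _ => 0 from rfl]; simp⟩⟩ h

/-- The value of `r` at `x = 0`. -/
noncomputable def tVar (lam : ℝ) (i : Par) : ℝ := Real.sqrt i.1.1 * (mu lam i.1.1 * i.1.2)

theorem rVar_eq (lam : ℝ) (i : Par) (x : ℝ) : rVar lam i x = Real.sqrt i.1.1 * x + tVar lam i := by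
  rw [rVar, ySig, tVar, mul_add]

/-- Weight for the terms which are localised near the large soliton. -/
noncomputable def wLoc (lam : ℝ) (i : Par) (x : ℝ) : ℝ :=
  Real.exp (-tVar lam i) * Real.exp ((Real.sqrt i.1.1 - 3 / 4) * |x|)

/-- Weight for the tail of the small soliton on the right of the large one. -/
noncomputable def wTail (lam : ℝ) (i : Par) (x : ℝ) : ℝ :=
  Real.exp (-(tVar lam i / 2)) * Real.exp (-(|rVar lam i x| / 2))

/-- With `r = √σ x + T`, where T is the value at x = 0, the small soliton near the large one has
size at most `e^{-T} e^{√σ|x|}`; the localisation `e^{-3|x|/4}` compensates the growth in x. -/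
theorem exp_rVar_le (lam : ℝ) (i : Par) (x : ℝ) :
    Real.exp (-(3 / 4 * |x|)) * Real.exp (-rVar lam i x) ≤ wLoc lam i x := by
  rw [wLoc, ← Real.exp_add, ← Real.exp_add, rVar_eq]
  have h := mul_le_mul_of_nonneg_left (neg_abs_le x) (Real.sqrt_nonneg i.1.1)
  exact Real.exp_le_exp.2 (by linarith)

theorem ord_loc_mul {lam : ℝ} {f g : Par → ℝ → ℝ}
    (hf : Ord (fun _ x => Real.exp (-(3 / 4 * |x|))) f) (hg : Ord (wExp lam 0) g) :
    Ord (wLoc lam) (f * g) := by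
  refine (hf.mul hg).mono 1 zero_le_one fun i x => ?_
  rw [one_mul]
  refine le_trans ?_ (exp_rVar_le lam i x)
  show Real.exp (-(3 / 4 * |x|)) * wExp lam 0 i x ≤ _
  rw [wExp, pow_zero, one_mul]
  gcongr
  exact le_abs_self _

/-- `√σ x/2 = (r - T)/2`, and `r/2 - |r| ≤ -|r|/2`: half of the decay in r is traded for the factor
`e^{-T/2}`. -/
theorem ord_tail_mul {lam : ℝ} {f g : Par → ℝ → ℝ}
    (hf : Ord (fun i x => Real.exp (Real.sqrt i.1.1 / 2 * x)) f) (hg : Ord (wExp lam 0) g) :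
    Ord (wTail lam) (f * g) := by
  refine (hf.mul hg).mono 1 zero_le_one fun i x => ?_
  show Real.exp (Real.sqrt i.1.1 / 2 * x) * wExp lam 0 i x ≤ _
  rw [one_mul, wExp, pow_zero, one_mul, wTail, ← Real.exp_add, ← Real.exp_add]
  have h := le_abs_self (rVar lam i x)
  rw [rVar_eq] at h ⊢
  exact Real.exp_le_exp.2 (by linarith)

theorem ord_comp_yVar_of_le {lam : ℝ} (h0 : 0 < lam) (h1 : lam < 1) (P : Profile) {f : ℝ → ℝ}
    (hf : Differentiable ℝ f) {w : Par → ℝ → ℝ} {K : ℝ} (hK : 0 ≤ K)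
    (h : ∀ i x, |f (yVar lam i.1.1 P i.1.2 x)| ≤ K * w i x)
    (h' : ∀ i x, |deriv f (yVar lam i.1.1 P i.1.2 x)| ≤ K * w i x) :
    Ord w fun i x => f (yVar lam i.1.1 P i.1.2 x) := by
  obtain ⟨K', hK', hb⟩ := abs_beta_le h0 h1 P
  refine ⟨K * (1 + K'), by positivity, fun i x => ?_⟩
  have hw : 0 ≤ K * w i x := (abs_nonneg _).trans (h i x)
  have hd := (hf (yVar lam i.1.1 P i.1.2 x)).hasDerivAt.comp x (hasDerivAt_yVar lam i.1.1 P i.1.2 x)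
  refine ⟨hd.differentiableAt, (h i x).trans (by nlinarith), ?_⟩
  have e : deriv (fun x => f (yVar lam i.1.1 P i.1.2 x)) x = _ := hd.deriv
  rw [e, abs_mul]
  have hb' : |beta lam i.1.1 P (ySig lam i.1.1 i.1.2 x)| ≤ K' := by
    refine (hb _ i.2.1 i.2.2 _).trans (mul_le_of_le_one_right hK' ?_)
    exact mul_le_one₀ i.2.2.le (Real.exp_pos _).le
      (Real.exp_le_one_iff.2 (neg_nonpos.2 (abs_nonneg _)))
  have := abs_sub (1 : ℝ) (beta lam i.1.1 P (ySig lam i.1.1 i.1.2 x))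
  rw [abs_one] at this
  calc _ ≤ K * w i x * (1 + K') := mul_le_mul (h' i x) (by linarith) (abs_nonneg _) hw
    _ = _ := by ring

theorem ord_beta {lam : ℝ} (h0 : 0 < lam) (h1 : lam < 1) (P : Profile) :
    ∃ K, 0 ≤ K ∧ ∀ (i : Par) x, |beta lam i.1.1 P (ySig lam i.1.1 i.1.2 x)| ≤
      K * Real.exp (-rVar lam i x) := by
  obtain ⟨K, hK, hb⟩ := abs_beta_le h0 h1 P
  refine ⟨K, hK, fun i x => (hb _ i.2.1 i.2.2 _).trans ?_⟩
  refine mul_le_mul_of_nonneg_left ((mul_le_of_le_one_left (Real.exp_pos _).le i.2.2.le).trans ?_) hK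
  gcongr
  exact le_abs_self _

/-- As α is bounded uniformly in σ, `y` and `x` differ by a bounded amount, and decay in `y` is
decay in `x`. -/
theorem ord_localized {lam : ℝ} (h0 : 0 < lam) (h1 : lam < 1) (P : Profile) {f : ℝ → ℝ}
    (hf : Gr 1 f) : Ord (fun _ x => Real.exp (-(3 / 4 * |x|))) fun (i : Par) x =>
      f (yVar lam i.1.1 P i.1.2 x) := by
  obtain ⟨M, hM, ha⟩ := exists_alpha_bound h0 h1 P
  obtain ⟨K, hK, hb⟩ := hf.bnd.le_exp (show (3 / 4 : ℝ) < 1 by norm_num)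
  obtain ⟨K', hK', hb'⟩ := hf.derivative.bnd.le_exp (show (3 / 4 : ℝ) < 1 by norm_num)
  have key : ∀ (i : Par) x, Real.exp (-(3 / 4 * |yVar lam i.1.1 P i.1.2 x|)) ≤
      Real.exp (3 / 4 * M) * Real.exp (-(3 / 4 * |x|)) := fun i x => by
    rw [← Real.exp_add]
    have h1 := abs_sub_abs_le_abs_sub x (alpha lam i.1.1 P (ySig lam i.1.1 i.1.2 x))
    have h2 := ((ha i.1.1 i.2.1 i.2.2).2 (ySig lam i.1.1 i.1.2 x)).1
    rw [yVar]
    gcongr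
    linarith
  refine ord_comp_yVar_of_le h0 h1 P (fun x => (contDiff_hasDerivAt hf.1 x).differentiableAt)
    (K := (K + K') * Real.exp (3 / 4 * M)) (by positivity) (fun i x => (hb _).trans ?_)
    fun i x => (hb' _).trans ?_
  · rw [mul_assoc]
    exact mul_le_mul (by linarith) (key i x) (Real.exp_pos _).le (by positivity)
  · rw [mul_assoc]
    exact mul_le_mul (by linarith) (key i x) (Real.exp_pos _).le (by positivity)

/-- The rate c is left free because it is used with `c = √σ/2`, slower than the decay of the small
soliton. On y ≥ 0, `1 + φ ≤ 2`; on y ≤ 0, `1 + φ` decays like `e^y`, which is at most `e^{cy}`. -/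
theorem abs_one_add_phi_le {c : ℝ} (hc : 0 ≤ c) (hc1 : c ≤ 1) (y : ℝ) :
    |1 + phi y| ≤ 4 * Real.exp (c * y) := by
  rcases le_total 0 y with h | h
  · have h1 := abs_le.1 (abs_phi_le y)
    have h2 := Real.add_one_le_exp (c * y)
    have h3 := mul_nonneg hc h
    rw [abs_of_nonneg (by linarith)]
    linarith
  · have h1 := one_sub_phi_le (-y) (by linarith)
    rw [phi_odd, neg_neg, abs_sub_comm, sub_neg_eq_add] at h1
    refine h1.trans ?_
    gcongr
    nlinarith

theorem ord_one_add_phi {lam : ℝ} (h0 : 0 < lam) (h1 : lam < 1) (P : Profile) :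
    Ord (fun i x => Real.exp (Real.sqrt i.1.1 / 2 * x)) fun (i : Par) x =>
      1 + phi (yVar lam i.1.1 P i.1.2 x) := by
  obtain ⟨M, hM, ha⟩ := exists_alpha_bound h0 h1 P
  have key : ∀ (i : Par) x, |1 + phi (yVar lam i.1.1 P i.1.2 x)| ≤
      4 * Real.exp M * Real.exp (Real.sqrt i.1.1 / 2 * x) := fun i x => by
    have hε0 := Real.sqrt_nonneg i.1.1
    have hε1 : Real.sqrt i.1.1 ≤ 1 := Real.sqrt_le_one.2 i.2.2.le
    refine (abs_one_add_phi_le (c := Real.sqrt i.1.1 / 2) (by linarith) (by linarith) _).trans ?_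
    rw [mul_assoc, ← Real.exp_add]
    have h2 := (abs_le.1 ((ha i.1.1 i.2.1 i.2.2).2 (ySig lam i.1.1 i.1.2 x)).1).1
    rw [yVar]
    gcongr
    nlinarith
  refine ord_comp_yVar_of_le (f := fun y => 1 + phi y) h0 h1 P
    (fun x => (hasDerivAt_phi x).differentiableAt.const_add 1)
    (K := 4 * Real.exp M) (by positivity) key fun i x => le_trans ?_ (key i x)
  rw [deriv_const_add, (hasDerivAt_phi _).deriv, Q_eq_phi]
  set p := phi (yVar lam i.1.1 P i.1.2 x)
  have h1 := abs_le.1 (abs_phi_le (yVar lam i.1.1 P i.1.2 x))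
  -- The derivative `φ' = (1 - φ)(1 + φ)/2` is dominated by `1 + φ` itself, so it obeys the same
  -- bound.
  rw [show 3 / 2 * (1 - p ^ 2) / 3 = (1 - p) / 2 * (1 + p) by ring, abs_mul]
  refine mul_le_of_le_one_left (abs_nonneg _) (abs_le.2 ⟨by linarith [h1.2], by linarith [h1.1]⟩)

/-- The two arguments differ by `α - δ/2 = O(e^{-r})`, and Q' localises near x = 0. The x-derivative
has the additional term `-β Q'(y)`, which is small for the same reason. -/
theorem ord_Q_shift {lam : ℝ} (h0 : 0 < lam) (h1 : lam < 1) (P : Profile) :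
    Ord (wLoc lam) fun i x =>
      Q (yVar lam i.1.1 P i.1.2 x) - Q (x - delta lam i.1.1 P / 2) := by
  obtain ⟨M, hM, ha⟩ := exists_alpha_bound h0 h1 P
  obtain ⟨K, hK, hb⟩ := gr_Q.shift_sub M
  obtain ⟨K', hK', hb'⟩ := gr_deriv_Q.shift_sub M
  obtain ⟨K₁, hK₁, hβ⟩ := ord_beta h0 h1 P
  obtain ⟨K₂, hK₂, h2⟩ := ord_localized h0 h1 P gr_deriv_Q
  have hw : ∀ i x, 0 ≤ wLoc lam i x := fun i x => by rw [wLoc]; positivity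
  have bound : ∀ {L : ℝ} (i : Par) x, 0 ≤ L →
      L * |alpha lam i.1.1 P (ySig lam i.1.1 i.1.2 x) - delta lam i.1.1 P / 2| *
        Real.exp (-(3 / 4 * |x|)) ≤ L * M * wLoc lam i x := fun {L} i x hL => by
    have h3 := ((ha i.1.1 i.2.1 i.2.2).2 (ySig lam i.1.1 i.1.2 x)).2
    calc _ ≤ L * (M * Real.exp (-rVar lam i x)) * Real.exp (-(3 / 4 * |x|)) := by gcongr; exact h3
      _ = L * M * (Real.exp (-(3 / 4 * |x|)) * Real.exp (-rVar lam i x)) := by ring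
      _ ≤ _ := by gcongr; exact exp_rVar_le lam i x
  refine ⟨K * M + K' * M + K₁ * K₂, by positivity, fun i x => ?_⟩
  have a1 := ((ha i.1.1 i.2.1 i.2.2).2 (ySig lam i.1.1 i.1.2 x)).1
  have a2 := (ha i.1.1 i.2.1 i.2.2).1
  have hd := ((hasDerivAt_Q' _).comp x (hasDerivAt_yVar lam i.1.1 P i.1.2 x)).sub
    ((hasDerivAt_Q' _).comp x ((hasDerivAt_id x).sub_const (delta lam i.1.1 P / 2)))
  refine ⟨hd.differentiableAt, ?_, ?_⟩
  · refine (hb x _ _ a1 a2).trans ((bound i x hK).trans ?_)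
    gcongr
    · exact hw i x
    · nlinarith [mul_nonneg hK' hM, mul_nonneg hK₁ hK₂]
  · have e : deriv (fun x => Q (yVar lam i.1.1 P i.1.2 x) - Q (x - delta lam i.1.1 P / 2)) x = _ :=
      hd.deriv
    have b1 := (hb' x _ _ a1 a2).trans (bound i x hK')
    have b2 := mul_le_mul (hβ i x) (h2 i x).2.1 (abs_nonneg _) (by positivity)
    have b3 : K₁ * Real.exp (-rVar lam i x) * (K₂ * Real.exp (-(3 / 4 * |x|))) ≤
        K₁ * K₂ * wLoc lam i x := by
      calc _ = K₁ * K₂ * (Real.exp (-(3 / 4 * |x|)) * Real.exp (-rVar lam i x)) := by ring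
        _ ≤ _ := by gcongr; exact exp_rVar_le lam i x
    rw [e, mul_one, mul_sub, mul_one, sub_right_comm]
    refine (abs_sub _ _).trans ?_
    rw [abs_mul, mul_comm |deriv Q _|]
    have b4 := mul_nonneg (mul_nonneg hK hM) (hw i x)
    have b5 := add_le_add b1 (b2.trans b3)
    refine (b5.trans ?_)
    nlinarith

theorem ord_Qt_pow {lam : ℝ} (h0 : 0 < lam) (h1 : lam < 1) {k : ℕ} (hk : k ≠ 0) :
    Ord (wExp lam 0) fun i x => Qt lam i.1.1 (ySig lam i.1.1 i.1.2 x) ^ k := by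
  obtain ⟨j, rfl⟩ := Nat.exists_eq_succ_of_ne_zero hk
  have hX : (fun i x => Qt lam i.1.1 (ySig lam i.1.1 i.1.2 x)) ∈ bddRing Par :=
    (ord_X h0 h1).to_one (wExp_le_one lam 2)
  exact (Ord.mul (pow_mem hX j) ((ord_X h0 h1).wExp_mono (Nat.zero_le _))).mono 1 zero_le_one
    fun i x => by simp

theorem ord_deriv_Qt_pow {lam : ℝ} (h0 : 0 < lam) (h1 : lam < 1) (k : ℕ) :
    Ord (wExp lam 0) fun i x => deriv (fun r => Qt lam i.1.1 r ^ k) (ySig lam i.1.1 i.1.2 x) := by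
  have hX : (fun i x => Qt lam i.1.1 (ySig lam i.1.1 i.1.2 x)) ∈ bddRing Par :=
    (ord_X h0 h1).to_one (wExp_le_one lam 2)
  simp only [deriv_Qt_pow]
  exact (Ord.mul (mul_mem (constFam k).2 (pow_mem hX (k - 1)))
    ((ord_Y h0 h1).wExp_mono (Nat.zero_le _))).mono 1 zero_le_one fun i x => by simp

/-! ### Decomposition of the error after the collision. -/

/-- The difference between the approximate solution and two decoupled solitons. -/
noncomputable def collisionErr (lam : ℝ) (P : Profile) (i : Par) (x : ℝ) : ℝ :=
  zApp lam i.1.1 P i.1.2 x - (Q (x - delta lam i.1.1 P / 2) +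
    Qt lam i.1.1 (ySig lam i.1.1 i.1.2 x - deltaSig i.1.1 P / 2) -
    dCoef lam P * deriv (fun r => Qt lam i.1.1 r ^ 2)
      (ySig lam i.1.1 i.1.2 x - deltaSig i.1.1 P / 2))

/-- The error splits as `[Q(y) - Q(x - δ/2)]`, plus the matching error, plus the sum of `σ^l {(A -
γ) X^k + (B - b φ)(X^k)' + b (1 + φ)(X^k)'}`. The first difference and the terms with `A - γ`, `B -
b φ` are localised near the large soliton, and `1 + φ` carries the tail of the small soliton on its
right. -/
theorem ord_collisionErr {lam : ℝ} (h0 : 0 < lam) (h1 : lam < 1) {P : Profile}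
    (h : IsAdmissible lam P) :
    Ord (wLoc lam + wTail lam + wHalf lam 7) (collisionErr lam P) := by
  have w1 : ∀ i x, 0 ≤ wLoc lam i x := fun i x => by rw [wLoc]; positivity
  have w2 : ∀ i x, 0 ≤ wTail lam i x := fun i x => by rw [wTail]; positivity
  have w3 : ∀ i x, 0 ≤ wHalf lam 7 i x := fun i x => by rw [wHalf]; positivity
  have m1 : ∀ {f}, Ord (wLoc lam) f → Ord (wLoc lam + wTail lam + wHalf lam 7) f := fun hf =>
    hf.mono 1 zero_le_one fun i x => by
      simp only [Pi.add_apply, one_mul]; linarith [w2 i x, w3 i x]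
  have m2 : ∀ {f}, Ord (wTail lam) f → Ord (wLoc lam + wTail lam + wHalf lam 7) f := fun hf =>
    hf.mono 1 zero_le_one fun i x => by
      simp only [Pi.add_apply, one_mul]; linarith [w1 i x, w3 i x]
  have m3 : ∀ {f}, Ord (wHalf lam 7) f → Ord (wLoc lam + wTail lam + wHalf lam 7) f := fun hf =>
    hf.mono 1 zero_le_one fun i x => by
      simp only [Pi.add_apply, one_mul]; linarith [w1 i x, w2 i x]
  have one_mul' : ∀ {w f g : Par → ℝ → ℝ}, Ord (fun _ _ => 1) f → Ord w g → Ord w (f * g) :=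
    fun hf hg => (hf.mul hg).mono 1 zero_le_one fun i x => by simp
  have hs := (ord_sig.to_one fun i _ => pow_le_one₀ (Real.sqrt_nonneg _)
    (Real.sqrt_le_one.2 i.2.2.le) : (fun (i : Par) (_ : ℝ) => i.1.1) ∈ bddRing Par)
  have sum := Ord.sum (s := Sigma0) fun p hp => by
    have hk : p.1 ≠ 0 := by
      rcases mem_Sigma0_cases hp with rfl | rfl | rfl | rfl | rfl | rfl <;> simp
    exact one_mul' (show Ord _ (_ ^ p.2) from pow_mem (S := bddRing Par) hs p.2) (((m1 (ord_loc_mul (ord_localized h0 h1 P (h.grLim_A hp))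
      (ord_Qt_pow h0 h1 hk))).add (m1 (ord_loc_mul (ord_localized h0 h1 P (h.gr_B hp))
        (ord_deriv_Qt_pow h0 h1 p.1)))).add (one_mul' (constFam (P.b p.1 p.2)).2
          (m2 (ord_tail_mul (ord_one_add_phi h0 h1 P) (ord_deriv_Qt_pow h0 h1 p.1)))))
  have key := ((m1 (ord_Q_shift h0 h1 P)).add (m3 (ord_matchErr h0 h1 P))).add sum
  refine (congrArg (Ord _) ?_).mpr key
  funext i x
  simp only [Pi.add_apply, Finset.sum_apply, Pi.mul_apply, Pi.pow_apply, constFam]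
  rw [collisionErr, matchErr, zApp, wErr]
  simp only [sum_Sigma0]
  ring


/-! ### Norm estimates at the times ±τ_σ and conclusion. -/

theorem exists_exp_neg_rpow_le (n : ℕ) : ∃ C : ℝ, 0 < C ∧ ∀ sig : ℝ, 0 < sig →
    Real.exp (-(sig ^ (-(1 / 100) : ℝ) / 4)) ≤ C * sig ^ (n / 100 : ℝ) := by
  refine ⟨n.factorial * 4 ^ n, by positivity, fun sig hp => ?_⟩
  have hu : 0 < sig ^ (-(1 / 100) : ℝ) := Real.rpow_pos_of_pos hp _
  -- `u^n/n! ≤ e^u` with `u = σ^{-1/100}/4`: the exponential beats every power of σ, which is what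
  -- the extra exponent -1/100 in τ_σ is for.
  have h := Real.pow_div_factorial_le_exp _ (div_nonneg hu.le (by norm_num : (0 : ℝ) ≤ 4)) n
  have e : (sig ^ (-(1 / 100) : ℝ)) ^ n * sig ^ (n / 100 : ℝ) = 1 := by
    rw [← Real.rpow_natCast, ← Real.rpow_mul hp.le, ← Real.rpow_add hp,
      show -(1 / 100) * (n : ℝ) + n / 100 = 0 by ring, Real.rpow_zero]
  rw [Real.exp_neg, inv_le_iff_one_le_mul₀ (Real.exp_pos _)]
  calc (1 : ℝ) = n.factorial * 4 ^ n * sig ^ (n / 100 : ℝ) *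
        ((sig ^ (-(1 / 100) : ℝ) / 4) ^ n / n.factorial) := by
        rw [div_pow]
        have : (n.factorial : ℝ) ≠ 0 := by positivity
        field_simp
        rw [mul_comm, e]
    _ ≤ _ := by
        refine mul_le_mul_of_nonneg_left h ?_
        have := Real.rpow_pos_of_pos hp (n / 100 : ℝ)
        positivity

/-- `√σ τ_σ = σ^{-1/100}` exactly, and μ_σ ≥ 1/2 for σ < 1/4: the distance between the solitons,
measured in widths of the small one, tends to infinity. -/
theorem tVar_tau_ge {lam sig : ℝ} (h0 : 0 < lam) (h1 : lam < 1) (hp : 0 < sig) (hs : sig < 1 / 4) :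
    sig ^ (-(1 / 100) : ℝ) / 2 ≤ Real.sqrt sig * (mu lam sig * tau sig) := by
  have hu : 0 < sig ^ (-(1 / 100) : ℝ) := Real.rpow_pos_of_pos hp _
  have e : Real.sqrt sig * tau sig = sig ^ (-(1 / 100) : ℝ) := by
    rw [Real.sqrt_eq_rpow, tau, ← Real.rpow_add hp]; norm_num
  have hm : 1 / 2 ≤ mu lam sig := by
    rw [mu, le_div_iff₀ (by nlinarith)]; nlinarith
  rw [mul_left_comm, e]
  nlinarith

theorem sqrt_pow_seven {sig : ℝ} (hp : 0 < sig) : Real.sqrt sig ^ 7 = sig ^ ((350 : ℕ) / 100 : ℝ) := by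
  rw [Real.sqrt_eq_rpow, ← Real.rpow_natCast, ← Real.rpow_mul hp.le]
  norm_num

theorem h1Norm_comp_neg (f : ℝ → ℝ) : h1Norm (fun x => f (-x)) = h1Norm f := by
  have h : ∀ g : ℝ → ℝ, eLpNorm (fun x => g (-x)) 2 volume = eLpNorm g 2 volume := fun g => by
    have := (MeasurableEquiv.neg ℝ).measurableEmbedding.eLpNorm_map_measure (g := g) (p := 2)
      (μ := volume)
    rw [show Measure.map (MeasurableEquiv.neg ℝ) volume = (volume : Measure ℝ) from
      Measure.map_neg_eq_self volume] at this
    exact this.symm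
  have hd : deriv (fun x => f (-x)) = fun x => -deriv f (-x) := funext fun x => deriv_comp_neg f x
  rw [h1Norm, h1Norm, h, hd, show (fun x => -deriv f (-x)) = -fun x => deriv f (-x) from rfl,
    eLpNorm_neg, h]

theorem beforeCollision_eq (lam sig : ℝ) (P : Profile) (x : ℝ) :
    beforeCollision lam sig P x = afterCollision lam sig P (-x) := by
  have e1 : -x - delta lam sig P / 2 = -(x + delta lam sig P / 2) := by ring
  have e2 : -x + mu lam sig * tau sig - deltaSig sig P / 2 =
    -(x - mu lam sig * tau sig + deltaSig sig P / 2) := by ring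
  rw [beforeCollision, afterCollision, e1, e2, Q_even, Qt_even,
    deriv_odd_of_even fun r => by rw [Qt_even]]
  ring

theorem IsAdmissible.h1Norm_after_le {lam : ℝ} (h0 : 0 < lam) (h1 : lam < 1) {P : Profile}
    (h : IsAdmissible lam P) :
    ∃ C, 0 < C ∧ ∀ sig, 0 < sig → sig < 1 / 4 →
      h1Norm (fun x => zApp lam sig P (tau sig) x - afterCollision lam sig P x) ≤
        ENNReal.ofReal (C * sig ^ (13 / 4 : ℝ)) := by
  obtain ⟨C, hC, hb⟩ := ord_collisionErr h0 h1 h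
  -- 350/100 = 7/2, so the exponentially small factors are brought to the size `ε^7` of the matching
  -- error, with ε = √σ.
  obtain ⟨D, hD, hexp⟩ := exists_exp_neg_rpow_le 350
  have hE : 0 ≤ expNorm := Real.sqrt_nonneg _
  refine ⟨2 * expNorm * (2 * (C * D) + 2 * (C * (D + 1))) + 1, by positivity, fun sig hp hs => ?_⟩
  let i : Par := ⟨(sig, tau sig), hp, by show sig < 1; linarith⟩
  set ε := Real.sqrt sig with hε
  have hε0 : 0 < ε := Real.sqrt_pos.2 hp
  -- With ε ≤ 1/2 the exponent `(ε - 3/4)|x|` of the localised weight is at most `-|x|/4`.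
  have hε1 : ε ≤ 1 / 2 := by
    rw [hε, Real.sqrt_le_left (by norm_num)]; norm_num; linarith
  have hT := tVar_tau_ge h0 h1 hp hs
  change _ ≤ tVar lam i at hT
  have hu : 0 < sig ^ (-(1 / 100) : ℝ) := Real.rpow_pos_of_pos hp _
  have hT1 : Real.exp (-(tVar lam i / 2)) ≤ D * ε ^ 7 := by
    rw [sqrt_pow_seven hp]
    exact (Real.exp_le_exp.2 (by linarith)).trans (hexp sig hp)
  have hT2 : Real.exp (-tVar lam i) ≤ D * ε ^ 7 := by
    exact (Real.exp_le_exp.2 (by linarith)).trans hT1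
  have bound : ∀ x, C * (wLoc lam + wTail lam + wHalf lam 7) i x ≤
      C * D * ε ^ 7 * Real.exp (-|1 / 4 * (x + 0)|) +
        C * (D + 1) * ε ^ 7 * Real.exp (-|ε / 2 * (x + mu lam sig * tau sig)|) := fun x => by
    have l1 : wLoc lam i x ≤ D * ε ^ 7 * Real.exp (-|1 / 4 * (x + 0)|) := by
      rw [wLoc, add_zero, abs_mul, abs_of_pos (by norm_num : (0 : ℝ) < 1 / 4)]
      have : (ε - 3 / 4) * |x| ≤ -(1 / 4 * |x|) := by nlinarith [abs_nonneg x]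
      exact mul_le_mul hT2 (Real.exp_le_exp.2 this) (Real.exp_pos _).le (by positivity)
    have er : |rVar lam i x| / 2 = |ε / 2 * (x + mu lam sig * tau sig)| := by
      rw [show ε / 2 * (x + mu lam sig * tau sig) = rVar lam i x / 2 by
        show _ = ε * (x + mu lam sig * tau sig) / 2; ring, abs_div, abs_two]
    have l2 : wTail lam i x ≤ D * ε ^ 7 *
        Real.exp (-|ε / 2 * (x + mu lam sig * tau sig)|) := by
      rw [wTail, er]; gcongr
    have l3 : wHalf lam 7 i x = ε ^ 7 *
        Real.exp (-|ε / 2 * (x + mu lam sig * tau sig)|) := by rw [wHalf, er]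
    calc _ = C * (wLoc lam i x + wTail lam i x + wHalf lam 7 i x) := rfl
      _ ≤ C * (D * ε ^ 7 * Real.exp (-|1 / 4 * (x + 0)|) + D * ε ^ 7 *
        Real.exp (-|ε / 2 * (x + mu lam sig * tau sig)|) + ε ^ 7 *
        Real.exp (-|ε / 2 * (x + mu lam sig * tau sig)|)) := by rw [l3]; gcongr
      _ = _ := by ring
  refine (h1Norm_le_of_exp (M := C * D * ε ^ 7) (N := C * (D + 1) * ε ^ 7) (by positivity)
    (by positivity) (by norm_num : (0 : ℝ) < 1 / 4) (by positivity : 0 < ε / 2)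
    (fun x => (hb i x).2.1.trans (bound x)) fun x => (hb i x).2.2.trans (bound x)).trans
    (ENNReal.ofReal_le_ofReal ?_)
  have q := rpow_quarter hp 6
  rw [show ((2 * (6 : ℕ) + 1 : ℝ) / 4) = 13 / 4 by norm_num] at q
  rw [← q, ← hε]
  have s0 : 0 < Real.sqrt ε := Real.sqrt_pos.2 hε0
  have s1 : Real.sqrt ε ≤ 1 := Real.sqrt_le_one.2 (by linarith)
  -- The localised part has fixed width and loses nothing in L²; dividing by √ε only puts it into
  -- the form of the other part.
  have r1 : C * D * ε ^ 7 / Real.sqrt (1 / 4) ≤ 2 * (C * D) * (ε ^ 7 / Real.sqrt ε) := by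
    rw [show Real.sqrt (1 / 4) = 1 / 2 by
      rw [show (1 / 4 : ℝ) = (1 / 2) ^ 2 by norm_num, Real.sqrt_sq (by norm_num)]]
    rw [div_div_eq_mul_div, div_one]
    have : ε ^ 7 ≤ ε ^ 7 / Real.sqrt ε := le_div_self (by positivity) s0 s1
    nlinarith [mul_nonneg hC hD.le]
  have r2 : C * (D + 1) * ε ^ 7 / Real.sqrt (ε / 2) ≤
      2 * (C * (D + 1)) * (ε ^ 7 / Real.sqrt ε) := by
    have : Real.sqrt ε / 2 ≤ Real.sqrt (ε / 2) := by
      refine Real.le_sqrt_of_sq_le ?_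
      rw [div_pow, Real.sq_sqrt hε0.le]
      linarith
    calc _ ≤ C * (D + 1) * ε ^ 7 / (Real.sqrt ε / 2) := by gcongr
      _ = _ := by field_simp
  have hq : 0 ≤ ε ^ 7 / Real.sqrt ε := by positivity
  calc _ ≤ 2 * expNorm * (2 * (C * D) * (ε ^ 7 / Real.sqrt ε) +
        2 * (C * (D + 1)) * (ε ^ 7 / Real.sqrt ε)) := by gcongr
    _ = 2 * expNorm * (2 * (C * D) + 2 * (C * (D + 1))) * (ε ^ 7 / Real.sqrt ε) := by ring
    _ ≤ _ := by gcongr; linarith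

/-- Both terms of the difference at time -τ_σ are the reflections in x of those at time τ_σ, and
reflection preserves the H¹ norm. -/
theorem IsAdmissible.h1Norm_before_eq {lam : ℝ} {P : Profile} (h : IsAdmissible lam P) (sig : ℝ) :
    h1Norm (fun x => zApp lam sig P (-tau sig) x - beforeCollision lam sig P x) =
      h1Norm (fun x => zApp lam sig P (tau sig) x - afterCollision lam sig P x) := by
  rw [← h1Norm_comp_neg fun x => zApp lam sig P (tau sig) x - afterCollision lam sig P x]
  congr 1
  funext x
  rw [beforeCollision_eq, zApp_symm lam sig h.A_even h.B_odd, neg_neg]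

theorem lamOf_mem {c₁ : ℝ} (h : 1 < c₁) : 0 < lamOf c₁ ∧ lamOf c₁ < 1 :=
  ⟨div_pos (by linarith) (by linarith), (div_lt_one (by linarith)).2 (by linarith)⟩

theorem sigmaOf_mem {c₁ c₂ : ℝ} (h1 : 1 < c₁) (h2 : 1 < c₂) (h : c₂ - 1 < lamOf c₁ / 4) :
    0 < sigmaOf c₁ c₂ ∧ sigmaOf c₁ c₂ < 1 / 4 := by
  have hl := (lamOf_mem h1).1
  have hd : 0 < c₂ * lamOf c₁ := mul_pos (by linarith) hl
  refine ⟨div_pos (by linarith) hd, ?_⟩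
  rw [sigmaOf, div_lt_iff₀ hd]
  nlinarith

end BBM

theorem mainTheorem7 (c₁ : ℝ) (hc₁ : 1 < c₁) (lam : ℝ) (hlam : lam = BBM.lamOf c₁) :
    (∃ P : BBM.Profile, BBM.IsAdmissible lam P) ∧
    ∀ P : BBM.Profile, BBM.IsAdmissible lam P →
      ∃ ε₀ : ℝ, 0 < ε₀ ∧ ∃ C : ℝ, 0 < C ∧
        ∀ c₂ : ℝ, 1 < c₂ → c₂ < c₁ → c₂ - 1 < ε₀ →
        ∀ sig : ℝ, sig = BBM.sigmaOf c₁ c₂ →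
          ContDiff ℝ ∞ (fun p : ℝ × ℝ => BBM.zApp lam sig P p.1 p.2) ∧
          (∀ t x : ℝ, BBM.zApp lam sig P t x = BBM.zApp lam sig P (-t) (-x)) ∧
          (∀ t : ℝ, BBM.h1Norm (BBM.residual lam (BBM.zApp lam sig P) t) ≤
            ENNReal.ofReal (C * sig ^ (15 / 4 : ℝ))) ∧
          BBM.h1Norm (fun x => BBM.zApp lam sig P (BBM.tau sig) x -
              BBM.afterCollision lam sig P x) ≤
            ENNReal.ofReal (C * sig ^ (13 / 4 : ℝ)) ∧
          BBM.h1Norm (fun x => BBM.zApp lam sig P (-BBM.tau sig) x -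
              BBM.beforeCollision lam sig P x) ≤
            ENNReal.ofReal (C * sig ^ (13 / 4 : ℝ)) := by
  obtain ⟨h0, h1⟩ := BBM.lamOf_mem hc₁
  rw [← hlam] at h0 h1
  refine ⟨BBM.exists_isAdmissible h0 h1, fun P hP => ?_⟩
  obtain ⟨C, hC, hres⟩ := hP.h1Norm_residual_le h0 h1
  obtain ⟨D, hD, hcol⟩ := hP.h1Norm_after_le h0 h1
  -- `c₂ - 1 < λ/4` gives `σ = (c₂ - 1)/(c₂ λ) < 1/4`, the range required at the times ±τ_σ. The
  -- constant `C + D` serves all the estimates.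
  refine ⟨lam / 4, by positivity, C + D, by positivity, fun c₂ h2 _ hc sig hsig => ?_⟩
  obtain ⟨hp, hs⟩ := BBM.sigmaOf_mem hc₁ h2 (hlam ▸ hc)
  rw [← hsig] at hp hs
  have hcol' := (hcol sig hp hs).trans (ENNReal.ofReal_le_ofReal
    (mul_le_mul_of_nonneg_right (by linarith : D ≤ C + D) (Real.rpow_nonneg hp.le _)))
  refine ⟨BBM.contDiff_zApp lam sig (fun p hp => (hP.grLim_A hp).bddDer.1)
    (fun p hp => (BBM.bddDer_of_sub_phi (hP.gr_B hp)).1),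
    BBM.zApp_symm lam sig hP.A_even hP.B_odd, fun t => ?_, hcol', ?_⟩
  · exact (hres sig hp (by linarith) t).trans (ENNReal.ofReal_le_ofReal
      (mul_le_mul_of_nonneg_right (by linarith) (Real.rpow_nonneg hp.le _)))
  · rw [hP.h1Norm_before_eq]
    exact hcol'
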